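/- **Setting.** Let $n\ge 1$ and $\lambda>0$. Consider $n$ one-dimensional quantum harmonic oscillators with common frequency $\omega>0$; the $j$-th one has mass $m_j>0$ and position $\vec R^0_j+x_j\hat n_j$, where the centres $\vec R^0_j\in\mathbb R^3$ are distinct and $\|\hat n_j\|=1$. Put $\vec d_{jk}=\vec R^0_k-\vec R^0_j$, $d_{jk}=\|\vec d_{jk}\|$, $\cos\theta_{jk}=\hat n_j\cdot\vec d_{jk}/d_{jk}$, $\cos\varphi_{jk}=\hat n_j\cdot\hat n_k$, and let $\mathcal V(x)=-\sum_{j<k}Gm_jm_k/\|\vec d_{jk}-x_j\hat n_j+x_k\hat n_k\|$ be the Newtonian potential ($G>0$). On $L^2(\mathbb R^n)=L^2(\mathbb R)^{\otimes n}$, with $\bar x_j=\sqrt{m_j\omega/\hbar}\,x_j$, $\bar p_j=p_j/\sqrt{\hbar m_j\omega}=-i\partial_{\bar x_j}$, let $$H=\sum_j\Big(\tfrac12 m_j\omega^2x_j^2+\tfrac{p_j^2}{2m_j}\Big)+\mathcal V(0)+\sum_j\partial_j\mathcal V(0)\,x_j+\tfrac12\sum_{j,k}\partial_j\partial_k\mathcal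 V(0)\,x_jx_k$$ be the Hamiltonian of linearised gravity. Define the real symmetric matrix $g$ by $g_{jj}=\sum_{\ell\ne j}\frac{Gm_\ell}{d_{j\ell}^3\omega}(1-3\cos^2\theta_{j\ell})$ and $g_{jk}=-\frac{G\sqrt{m_jm_k}}{d_{jk}^3\omega}(\cos\varphi_{jk}+3\cos\theta_{jk}\cos\theta_{kj})$ for $j\ne k$, and for $t\in\mathbb R$ $$S_{\mathrm{eff}}=\begin{pmatrix}\cos(gt/2)&\sin(gt/2)\\-\sin(gt/2)&\cos(gt/2)\end{pmatrix}.$$ For symplectic $S$, the Gaussian unitary $U_S$ is the unitary, unique up to a phase, with $U_SD_\delta U_S^\dagger=D_{S\delta}$ for all $\delta=(\delta_X,\delta_P)\in\mathbb R^{2n}$ (equivalently $U_S^\dagger\bar r\,U_S=S\bar r$ with $\bar r=(\bar x,\bar p)$), where $D_\delta=e^{-i(\delta_X\cdot\bar p-\delta_P\cdot\bar x)}$. For a unitary $U$ let $$F_{c\ell}(\mathcal E_\lambda,U)=\sup_{\Lambda}\int_{\mathbb C^n}\Big(\frac\lambda\pi\Big)^ne^{-\lambda\|\alpha\|^2}\,\mathrm{Tr}\big[\Lambda(|\alpha\rangle\langle\alpha|)\,U|\alpha\rangle\langle\alpha|U^\dagger\big]\,d\alpha,$$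 where $|\alpha\rangle=|\alpha_1\rangle\otimes\cdots\otimes|\alpha_n\rangle$ are the coherent states and $\Lambda$ runs over the channels that can be implemented by local operations and classical communication (LOCC) among $n$ parties holding one oscillator each. **Theorem.** 1. $\mathcal V$ is smooth near $0$ and $\partial_j\partial_k\mathcal V(0)=\omega\sqrt{m_jm_k}\,g_{jk}$, i.e. $H=\frac\hbar2\sum_j\omega(\bar x_j^2+\bar p_j^2)+\frac\hbar2\bar x^{\mathsf T}g\bar x$ + linear terms in $\bar x$ + constant. There is exactly one strongly continuous one-parameter unitary group $e^{-itH/\hbar}$ whose generator extends $-iH/\hbar$ on the Schwartz functions. 2. $S_{\mathrm{eff}}$ is symplectic and orthogonal, and $U_{S_{\mathrm{eff}}}$ exists. 3. (Rotating-wave approximation.) For all $B$, all $\varepsilon>0$ and all compact $C\subset L^2(\mathbb R^n)$ there is $\eta>0$, depending only on $n,\lambda,B,\varepsilon,C$, such that whenever $\frac{Gm_j|t|}{d_{jk}^3\omega}\le B$ and $\frac{Gm_j}{d_{jk}^3\omega^2}\le\eta$ for all $j\ne k$, there is a local unitary $W=W_1\otimes\cdots\otimes W_n$ with $\|We^{-itH/\hbar}\psi-U_{S_{\mathrm{eff}}}\psi\|\le\varepsilon$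 for all $\psi\in C$, and $|F_{c\ell}(\mathcal E_\lambda,e^{-itH/\hbar})-F_{c\ell}(\mathcal E_\lambda,U_{S_{\mathrm{eff}}})|\le\varepsilon$. 4. (LOCC inequality.) For all $t$, $$F_{c\ell}(\mathcal E_\lambda,U_{S_{\mathrm{eff}}})\le\min_{J\subseteq\{1,\dots,n\}}\frac{2^n(1+\lambda)^n}{\prod_{\ell=1}^n(2+\lambda+|w_\ell(\lambda,gt,J)|)},$$ where $w_1,\dots,w_n$ are the eigenvalues, with multiplicity, of the Hermitian matrix $(1+\lambda)e^{igt/2}\,\Xi_J\,e^{-igt/2}-\Xi_J$ and $\Xi_J$ is the diagonal matrix with entries $+1$ for $j\in J$ and $-1$ for $j\notin J$. If $n\ge2$, the minimum is unchanged when restricted to $1\le|J|\le\lfloor n/2\rfloor$. -/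

import Mathlib

open MeasureTheory
open scoped ENNReal SchwartzMap

namespace GravLOCC

noncomputable section

/-! ### Hilbert spaces, product vectors, local operators -/

/-- The Hilbert space `L²(ℝ)` of one mode (one one-dimensional oscillator). -/
abbrev Mode : Type := Lp ℂ 2 (volume : Measure ℝ)

/-- The Hilbert space `L²(ℝⁿ) = L²(ℝ)^{⊗ n}` of `n` modes. -/
abbrev Modes (n : ℕ) : Type := Lp ℂ 2 (volume : Measure (Fin n → ℝ))

theorem memLp_tensor {n : ℕ} (f : Fin n → Mode) :
    MemLp (fun x : Fin n → ℝ => ∏ j, f j (x j)) 2 volume := by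
  have hm : AEStronglyMeasurable (fun x : Fin n → ℝ => ∏ j, f j (x j)) volume := by
    refine Finset.aestronglyMeasurable_fun_prod _ fun j _ => ?_
    exact (Lp.aestronglyMeasurable (f j)).comp_quasiMeasurePreserving
      (Measure.quasiMeasurePreserving_eval (fun _ => (volume : Measure ℝ)) j)
  rw [memLp_two_iff_integrable_sq_norm hm]
  have h : Integrable (fun x : Fin n → ℝ => ∏ j, ‖f j (x j)‖ ^ 2) volume :=
    Integrable.fintype_prod (f := fun j (y : ℝ) => ‖f j y‖ ^ 2)
      fun j => (memLp_two_iff_integrable_sq_norm (Lp.aestronglyMeasurable (f j))).1 (Lp.memLp (f j))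
  refine h.congr (Filter.Eventually.of_forall fun x => ?_)
  simp only [norm_prod, Finset.prod_pow]

/-- The product vector `f₁ ⊗ ⋯ ⊗ fₙ`, i.e. the function `x ↦ ∏ⱼ fⱼ(xⱼ)`. -/
def tensor {n : ℕ} (f : Fin n → Mode) : Modes n := (memLp_tensor f).toLp _

/-- `T` is a local operator of party `j`: `T = 1 ⊗ ⋯ ⊗ K ⊗ ⋯ ⊗ 1` with a bounded `K` on the
`j`-th mode. (Product vectors are total, so that `T` is determined by `K`.) -/
def IsLocalOp {n : ℕ} (j : Fin n) (T : Modes n →L[ℂ] Modes n) : Prop :=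
  ∃ K : Mode →L[ℂ] Mode, ∀ f : Fin n → Mode,
    T (tensor f) = tensor (Function.update f j (K (f j)))

/-- `W` is a local unitary `W₁ ⊗ ⋯ ⊗ Wₙ`. -/
def IsLocalUnitary {n : ℕ} (W : Modes n ≃ₗᵢ[ℂ] Modes n) : Prop :=
  ∃ w : Fin n → (Mode ≃ₗᵢ[ℂ] Mode), ∀ f : Fin n → Mode,
    W (tensor f) = tensor (fun j => w j (f j))

/-! ### LOCC -/

/-- `(Tₘ)ₘ` are the Kraus operators of a measurement: `∑ₘ Tₘ† Tₘ = 1`. -/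
def IsKrausFamily {n : ℕ} (T : ℕ → (Modes n →L[ℂ] Modes n)) : Prop :=
  ∀ ψ : Modes n, HasSum (fun m => ‖T m ψ‖ ^ 2) (‖ψ‖ ^ 2)

/-- Protocols of local operations and classical communication between `n` parties, party `j`
holding the `j`-th mode. In each round some party `j` performs a local measurement with countably
many outcomes and broadcasts the outcome `m`; how the protocol continues may depend on `m`, hence
on the whole history. Each outcome comes with one Kraus operator, which is no restriction because a
party need not use an outcome. Local ancillas are no restriction either because each mode is
infinite dimensional and can absorb them. -/
inductive LOCC (n : ℕ) : Type
  | finish : LOCC n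
  | round (j : Fin n) (T : ℕ → (Modes n →L[ℂ] Modes n)) (hloc : ∀ m, IsLocalOp j (T m))
      (hT : IsKrausFamily T) (next : ℕ → LOCC n) : LOCC n

/-- The channel `Λ` implemented by a protocol, `Λ(ρ) = ∑ₘ Λₘ(Tₘ ρ Tₘ†)` where `Λₘ` is the
continuation after the outcome `m`. For `ρ` of trace class (in particular for pure states) the
series converges absolutely in trace norm, hence in operator norm. -/
def LOCC.channel {n : ℕ} : LOCC n → (Modes n →L[ℂ] Modes n) → (Modes n →L[ℂ] Modes n)
  | .finish, ρ => ρ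
  | .round _ T _ _ next, ρ =>
      ∑' m, (next m).channel (T m ∘L ρ ∘L ContinuousLinearMap.adjoint (T m))

/-- The operator `|ψ⟩⟨ψ|`. -/
def ketbra {n : ℕ} (ψ : Modes n) : Modes n →L[ℂ] Modes n := InnerProductSpace.rankOne ℂ ψ ψ

/-! ### Displacements, coherent states, Gaussian unitaries

Phase space vectors are indexed by `Fin n ⊕ Fin n`: first all positions, then all momenta. -/

theorem memLp_displace {n : ℕ} (δ : Fin n ⊕ Fin n → ℝ) (ψ : Modes n) :
    MemLp (fun x : Fin n → ℝ =>
      Complex.exp (Complex.I *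
        ((∑ j, δ (.inr j) * x j - (1 / 2) * ∑ j, δ (.inl j) * δ (.inr j) : ℝ) : ℂ)) *
      ψ (fun j => x j - δ (.inl j))) 2 volume := by
  have h1 : MemLp (fun x : Fin n → ℝ => ψ (fun j => x j - δ (.inl j))) 2 volume :=
    (Lp.memLp ψ).comp_measurePreserving
      (measurePreserving_sub_right volume (fun j => δ (.inl j)))
  refine h1.of_le ?_ (Filter.Eventually.of_forall fun x => ?_)
  · refine AEStronglyMeasurable.mul (Continuous.aestronglyMeasurable ?_) h1.1
    fun_prop
  · rw [norm_mul, mul_comm Complex.I, Complex.norm_exp_ofReal_mul_I, one_mul]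

/-- The displacement operator `D_δ = exp(-i δᵀ Ω r) = exp(-i (δ_X · p - δ_P · x))`, that is
`(D_δ ψ)(x) = exp(i (δ_P · x - δ_X · δ_P / 2)) ψ(x - δ_X)`. -/
def displace {n : ℕ} (δ : Fin n ⊕ Fin n → ℝ) (ψ : Modes n) : Modes n :=
  (memLp_displace δ ψ).toLp _

/-- The wave function `π^{-1/4} exp(-x² / 2)` of the ground state of one oscillator. -/
def vacuumFun (x : ℝ) : ℂ := ((Real.pi ^ (-(1 / 4) : ℝ) * Real.exp (-x ^ 2 / 2) : ℝ) : ℂ)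

theorem memLp_vacuumFun : MemLp vacuumFun 2 (volume : Measure ℝ) := by
  have hc : Continuous vacuumFun := by
    unfold vacuumFun
    fun_prop
  rw [memLp_two_iff_integrable_sq_norm hc.aestronglyMeasurable]
  have h := (integrable_exp_neg_mul_sq (b := 1) one_pos).const_mul
    ((Real.pi ^ (-(1 / 4) : ℝ)) ^ 2)
  refine h.congr (Filter.Eventually.of_forall fun x => ?_)
  simp only [vacuumFun, Complex.norm_real, Real.norm_eq_abs, sq_abs, mul_pow]
  rw [← Real.exp_nat_mul]
  congr 2
  push_cast
  ring

/-- The `n`-mode vacuum `|0⟩ ⊗ ⋯ ⊗ |0⟩`. -/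
def vacuum (n : ℕ) : Modes n := tensor fun _ => memLp_vacuumFun.toLp vacuumFun

/-- The `n`-mode coherent state `|α⟩ = |α₁⟩ ⊗ ⋯ ⊗ |αₙ⟩`, i.e. the vacuum displaced by
`δ = √2 (Re α, Im α)`. -/
def coherent {n : ℕ} (α : Fin n → ℂ) : Modes n :=
  displace (Sum.elim (fun j => √2 * (α j).re) (fun j => √2 * (α j).im)) (vacuum n)

/-- `U` is the Gaussian unitary (unique up to a phase) of the symplectic matrix `S`, that is
`U† r U = S r`, in the bounded form `U D_δ U† = D_{S δ}` for all `δ`. -/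
def IsGaussianUnitary {n : ℕ} (S : Matrix (Fin n ⊕ Fin n) (Fin n ⊕ Fin n) ℝ)
    (U : Modes n ≃ₗᵢ[ℂ] Modes n) : Prop :=
  ∀ (δ : Fin n ⊕ Fin n → ℝ) (ψ : Modes n), U (displace δ ψ) = displace (S.mulVec δ) (U ψ)

/-! ### The LOCC simulation fidelity on the Gaussian ensemble of coherent states -/

/-- The density `p_λ(α) = (λ/π)ⁿ exp(-λ ‖α‖²)` on `ℂⁿ`. -/
def gaussianDensity {n : ℕ} (lam : ℝ) (α : Fin n → ℂ) : ℝ :=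
  (lam / Real.pi) ^ n * Real.exp (-lam * ∑ j, ‖α j‖ ^ 2)

/-- The overlap `Tr[Λ(|ψ⟩⟨ψ|) |φ⟩⟨φ|] = ⟨φ| Λ(|ψ⟩⟨ψ|) |φ⟩`. -/
def overlap {n : ℕ} (P : LOCC n) (ψ φ : Modes n) : ℝ :=
  (inner ℂ φ (P.channel (ketbra ψ) φ)).re

/-- The LOCC simulation fidelity `sup_Λ ∫ p_λ(α) Tr[Λ(|α⟩⟨α|) U|α⟩⟨α|U†] dα` of `U` on the
ensemble of coherent states with density `p_λ`. -/
def simFidelity {n : ℕ} (lam : ℝ) (U : Modes n ≃ₗᵢ[ℂ] Modes n) : ℝ≥0∞ :=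
  ⨆ P : LOCC n, ∫⁻ α : Fin n → ℂ,
    ENNReal.ofReal (gaussianDensity lam α * overlap P (coherent α) (U (coherent α)))

/-! ### The oscillators and their gravitational interaction -/

/-- `n` one-dimensional oscillators in space with common angular frequency `ω`. The `j`-th one has
mass `mass j`, oscillates about `center j` along the unit vector `dir j`. `G` is the gravitational
constant and `hbar` the reduced Planck constant. -/
structure Oscillators (n : ℕ) where
  G : ℝ
  hbar : ℝ
  ω : ℝ
  mass : Fin n → ℝ
  center : Fin n → EuclideanSpace ℝ (Fin 3)
  dir : Fin n → EuclideanSpace ℝ (Fin 3)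
  G_pos : 0 < G
  hbar_pos : 0 < hbar
  ω_pos : 0 < ω
  mass_pos : ∀ j, 0 < mass j
  center_injective : Function.Injective center
  norm_dir : ∀ j, ‖dir j‖ = 1

namespace Oscillators

variable {n : ℕ} (A : Oscillators n)

/-- The vector from the `j`-th to the `k`-th centre. -/
def sep (j k : Fin n) : EuclideanSpace ℝ (Fin 3) := A.center k - A.center j

/-- The distance between the `j`-th and the `k`-th centre. -/
def distance (j k : Fin n) : ℝ := ‖A.sep j k‖

/-- The cosine of the angle between the `j`-th line and the direction from `j` to `k`. -/
def cosθ (j k : Fin n) : ℝ := inner ℝ (A.dir j) ((A.distance j k)⁻¹ • A.sep j k)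

/-- The cosine of the angle between the `j`-th and the `k`-th line. -/
def cosφ (j k : Fin n) : ℝ := inner ℝ (A.dir j) (A.dir k)

/-- The Newtonian potential energy as a function of the displacements `x` along the lines. -/
def potential (x : Fin n → ℝ) : ℝ :=
  -∑ j, ∑ k ∈ Finset.Ioi j,
    A.G * A.mass j * A.mass k / ‖A.sep j k - x j • A.dir j + x k • A.dir k‖

/-- The matrix `g`. -/
def coupling : Matrix (Fin n) (Fin n) ℝ := fun j k =>
  if j = k then
    ∑ l ∈ Finset.univ.erase j,
      A.G * A.mass l / (A.distance j l ^ 3 * A.ω) * (1 - 3 * A.cosθ j l ^ 2)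
  else
    -(A.G * √(A.mass j * A.mass k) / (A.distance j k ^ 3 * A.ω)) *
      (A.cosφ j k + 3 * A.cosθ j k * A.cosθ k j)

theorem coupling_isSymm : A.coupling.IsSymm := by
  have hd : ∀ j k, A.distance j k = A.distance k j := fun j k => norm_sub_rev _ _
  ext j k
  by_cases h : j = k
  · simp [h]
  · have h' : ¬ k = j := fun e => h e.symm
    simp only [Matrix.transpose_apply, coupling, if_neg h, if_neg h']
    rw [hd k j, mul_comm (A.mass k), show A.cosφ k j = A.cosφ j k from real_inner_comm _ _]
    ring

end Oscillators

/-- The partial derivative `∂_k f`. -/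
def partialDeriv {n : ℕ} (k : Fin n) (f : (Fin n → ℝ) → ℝ) (x : Fin n → ℝ) : ℝ :=
  fderiv ℝ f x (Pi.single k 1)

theorem hasTemperateGrowth_coord {n : ℕ} (j : Fin n) :
    Function.HasTemperateGrowth (fun x : Fin n → ℝ => ((x j : ℝ) : ℂ)) :=
  (Complex.ofRealCLM ∘L ContinuousLinearMap.proj (R := ℝ) (φ := fun _ : Fin n => ℝ) j
    ).hasTemperateGrowth

/-- The dimensionless position operator: multiplication by the `j`-th coordinate. -/
def opX {n : ℕ} (j : Fin n) : 𝓢(Fin n → ℝ, ℂ) → 𝓢(Fin n → ℝ, ℂ) :=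
  SchwartzMap.smulLeftCLM ℂ (fun x : Fin n → ℝ => ((x j : ℝ) : ℂ))

theorem opX_apply {n : ℕ} (j : Fin n) (ψ : 𝓢(Fin n → ℝ, ℂ)) (x : Fin n → ℝ) :
    opX j ψ x = (x j : ℂ) * ψ x := by
  simp [opX, SchwartzMap.smulLeftCLM_apply_apply (hasTemperateGrowth_coord j)]

/-- The dimensionless momentum operator `-i ∂_j`. -/
def opP {n : ℕ} (j : Fin n) (ψ : 𝓢(Fin n → ℝ, ℂ)) : 𝓢(Fin n → ℝ, ℂ) :=
  (-Complex.I) • LineDeriv.lineDerivOp (Pi.single j (1 : ℝ) : Fin n → ℝ) ψ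

namespace Oscillators

variable {n : ℕ} (A : Oscillators n)

/-- The position operator `x_j = √(ħ / (m_j ω)) x̄_j`. -/
def posOp (j : Fin n) (ψ : 𝓢(Fin n → ℝ, ℂ)) : 𝓢(Fin n → ℝ, ℂ) :=
  ((√(A.hbar / (A.mass j * A.ω)) : ℝ) : ℂ) • opX j ψ

/-- The momentum operator `p_j = √(ħ m_j ω) p̄_j`. -/
def momOp (j : Fin n) (ψ : 𝓢(Fin n → ℝ, ℂ)) : 𝓢(Fin n → ℝ, ℂ) :=
  ((√(A.hbar * A.mass j * A.ω) : ℝ) : ℂ) • opP j ψ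

/-- The Hamiltonian of the oscillators coupled by linearised gravity: the Newtonian potential is
replaced by its second order Taylor polynomial at the centres. -/
def hamiltonian (ψ : 𝓢(Fin n → ℝ, ℂ)) : 𝓢(Fin n → ℝ, ℂ) :=
  ∑ j, (((1 / 2 * A.mass j * A.ω ^ 2 : ℝ) : ℂ) • A.posOp j (A.posOp j ψ)
      + ((1 / (2 * A.mass j) : ℝ) : ℂ) • A.momOp j (A.momOp j ψ))
  + (A.potential 0 : ℂ) • ψ
  + ∑ j, (partialDeriv j A.potential 0 : ℂ) • A.posOp j ψ
  + ((1 / 2 : ℝ) : ℂ) • ∑ j, ∑ k,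
      (partialDeriv j (partialDeriv k A.potential) 0 : ℂ) • A.posOp j (A.posOp k ψ)

/-- `V t = exp(-i t H / ħ)` for the Hamiltonian `H` of linearised gravity: `V` is the strongly
continuous one-parameter unitary group whose generator extends `-i H / ħ` on Schwartz functions. -/
structure IsEvolution (V : ℝ → (Modes n ≃ₗᵢ[ℂ] Modes n)) : Prop where
  map_add : ∀ (s t : ℝ) (ψ : Modes n), V (s + t) ψ = V s (V t ψ)
  continuous : ∀ ψ : Modes n, Continuous fun t => V t ψ
  generator : ∀ ψ : 𝓢(Fin n → ℝ, ℂ),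
    HasDerivAt (fun t => V t (ψ.toLp 2 volume))
      ((-(Complex.I / (A.hbar : ℂ))) • (A.hamiltonian ψ).toLp 2 volume) 0

end Oscillators

/-! ### The effective symplectic matrix and the bound -/

/-- `S_eff = [[cos (M/2), sin (M/2)], [-sin (M/2), cos (M/2)]]` for a real symmetric matrix `M`;
it is used with `M = g t`. -/
def Seff {n : ℕ} (M : Matrix (Fin n) (Fin n) ℝ) : Matrix (Fin n ⊕ Fin n) (Fin n ⊕ Fin n) ℝ :=
  Matrix.fromBlocks (cfc Real.cos ((1 / 2 : ℝ) • M)) (cfc Real.sin ((1 / 2 : ℝ) • M))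
    (-cfc Real.sin ((1 / 2 : ℝ) • M)) (cfc Real.cos ((1 / 2 : ℝ) • M))

/-- The diagonal matrix `Ξ_J`. -/
def Xi {n : ℕ} (J : Finset (Fin n)) : Matrix (Fin n) (Fin n) ℂ :=
  Matrix.diagonal fun j => if j ∈ J then 1 else -1

/-- The matrix `(1+λ) exp(iM/2) Ξ_J exp(-iM/2) - Ξ_J`. -/
def rotatedXi {n : ℕ} (lam : ℝ) (M : Matrix (Fin n) (Fin n) ℝ) (J : Finset (Fin n)) :
    Matrix (Fin n) (Fin n) ℂ :=
  ((1 + lam : ℝ) : ℂ) •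
      (NormedSpace.exp ((Complex.I / 2) • M.map Complex.ofReal) * Xi J *
        NormedSpace.exp (-(Complex.I / 2) • M.map Complex.ofReal)) - Xi J

theorem rotatedXi_isHermitian {n : ℕ} (lam : ℝ) {M : Matrix (Fin n) (Fin n) ℝ} (hM : M.IsSymm)
    (J : Finset (Fin n)) : (rotatedXi lam M J).IsHermitian := by
  have hX : (Xi J).conjTranspose = Xi J := by
    rw [Xi, Matrix.diagonal_conjTranspose]
    congr 1
    ext j
    by_cases h : j ∈ J <;> simp [h]
  have hMc : (M.map Complex.ofReal).conjTranspose = M.map Complex.ofReal := by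
    ext j k
    simp [Matrix.conjTranspose_apply, hM.apply j k]
  have hI : star (Complex.I / 2) = -(Complex.I / 2) := by
    simp [neg_div]
  have hI' : star (-(Complex.I / 2)) = Complex.I / 2 := by
    rw [star_neg, hI, neg_neg]
  unfold rotatedXi Matrix.IsHermitian
  rw [Matrix.conjTranspose_sub, Matrix.conjTranspose_smul, Matrix.conjTranspose_mul,
    Matrix.conjTranspose_mul, ← Matrix.exp_conjTranspose, ← Matrix.exp_conjTranspose,
    Matrix.conjTranspose_smul, Matrix.conjTranspose_smul, hX, hMc, hI, hI', mul_assoc]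
  simp

/-- The eigenvalues `w_ℓ(λ, M, J)`, counted with multiplicity. -/
def w {n : ℕ} (lam : ℝ) {M : Matrix (Fin n) (Fin n) ℝ} (hM : M.IsSymm) (J : Finset (Fin n))
    (l : Fin n) : ℝ :=
  (rotatedXi_isHermitian lam hM J).eigenvalues l

/-- The bound `2ⁿ (1+λ)ⁿ / ∏_ℓ (2 + λ + |w_ℓ|)`. -/
def bound {n : ℕ} (lam : ℝ) {M : Matrix (Fin n) (Fin n) ℝ} (hM : M.IsSymm)
    (J : Finset (Fin n)) : ℝ :=
  2 ^ n * (1 + lam) ^ n / ∏ l, (2 + lam + |w lam hM J l|)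

end

end GravLOCC

/-! ### Gaussian integrals, Fourier uniqueness, and unitaries from Gram matrices -/

namespace GravLOCC

noncomputable section

open Complex
open scoped ComplexConjugate

/-! ### Gaussian integrals over `ℂⁿ` -/

/-! LOCC inequality. The argument is a partial transposition. Every Kraus operator of an LOCC
protocol is a product `k₁ ⊗ ⋯ ⊗ kₙ` (`LOCC.exists_kraus`). Complex conjugation of one mode is
antiunitary and sends `|a⟩` to `|ā⟩`, so conjugating the factors with `j ∈ J`, and the amplitudes
`αⱼ`, `βⱼ` along with them, changes neither `‖K|α⟩‖` nor `|⟨β|K|α⟩|` (`IsProductPair.norm_eq`,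
`IsProductPair.norm_inner_eq`). Since `U|α⟩` is `|Vα⟩` up to a fixed phase, with `V = exp(-igt/2)`
(`IsGaussianUnitary.exists_coherent`), the protocol may be judged against the target `α ↦ |Lα⟩`,
where `L` is `V` conjugated by the partial complex conjugation. This map is only real linear.

For that target there is a bound valid for every bounded operator `K`: the integral of
`p|⟨Lα|K|α⟩|²` is at most a constant times that of `p‖K|α⟩‖²` (`integral_density_mul_le`). Indeed
`√p ⟨α|ψ⟩` is a Gaussian times an antiholomorphic function and is reproduced by a Gaussian kernel
`R` (`reproduce_eq`). Inserting this and applying Cauchy-Schwarz reduces the constant to a bound for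
the quadratic form with kernel `R(β,α)⟨Lα|Lβ⟩`. In suitable unitary coordinates
(`exists_unitary_conj_form`, `kernel_eq_twistedKernel`) this is the kernel of a twisted convolution
with a Gaussian, with damping `(2+λ)/2` and twists `w_ℓ`. Squaring the kernel repeatedly bounds its
form by `∏ π/((2+λ)/2 + |w_ℓ|/2)` (`norm_twistedForm_le_prod`). Summation over the Kraus operators
gives the claim for every `J`.

Dynamics. An orthogonal matrix diagonalising `g` separates `H` into `n` one-dimensional quadratic
problems. Gaussian wave packets stay Gaussian: their parameters obey a Riccati equation and linear
equations that are solved in closed form, for every sign of the squared frequency. Displacing such a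
packet along the classical flow gives another solution (`Oscillators.exists_displaced_solution`). At
time zero the resulting vectors are multiples of coherent states, hence total, and skew symmetry
keeps their Gram matrix constant; so the map from initial to later values extends to a unitary group
(`existsUnique_isGroupOf`). The same solutions show that the evolution sends `D_δ` to `D_{Φδ}` times
a phase linear in `δ`, and one further displacement removes this phase.

Rotating waves. An eigenmode `κ` of `g` rotates with frequency `√(ω(ω+κ))` and is slightly squeezed.
Compared with the pure rotation of frequency `ω + κ/2`, the error is `O(|κ/ω|(1+|κt|))`
(`rotating_wave_estimate`). The local unitary `W` undoes the displacement and the rotation by `ωt`;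
then `X = U†We^{-itH/ħ}` implements a map of phase space close to the identity. A Gaussian average
of Weyl operators is the vacuum projection up to a factor, which forces `|⟨0|X|0⟩|` close to 1
(`le_norm_inner_vacuum_sq`); the phase is absorbed in `W`. Covariance gives closeness on coherent
states, totality gives it on every vector, and compactness makes it uniform. The fidelity statement
follows because the fidelity is invariant under local unitaries (`IsLocalUnitary.simFidelity_trans`)
and is controlled, up to a small Gaussian tail, by a compact set of coherent states
(`exists_simFidelity_le`). -/

theorem neg_mul_sq_norm_add_eq {μ : ℝ} (u v z : ℂ) :
    -(μ : ℂ) * ((‖z‖ ^ 2 : ℝ) : ℂ) + u * conj z + v * z =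
      (-(μ : ℂ) * (z.re : ℂ) ^ 2 + (u + v) * z.re + 0) +
        (-(μ : ℂ) * (z.im : ℂ) ^ 2 + (I * (v - u)) * z.im + 0) := by
  have h1 : ‖z‖ ^ 2 = z.re ^ 2 + z.im ^ 2 := by
    rw [Complex.sq_norm, Complex.normSq_apply]; ring
  have hz : z = z.re + z.im * I := (Complex.re_add_im z).symm
  have hc : conj z = z.re - z.im * I := Complex.ext (by simp) (by simp)
  rw [h1]
  push_cast
  linear_combination u * hc + v * hz

theorem integrable_cexp_sq_norm {μ : ℝ} (hμ : 0 < μ) (u v : ℂ) :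
    Integrable fun z : ℂ => cexp (-(μ : ℂ) * ((‖z‖ ^ 2 : ℝ) : ℂ) + u * conj z + v * z) := by
  have hx := integrable_cexp_quadratic (b := (μ : ℂ)) (by simpa using hμ) (u + v) 0
  have hy := integrable_cexp_quadratic (b := (μ : ℂ)) (by simpa using hμ) (I * (v - u)) 0
  have h := (Complex.volume_preserving_equiv_real_prod.integrable_comp_emb
    Complex.measurableEquivRealProd.measurableEmbedding).2 (hx.mul_prod hy)
  refine h.congr (Filter.Eventually.of_forall fun z => ?_)
  simp only [Function.comp_apply, Complex.measurableEquivRealProd_apply]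
  rw [neg_mul_sq_norm_add_eq, ← Complex.exp_add]

theorem integral_cexp_sq_norm {μ : ℝ} (hμ : 0 < μ) (u v : ℂ) :
    ∫ z : ℂ, cexp (-(μ : ℂ) * ((‖z‖ ^ 2 : ℝ) : ℂ) + u * conj z + v * z) =
      (Real.pi / μ : ℝ) * cexp (u * v / μ) := by
  have hμ' : (μ : ℂ) ≠ 0 := by exact_mod_cast hμ.ne'
  have hre : (-(μ : ℂ)).re < 0 := by simpa using hμ
  calc ∫ z : ℂ, cexp (-(μ : ℂ) * ((‖z‖ ^ 2 : ℝ) : ℂ) + u * conj z + v * z)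
      = ∫ z : ℂ, (fun q : ℝ × ℝ => cexp (-(μ : ℂ) * (q.1 : ℂ) ^ 2 + (u + v) * q.1 + 0) *
          cexp (-(μ : ℂ) * (q.2 : ℂ) ^ 2 + (I * (v - u)) * q.2 + 0))
          (Complex.measurableEquivRealProd z) := by
        refine integral_congr_ae (Filter.Eventually.of_forall fun z => ?_)
        simp only [Complex.measurableEquivRealProd_apply]
        rw [neg_mul_sq_norm_add_eq, Complex.exp_add]
    _ = _ := by
        refine (Complex.volume_preserving_equiv_real_prod.integral_comp
          Complex.measurableEquivRealProd.measurableEmbedding (fun q : ℝ × ℝ =>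
            cexp (-(μ : ℂ) * (q.1 : ℂ) ^ 2 + (u + v) * q.1 + 0) *
              cexp (-(μ : ℂ) * (q.2 : ℂ) ^ 2 + (I * (v - u)) * q.2 + 0))).trans ?_
        rw [Measure.volume_eq_prod, integral_prod_mul (fun x : ℝ => cexp (-(μ : ℂ) * (x : ℂ) ^ 2 + (u + v) * x + 0))
            (fun x : ℝ => cexp (-(μ : ℂ) * (x : ℂ) ^ 2 + (I * (v - u)) * x + 0)),
          integral_cexp_quadratic hre, integral_cexp_quadratic hre, mul_mul_mul_comm,
          ← Complex.exp_add]
        congr 1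
        · rw [← Complex.cpow_add _ _ (by simp [hμ', Real.pi_ne_zero])]
          norm_num
        · congr 1
          have : (I * (v - u)) ^ 2 = -(v - u) ^ 2 := by
            rw [mul_pow, Complex.I_sq]; ring
          rw [this]
          field_simp
          ring

variable {n : ℕ}

theorem integrable_cexp_sum_sq_norm {μ : Fin n → ℝ} (hμ : ∀ j, 0 < μ j) (u v : Fin n → ℂ) :
    Integrable fun z : Fin n → ℂ =>
      cexp (∑ j, (-(μ j : ℂ) * ((‖z j‖ ^ 2 : ℝ) : ℂ) + u j * conj (z j) + v j * z j)) := by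
  simp_rw [Complex.exp_sum]
  exact Integrable.fintype_prod
    (f := fun j (z : ℂ) => cexp (-(μ j : ℂ) * ((‖z‖ ^ 2 : ℝ) : ℂ) + u j * conj z + v j * z))
    fun j => integrable_cexp_sq_norm (hμ j) (u j) (v j)

theorem integral_cexp_sum_sq_norm {μ : Fin n → ℝ} (hμ : ∀ j, 0 < μ j) (u v : Fin n → ℂ) :
    ∫ z : Fin n → ℂ,
      cexp (∑ j, (-(μ j : ℂ) * ((‖z j‖ ^ 2 : ℝ) : ℂ) + u j * conj (z j) + v j * z j)) =
      (∏ j, (Real.pi / μ j) : ℝ) * cexp (∑ j, u j * v j / μ j) := by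
  simp_rw [Complex.exp_sum]
  rw [integral_fintype_prod_volume_eq_prod
    (f := fun j (z : ℂ) => cexp (-(μ j : ℂ) * ((‖z‖ ^ 2 : ℝ) : ℂ) + u j * conj z + v j * z))]
  simp_rw [integral_cexp_sq_norm (hμ _)]
  rw [Finset.prod_mul_distrib]
  push_cast
  rfl

theorem integrable_exp_sum_sq_norm {a : Fin n → ℝ} (ha : ∀ j, 0 < a j) (u : Fin n → ℂ) :
    Integrable fun z : Fin n → ℂ =>
      Real.exp (∑ j, (-a j * ‖z j‖ ^ 2 + (u j * z j).re)) := by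
  refine (integrable_cexp_sum_sq_norm ha 0 u).norm.congr
    (Filter.Eventually.of_forall fun z => ?_)
  simp only [Complex.norm_exp, Complex.re_sum]
  congr 1
  refine Finset.sum_congr rfl fun j _ => ?_
  simp only [Pi.zero_apply, zero_mul, add_zero, Complex.add_re]
  rw [← Complex.ofReal_neg, ← Complex.ofReal_mul, Complex.ofReal_re]

theorem integrable_exp_neg_sum_sq_norm {a : ℝ} (ha : 0 < a) :
    Integrable fun z : Fin n → ℂ => Real.exp (-a * ∑ j, ‖z j‖ ^ 2) := by
  refine (integrable_exp_sum_sq_norm (a := fun _ : Fin n => a) (fun _ => ha) 0).congr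
    (Filter.Eventually.of_forall fun z => ?_)
  simp [Finset.mul_sum]

theorem integral_exp_neg_sum_sq_norm {a : ℝ} (ha : 0 < a) :
    ∫ z : Fin n → ℂ, Real.exp (-a * ∑ j, ‖z j‖ ^ 2) = (Real.pi / a) ^ n := by
  have h := integral_cexp_sum_sq_norm (μ := fun _ : Fin n => a) (fun _ => ha) 0 0
  have h2 : ∀ z : Fin n → ℂ, cexp (∑ j, (-(a : ℂ) * ((‖z j‖ ^ 2 : ℝ) : ℂ) +
      (0 : Fin n → ℂ) j * conj (z j) + (0 : Fin n → ℂ) j * z j)) =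
      ((Real.exp (-a * ∑ j, ‖z j‖ ^ 2) : ℝ) : ℂ) := by
    intro z
    push_cast
    simp [Finset.mul_sum]
  simp_rw [h2] at h
  rw [integral_complex_ofReal] at h
  have h3 : ((∫ z : Fin n → ℂ, Real.exp (-a * ∑ j, ‖z j‖ ^ 2) : ℝ) : ℂ) =
      (((Real.pi / a) ^ n : ℝ) : ℂ) := by
    rw [h]; simp [div_pow]
  exact_mod_cast h3

/-! ### Injectivity of the Fourier transform on integrable functions -/

/-- The positive and the negative part of `g` are densities of finite measures with the same
characteristic function, so the two measures coincide. -/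
theorem ae_eq_zero_of_fourier_eq_zero_real {g : (Fin n → ℝ) → ℝ} (hg : Integrable g)
    (h : ∀ L : StrongDual ℝ (Fin n → ℝ), ∫ x, cexp (L x * I) * (g x : ℂ) = 0) : g =ᵐ[volume] 0 := by
  have hp : AEMeasurable (fun x => ENNReal.ofReal (g x)) volume := hg.aemeasurable.ennreal_ofReal
  have hm : AEMeasurable (fun x => ENNReal.ofReal (-g x)) volume :=
    hg.neg.aemeasurable.ennreal_ofReal
  have hpf : ∫⁻ x, ENNReal.ofReal (g x) ≠ ∞ := hg.lintegral_lt_top.ne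
  have hmf : ∫⁻ x, ENNReal.ofReal (-g x) ≠ ∞ := hg.neg.lintegral_lt_top.ne
  have := isFiniteMeasure_withDensity hpf
  have := isFiniteMeasure_withDensity hmf
  have key : (volume.withDensity fun x => ENNReal.ofReal (g x)) =
      volume.withDensity fun x => ENNReal.ofReal (-g x) := by
    refine Measure.ext_of_charFunDual (funext fun L => ?_)
    have hL : Continuous fun x : Fin n → ℝ => cexp (L x * I) := by fun_prop
    have hb : ∀ x, ‖cexp (L x * I)‖ ≤ 1 := fun x => by
      rw [Complex.norm_exp_ofReal_mul_I]
    have hint : ∀ f : (Fin n → ℝ) → ℝ, Integrable f →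
        Integrable fun x => ((f x : ℝ) : ℂ) * cexp (L x * I) := fun f hf =>
      hf.ofReal.mul_bdd (c := 1) hL.aestronglyMeasurable
        (Filter.Eventually.of_forall hb)
    rw [charFunDual_apply, charFunDual_apply,
      integral_withDensity_eq_integral_toReal_smul₀ hp (by simp),
      integral_withDensity_eq_integral_toReal_smul₀ hm (by simp), ← sub_eq_zero]
    simp_rw [ENNReal.toReal_ofReal', Complex.real_smul]
    rw [← integral_sub (hint _ hg.pos_part) (hint _ hg.neg_part), ← h L]
    refine integral_congr_ae (Filter.Eventually.of_forall fun x => ?_)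
    simp only
    rw [← sub_mul, mul_comm, ← Complex.ofReal_sub]
    congr 2
    rcases le_total (g x) 0 with h0 | h0
    · rw [max_eq_right h0, max_eq_left (by linarith)]; ring
    · rw [max_eq_left h0, max_eq_right (by linarith)]; ring
  filter_upwards [(withDensity_eq_iff hp hm hpf).1 key] with x hx
  rcases le_total (g x) 0 with h0 | h0
  · rw [ENNReal.ofReal_of_nonpos h0, eq_comm, ENNReal.ofReal_eq_zero] at hx
    simp only [Pi.zero_apply]; linarith
  · rw [ENNReal.ofReal_of_nonpos (by linarith : -g x ≤ 0), ENNReal.ofReal_eq_zero] at hx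
    simp only [Pi.zero_apply]; linarith

theorem ae_eq_zero_of_fourier_eq_zero {f : (Fin n → ℝ) → ℂ} (hf : Integrable f)
    (h : ∀ p : Fin n → ℝ, ∫ x, cexp (((∑ j, p j * x j : ℝ) : ℂ) * I) * f x = 0) :
    f =ᵐ[volume] 0 := by
  have hL : ∀ L : StrongDual ℝ (Fin n → ℝ), ∫ x, cexp (L x * I) * f x = 0 := by
    intro L
    rw [← h fun j => L (Pi.single j 1)]
    refine integral_congr_ae (Filter.Eventually.of_forall fun x => ?_)
    simp only
    congr 4
    conv_lhs => rw [← Finset.univ_sum_single x, map_sum]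
    refine Finset.sum_congr rfl fun j _ => ?_
    have : (Pi.single j (x j) : Fin n → ℝ) = x j • (Pi.single j 1 : Fin n → ℝ) := by
      rw [← Pi.single_smul]; simp
    rw [this, map_smul, smul_eq_mul, mul_comm]
  -- The hypothesis at `-L`, conjugated. It lets the real and the imaginary part of `f` be treated
  -- separately by the real case.
  have hLc : ∀ L : StrongDual ℝ (Fin n → ℝ), ∫ x, cexp (L x * I) * conj (f x) = 0 := by
    intro L
    have h1 := congrArg conj (hL (-L))
    rw [← integral_conj, map_zero] at h1
    rw [← h1]
    refine integral_congr_ae (Filter.Eventually.of_forall fun x => ?_)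
    simp [← Complex.exp_conj]
  have hb : ∀ (L : StrongDual ℝ (Fin n → ℝ)) (g : (Fin n → ℝ) → ℂ), Integrable g →
      Integrable fun x => cexp (L x * I) * g x := fun L g hg =>
    hg.bdd_mul (c := 1) (Continuous.aestronglyMeasurable (by fun_prop))
      (Filter.Eventually.of_forall fun x => by rw [Complex.norm_exp_ofReal_mul_I])
  have hfc : Integrable fun x => conj (f x) := (LinearIsometryEquiv.integrable_comp_iff conjLIE).2 hf
  have hre : (fun x => (f x).re) =ᵐ[volume] 0 := by
    refine ae_eq_zero_of_fourier_eq_zero_real hf.re fun L => ?_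
    have : ∀ x, cexp (L x * I) * ((f x).re : ℂ) =
        (1 / 2 : ℂ) * (cexp (L x * I) * f x + cexp (L x * I) * conj (f x)) := fun x => by
      rw [Complex.re_eq_add_conj]; ring
    simp_rw [this]
    rw [integral_const_mul, integral_add (hb L f hf) (hb L _ hfc), hL, hLc]
    simp
  have him : (fun x => (f x).im) =ᵐ[volume] 0 := by
    refine ae_eq_zero_of_fourier_eq_zero_real hf.im fun L => ?_
    have : ∀ x, cexp (L x * I) * ((f x).im : ℂ) =
        (1 / (2 * I) : ℂ) * (cexp (L x * I) * f x - cexp (L x * I) * conj (f x)) := fun x => by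
      rw [Complex.im_eq_sub_conj]; ring
    simp_rw [this]
    rw [integral_const_mul, integral_sub (hb L f hf) (hb L _ hfc), hL, hLc]
    simp
  filter_upwards [hre, him] with x h1 h2
  exact Complex.ext h1 h2

set_option linter.unusedSectionVars false

/-! ### Unitaries from families with equal Gram matrices -/

section Gram

variable {H H' ι : Type*} [NormedAddCommGroup H'] [InnerProductSpace ℂ H'] [CompleteSpace H']
  [NormedAddCommGroup H] [InnerProductSpace ℂ H] [CompleteSpace H]

/-- A family of vectors is total if only `0` is orthogonal to all of them. -/
def Total (e : ι → H) : Prop := ∀ ψ : H, (∀ i, inner ℂ (e i) ψ = 0) → ψ = 0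

theorem Total.dense_span {e : ι → H} (he : Total e) :
    Dense (Submodule.span ℂ (Set.range e) : Set H) := by
  rw [Submodule.dense_iff_topologicalClosure_eq_top, Submodule.topologicalClosure_eq_top_iff,
    Submodule.eq_bot_iff]
  intro ψ hψ
  refine he ψ fun i => ?_
  exact (Submodule.mem_orthogonal _ _).1 hψ _ (Submodule.subset_span ⟨i, rfl⟩)

theorem Total.denseRange_linearCombination {e : ι → H} (he : Total e) :
    DenseRange (Finsupp.linearCombination ℂ e) := by
  have h := he.dense_span
  rw [← Finsupp.range_linearCombination] at h
  exact h

theorem norm_linearCombination_eq_of_gram {e : ι → H} {f : ι → H'}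
    (h : ∀ i j, inner ℂ (e i) (e j) = inner ℂ (f i) (f j)) (c : ι →₀ ℂ) :
    ‖Finsupp.linearCombination ℂ f c‖ = ‖Finsupp.linearCombination ℂ e c‖ := by
  have : (inner ℂ (Finsupp.linearCombination ℂ f c) (Finsupp.linearCombination ℂ f c) : ℂ) =
      inner ℂ (Finsupp.linearCombination ℂ e c) (Finsupp.linearCombination ℂ e c) := by
    simp only [Finsupp.linearCombination_apply, Finsupp.sum, sum_inner, inner_sum,
      inner_smul_left, inner_smul_right, h]
  rw [inner_self_eq_norm_sq_to_K, inner_self_eq_norm_sq_to_K] at this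
  have h2 : ‖Finsupp.linearCombination ℂ f c‖ ^ 2 = ‖Finsupp.linearCombination ℂ e c‖ ^ 2 := by
    exact_mod_cast this
  exact (pow_left_inj₀ (norm_nonneg _) (norm_nonneg _) two_ne_zero).1 h2

/-- Equal Gram matrices mean that a linear combination of the `e i` and the same combination of the
`f i` have equal norm. The correspondence extends from the dense span by continuity, and totality of
`f` makes it onto. -/
theorem exists_isometryEquiv_of_gram {e : ι → H} {f : ι → H'} (he : Total e) (hf : Total f)
    (h : ∀ i j, inner ℂ (e i) (e j) = inner ℂ (f i) (f j)) :
    ∃ U : H ≃ₗᵢ[ℂ] H', ∀ i, U (e i) = f i := by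
  let U := (LinearEquiv.refl ℂ (ι →₀ ℂ)).extendOfIsometry (Finsupp.linearCombination ℂ e)
    (Finsupp.linearCombination ℂ f) he.denseRange_linearCombination
    hf.denseRange_linearCombination (fun c => norm_linearCombination_eq_of_gram h c)
  refine ⟨U, fun i => ?_⟩
  have h1 := LinearEquiv.extendOfIsometry_eq (LinearEquiv.refl ℂ (ι →₀ ℂ))
    (e₁ := Finsupp.linearCombination ℂ e) (e₂ := Finsupp.linearCombination ℂ f)
    he.denseRange_linearCombination hf.denseRange_linearCombination
    (fun c => norm_linearCombination_eq_of_gram h c) (Finsupp.single i 1)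
  simpa using h1

/-- Continuous maps that agree on a total family and are linear agree. -/
theorem Total.ext_clm {F : Type*} [NormedAddCommGroup F] [NormedSpace ℂ F] {e : ι → H}
    (he : Total e) {S T : H →L[ℂ] F} (h : ∀ i, S (e i) = T (e i)) : S = T := by
  refine ContinuousLinearMap.ext_on he.dense_span ?_
  rintro _ ⟨i, rfl⟩
  exact h i

/-- A closed submodule containing a total family is everything. -/
theorem Total.induction {e : ι → H} (he : Total e) (p : Submodule ℂ H)
    (hp : IsClosed (p : Set H)) (h : ∀ i, e i ∈ p) (ψ : H) : ψ ∈ p := by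
  have h1 : Submodule.span ℂ (Set.range e) ≤ p := by
    rw [Submodule.span_le]; rintro _ ⟨i, rfl⟩; exact h i
  have h2 : closure (Submodule.span ℂ (Set.range e) : Set H) ⊆ p := closure_minimal h1 hp
  exact h2 (he.dense_span ψ)

end Gram

end

end GravLOCC

/-! ### Weyl operators, coherent states and the vacuum projection -/

namespace GravLOCC

noncomputable section

open Complex
open scoped ComplexConjugate

variable {n : ℕ}

/-! ### The displacement operators -/

/-- The symplectic form, `symp δ δ' = δ_P · δ'_X - δ_X · δ'_P`. -/
def symp (δ δ' : Fin n ⊕ Fin n → ℝ) : ℝ :=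
  ∑ j, (δ (.inr j) * δ' (.inl j) - δ (.inl j) * δ' (.inr j))

theorem coeFn_displace (δ : Fin n ⊕ Fin n → ℝ) (ψ : Modes n) :
    displace δ ψ =ᵐ[volume] fun x => cexp (I *
        ((∑ j, δ (.inr j) * x j - (1 / 2) * ∑ j, δ (.inl j) * δ (.inr j) : ℝ) : ℂ)) *
      ψ (fun j => x j - δ (.inl j)) :=
  MemLp.coeFn_toLp _

theorem ae_comp_sub {p : (Fin n → ℝ) → Prop} (h : ∀ᵐ x, p x) (a : Fin n → ℝ) :
    ∀ᵐ x : Fin n → ℝ, p fun j => x j - a j :=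
  (measurePreserving_sub_right volume a).quasiMeasurePreserving.ae h

theorem displace_add_right (δ : Fin n ⊕ Fin n → ℝ) (ψ φ : Modes n) :
    displace δ (ψ + φ) = displace δ ψ + displace δ φ := by
  refine Lp.ext ?_
  filter_upwards [coeFn_displace δ (ψ + φ), coeFn_displace δ ψ, coeFn_displace δ φ,
    Lp.coeFn_add (displace δ ψ) (displace δ φ),
    ae_comp_sub (Lp.coeFn_add ψ φ) fun j => δ (.inl j)] with x h1 h2 h3 h4 h5
  rw [h1, h4, Pi.add_apply, h2, h3, h5, Pi.add_apply, mul_add]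

theorem displace_smul_right (δ : Fin n ⊕ Fin n → ℝ) (c : ℂ) (ψ : Modes n) :
    displace δ (c • ψ) = c • displace δ ψ := by
  refine Lp.ext ?_
  filter_upwards [coeFn_displace δ (c • ψ), coeFn_displace δ ψ,
    Lp.coeFn_smul c (displace δ ψ),
    ae_comp_sub (Lp.coeFn_smul c ψ) fun j => δ (.inl j)] with x h1 h2 h4 h5
  rw [h1, h4, Pi.smul_apply, h2, h5, Pi.smul_apply, smul_eq_mul, smul_eq_mul]
  ring

theorem norm_displace (δ : Fin n ⊕ Fin n → ℝ) (ψ : Modes n) : ‖displace δ ψ‖ = ‖ψ‖ := by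
  rw [Lp.norm_def, Lp.norm_def]
  congr 1
  have h1 : eLpNorm (displace δ ψ) 2 volume =
      eLpNorm (fun x : Fin n → ℝ => ψ (fun j => x j - δ (.inl j))) 2 volume := by
    refine eLpNorm_congr_norm_ae ?_
    filter_upwards [coeFn_displace δ ψ] with x hx
    rw [hx, norm_mul, mul_comm I, Complex.norm_exp_ofReal_mul_I, one_mul]
  rw [h1]
  exact eLpNorm_comp_measurePreserving (Lp.aestronglyMeasurable ψ)
    (measurePreserving_sub_right volume fun j => δ (.inl j))

/-- The Weyl relation. The phase is half the symplectic form because of the term `-δ_X · δ_P / 2` in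
the prefactor of `displace`. -/
theorem displace_displace (δ δ' : Fin n ⊕ Fin n → ℝ) (ψ : Modes n) :
    displace δ (displace δ' ψ) =
      cexp (I * ((1 / 2 * symp δ δ' : ℝ) : ℂ)) • displace (δ + δ') ψ := by
  refine Lp.ext ?_
  filter_upwards [coeFn_displace δ (displace δ' ψ), coeFn_displace (δ + δ') ψ,
    Lp.coeFn_smul (cexp (I * ((1 / 2 * symp δ δ' : ℝ) : ℂ))) (displace (δ + δ') ψ),
    ae_comp_sub (coeFn_displace δ' ψ) fun j => δ (.inl j)] with x h1 h2 h3 h4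
  rw [h1, h4, h3, Pi.smul_apply, h2, smul_eq_mul, ← mul_assoc, ← mul_assoc, ← Complex.exp_add,
    ← Complex.exp_add, ← mul_add, ← mul_add, ← Complex.ofReal_add, ← Complex.ofReal_add]
  congr 1
  · congr 3
    simp only [symp, Pi.add_apply, Finset.mul_sum, ← Finset.sum_add_distrib,
      ← Finset.sum_sub_distrib]
    refine Finset.sum_congr rfl fun j _ => ?_
    ring
  · congr 1
    ext j
    simp only [Pi.add_apply]
    ring

theorem displace_zero (ψ : Modes n) : displace 0 ψ = ψ := by
  refine Lp.ext ?_
  filter_upwards [coeFn_displace 0 ψ] with x h1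
  rw [h1]
  simp

theorem symp_self_neg (δ : Fin n ⊕ Fin n → ℝ) : symp δ (-δ) = 0 := by
  simp only [symp, Pi.neg_apply]
  exact Finset.sum_eq_zero fun j _ => by ring

theorem displace_neg_displace (δ : Fin n ⊕ Fin n → ℝ) (ψ : Modes n) :
    displace (-δ) (displace δ ψ) = ψ := by
  have h := symp_self_neg (-δ)
  rw [neg_neg] at h
  rw [displace_displace, h]
  simp [displace_zero]

theorem displace_displace_neg (δ : Fin n ⊕ Fin n → ℝ) (ψ : Modes n) :
    displace δ (displace (-δ) ψ) = ψ := by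
  rw [displace_displace, symp_self_neg]
  simp [displace_zero]

/-- The displacement operators as unitaries. -/
def dispLIE (δ : Fin n ⊕ Fin n → ℝ) : Modes n ≃ₗᵢ[ℂ] Modes n where
  toFun := displace δ
  invFun := displace (-δ)
  map_add' := displace_add_right δ
  map_smul' := displace_smul_right δ
  left_inv := displace_neg_displace δ
  right_inv := displace_displace_neg δ
  norm_map' := norm_displace δ

@[simp] theorem dispLIE_apply (δ : Fin n ⊕ Fin n → ℝ) (ψ : Modes n) :
    dispLIE δ ψ = displace δ ψ := rfl

@[simp] theorem dispLIE_symm_apply (δ : Fin n ⊕ Fin n → ℝ) (ψ : Modes n) :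
    (dispLIE δ).symm ψ = displace (-δ) ψ := rfl

theorem inner_displace_right (δ : Fin n ⊕ Fin n → ℝ) (φ ψ : Modes n) :
    inner ℂ φ (displace δ ψ) = inner ℂ (displace (-δ) φ) ψ := by
  rw [← dispLIE_symm_apply, ← dispLIE_apply, ← (dispLIE δ).inner_map_map ((dispLIE δ).symm φ) ψ,
    LinearIsometryEquiv.apply_symm_apply]

theorem displace_sub_right (δ : Fin n ⊕ Fin n → ℝ) (ψ φ : Modes n) :
    displace δ (ψ - φ) = displace δ ψ - displace δ φ := map_sub (dispLIE δ) ψ φ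

/-! ### Product vectors -/

theorem ae_comp_eval {p : ℝ → Prop} (h : ∀ᵐ y, p y) (j : Fin n) :
    ∀ᵐ x : Fin n → ℝ, p (x j) :=
  (Measure.quasiMeasurePreserving_eval (fun _ : Fin n => (volume : Measure ℝ)) j).ae h

theorem coeFn_tensor (f : Fin n → Mode) :
    tensor f =ᵐ[volume] fun x => ∏ j, f j (x j) := MemLp.coeFn_toLp _

theorem coeFn_tensor_of_ae {f : Fin n → Mode} {g : Fin n → ℝ → ℂ}
    (h : ∀ j, f j =ᵐ[volume] g j) : tensor f =ᵐ[volume] fun x => ∏ j, g j (x j) := by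
  filter_upwards [coeFn_tensor f, ae_all_iff.2 fun j => ae_comp_eval (h j) j] with x h1 h2
  rw [h1]
  exact Finset.prod_congr rfl fun j _ => h2 j

theorem inner_tensor (f g : Fin n → Mode) :
    inner ℂ (tensor f) (tensor g) = ∏ j, (inner ℂ (f j) (g j) : ℂ) := by
  simp_rw [L2.inner_def]
  rw [← integral_fintype_prod_volume_eq_prod (f := fun j (x : ℝ) => (inner ℂ (f j x) (g j x) : ℂ))]
  refine integral_congr_ae ?_
  filter_upwards [coeFn_tensor f, coeFn_tensor g] with x h1 h2
  rw [h1, h2]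
  simp only [RCLike.inner_apply, map_prod, Finset.prod_mul_distrib]

theorem norm_tensor (f : Fin n → Mode) : ‖tensor f‖ = ∏ j, ‖f j‖ := by
  have h := inner_tensor f f
  simp_rw [inner_self_eq_norm_sq_to_K] at h
  have h2 : ‖tensor f‖ ^ 2 = (∏ j, ‖f j‖) ^ 2 := by
    rw [← Finset.prod_pow]
    exact_mod_cast h
  exact (pow_left_inj₀ (norm_nonneg _) (Finset.prod_nonneg fun _ _ => norm_nonneg _)
    two_ne_zero).1 h2

/-! ### Coherent states -/

/-- Phase space coordinates of `z ∈ ℂⁿ`: `√2 (Re z, Im z)`. -/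
def ph (z : Fin n → ℂ) : Fin n ⊕ Fin n → ℝ :=
  Sum.elim (fun j => √2 * (z j).re) (fun j => √2 * (z j).im)

theorem ph_add (z w : Fin n → ℂ) : ph (z + w) = ph z + ph w := by
  ext i; cases i <;> simp [ph, mul_add]

theorem ph_neg (z : Fin n → ℂ) : ph (-z) = -ph z := by
  ext i; cases i <;> simp [ph]

theorem sum_ph_sq (z : Fin n → ℂ) : ∑ i, ph z i ^ 2 = 2 * ∑ j, ‖z j‖ ^ 2 := by
  simp only [ph, Fintype.sum_sum_type, Sum.elim_inl, Sum.elim_inr, ← Finset.sum_add_distrib,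
    Finset.mul_sum, Complex.sq_norm, Complex.normSq_apply, mul_pow]
  refine Finset.sum_congr rfl fun j _ => ?_
  rw [Real.sq_sqrt zero_le_two]
  ring

/-- The inverse of `ph`. -/
def phInv (δ : Fin n ⊕ Fin n → ℝ) : Fin n → ℂ :=
  fun j => ⟨δ (.inl j) / √2, δ (.inr j) / √2⟩

theorem ph_phInv (δ : Fin n ⊕ Fin n → ℝ) : ph (phInv δ) = δ := by
  have : √(2 : ℝ) ≠ 0 := by positivity
  ext i
  cases i <;> simp only [ph, phInv, Sum.elim_inl, Sum.elim_inr] <;> field_simp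

theorem symp_ph (z w : Fin n → ℂ) : symp (ph z) (ph w) = 2 * ∑ j, (z j * conj (w j)).im := by
  simp only [symp, ph, Sum.elim_inl, Sum.elim_inr, Finset.mul_sum]
  refine Finset.sum_congr rfl fun j _ => ?_
  have : √(2 : ℝ) * √2 = 2 := Real.mul_self_sqrt zero_le_two
  simp only [Complex.mul_im, Complex.conj_re, Complex.conj_im]
  linear_combination ((z j).im * (w j).re - (z j).re * (w j).im) * this

theorem coherent_eq (α : Fin n → ℂ) : coherent α = displace (ph α) (vacuum n) := rfl

theorem displace_coherent (z β : Fin n → ℂ) : displace (ph z) (coherent β) =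
    cexp (I * ((∑ j, (z j * conj (β j)).im : ℝ) : ℂ)) • coherent (z + β) := by
  rw [coherent_eq, displace_displace, ← ph_add, symp_ph, coherent_eq]
  congr 5
  ring

/-- The wave function of a one-mode coherent state. -/
def cohFun (a : ℂ) (x : ℝ) : ℂ :=
  ((Real.pi ^ (-(1 / 4) : ℝ) : ℝ) : ℂ) *
    cexp (-(1 / 2) * (x : ℂ) ^ 2 + (√2 * a) * x + -(a ^ 2 + ((‖a‖ ^ 2 : ℝ) : ℂ)) / 2)

/-- Links two normal forms: in `cohFun` the exponent is holomorphic in `a` apart from the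
normalisation, which suits overlaps; on the right is the displaced vacuum, from which the modulus is
read off. -/
theorem cohFun_eq (a : ℂ) (x : ℝ) : cohFun a x =
    cexp (I * ((√2 * a.im * x - 1 / 2 * (√2 * a.re * (√2 * a.im)) : ℝ) : ℂ)) *
      vacuumFun (x - √2 * a.re) := by
  have h2 : (√(2 : ℝ) : ℂ) * (√(2 : ℝ) : ℂ) = 2 := by
    exact_mod_cast Real.mul_self_sqrt zero_le_two
  have h1 : ‖a‖ ^ 2 = a.re ^ 2 + a.im ^ 2 := by
    rw [Complex.sq_norm, Complex.normSq_apply]; ring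
  have ha : a = a.re + a.im * I := (Complex.re_add_im a).symm
  rw [cohFun, vacuumFun, Complex.ofReal_mul, mul_left_comm, Complex.ofReal_exp, ← Complex.exp_add,
    h1]
  congr 2
  generalize a.re = p at *
  generalize a.im = q at *
  subst ha
  push_cast
  linear_combination (-(1/2) * (p : ℂ) ^ 2 - (1 / 2) * p * q * I) * (-h2) +
    (-(q:ℂ)^2 / 2) * Complex.I_sq

theorem norm_cohFun (a : ℂ) (x : ℝ) : ‖cohFun a x‖ = ‖vacuumFun (x - √2 * a.re)‖ := by
  rw [cohFun_eq, norm_mul, mul_comm I, Complex.norm_exp_ofReal_mul_I, one_mul]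

theorem continuous_cohFun (a : ℂ) : Continuous (cohFun a) := by
  unfold cohFun; fun_prop

theorem memLp_cohFun (a : ℂ) : MemLp (cohFun a) 2 (volume : Measure ℝ) :=
  (memLp_vacuumFun.comp_measurePreserving (measurePreserving_sub_right volume (√2 * a.re))).of_le
    (continuous_cohFun a).aestronglyMeasurable
    (Filter.Eventually.of_forall fun x => (norm_cohFun a x).le)

/-- The one-mode coherent state. -/
def coh (a : ℂ) : Mode := (memLp_cohFun a).toLp _

theorem coeFn_coh (a : ℂ) : coh a =ᵐ[volume] cohFun a := MemLp.coeFn_toLp _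

theorem coeFn_vacuum : vacuum n =ᵐ[volume] fun x => ∏ j, vacuumFun (x j) :=
  coeFn_tensor_of_ae fun _ => MemLp.coeFn_toLp _

theorem coeFn_coherent (α : Fin n → ℂ) :
    coherent α =ᵐ[volume] fun x => ∏ j, cohFun (α j) (x j) := by
  filter_upwards [coeFn_displace (ph α) (vacuum n),
    ae_comp_sub coeFn_vacuum fun j => ph α (.inl j)] with x h1 h2
  rw [coherent_eq, h1, h2]
  simp only [cohFun_eq, Finset.prod_mul_distrib, ← Complex.exp_sum]
  congr 1
  rw [← Finset.mul_sum, ← Complex.ofReal_sum]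
  congr 3
  simp [ph, Finset.sum_sub_distrib, Finset.mul_sum]

theorem coherent_eq_tensor (α : Fin n → ℂ) : coherent α = tensor fun j => coh (α j) := by
  refine Lp.ext ?_
  filter_upwards [coeFn_coherent α, coeFn_tensor_of_ae fun j => coeFn_coh (α j)] with x h1 h2
  rw [h1, h2]

theorem inner_coh (a b : ℂ) : inner ℂ (coh a) (coh b) =
    cexp (-((‖a‖ ^ 2 : ℝ) : ℂ) / 2 - ((‖b‖ ^ 2 : ℝ) : ℂ) / 2 + conj a * b) := by
  have h2 : (√(2 : ℝ) : ℂ) ^ 2 = 2 := by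
    exact_mod_cast Real.sq_sqrt zero_le_two
  have hs : ((Real.pi ^ (-(1 / 4) : ℝ) : ℝ) : ℂ) * ((Real.pi ^ (-(1 / 4) : ℝ) : ℝ) : ℂ) *
      ((Real.pi : ℂ) / -(-1)) ^ (1 / 2 : ℂ) = 1 := by
    rw [neg_neg, div_one, show (1 / 2 : ℂ) = ((1 / 2 : ℝ) : ℂ) by push_cast; rfl,
      ← Complex.ofReal_cpow Real.pi_pos.le, ← Complex.ofReal_mul, ← Complex.ofReal_mul,
      ← Real.rpow_add Real.pi_pos, ← Real.rpow_add Real.pi_pos]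
    norm_num
  rw [L2.inner_def]
  calc ∫ x, (inner ℂ (coh a x) (coh b x) : ℂ)
      = ∫ x : ℝ, ((Real.pi ^ (-(1 / 4) : ℝ) : ℝ) : ℂ) * ((Real.pi ^ (-(1 / 4) : ℝ) : ℝ) : ℂ) *
        cexp ((-1) * (x : ℂ) ^ 2 + (√2 * (conj a + b)) * x +
          (-(conj a ^ 2 + ((‖a‖ ^ 2 : ℝ) : ℂ)) / 2 + -(b ^ 2 + ((‖b‖ ^ 2 : ℝ) : ℂ)) / 2)) := by
        refine integral_congr_ae ?_
        filter_upwards [coeFn_coh a, coeFn_coh b] with x h1 h3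
        rw [h1, h3, RCLike.inner_apply]
        simp only [cohFun, map_mul, Complex.conj_ofReal, ← Complex.exp_conj, map_add, map_neg,
          map_div₀, map_one, map_pow, map_ofNat]
        rw [mul_mul_mul_comm, ← Complex.exp_add]
        congr 2
        ring
    _ = _ := by
        rw [integral_const_mul, integral_cexp_quadratic (by norm_num), ← mul_assoc, hs, one_mul]
        congr 1
        rw [mul_pow, h2]
        ring

theorem inner_coherent (α β : Fin n → ℂ) : inner ℂ (coherent α) (coherent β) =
    cexp (∑ j, (-((‖α j‖ ^ 2 : ℝ) : ℂ) / 2 - ((‖β j‖ ^ 2 : ℝ) : ℂ) / 2 + conj (α j) * β j)) := by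
  rw [coherent_eq_tensor, coherent_eq_tensor, inner_tensor, Complex.exp_sum]
  simp_rw [inner_coh]

theorem norm_coherent (α : Fin n → ℂ) : ‖coherent α‖ = 1 := by
  have h : ((‖coherent α‖ ^ 2 : ℝ) : ℂ) = 1 := by
    rw [Complex.ofReal_pow]
    refine (inner_self_eq_norm_sq_to_K (𝕜 := ℂ) (coherent α)).symm.trans ?_
    rw [inner_coherent, ← Complex.exp_zero]
    congr 1
    refine Finset.sum_eq_zero fun j _ => ?_
    rw [mul_comm, Complex.mul_conj, Complex.normSq_eq_norm_sq]
    ring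
  have h2 : ‖coherent α‖ ^ 2 = 1 := by exact_mod_cast h
  exact (pow_eq_one_iff_of_nonneg (norm_nonneg _) two_ne_zero).1 h2

theorem coherent_zero : coherent (0 : Fin n → ℂ) = vacuum n := by
  rw [coherent_eq, show ph (0 : Fin n → ℂ) = 0 by ext i; cases i <;> simp [ph], displace_zero]

theorem norm_vacuum : ‖vacuum n‖ = 1 := by rw [← coherent_zero, norm_coherent]

/-- The squared distance of unit vectors is `2 - 2 Re` of their overlap, and the overlap is an
explicit continuous function. -/
theorem continuous_coherent : Continuous (coherent : (Fin n → ℂ) → Modes n) := by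
  have h : ∀ α β : Fin n → ℂ, ‖coherent α - coherent β‖ ^ 2 =
      2 - 2 * (inner ℂ (coherent α) (coherent β)).re := by
    intro α β
    rw [@norm_sub_sq ℂ, norm_coherent, norm_coherent]
    simp only [RCLike.re_eq_complex_re]
    ring
  refine continuous_iff_continuousAt.2 fun β => ?_
  rw [ContinuousAt, tendsto_iff_norm_sub_tendsto_zero]
  have h1 : Filter.Tendsto (fun α : Fin n → ℂ => √(2 - 2 * (inner ℂ (coherent α) (coherent β)).re))
      (nhds β) (nhds √(2 - 2 * (inner ℂ (coherent β) (coherent β)).re)) := by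
    refine Continuous.tendsto (f := fun α : Fin n → ℂ =>
      √(2 - 2 * (inner ℂ (coherent α) (coherent β)).re)) ?_ β
    simp_rw [inner_coherent]
    fun_prop
  rw [← h, sub_self, norm_zero] at h1
  simp_rw [← h, Real.sqrt_sq (norm_nonneg _)] at h1
  simpa using h1

/-- Purely imaginary amplitudes suffice. Their coherent states are plane waves times the vacuum, so
orthogonality says that the Fourier transform of vacuum times `ψ` vanishes; the vacuum wave function
has no zeros. -/
theorem total_coherent : Total (coherent : (Fin n → ℂ) → Modes n) := by
  intro ψ hψ
  have hv : MemLp (fun x : Fin n → ℝ => ∏ j, vacuumFun (x j)) 2 volume :=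
    (Lp.memLp (vacuum n)).ae_eq coeFn_vacuum
  have hint : Integrable fun x : Fin n → ℝ => (∏ j, vacuumFun (x j)) * ψ x :=
    hv.integrable_mul (Lp.memLp ψ)
  have hz := ae_eq_zero_of_fourier_eq_zero hint fun p => by
    -- The minus sign is undone by the conjugation in the first slot of the inner product, which
    -- leaves `exp(i p · x)`.
    have h := hψ fun j => -(p j / √2 : ℝ) * I
    rw [L2.inner_def] at h
    rw [← h]
    refine integral_congr_ae ?_
    filter_upwards [coeFn_coherent fun j => -((p j / √2 : ℝ) : ℂ) * I] with x hx
    rw [hx, RCLike.inner_apply, mul_comm (ψ x), ← mul_assoc, map_prod]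
    congr 1
    simp only [cohFun_eq, map_mul, ← Complex.exp_conj, Finset.prod_mul_distrib, ← Complex.exp_sum]
    congr 1
    · congr 1
      simp only [Complex.conj_I, Complex.conj_ofReal, Complex.ofReal_sum, Finset.sum_mul]
      refine Finset.sum_congr rfl fun j _ => ?_
      rw [mul_comm, neg_mul, ← mul_neg, ← Complex.ofReal_neg]
      congr 2
      have : √(2 : ℝ) ≠ 0 := by positivity
      simp
      left
      field_simp
    · refine Finset.prod_congr rfl fun j _ => ?_
      rw [show (-((p j / √2 : ℝ) : ℂ) * I).re = 0 by simp, mul_zero, sub_zero, vacuumFun,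
        Complex.conj_ofReal]
  refine Lp.ext ?_
  filter_upwards [hz, Lp.coeFn_zero ℂ 2 (volume : Measure (Fin n → ℝ))] with x hx h0
  rw [h0]
  have : (∏ j, vacuumFun (x j)) ≠ 0 := by
    refine Finset.prod_ne_zero_iff.2 fun j _ => ?_
    unfold vacuumFun
    have := Real.rpow_pos_of_pos Real.pi_pos (-(1 / 4) : ℝ)
    exact_mod_cast (by positivity : (Real.pi ^ (-(1 / 4) : ℝ) * Real.exp (-(x j) ^ 2 / 2)) ≠ 0)
  simpa [this] using hx

theorem total_tensor : Total (tensor : (Fin n → Mode) → Modes n) := fun ψ hψ =>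
  total_coherent ψ fun α => by rw [coherent_eq_tensor]; exact hψ _

theorem total_coh : Total coh := by
  intro f hf
  have h : tensor (fun _ : Fin 1 => f) = 0 := by
    refine total_coherent _ fun α => ?_
    rw [coherent_eq_tensor, inner_tensor]
    simp [hf]
  have h2 := norm_tensor (fun _ : Fin 1 => f)
  rw [h] at h2
  rw [← norm_eq_zero]
  simpa using h2.symm

theorem exists_tensor_unitary (u : Fin n → (Mode ≃ₗᵢ[ℂ] Mode)) :
    ∃ W : Modes n ≃ₗᵢ[ℂ] Modes n, ∀ f, W (tensor f) = tensor fun j => u j (f j) := by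
  have h2 : Total fun f : Fin n → Mode => tensor fun j => u j (f j) := by
    intro ψ hψ
    refine total_tensor ψ fun f => ?_
    have := hψ fun j => (u j).symm (f j)
    simpa using this
  exact exists_isometryEquiv_of_gram total_tensor h2 fun f g => by
    simp [inner_tensor, LinearIsometryEquiv.inner_map_map]

/-! ### Strong continuity and the vacuum projection -/

/-- The vectors with continuous orbit form a subspace, closed because displacements are isometric,
and coherent states lie in it by explicit computation. -/
theorem continuous_displace (ψ : Modes n) :
    Continuous fun z : Fin n → ℂ => displace (ph z) ψ := by
  let p : Submodule ℂ (Modes n) :=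
    { carrier := {ψ | Continuous fun z : Fin n → ℂ => displace (ph z) ψ}
      add_mem' := fun {a b} ha hb => by
        simp only [Set.mem_ofPred_eq, displace_add_right] at *
        exact ha.add hb
      zero_mem' := by
        simp only [Set.mem_ofPred_eq]
        have : ∀ z : Fin n → ℂ, displace (ph z) 0 = 0 := fun z => map_zero (dispLIE (ph z))
        simp_rw [this]
        exact continuous_const
      smul_mem' := fun c a ha => by
        simp only [Set.mem_ofPred_eq, displace_smul_right] at *
        exact ha.const_smul c }
  refine total_coherent.induction p ?_ (fun β => ?_) ψ
  · refine isClosed_of_closure_subset fun ψ hψ => ?_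
    refine continuous_of_uniform_approx_of_continuous fun u hu => ?_
    obtain ⟨ε, hε, hεu⟩ := Metric.mem_uniformity_dist.1 hu
    obtain ⟨φ, hφ, hd⟩ := Metric.mem_closure_iff.1 hψ ε hε
    refine ⟨_, hφ, fun z => hεu ?_⟩
    rw [dist_eq_norm, ← displace_sub_right, norm_displace, ← dist_eq_norm]
    exact hd
  · change Continuous fun z : Fin n → ℂ => displace (ph z) (coherent β)
    simp_rw [displace_coherent]
    have := continuous_coherent (n := n)
    fun_prop

theorem integrable_exp_mul_inner_displace (φ ψ : Modes n) :
    Integrable fun z : Fin n → ℂ =>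
      ((Real.exp (-(1 / 2) * ∑ j, ‖z j‖ ^ 2) : ℝ) : ℂ) * inner ℂ φ (displace (ph z) ψ) := by
  refine (integrable_exp_neg_sum_sq_norm one_half_pos).ofReal.mul_bdd (c := ‖φ‖ * ‖ψ‖) ?_ ?_
  · have := continuous_displace ψ
    exact Continuous.aestronglyMeasurable (by fun_prop)
  · refine Filter.Eventually.of_forall fun z => ?_
    rw [← norm_displace (ph z) ψ]
    exact norm_inner_le_norm _ _

/-- The operator `∫ exp(-|z|²/2) D_z dz`, paired with a vector. -/
def gaussAverage (φ : Modes n) : Modes n →L[ℂ] ℂ :=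
  LinearMap.mkContinuous
    { toFun := fun ψ => ∫ z : Fin n → ℂ,
        ((Real.exp (-(1 / 2) * ∑ j, ‖z j‖ ^ 2) : ℝ) : ℂ) * inner ℂ φ (displace (ph z) ψ)
      map_add' := fun ψ ψ' => by
        simp_rw [displace_add_right, inner_add_right, mul_add]
        exact integral_add (integrable_exp_mul_inner_displace φ ψ)
          (integrable_exp_mul_inner_displace φ ψ')
      map_smul' := fun c ψ => by
        simp_rw [displace_smul_right, inner_smul_right, mul_left_comm _ c]
        exact integral_const_mul _ _ }
    ((∫ z : Fin n → ℂ, Real.exp (-(1 / 2) * ∑ j, ‖z j‖ ^ 2)) * ‖φ‖) fun ψ => by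
      rw [mul_assoc, ← integral_mul_const]
      refine norm_integral_le_of_norm_le
        ((integrable_exp_neg_sum_sq_norm one_half_pos).mul_const _)
        (Filter.Eventually.of_forall fun z => ?_)
      rw [norm_mul, Complex.norm_real, Real.norm_of_nonneg (Real.exp_pos _).le]
      gcongr
      rw [← norm_displace (ph z) ψ]
      exact norm_inner_le_norm _ _

theorem gaussAverage_apply (φ ψ : Modes n) : gaussAverage φ ψ = ∫ z : Fin n → ℂ,
    ((Real.exp (-(1 / 2) * ∑ j, ‖z j‖ ^ 2) : ℝ) : ℂ) * inner ℂ φ (displace (ph z) ψ) := rfl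

/-- The adjoint of a displacement is the opposite displacement, and the weight is even. -/
theorem gaussAverage_conj (φ ψ : Modes n) : gaussAverage φ ψ = conj (gaussAverage ψ φ) := by
  rw [gaussAverage_apply, gaussAverage_apply, ← integral_conj,
    ← integral_neg_eq_self (fun z : Fin n → ℂ => conj _)]
  refine integral_congr_ae (Filter.Eventually.of_forall fun z => ?_)
  simp only [map_mul, Complex.conj_ofReal, Pi.neg_apply, norm_neg, ph_neg]
  rw [inner_conj_symm, inner_displace_right]

theorem gaussAverage_coherent (α β : Fin n → ℂ) : gaussAverage (coherent α) (coherent β) =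
    ((Real.pi ^ n : ℝ) : ℂ) * (inner ℂ (coherent α) (vacuum n) * inner ℂ (vacuum n) (coherent β)) := by
  rw [← coherent_zero, inner_coherent, inner_coherent, gaussAverage_apply, ← Complex.exp_add,
    ← Finset.sum_add_distrib]
  calc _ = ∫ z : Fin n → ℂ, cexp (∑ j, (-((1 : ℝ) : ℂ) * ((‖z j‖ ^ 2 : ℝ) : ℂ) +
            (-β j) * conj (z j) + (conj (α j)) * z j)) *
          cexp (∑ j, (-((‖α j‖ ^ 2 : ℝ) : ℂ) / 2 - ((‖β j‖ ^ 2 : ℝ) : ℂ) / 2 + conj (α j) * β j)) := by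
        refine integral_congr_ae (Filter.Eventually.of_forall fun z => ?_)
        simp only [displace_coherent, inner_smul_right, inner_coherent]
        rw [Complex.ofReal_exp, ← Complex.exp_add, ← Complex.exp_add, ← Complex.exp_add]
        congr 1
        rw [Complex.ofReal_mul, Complex.ofReal_sum, Complex.ofReal_sum, Finset.mul_sum,
          Finset.mul_sum, ← Finset.sum_add_distrib, ← Finset.sum_add_distrib,
          ← Finset.sum_add_distrib]
        refine Finset.sum_congr rfl fun j _ => ?_
        have h1 : ((‖(z + β) j‖ ^ 2 : ℝ) : ℂ) = (z j + β j) * (conj (z j) + conj (β j)) := by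
          rw [Pi.add_apply, ← map_add, Complex.mul_conj, Complex.normSq_eq_norm_sq]
        have h2 : ∀ w : ℂ, ((‖w‖ ^ 2 : ℝ) : ℂ) = w * conj w := fun w => by
          rw [Complex.mul_conj, Complex.normSq_eq_norm_sq]
        have h3 : (((z j * conj (β j)).im : ℝ) : ℂ) * I =
            (z j * conj (β j) - conj (z j) * β j) / 2 := by
          rw [Complex.im_eq_sub_conj, map_mul, Complex.conj_conj]
          field_simp
        rw [h1, h2, h2, h2, mul_comm I, h3]
        push_cast
        simp only [Pi.add_apply]
        ring
    _ = _ := by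
        rw [integral_mul_const, integral_cexp_sum_sq_norm (fun _ => one_pos), mul_assoc,
          ← Complex.exp_add, ← Finset.sum_add_distrib]
        congr 1
        · simp
        · congr 1
          refine Finset.sum_congr rfl fun j _ => ?_
          simp
          ring

/-- The weight is the characteristic function `⟨0|D_z|0⟩` of the vacuum, so the average is `πⁿ`
times the vacuum projection. The identity holds on coherent states by a Gaussian integral; totality
extends it in the second argument and hermiticity then in the first. -/
theorem gaussAverage_eq (φ ψ : Modes n) : gaussAverage φ ψ =
    ((Real.pi ^ n : ℝ) : ℂ) * (inner ℂ φ (vacuum n) * inner ℂ (vacuum n) ψ) := by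
  have key : ∀ φ : Modes n, (∀ β, gaussAverage φ (coherent β) =
      ((Real.pi ^ n : ℝ) : ℂ) * (inner ℂ φ (vacuum n) * inner ℂ (vacuum n) (coherent β))) →
      ∀ ψ, gaussAverage φ ψ =
        ((Real.pi ^ n : ℝ) : ℂ) * (inner ℂ φ (vacuum n) * inner ℂ (vacuum n) ψ) := by
    intro φ h ψ
    have := total_coherent.ext_clm (S := gaussAverage φ)
      (T := (((Real.pi ^ n : ℝ) : ℂ) * inner ℂ φ (vacuum n)) • innerSL ℂ (vacuum n))
      fun β => by simp [h β, mul_assoc]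
    rw [this]
    simp [mul_assoc]
  refine key φ (fun β => ?_) ψ
  rw [gaussAverage_conj, key (coherent β) (fun α => gaussAverage_coherent β α)]
  simp only [map_mul, Complex.conj_ofReal, inner_conj_symm]
  ring

theorem inner_vacuum_displace (δ : Fin n ⊕ Fin n → ℝ) :
    inner ℂ (vacuum n) (displace δ (vacuum n)) = ((Real.exp (-(1 / 4) * ∑ i, δ i ^ 2) : ℝ) : ℂ) := by
  rw [← ph_phInv δ, ← coherent_eq, ← coherent_zero, inner_coherent, sum_ph_sq]
  push_cast
  congr 1
  rw [← mul_assoc, Finset.mul_sum]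
  refine Finset.sum_congr rfl fun j _ => ?_
  simp
  ring

/-- A unitary that implements a nearly norm preserving map of phase space nearly fixes the
vacuum. -/
theorem le_norm_inner_vacuum_sq {X : Modes n ≃ₗᵢ[ℂ] Modes n}
    {T : (Fin n ⊕ Fin n → ℝ) → (Fin n ⊕ Fin n → ℝ)}
    (hX : ∀ δ ψ, X (displace δ ψ) = displace (T δ) (X ψ)) {s : ℝ} (hs : 0 ≤ s)
    (hT : ∀ δ, ∑ i, T δ i ^ 2 ≤ s * ∑ i, δ i ^ 2) :
    (2 / (1 + s)) ^ n ≤ ‖(inner ℂ (vacuum n) (X (vacuum n)) : ℂ)‖ ^ 2 := by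
  -- For this vector `⟨v, D_z v⟩ = ⟨0, D_{Tz} 0⟩` is a Gaussian, bounded below by `hT`, while
  -- `gaussAverage_eq` identifies its weighted integral with `πⁿ |⟨0|X|0⟩|²`.
  set v := X.symm (vacuum n) with hv
  have h1 : ∀ z : Fin n → ℂ, inner ℂ v (displace (ph z) v) =
      ((Real.exp (-(1 / 4) * ∑ i, T (ph z) i ^ 2) : ℝ) : ℂ) := by
    intro z
    rw [← X.inner_map_map, hX, hv, X.apply_symm_apply, inner_vacuum_displace]
  have h2 := gaussAverage_eq v v
  have h3 : (inner ℂ v (vacuum n) * inner ℂ (vacuum n) v : ℂ) =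
      ((‖(inner ℂ (vacuum n) (X (vacuum n)) : ℂ)‖ ^ 2 : ℝ) : ℂ) := by
    have : (inner ℂ v (vacuum n) : ℂ) = inner ℂ (vacuum n) (X (vacuum n)) := by
      rw [← X.inner_map_map, hv, X.apply_symm_apply]
    rw [← inner_conj_symm (vacuum n) v, this, Complex.mul_conj, Complex.normSq_eq_norm_sq]
  have hint := integrable_exp_mul_inner_displace v v
  rw [gaussAverage_apply, h3] at h2
  simp_rw [h1, ← Complex.ofReal_mul] at h2 hint
  rw [integral_complex_ofReal] at h2
  have h4 : ∫ z : Fin n → ℂ, Real.exp (-(1 / 2) * ∑ j, ‖z j‖ ^ 2) *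
      Real.exp (-(1 / 4) * ∑ i, T (ph z) i ^ 2) =
      Real.pi ^ n * ‖(inner ℂ (vacuum n) (X (vacuum n)) : ℂ)‖ ^ 2 := by exact_mod_cast h2
  have h5 : (Real.pi / ((1 + s) / 2)) ^ n ≤
      Real.pi ^ n * ‖(inner ℂ (vacuum n) (X (vacuum n)) : ℂ)‖ ^ 2 := by
    rw [← h4, ← integral_exp_neg_sum_sq_norm (n := n) (by positivity : 0 < (1 + s) / 2)]
    refine integral_mono (integrable_exp_neg_sum_sq_norm (by positivity)) ?_ fun z => ?_
    · exact hint.re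
    · simp only [← Real.exp_add]
      refine Real.exp_le_exp.2 ?_
      have := hT (ph z)
      rw [sum_ph_sq] at this
      nlinarith
  have h6 : (Real.pi / ((1 + s) / 2)) ^ n = Real.pi ^ n * (2 / (1 + s)) ^ n := by
    rw [← mul_pow]
    congr 1
    field_simp
  rw [h6] at h5
  exact le_of_mul_le_mul_left h5 (by positivity)

end

end GravLOCC

/-! ### Product operators, partial conjugation and LOCC protocols -/

namespace GravLOCC

noncomputable section

open Complex
open scoped ComplexConjugate

variable {n : ℕ}

/-! ### Complex conjugation on `L²` -/

section Star

variable {X : Type*} [MeasurableSpace X] {μ : Measure X}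

theorem Lp_star_add (f g : Lp ℂ 2 μ) : star (f + g) = star f + star g := by
  refine Lp.ext ?_
  filter_upwards [Lp.coeFn_star (f + g), Lp.coeFn_add f g, Lp.coeFn_add (star f) (star g),
    Lp.coeFn_star f, Lp.coeFn_star g] with x h1 h2 h3 h4 h5
  rw [h1, h3, Pi.star_apply, h2, Pi.add_apply, Pi.add_apply, h4, h5, star_add]
  rfl

theorem Lp_star_smul (c : ℂ) (f : Lp ℂ 2 μ) : star (c • f) = conj c • star f := by
  refine Lp.ext ?_
  filter_upwards [Lp.coeFn_star (c • f), Lp.coeFn_smul c f, Lp.coeFn_smul (conj c) (star f),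
    Lp.coeFn_star f] with x h1 h2 h3 h4
  rw [h1, h3, Pi.star_apply, h2, Pi.smul_apply, Pi.smul_apply, h4, star_smul]
  rfl

theorem Lp_norm_star (f : Lp ℂ 2 μ) : ‖star f‖ = ‖f‖ := by
  rw [Lp.norm_def, Lp.norm_def, eLpNorm_congr_ae (Lp.coeFn_star f), eLpNorm_star]

theorem Lp_inner_star_star (f g : Lp ℂ 2 μ) : (inner ℂ (star f) (star g) : ℂ) = inner ℂ g f := by
  rw [L2.inner_def, L2.inner_def]
  refine integral_congr_ae ?_
  filter_upwards [Lp.coeFn_star f, Lp.coeFn_star g] with x h1 h2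
  rw [h1, h2]
  simp [RCLike.inner_apply, mul_comm]

/-- The complex conjugate `f ↦ conj (T (conj f))` of an operator. -/
def conjOp (T : Lp ℂ 2 μ →L[ℂ] Lp ℂ 2 μ) : Lp ℂ 2 μ →L[ℂ] Lp ℂ 2 μ :=
  LinearMap.mkContinuous
    { toFun := fun f => star (T (star f))
      map_add' := fun f g => by rw [Lp_star_add, map_add, Lp_star_add]
      map_smul' := fun c f => by
        rw [Lp_star_smul, map_smul, Lp_star_smul, Complex.conj_conj, RingHom.id_apply] } ‖T‖
    fun f => by
      change ‖star (T (star f))‖ ≤ _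
      rw [Lp_norm_star, ← Lp_norm_star f]
      exact T.le_opNorm _

theorem conjOp_apply (T : Lp ℂ 2 μ →L[ℂ] Lp ℂ 2 μ) (f : Lp ℂ 2 μ) :
    conjOp T f = star (T (star f)) := rfl

end Star

theorem star_tensor (f : Fin n → Mode) : star (tensor f) = tensor fun j => star (f j) := by
  refine Lp.ext ?_
  filter_upwards [Lp.coeFn_star (tensor f), coeFn_tensor f,
    coeFn_tensor_of_ae fun j => Lp.coeFn_star (f j)] with x h1 h2 h3
  rw [h1, h3, Pi.star_apply, h2, star_prod]
  rfl

theorem star_coh (a : ℂ) : star (coh a) = coh (conj a) := by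
  refine Lp.ext ?_
  filter_upwards [Lp.coeFn_star (coh a), coeFn_coh a, coeFn_coh (conj a)] with x h1 h2 h3
  rw [h1, h3, Pi.star_apply, h2]
  change conj (cohFun a x) = _
  simp only [cohFun, map_mul, Complex.conj_ofReal, ← Complex.exp_conj, map_add, map_neg,
    map_div₀, map_one, map_pow, map_ofNat, RCLike.norm_conj]

/-- Complex conjugation of the coordinates in `J`. -/
def conjOn (J : Finset (Fin n)) (α : Fin n → ℂ) : Fin n → ℂ :=
  fun j => if j ∈ J then conj (α j) else α j

/-! ### Product operators -/

/-- `K = k₁ ⊗ ⋯ ⊗ kₙ`, and `K'` is the same product with `k_j` replaced by its complex conjugate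
for `j ∈ J`. -/
def IsProductPair (J : Finset (Fin n)) (K K' : Modes n →L[ℂ] Modes n) : Prop :=
  ∃ k : Fin n → (Mode →L[ℂ] Mode), (∀ f, K (tensor f) = tensor fun j => k j (f j)) ∧
    ∀ f, K' (tensor f) = tensor fun j => if j ∈ J then conjOp (k j) (f j) else k j (f j)

theorem IsProductPair.norm_eq {J : Finset (Fin n)} {K K' : Modes n →L[ℂ] Modes n}
    (h : IsProductPair J K K') (α : Fin n → ℂ) :
    ‖K' (coherent (conjOn J α))‖ = ‖K (coherent α)‖ := by
  obtain ⟨k, h1, h2⟩ := h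
  rw [coherent_eq_tensor, coherent_eq_tensor, h1, h2, norm_tensor, norm_tensor]
  refine Finset.prod_congr rfl fun j _ => ?_
  by_cases hj : j ∈ J
  · simp only [hj, conjOn, if_true, conjOp_apply, Lp_norm_star, star_coh, Complex.conj_conj]
  · simp only [hj, conjOn, if_false]

/-- Matrix elements of a product operator between coherent states factorise. Conjugating a mode
sends `coh a` to `coh (conj a)` and reverses the inner product, so each factor keeps its modulus.
This takes the place of a partial transpose. -/
theorem IsProductPair.norm_inner_eq {J : Finset (Fin n)} {K K' : Modes n →L[ℂ] Modes n}
    (h : IsProductPair J K K') (α β : Fin n → ℂ) :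
    ‖(inner ℂ (coherent (conjOn J β)) (K' (coherent (conjOn J α))) : ℂ)‖ =
      ‖(inner ℂ (coherent β) (K (coherent α)) : ℂ)‖ := by
  obtain ⟨k, h1, h2⟩ := h
  simp_rw [coherent_eq_tensor]
  rw [h1, h2, inner_tensor, inner_tensor, norm_prod, norm_prod]
  refine Finset.prod_congr rfl fun j _ => ?_
  by_cases hj : j ∈ J
  · simp only [hj, conjOn, if_true, conjOp_apply, star_coh, Complex.conj_conj]
    rw [← star_coh, Lp_inner_star_star, norm_inner_symm]
  · simp only [hj, conjOn, if_false]

theorem IsProductPair.comp_local {J : Finset (Fin n)} {K K' : Modes n →L[ℂ] Modes n}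
    (h : IsProductPair J K K') {j : Fin n} {T : Modes n →L[ℂ] Modes n} (hT : IsLocalOp j T) :
    IsProductPair J (K ∘L T) (K' ∘L if j ∈ J then conjOp T else T) := by
  obtain ⟨k, h1, h2⟩ := h
  obtain ⟨κ, hκ⟩ := hT
  refine ⟨Function.update k j (k j ∘L κ), fun f => ?_, fun f => ?_⟩
  · rw [ContinuousLinearMap.comp_apply, hκ, h1]
    congr 1
    ext1 l
    by_cases hl : l = j
    · subst hl; simp
    · simp [hl]
  · have h3 : (if j ∈ J then conjOp T else T) (tensor f) =
        tensor (Function.update f j (if j ∈ J then conjOp κ (f j) else κ (f j))) := by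
      by_cases hj : j ∈ J
      · simp only [hj, if_true, conjOp_apply]
        rw [star_tensor, hκ, star_tensor]
        congr 1
        ext1 l
        by_cases hl : l = j
        · subst hl; simp
        · simp [hl]
      · simp only [hj, if_false, hκ]
    rw [ContinuousLinearMap.comp_apply, h3, h2]
    congr 1
    ext1 l
    by_cases hl : l = j
    · subst hl
      by_cases hj : l ∈ J <;> simp [hj, conjOp_apply]
    · simp [hl]

/-! ### Kraus operators of an LOCC protocol -/

theorem norm_ketbra (ψ : Modes n) : ‖ketbra ψ‖ = ‖ψ‖ ^ 2 := by
  rw [ketbra, InnerProductSpace.norm_rankOne, sq]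

theorem comp_ketbra_comp_adjoint (T : Modes n →L[ℂ] Modes n) (ψ : Modes n) :
    T ∘L ketbra ψ ∘L ContinuousLinearMap.adjoint T = ketbra (T ψ) := by
  rw [ketbra, InnerProductSpace.rankOne_comp, ContinuousLinearMap.adjoint_adjoint,
    InnerProductSpace.comp_rankOne]
  rfl

theorem hasSum_sigma_of_summable_norm {E : Type*} [NormedAddCommGroup E] [CompleteSpace E]
    {ι : ℕ → Type} {F : (Σ m, ι m) → E} {c : ℕ → E} (hF : Summable fun p => ‖F p‖)
    (h : ∀ m, HasSum (fun i => F ⟨m, i⟩) (c m)) : HasSum F (∑' m, c m) := by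
  have h2 : Summable F := hF.of_norm
  have h3 := h2.hasSum
  rw [h2.tsum_sigma' fun m => (h m).summable] at h3
  simpa only [(h _).tsum_eq] using h3

/-- The Kraus operators are indexed by the branches of the protocol tree; along a branch local
operators are composed, which yields a product operator. The conjugated partners are built in the
same induction. They are not asserted to form a Kraus family, and none is needed. -/
theorem LOCC.exists_kraus (P : LOCC n) (J : Finset (Fin n)) :
    ∃ (ι : Type) (_ : Countable ι) (K K' : ι → (Modes n →L[ℂ] Modes n)),
      (∀ i, IsProductPair J (K i) (K' i)) ∧ ∀ ψ, HasSum (fun i => ‖K i ψ‖ ^ 2) (‖ψ‖ ^ 2) ∧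
        HasSum (fun i => ketbra (K i ψ)) (P.channel (ketbra ψ)) := by
  induction P with
  | finish =>
    refine ⟨Unit, inferInstance, fun _ => ContinuousLinearMap.id ℂ _,
      fun _ => ContinuousLinearMap.id ℂ _, fun _ => ⟨fun _ => ContinuousLinearMap.id ℂ _,
        fun f => rfl, fun f => ?_⟩, fun ψ => ⟨?_, ?_⟩⟩
    · simp [conjOp_apply]
    · simp
    · simp [LOCC.channel]
  | round j T hloc hT next ih =>
    choose ι hι K K' hK hs using ih
    -- These numbers are the norms of the rank-one operators of the two-level sum, so one
    -- summability serves both the completeness relation and the channel.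
    have h1 : ∀ ψ : Modes n, Summable fun p : Σ m, ι m => ‖K p.1 p.2 (T p.1 ψ)‖ ^ 2 := by
      intro ψ
      rw [summable_sigma_of_nonneg fun p => by positivity]
      refine ⟨fun m => ((hs m (T m ψ)).1).summable, ?_⟩
      simp_rw [((hs _ (T _ ψ)).1).tsum_eq]
      exact (hT ψ).summable
    refine ⟨Σ m, ι m, inferInstance, fun p => K p.1 p.2 ∘L T p.1,
      fun p => K' p.1 p.2 ∘L if j ∈ J then conjOp (T p.1) else T p.1,
      fun p => (hK p.1 p.2).comp_local (hloc p.1), fun ψ => ⟨?_, ?_⟩⟩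
    · exact (hT ψ).sigma_of_hasSum (fun m => (hs m (T m ψ)).1) (h1 ψ)
    · simp only [ContinuousLinearMap.comp_apply, LOCC.channel, comp_ketbra_comp_adjoint]
      refine hasSum_sigma_of_summable_norm
        (F := fun p : Σ m, ι m => ketbra (K p.1 p.2 (T p.1 ψ))) ?_ fun m => (hs m (T m ψ)).2
      simp only [norm_ketbra]
      exact h1 ψ

theorem LOCC.norm_channel_ketbra_le (P : LOCC n) (ψ : Modes n) :
    ‖P.channel (ketbra ψ)‖ ≤ ‖ψ‖ ^ 2 := by
  obtain ⟨ι, _, K, _, _, h⟩ := P.exists_kraus ∅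
  exact (h ψ).2.norm_le_of_bounded (h ψ).1 fun i => (norm_ketbra _).le

theorem re_inner_ketbra (ψ φ : Modes n) :
    (inner ℂ φ (ketbra ψ φ) : ℂ).re = ‖(inner ℂ φ ψ : ℂ)‖ ^ 2 := by
  rw [ketbra, InnerProductSpace.rankOne_apply, inner_smul_right, ← inner_conj_symm, mul_comm,
    Complex.mul_conj, Complex.normSq_eq_norm_sq, Complex.ofReal_re]

/-- The functional `A ↦ ⟨φ, A φ⟩`. -/
def expectation (φ : Modes n) : (Modes n →L[ℂ] Modes n) →L[ℂ] ℂ :=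
  (innerSL ℂ φ).comp (ContinuousLinearMap.apply ℂ (Modes n) φ)

theorem expectation_apply (φ : Modes n) (A : Modes n →L[ℂ] Modes n) :
    expectation φ A = inner ℂ φ (A φ) := rfl

theorem hasSum_overlap {ι : Type} {K : ι → (Modes n →L[ℂ] Modes n)} {P : LOCC n} {ψ : Modes n}
    (h : HasSum (fun i => ketbra (K i ψ)) (P.channel (ketbra ψ))) (φ : Modes n) :
    HasSum (fun i => ‖(inner ℂ φ (K i ψ) : ℂ)‖ ^ 2) (overlap P ψ φ) := by
  have h3 := (Complex.reCLM.comp ((expectation φ).restrictScalars ℝ)).hasSum h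
  simp only [ContinuousLinearMap.comp_apply, ContinuousLinearMap.coe_restrictScalars',
    expectation_apply, Complex.reCLM_apply, re_inner_ketbra] at h3
  exact h3

theorem overlap_nonneg (P : LOCC n) (ψ φ : Modes n) : 0 ≤ overlap P ψ φ := by
  obtain ⟨ι, _, K, _, _, h⟩ := P.exists_kraus ∅
  exact (hasSum_overlap (h ψ).2 φ).nonneg fun _ => by positivity

/-- The fidelity of a protocol on a coherent input, in terms of the Kraus operators that are
complex conjugated for the parties in `J`. -/
theorem LOCC.exists_kraus_conjOn (P : LOCC n) (J : Finset (Fin n)) :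
    ∃ (ι : Type) (_ : Countable ι) (K : ι → (Modes n →L[ℂ] Modes n)),
      (∀ α, HasSum (fun i => ‖K i (coherent (conjOn J α))‖ ^ 2) 1) ∧
      ∀ α β, HasSum (fun i =>
        ‖(inner ℂ (coherent (conjOn J β)) (K i (coherent (conjOn J α))) : ℂ)‖ ^ 2)
        (overlap P (coherent α) (coherent β)) := by
  obtain ⟨ι, hι, K, K', hK, h⟩ := P.exists_kraus J
  refine ⟨ι, hι, K', fun α => ?_, fun α β => ?_⟩
  · have := (h (coherent α)).1
    rw [norm_coherent, one_pow] at this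
    simpa only [(hK _).norm_eq] using this
  · have := hasSum_overlap (h (coherent α)).2 (coherent β)
    simpa only [(hK _).norm_inner_eq] using this

/-- The two occurrences of `φ` are replaced one after the other; each replacement costs at most `‖φ
- φ'‖` because the output of the channel has operator norm at most 1. -/
theorem overlap_le_add (P : LOCC n) {ψ φ φ' : Modes n} (hψ : ‖ψ‖ = 1) (hφ : ‖φ‖ = 1)
    (hφ' : ‖φ'‖ = 1) : overlap P ψ φ ≤ overlap P ψ φ' + 2 * ‖φ - φ'‖ := by
  have hA := P.norm_channel_ketbra_le ψ
  rw [hψ, one_pow] at hA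
  set A := P.channel (ketbra ψ) with hAdef
  have h1 : overlap P ψ φ - overlap P ψ φ' =
      (inner ℂ (φ - φ') (A φ) + inner ℂ φ' (A (φ - φ')) : ℂ).re := by
    simp only [overlap, ← hAdef, map_sub, inner_sub_left, inner_sub_right]
    rw [← Complex.sub_re]
    congr 1
    ring
  have h2 : ‖(inner ℂ (φ - φ') (A φ) : ℂ)‖ ≤ ‖φ - φ'‖ := by
    refine (norm_inner_le_norm _ _).trans (mul_le_of_le_one_right (norm_nonneg _) ?_)
    exact (A.le_opNorm φ).trans (by rw [hφ, mul_one]; exact hA)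
  have h3 : ‖(inner ℂ φ' (A (φ - φ')) : ℂ)‖ ≤ ‖φ - φ'‖ := by
    refine (norm_inner_le_norm _ _).trans ?_
    rw [hφ', one_mul]
    exact (A.le_opNorm _).trans (mul_le_of_le_one_left (norm_nonneg _) hA)
  have h4 := (Complex.re_le_norm (inner ℂ (φ - φ') (A φ) + inner ℂ φ' (A (φ - φ')) : ℂ)).trans
    ((norm_add_le _ _).trans (add_le_add h2 h3))
  linarith

/-! ### Local unitaries at the end of a protocol -/

/-- The unitary conjugation `A ↦ U A U†` on operators. -/
def conjugation (U : Modes n ≃ₗᵢ[ℂ] Modes n) :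
    (Modes n →L[ℂ] Modes n) →L[ℂ] (Modes n →L[ℂ] Modes n) :=
  (ContinuousLinearMap.compL ℂ (Modes n) (Modes n) (Modes n)
    (U.toContinuousLinearEquiv : Modes n →L[ℂ] Modes n)).comp
    ((ContinuousLinearMap.compL ℂ (Modes n) (Modes n) (Modes n)).flip
      (ContinuousLinearMap.adjoint (U.toContinuousLinearEquiv : Modes n →L[ℂ] Modes n)))

theorem conjugation_apply (U : Modes n ≃ₗᵢ[ℂ] Modes n) (A : Modes n →L[ℂ] Modes n) :
    conjugation U A = (U.toContinuousLinearEquiv : Modes n →L[ℂ] Modes n) ∘L A ∘L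
      ContinuousLinearMap.adjoint (U.toContinuousLinearEquiv : Modes n →L[ℂ] Modes n) := rfl

theorem LOCC.exists_append_local (P : LOCC n) {j : Fin n} {U : Modes n ≃ₗᵢ[ℂ] Modes n}
    (hU : IsLocalOp j (U.toContinuousLinearEquiv : Modes n →L[ℂ] Modes n)) :
    ∃ P' : LOCC n, ∀ ψ, P'.channel (ketbra ψ) = conjugation U (P.channel (ketbra ψ)) := by
  induction P with
  | finish =>
    -- A unitary is a measurement with one outcome. Outcomes are indexed by `ℕ`, so the others get
    -- the operator `0`, which is local as well.
    let T : ℕ → (Modes n →L[ℂ] Modes n) := fun m =>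
      if m = 0 then (U.toContinuousLinearEquiv : Modes n →L[ℂ] Modes n) else 0
    have hloc : ∀ m, IsLocalOp j (T m) := by
      intro m
      by_cases hm : m = 0
      · simpa [T, hm] using hU
      · refine ⟨0, fun f => ?_⟩
        simp only [T, hm, if_false, zero_apply]
        rw [eq_comm, ← norm_eq_zero, norm_tensor]
        exact Finset.prod_eq_zero (Finset.mem_univ j) (by simp)
    have hT : IsKrausFamily T := by
      intro ψ
      convert hasSum_ite_eq (α := ℝ) 0 (‖ψ‖ ^ 2) using 2 with m
      by_cases hm : m = 0 <;> simp [T, hm]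
    refine ⟨.round j T hloc hT fun _ => .finish, fun ψ => ?_⟩
    simp only [LOCC.channel]
    rw [tsum_eq_single 0 fun m hm => by simp [T, hm]]
    simp [T, conjugation_apply]
  | round i T hloc hT next ih =>
    choose next' h using ih
    refine ⟨.round i T hloc hT next', fun ψ => ?_⟩
    have hsum : Summable fun m => (next m).channel (ketbra (T m ψ)) :=
      Summable.of_norm_bounded (hT ψ).summable fun m => (next m).norm_channel_ketbra_le (T m ψ)
    simp only [LOCC.channel, comp_ketbra_comp_adjoint, h]
    rw [(conjugation U).map_tsum hsum]

theorem adjoint_apply_apply (W : Modes n ≃ₗᵢ[ℂ] Modes n) (φ : Modes n) :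
    ContinuousLinearMap.adjoint (W.toContinuousLinearEquiv : Modes n →L[ℂ] Modes n) (W φ) = φ := by
  refine ext_inner_right ℂ fun χ => ?_
  rw [ContinuousLinearMap.adjoint_inner_left]
  exact W.inner_map_map φ χ

theorem exists_local_unitary (j : Fin n) (u : Mode ≃ₗᵢ[ℂ] Mode) :
    ∃ U : Modes n ≃ₗᵢ[ℂ] Modes n, ∀ f, U (tensor f) = tensor (Function.update f j (u (f j))) := by
  obtain ⟨U, hU⟩ := exists_tensor_unitary fun l : Fin n =>
    if l = j then u else LinearIsometryEquiv.refl ℂ Mode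
  refine ⟨U, fun f => ?_⟩
  rw [hU]
  congr 1
  ext1 l
  by_cases hl : l = j
  · subst hl; simp
  · simp [hl]

theorem conjugation_apply_apply (U : Modes n ≃ₗᵢ[ℂ] Modes n) (A : Modes n →L[ℂ] Modes n)
    (ψ : Modes n) : conjugation U A ψ = U (A (U.symm ψ)) := by
  rw [conjugation_apply, ContinuousLinearMap.comp_apply, ContinuousLinearMap.comp_apply]
  conv_lhs => rw [← U.apply_symm_apply ψ, adjoint_apply_apply]
  rfl

theorem conjugation_trans (U U' : Modes n ≃ₗᵢ[ℂ] Modes n) (A : Modes n →L[ℂ] Modes n) :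
    conjugation (U.trans U') A = conjugation U' (conjugation U A) := by
  ext1 ψ
  simp only [conjugation_apply_apply]
  rfl

theorem inner_conjugation (W : Modes n ≃ₗᵢ[ℂ] Modes n) (A : Modes n →L[ℂ] Modes n) (φ : Modes n) :
    inner ℂ (W φ) (conjugation W A (W φ)) = (inner ℂ φ (A φ) : ℂ) := by
  rw [conjugation_apply_apply, W.symm_apply_apply, W.inner_map_map]

theorem conjugation_refl (A : Modes n →L[ℂ] Modes n) :
    conjugation (LinearIsometryEquiv.refl ℂ (Modes n)) A = A := by
  ext1 ψ
  rw [conjugation_apply_apply]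
  rfl

/-- The parties apply their unitaries in turn after the protocol has finished, whence the induction
over the set of parties that have already acted. -/
theorem IsLocalUnitary.exists_append {W : Modes n ≃ₗᵢ[ℂ] Modes n} (hW : IsLocalUnitary W)
    (P : LOCC n) : ∃ P' : LOCC n, ∀ ψ φ, overlap P' ψ (W φ) = overlap P ψ φ := by
  obtain ⟨u, hu⟩ := hW
  have key : ∀ s : Finset (Fin n), ∃ U : Modes n ≃ₗᵢ[ℂ] Modes n,
      (∀ f, U (tensor f) = tensor fun j => if j ∈ s then u j (f j) else f j) ∧
      ∀ P : LOCC n, ∃ P' : LOCC n, ∀ ψ,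
        P'.channel (ketbra ψ) = conjugation U (P.channel (ketbra ψ)) := by
    intro s
    induction s using Finset.induction_on with
    | empty =>
      exact ⟨LinearIsometryEquiv.refl ℂ _, fun f => by simp,
        fun P => ⟨P, fun ψ => (conjugation_refl _).symm⟩⟩
    | insert j s hj ih =>
      obtain ⟨U, h1, h2⟩ := ih
      obtain ⟨Uj, hUj⟩ := exists_local_unitary j (u j)
      have hloc : IsLocalOp j (Uj.toContinuousLinearEquiv : Modes n →L[ℂ] Modes n) :=
        ⟨((u j).toContinuousLinearEquiv : Mode →L[ℂ] Mode), hUj⟩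
      refine ⟨U.trans Uj, fun f => ?_, fun P => ?_⟩
      · rw [LinearIsometryEquiv.trans_apply, h1, hUj]
        congr 1
        ext1 l
        by_cases hl : l = j
        · subst hl; simp [hj]
        · simp [hl]
      · obtain ⟨P₁, hP₁⟩ := h2 P
        obtain ⟨P₂, hP₂⟩ := P₁.exists_append_local hloc
        exact ⟨P₂, fun ψ => by rw [hP₂, hP₁, conjugation_trans]⟩
  obtain ⟨U, hU, hP⟩ := key Finset.univ
  obtain ⟨P', hP'⟩ := hP P
  have hUW : U = W := by
    ext1 ψ
    refine congrArg (fun T : Modes n →L[ℂ] Modes n => T ψ) (total_tensor.ext_clm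
      (S := (U.toContinuousLinearEquiv : Modes n →L[ℂ] Modes n))
      (T := (W.toContinuousLinearEquiv : Modes n →L[ℂ] Modes n)) fun f => ?_)
    refine (hU f).trans (Eq.trans ?_ (hu f).symm)
    simp
  refine ⟨P', fun ψ φ => ?_⟩
  rw [overlap, overlap, hP', hUW, inner_conjugation]

theorem IsLocalUnitary.simFidelity_le {W : Modes n ≃ₗᵢ[ℂ] Modes n} (hW : IsLocalUnitary W)
    (lam : ℝ) (U : Modes n ≃ₗᵢ[ℂ] Modes n) :
    simFidelity lam U ≤ simFidelity lam (U.trans W) := by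
  refine iSup_le fun P => ?_
  obtain ⟨P', hP'⟩ := hW.exists_append P
  refine le_iSup_of_le P' ?_
  simp only [LinearIsometryEquiv.trans_apply, hP']
  exact le_rfl

theorem IsLocalUnitary.symm {W : Modes n ≃ₗᵢ[ℂ] Modes n} (hW : IsLocalUnitary W) :
    IsLocalUnitary W.symm := by
  obtain ⟨u, hu⟩ := hW
  refine ⟨fun j => (u j).symm, fun f => ?_⟩
  rw [LinearIsometryEquiv.symm_apply_eq, hu]
  simp

theorem IsLocalUnitary.trans {W W' : Modes n ≃ₗᵢ[ℂ] Modes n} (hW : IsLocalUnitary W)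
    (hW' : IsLocalUnitary W') : IsLocalUnitary (W.trans W') := by
  obtain ⟨u, hu⟩ := hW
  obtain ⟨u', hu'⟩ := hW'
  exact ⟨fun j => (u j).trans (u' j), fun f => by simp [hu, hu']⟩

/-- Appending `W` to protocols gives one inequality, appending its inverse the other. -/
theorem IsLocalUnitary.simFidelity_trans {W : Modes n ≃ₗᵢ[ℂ] Modes n} (hW : IsLocalUnitary W)
    (lam : ℝ) (U : Modes n ≃ₗᵢ[ℂ] Modes n) :
    simFidelity lam (U.trans W) = simFidelity lam U := by
  refine le_antisymm ?_ (hW.simFidelity_le lam U)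
  have h := hW.symm.simFidelity_le lam (U.trans W)
  have h2 : (U.trans W).trans W.symm = U := by ext1 x; simp
  rwa [h2] at h

/-- The simulation fidelity depends continuously on the unitary. -/
theorem simFidelity_le_add {lam : ℝ} (hlam : 0 < lam) (U U' : Modes n ≃ₗᵢ[ℂ] Modes n) :
    simFidelity lam U ≤ simFidelity lam U' + ∫⁻ α : Fin n → ℂ, ENNReal.ofReal
      (gaussianDensity lam α * (2 * ‖U (coherent α) - U' (coherent α)‖)) := by
  refine iSup_le fun P => ?_
  have hd : ∀ α : Fin n → ℂ, 0 ≤ gaussianDensity lam α := fun α => by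
    unfold gaussianDensity; positivity
  have hc : Continuous fun α : Fin n → ℂ =>
      gaussianDensity lam α * (2 * ‖U (coherent α) - U' (coherent α)‖) := by
    have := continuous_coherent (n := n)
    unfold gaussianDensity
    fun_prop
  calc _ ≤ ∫⁻ α : Fin n → ℂ, (ENNReal.ofReal
          (gaussianDensity lam α * overlap P (coherent α) (U' (coherent α))) + ENNReal.ofReal
          (gaussianDensity lam α * (2 * ‖U (coherent α) - U' (coherent α)‖))) := by
        refine lintegral_mono fun α => ?_
        rw [← ENNReal.ofReal_add (mul_nonneg (hd α) (overlap_nonneg _ _ _))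
          (mul_nonneg (hd α) (by positivity)), ← mul_add]
        refine ENNReal.ofReal_le_ofReal (mul_le_mul_of_nonneg_left ?_ (hd α))
        exact overlap_le_add P (norm_coherent α) (by simp [norm_coherent])
          (by simp [norm_coherent])
    _ = _ := lintegral_add_right _ hc.measurable.ennreal_ofReal
    _ ≤ _ := by
        gcongr
        exact le_iSup (fun P : LOCC n => ∫⁻ α : Fin n → ℂ, ENNReal.ofReal
          (gaussianDensity lam α * overlap P (coherent α) (U' (coherent α)))) P

end

end GravLOCC

/-! ### The form bound for twisted convolution with a Gaussian -/

namespace GravLOCC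

noncomputable section

open Complex
open scoped ComplexConjugate

variable {n : ℕ}

theorem ofReal_sq_norm (z : ℂ) : ((‖z‖ ^ 2 : ℝ) : ℂ) = z * conj z := by
  rw [Complex.mul_conj, Complex.normSq_eq_norm_sq]

/-! ### Twisted convolution with a Gaussian -/

/-- The kernel `exp(∑ (-a |ζ - ζ'|² + i w Im(conj ζ ζ')))`. -/
def twistedKernel (a w : Fin n → ℝ) (ζ ζ' : Fin n → ℂ) : ℂ :=
  cexp (∑ l, (-(a l : ℂ) * ((‖ζ l - ζ' l‖ ^ 2 : ℝ) : ℂ) +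
    (w l / 2 : ℂ) * (conj (ζ l) * ζ' l - ζ l * conj (ζ' l))))

theorem norm_twistedKernel (a w : Fin n → ℝ) (ζ ζ' : Fin n → ℂ) :
    ‖twistedKernel a w ζ ζ'‖ = Real.exp (∑ l, -a l * ‖ζ l - ζ' l‖ ^ 2) := by
  rw [twistedKernel, Complex.norm_exp, Complex.re_sum]
  congr 1
  refine Finset.sum_congr rfl fun l _ => ?_
  rw [Complex.add_re, ← Complex.ofReal_neg, ← Complex.ofReal_mul, Complex.ofReal_re]
  have h : (conj (ζ l) * ζ' l - ζ l * conj (ζ' l)).re = 0 := by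
    simp only [Complex.sub_re, Complex.mul_re, Complex.conj_re, Complex.conj_im]
    ring
  have h' : ((w l / 2 : ℂ) * (conj (ζ l) * ζ' l - ζ l * conj (ζ' l))).re = 0 := by
    rw [show (w l / 2 : ℂ) = ((w l / 2 : ℝ) : ℂ) by push_cast; rfl, Complex.re_ofReal_mul, h,
      mul_zero]
  rw [h', add_zero]

theorem norm_twistedKernel_le_one {a : Fin n → ℝ} (ha : ∀ l, 0 ≤ a l) (w : Fin n → ℝ)
    (ζ ζ' : Fin n → ℂ) : ‖twistedKernel a w ζ ζ'‖ ≤ 1 := by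
  rw [norm_twistedKernel, Real.exp_le_one_iff]
  refine Finset.sum_nonpos fun l _ => ?_
  have := ha l
  nlinarith [sq_nonneg ‖ζ l - ζ' l‖]

theorem conj_twistedKernel (a w : Fin n → ℝ) (ζ ζ' : Fin n → ℂ) :
    conj (twistedKernel a w ζ ζ') = twistedKernel a w ζ' ζ := by
  rw [twistedKernel, twistedKernel, ← Complex.exp_conj, map_sum]
  congr 1
  refine Finset.sum_congr rfl fun l _ => ?_
  simp only [map_add, map_mul, map_neg, map_sub, map_div₀, Complex.conj_ofReal, Complex.conj_conj,
    map_ofNat]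
  rw [norm_sub_rev]
  ring

theorem continuous_twistedKernel (a w : Fin n → ℝ) :
    Continuous fun p : (Fin n → ℂ) × (Fin n → ℂ) => twistedKernel a w p.1 p.2 := by
  unfold twistedKernel
  fun_prop

theorem continuous_twistedKernel_comp {X : Type*} [TopologicalSpace X] {f g : X → Fin n → ℂ}
    (hf : Continuous f) (hg : Continuous g) (a w : Fin n → ℝ) :
    Continuous fun x => twistedKernel a w (f x) (g x) := by
  unfold twistedKernel
  fun_prop

/-- Composition of the kernel with itself. -/
theorem integral_twistedKernel_mul {a : Fin n → ℝ} (ha : ∀ l, 0 < a l) (w : Fin n → ℝ)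
    (ζ ζ' : Fin n → ℂ) :
    ∫ η, twistedKernel a w ζ η * twistedKernel a w η ζ' =
      ((∏ l, (Real.pi / (2 * a l)) : ℝ) : ℂ) *
        twistedKernel (fun l => (a l ^ 2 + w l ^ 2 / 4) / (2 * a l)) w ζ ζ' := by
  calc _ = ∫ η : Fin n → ℂ, cexp (∑ l, (-((2 * a l : ℝ) : ℂ) * ((‖η l‖ ^ 2 : ℝ) : ℂ) +
          ((a l - w l / 2) * ζ l + (a l + w l / 2) * ζ' l) * conj (η l) +
          ((a l + w l / 2) * conj (ζ l) + (a l - w l / 2) * conj (ζ' l)) * η l)) *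
          cexp (∑ l, (-(a l : ℂ) * (((‖ζ l‖ ^ 2 : ℝ) : ℂ) + ((‖ζ' l‖ ^ 2 : ℝ) : ℂ)))) := by
        refine integral_congr_ae (Filter.Eventually.of_forall fun η => ?_)
        simp only [twistedKernel]
        rw [← Complex.exp_add, ← Complex.exp_add, ← Finset.sum_add_distrib,
          ← Finset.sum_add_distrib]
        congr 1
        refine Finset.sum_congr rfl fun l _ => ?_
        simp only [ofReal_sq_norm, map_sub]
        push_cast
        ring
    _ = _ := by
        rw [integral_mul_const, integral_cexp_sum_sq_norm fun l => by have := ha l; positivity,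
          mul_assoc, ← Complex.exp_add, ← Finset.sum_add_distrib]
        congr 1
        rw [twistedKernel]
        congr 1
        refine Finset.sum_congr rfl fun l _ => ?_
        have : (a l : ℂ) ≠ 0 := by exact_mod_cast (ha l).ne'
        simp only [ofReal_sq_norm, map_sub]
        push_cast
        field_simp
        ring

theorem norm_integral_conj_mul_sq_le {E : Type*} [MeasurableSpace E] {μ : Measure E} {f g : E → ℂ}
    (hf : MemLp f 2 μ) (hg : MemLp g 2 μ) :
    ‖∫ x, conj (f x) * g x ∂μ‖ ^ 2 ≤ (∫ x, ‖f x‖ ^ 2 ∂μ) * ∫ x, ‖g x‖ ^ 2 ∂μ := by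
  have h1 : (inner ℂ (hf.toLp f) (hg.toLp g) : ℂ) = ∫ x, conj (f x) * g x ∂μ := by
    rw [L2.inner_def]
    refine integral_congr_ae ?_
    filter_upwards [hf.coeFn_toLp, hg.coeFn_toLp] with x h1 h2
    rw [h1, h2, RCLike.inner_apply, mul_comm]
  have h2 : ∀ {k : E → ℂ} (hk : MemLp k 2 μ), ‖hk.toLp k‖ ^ 2 = ∫ x, ‖k x‖ ^ 2 ∂μ := by
    intro k hk
    rw [← inner_self_eq_norm_sq (𝕜 := ℂ), L2.inner_def, ← integral_re (L2.integrable_inner _ _)]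
    refine integral_congr_ae ?_
    filter_upwards [hk.coeFn_toLp] with x h1
    rw [h1, inner_self_eq_norm_sq]
  rw [← h1, ← h2 hf, ← h2 hg, ← mul_pow]
  gcongr
  exact norm_inner_le_norm _ _

/-- The quadratic form of the kernel. -/
def twistedForm (a w : Fin n → ℝ) (h : (Fin n → ℂ) → ℂ) : ℂ :=
  ∫ p : (Fin n → ℂ) × (Fin n → ℂ), conj (h p.1) * twistedKernel a w p.1 p.2 * h p.2

/-- A crude bound that only starts the iteration below; being independent of the number of
squarings, it disappears when roots are taken. -/
theorem norm_twistedForm_le {a : Fin n → ℝ} (ha : ∀ l, 0 ≤ a l) (w : Fin n → ℝ)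
    {h : (Fin n → ℂ) → ℂ} (hi : Integrable h) :
    ‖twistedForm a w h‖ ≤ (∫ ζ, ‖h ζ‖) ^ 2 := by
  rw [sq, ← integral_prod_mul]
  refine norm_integral_le_of_norm_le (hi.norm.mul_prod hi.norm)
    (Filter.Eventually.of_forall fun p => ?_)
  rw [norm_mul, norm_mul, RCLike.norm_conj]
  gcongr
  exact mul_le_of_le_one_right (norm_nonneg _) (norm_twistedKernel_le_one ha w _ _)

theorem aestronglyMeasurable_comp_snd_fst {E : Type*} [MeasurableSpace E] {μ : Measure E}
    [SFinite μ] {h : E → ℂ} (hm : AEStronglyMeasurable h μ) :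
    AEStronglyMeasurable (fun p : E × (E × E) => h p.2.1) (μ.prod (μ.prod μ)) :=
  hm.comp_quasiMeasurePreserving
    (Measure.quasiMeasurePreserving_fst.comp Measure.quasiMeasurePreserving_snd)

theorem aestronglyMeasurable_comp_snd_snd {E : Type*} [MeasurableSpace E] {μ : Measure E}
    [SFinite μ] {h : E → ℂ} (hm : AEStronglyMeasurable h μ) :
    AEStronglyMeasurable (fun p : E × (E × E) => h p.2.2) (μ.prod (μ.prod μ)) :=
  hm.comp_quasiMeasurePreserving
    (Measure.quasiMeasurePreserving_snd.comp Measure.quasiMeasurePreserving_snd)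

/-- Licenses Fubini when the kernel is squared: the Gaussian of one kernel controls the middle
variable, `h ⊗ h` the two outer ones, and the other kernel is at most 1. -/
theorem integrable_twisted_triple {a : Fin n → ℝ} (ha : ∀ l, 0 < a l) (w : Fin n → ℝ)
    {h : (Fin n → ℂ) → ℂ} (hi : Integrable h) :
    Integrable (fun p : (Fin n → ℂ) × ((Fin n → ℂ) × (Fin n → ℂ)) =>
      (conj (h p.2.1) * twistedKernel a w p.2.1 p.1) * (twistedKernel a w p.1 p.2.2 * h p.2.2))
      (volume.prod (volume.prod volume)) := by
  have hm : AEStronglyMeasurable (fun p : (Fin n → ℂ) × ((Fin n → ℂ) × (Fin n → ℂ)) =>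
      (conj (h p.2.1) * twistedKernel a w p.2.1 p.1) * (twistedKernel a w p.1 p.2.2 * h p.2.2))
      (volume.prod (volume.prod volume)) := by
    have h1 : Continuous fun p : (Fin n → ℂ) × ((Fin n → ℂ) × (Fin n → ℂ)) =>
      twistedKernel a w p.2.1 p.1 := continuous_twistedKernel_comp (by fun_prop) (by fun_prop) a w
    have h2 : Continuous fun p : (Fin n → ℂ) × ((Fin n → ℂ) × (Fin n → ℂ)) =>
      twistedKernel a w p.1 p.2.2 := continuous_twistedKernel_comp (by fun_prop) (by fun_prop) a w
    have h3 := hi.aestronglyMeasurable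
    exact (((Complex.continuous_conj.comp_aestronglyMeasurable
      (aestronglyMeasurable_comp_snd_fst h3)).mul h1.aestronglyMeasurable)).mul
        (h2.aestronglyMeasurable.mul (aestronglyMeasurable_comp_snd_snd h3))
  have hg : Integrable fun η : Fin n → ℂ => Real.exp (∑ l, -a l * ‖η l‖ ^ 2) := by
    simpa using integrable_exp_sum_sq_norm ha 0
  have hgt : ∀ ζ : Fin n → ℂ, Integrable fun η : Fin n → ℂ =>
      Real.exp (∑ l, -a l * ‖ζ l - η l‖ ^ 2) := by
    intro ζ
    have := hg.comp_sub_left ζ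
    simpa using this
  have hbound : ∀ η ζ ζ' : Fin n → ℂ, ‖(conj (h ζ) * twistedKernel a w ζ η) *
      (twistedKernel a w η ζ' * h ζ')‖ ≤
        Real.exp (∑ l, -a l * ‖ζ l - η l‖ ^ 2) * (‖h ζ‖ * ‖h ζ'‖) := by
    intro η ζ ζ'
    rw [norm_mul, norm_mul, norm_mul, RCLike.norm_conj, norm_twistedKernel a w ζ η]
    have := norm_twistedKernel_le_one (fun l => (ha l).le) w η ζ'
    calc _ ≤ ‖h ζ‖ * Real.exp (∑ l, -a l * ‖ζ l - η l‖ ^ 2) * (1 * ‖h ζ'‖) := by gcongr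
      _ = _ := by ring
  refine (integrable_prod_iff' hm).2 ⟨Filter.Eventually.of_forall fun p => ?_, ?_⟩
  · refine ((hgt p.1).mul_const (‖h p.1‖ * ‖h p.2‖)).mono' ?_
      (Filter.Eventually.of_forall fun η => hbound η p.1 p.2)
    have h1 : Continuous fun η => twistedKernel a w p.1 η :=
      continuous_twistedKernel_comp (by fun_prop) (by fun_prop) a w
    have h2 : Continuous fun η => twistedKernel a w η p.2 :=
      continuous_twistedKernel_comp (by fun_prop) (by fun_prop) a w
    have h3 : ∀ c d : ℂ, Continuous fun η =>
        (c * twistedKernel a w p.1 η) * (twistedKernel a w η p.2 * d) := fun c d => by fun_prop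
    exact (h3 (conj (h p.1)) (h p.2)).aestronglyMeasurable
  · refine ((hi.norm.mul_prod hi.norm).const_mul
      (∫ η : Fin n → ℂ, Real.exp (∑ l, -a l * ‖η l‖ ^ 2))).mono'
      (hm.norm.prod_swap.integral_prod_right') (Filter.Eventually.of_forall fun p => ?_)
    rw [Real.norm_of_nonneg (integral_nonneg fun _ => norm_nonneg _)]
    have h1 : ∫ η : Fin n → ℂ, Real.exp (∑ l, -a l * ‖η l‖ ^ 2) =
        ∫ η : Fin n → ℂ, Real.exp (∑ l, -a l * ‖p.1 l - η l‖ ^ 2) := by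
      rw [← integral_sub_left_eq_self (fun η : Fin n → ℂ =>
        Real.exp (∑ l, -a l * ‖η l‖ ^ 2)) volume p.1]
      rfl
    rw [h1, ← integral_mul_const]
    refine integral_mono_of_nonneg (Filter.Eventually.of_forall fun _ => norm_nonneg _)
      ((hgt p.1).mul_const _) (Filter.Eventually.of_forall fun η => hbound η p.1 p.2)

/-- With `T_a` the integral operator of the Hermitian kernel, Cauchy-Schwarz gives `|⟨h, T_a h⟩|² ≤
‖h‖² ⟨h, T_a² h⟩`. The square is a multiple of an operator of the same type, with the same twist and
with `a` replaced by its Heron iterate towards `|w|/2`. -/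
theorem norm_twistedForm_sq_le {a : Fin n → ℝ} (ha : ∀ l, 0 < a l) (w : Fin n → ℝ)
    {h : (Fin n → ℂ) → ℂ} (hi : Integrable h) (h2 : MemLp h 2) :
    ‖twistedForm a w h‖ ^ 2 ≤ (∫ ζ, ‖h ζ‖ ^ 2) * ((∏ l, (Real.pi / (2 * a l))) *
      ‖twistedForm (fun l => (a l ^ 2 + w l ^ 2 / 4) / (2 * a l)) w h‖) := by
  set A : (Fin n → ℂ) → ℂ := fun η => ∫ ζ', twistedKernel a w η ζ' * h ζ' with hA
  have htr := integrable_twisted_triple ha w hi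
  have hP : 0 ≤ ∏ l, (Real.pi / (2 * a l)) :=
    Finset.prod_nonneg fun l _ => by have := ha l; positivity
  have hAA : ∀ η, ∫ p : (Fin n → ℂ) × (Fin n → ℂ), (conj (h p.1) * twistedKernel a w p.1 η) *
      (twistedKernel a w η p.2 * h p.2) = ((‖A η‖ ^ 2 : ℝ) : ℂ) := by
    intro η
    rw [Measure.volume_eq_prod, integral_prod_mul (fun ζ => conj (h ζ) * twistedKernel a w ζ η)
      (fun ζ' => twistedKernel a w η ζ' * h ζ'), ofReal_sq_norm, mul_comm]
    congr 1
    rw [hA, ← integral_conj]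
    refine integral_congr_ae (Filter.Eventually.of_forall fun ζ => ?_)
    simp only [map_mul, conj_twistedKernel]
    ring
  have hAi : Integrable fun η => ‖A η‖ ^ 2 := by
    have := htr.integral_prod_left
    simp_rw [← Measure.volume_eq_prod, hAA] at this
    exact this.re
  have hAm : AEStronglyMeasurable A volume := by
    have hc := continuous_twistedKernel a w
    exact (hc.aestronglyMeasurable.mul hi.aestronglyMeasurable.comp_snd).integral_prod_right'
  have hA2 : MemLp A 2 := (memLp_two_iff_integrable_sq_norm hAm).2 hAi
  have hnorm : ((∫ η, ‖A η‖ ^ 2 : ℝ) : ℂ) = ((∏ l, (Real.pi / (2 * a l)) : ℝ) : ℂ) *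
      twistedForm (fun l => (a l ^ 2 + w l ^ 2 / 4) / (2 * a l)) w h := by
    rw [← integral_complex_ofReal]
    simp_rw [← hAA]
    rw [Measure.volume_eq_prod, integral_integral_swap htr, twistedForm, ← integral_const_mul]
    refine integral_congr_ae (Filter.Eventually.of_forall fun p => ?_)
    calc _ = ∫ η, (conj (h p.1) * h p.2) * (twistedKernel a w p.1 η * twistedKernel a w η p.2) := by
          refine integral_congr_ae (Filter.Eventually.of_forall fun η => ?_)
          ring
      _ = _ := by
          rw [integral_const_mul, integral_twistedKernel_mul ha]
          ring
  have hform : twistedForm a w h = ∫ ζ, conj (h ζ) * A ζ := by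
    rw [twistedForm, Measure.volume_eq_prod, integral_prod]
    · refine integral_congr_ae (Filter.Eventually.of_forall fun ζ => ?_)
      simp only [hA, mul_assoc]
      rw [integral_const_mul]
    · refine (hi.norm.mul_prod hi.norm).mono' ?_ (Filter.Eventually.of_forall fun p => ?_)
      · exact ((Complex.continuous_conj.comp_aestronglyMeasurable
          hi.aestronglyMeasurable.comp_fst).mul
          (continuous_twistedKernel a w).aestronglyMeasurable).mul hi.aestronglyMeasurable.comp_snd
      · rw [norm_mul, norm_mul, RCLike.norm_conj]
        gcongr
        exact mul_le_of_le_one_right (norm_nonneg _)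
          (norm_twistedKernel_le_one (fun l => (ha l).le) w _ _)
  have hle := norm_integral_conj_mul_sq_le h2 hA2
  rw [← hform] at hle
  refine hle.trans_eq ?_
  congr 1
  have := congrArg norm hnorm
  rwa [Complex.norm_real, norm_mul, Complex.norm_real, Real.norm_of_nonneg hP,
    Real.norm_of_nonneg (integral_nonneg fun _ => by positivity)] at this

/-- `k` squarings in a row. Since `|w|/2 ≤ a`, the Heron iterates decrease while staying above
`|w|/2`; hence `b` bounds them all and the last factor does not depend on `k`. The parameter `a` is
quantified inside because it changes in the induction. -/
theorem norm_twistedForm_pow_le {w b : Fin n → ℝ} {h : (Fin n → ℂ) → ℂ} (hi : Integrable h)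
    (h2 : MemLp h 2) (k : ℕ) : ∀ a : Fin n → ℝ, (∀ l, 0 < a l) → (∀ l, |w l| / 2 ≤ a l) →
      (∀ l, a l ≤ b l) → ‖twistedForm a w h‖ ^ 2 ^ k ≤
        (∫ ζ, ‖h ζ‖ ^ 2) ^ (2 ^ k - 1) * (∏ l, (Real.pi / (a l + |w l| / 2))) ^ 2 ^ k *
          ((∏ l, ((b l + |w l| / 2) / Real.pi)) * (∫ ζ, ‖h ζ‖) ^ 2) := by
  have hN : 0 ≤ ∫ ζ, ‖h ζ‖ ^ 2 := integral_nonneg fun _ => by positivity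
  induction k with
  | zero =>
    intro a ha hw hb
    have h1 : 1 ≤ (∏ l, (Real.pi / (a l + |w l| / 2))) * ∏ l, ((b l + |w l| / 2) / Real.pi) := by
      rw [← Finset.prod_mul_distrib]
      rw [← Finset.prod_const_one (s := (Finset.univ : Finset (Fin n)))]
      refine Finset.prod_le_prod (fun _ _ => zero_le_one) fun l _ => ?_
      have := ha l
      have := hb l
      have h3 : 0 < a l + |w l| / 2 := by positivity
      rw [div_mul_div_comm, mul_comm Real.pi, mul_div_mul_right _ _ Real.pi_ne_zero,
        one_le_div h3]
      linarith
    have h3 := norm_twistedForm_le (fun l => (ha l).le) w hi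
    simp only [pow_zero, pow_one, Nat.sub_self, one_mul]
    rw [← mul_assoc]
    exact h3.trans (le_mul_of_one_le_left (by positivity) h1)
  | succ k ih =>
    intro a ha hw hb
    set a' : Fin n → ℝ := fun l => (a l ^ 2 + w l ^ 2 / 4) / (2 * a l) with ha'
    have hpos : ∀ l, 0 < a' l := fun l => by have := ha l; simp only [ha']; positivity
    have hw' : ∀ l, |w l| / 2 ≤ a' l := fun l => by
      have := ha l
      simp only [ha']
      rw [le_div_iff₀ (by positivity), ← sq_abs (w l)]
      nlinarith [sq_nonneg (a l - |w l| / 2)]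
    have hb' : ∀ l, a' l ≤ b l := fun l => by
      have h1 := ha l
      refine le_trans ?_ (hb l)
      simp only [ha']
      rw [div_le_iff₀ (by positivity), ← sq_abs (w l)]
      nlinarith [hw l, abs_nonneg (w l)]
    have h3 := ih a' hpos hw' hb'
    have h4 := norm_twistedForm_sq_le ha w hi h2
    rw [← ha'] at h4
    have hP : 0 ≤ ∏ l, (Real.pi / (2 * a l)) :=
      Finset.prod_nonneg fun l _ => by have := ha l; positivity
    -- The constant reproduces itself under the iteration because `a' + |w|/2 = (a + |w|/2)² /
    -- (2a)`.
    have h5 : (∏ l, (Real.pi / (2 * a l))) * ∏ l, (Real.pi / (a' l + |w l| / 2)) =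
        (∏ l, (Real.pi / (a l + |w l| / 2))) ^ 2 := by
      rw [← Finset.prod_mul_distrib, ← Finset.prod_pow]
      refine Finset.prod_congr rfl fun l _ => ?_
      have h1 := ha l
      have h2 : 0 < a l + |w l| / 2 := by positivity
      have h3 : a' l + |w l| / 2 = (a l + |w l| / 2) ^ 2 / (2 * a l) := by
        simp only [ha']
        rw [← sq_abs (w l)]
        field_simp
        ring
      rw [h3]
      field_simp
    have hexp : (2 : ℕ) ^ (k + 1) - 1 = 2 ^ k + (2 ^ k - 1) := by
      have : 1 ≤ 2 ^ k := Nat.one_le_two_pow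
      rw [pow_succ]
      omega
    set N := ∫ ζ, ‖h ζ‖ ^ 2
    set M := (∏ l, ((b l + |w l| / 2) / Real.pi)) * (∫ ζ, ‖h ζ‖) ^ 2
    calc ‖twistedForm a w h‖ ^ 2 ^ (k + 1) = (‖twistedForm a w h‖ ^ 2) ^ 2 ^ k := by
          rw [← pow_mul, pow_succ, mul_comm]
      _ ≤ (N * ((∏ l, (Real.pi / (2 * a l))) * ‖twistedForm a' w h‖)) ^ 2 ^ k := by
          gcongr
      _ = N ^ 2 ^ k * (∏ l, (Real.pi / (2 * a l))) ^ 2 ^ k * ‖twistedForm a' w h‖ ^ 2 ^ k := by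
          rw [mul_pow, mul_pow, mul_assoc]
      _ ≤ N ^ 2 ^ k * (∏ l, (Real.pi / (2 * a l))) ^ 2 ^ k *
          (N ^ (2 ^ k - 1) * (∏ l, (Real.pi / (a' l + |w l| / 2))) ^ 2 ^ k * M) := by
          gcongr
      _ = N ^ (2 ^ k + (2 ^ k - 1)) * ((∏ l, (Real.pi / (2 * a l))) *
          ∏ l, (Real.pi / (a' l + |w l| / 2))) ^ 2 ^ k * M := by
          rw [pow_add, mul_pow]; ring
      _ = _ := by
          rw [h5, hexp, ← pow_mul, pow_succ' 2 k]

/-- The norm of the twisted convolution with a Gaussian. -/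
theorem norm_twistedForm_le_prod {a w : Fin n → ℝ} (ha : ∀ l, 0 < a l)
    (hw : ∀ l, |w l| / 2 ≤ a l) {h : (Fin n → ℂ) → ℂ} (hi : Integrable h) (h2 : MemLp h 2) :
    ‖twistedForm a w h‖ ≤ (∏ l, (Real.pi / (a l + |w l| / 2))) * ∫ ζ, ‖h ζ‖ ^ 2 := by
  have key := fun k => norm_twistedForm_pow_le hi h2 k a ha hw (fun l => le_rfl)
  set N := ∫ ζ, ‖h ζ‖ ^ 2 with hNdef
  set M := (∏ l, ((a l + |w l| / 2) / Real.pi)) * (∫ ζ, ‖h ζ‖) ^ 2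
  set p := ∏ l, (Real.pi / (a l + |w l| / 2)) with hp
  have hp0 : 0 < p := Finset.prod_pos fun l _ => by have := ha l; positivity
  have hN0 : 0 ≤ N := integral_nonneg fun _ => by positivity
  rcases hN0.eq_or_lt with hN | hN
  · have := norm_twistedForm_sq_le ha w hi h2
    rw [← hNdef, ← hN, zero_mul] at this
    have h3 : ‖twistedForm a w h‖ = 0 := by
      have := sq_nonneg ‖twistedForm a w h‖
      exact pow_eq_zero_iff two_ne_zero |>.1 (by linarith)
    rw [h3, ← hN, mul_zero]
  -- A normalised form larger than 1 would have unbounded powers with exponents `2 ^ k`, but the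
  -- iteration bounds all of these by `M / N`.
  · by_contra hcon
    push Not at hcon
    have hr : 1 < ‖twistedForm a w h‖ / (p * N) := (one_lt_div (by positivity)).2 hcon
    have hb : ∀ k : ℕ, (‖twistedForm a w h‖ / (p * N)) ^ 2 ^ k ≤ M / N := by
      intro k
      have h1 := key k
      have h3 : N ^ 2 ^ k = N ^ (2 ^ k - 1) * N := by
        rw [← pow_succ, Nat.sub_add_cancel Nat.one_le_two_pow]
      rw [div_pow, mul_pow, h3, div_le_div_iff₀ (by positivity) hN]
      calc _ ≤ N ^ (2 ^ k - 1) * p ^ 2 ^ k * M * N := by gcongr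
        _ = _ := by ring
    have h1 := tendsto_pow_atTop_atTop_of_one_lt hr
    have h3 := h1.comp (tendsto_pow_atTop_atTop_of_one_lt (one_lt_two : (1 : ℕ) < 2))
    obtain ⟨k, hk⟩ := (h3.eventually_gt_atTop (M / N)).exists
    exact absurd (hb k) (not_le.2 hk)

end

end GravLOCC

/-! ### The fidelity bound for a single operator -/

namespace GravLOCC

noncomputable section

open Complex
open scoped ComplexConjugate

variable {n : ℕ}

/-! ### The reproducing formula for coherent states -/

/-- The square root of the Gaussian density. -/
def amplitude (lam : ℝ) (α : Fin n → ℂ) : ℝ :=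
  √((lam / Real.pi) ^ n) * Real.exp (-(lam / 2) * ∑ j, ‖α j‖ ^ 2)

theorem amplitude_sq {lam : ℝ} (hlam : 0 < lam) (α : Fin n → ℂ) :
    amplitude lam α ^ 2 = gaussianDensity lam α := by
  rw [amplitude, gaussianDensity, mul_pow, Real.sq_sqrt (by positivity), ← Real.exp_nat_mul]
  congr 2
  push_cast
  ring

theorem amplitude_nonneg (lam : ℝ) (α : Fin n → ℂ) : 0 ≤ amplitude lam α := by
  unfold amplitude; positivity

theorem continuous_amplitude (lam : ℝ) : Continuous (amplitude lam : (Fin n → ℂ) → ℝ) := by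
  unfold amplitude; fun_prop

theorem integrable_amplitude {lam : ℝ} (hlam : 0 < lam) :
    Integrable (amplitude lam : (Fin n → ℂ) → ℝ) :=
  (integrable_exp_neg_sum_sq_norm (half_pos hlam)).const_mul _

theorem integrable_gaussianDensity {lam : ℝ} (hlam : 0 < lam) :
    Integrable (gaussianDensity lam : (Fin n → ℂ) → ℝ) :=
  (integrable_exp_neg_sum_sq_norm hlam).const_mul _

theorem integral_gaussianDensity {lam : ℝ} (hlam : 0 < lam) :
    ∫ α : Fin n → ℂ, gaussianDensity lam α = 1 := by
  simp only [gaussianDensity]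
  rw [integral_const_mul, integral_exp_neg_sum_sq_norm hlam, ← mul_pow]
  have := hlam.ne'
  have := Real.pi_ne_zero
  field_simp
  exact one_pow n

/-- The reproducing kernel of (rescaled) coherent states. -/
def reproKernel (lam : ℝ) : (Fin n → ℂ) → (Fin n → ℂ) → ℂ :=
  twistedKernel (fun _ => (1 + lam) / 2) (fun _ => 1 + lam)

theorem reproKernel_eq (lam : ℝ) (α β : Fin n → ℂ) : reproKernel lam α β =
    cexp (∑ j, (-((1 + lam) / 2 : ℂ) * ((‖α j‖ ^ 2 : ℝ) : ℂ) -
      ((1 + lam) / 2 : ℂ) * ((‖β j‖ ^ 2 : ℝ) : ℂ) + (1 + lam) * conj (α j) * β j)) := by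
  rw [reproKernel, twistedKernel]
  congr 1
  refine Finset.sum_congr rfl fun j _ => ?_
  simp only [ofReal_sq_norm, map_sub]
  push_cast
  ring

theorem norm_reproKernel_le_one {lam : ℝ} (hlam : 0 < lam) (α β : Fin n → ℂ) :
    ‖reproKernel lam α β‖ ≤ 1 :=
  norm_twistedKernel_le_one (fun _ => by positivity) _ _ _

theorem conj_reproKernel (lam : ℝ) (α β : Fin n → ℂ) :
    conj (reproKernel lam α β) = reproKernel lam β α := conj_twistedKernel _ _ _ _

theorem continuous_reproKernel_comp {X : Type*} [TopologicalSpace X] {f g : X → Fin n → ℂ}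
    (hf : Continuous f) (hg : Continuous g) (lam : ℝ) :
    Continuous fun x => reproKernel lam (f x) (g x) := continuous_twistedKernel_comp hf hg _ _

/-- Here `|w|/2 = a`, the fixed point of the Heron step, so the kernel is idempotent up to a factor.
-/
theorem integral_reproKernel_mul {lam : ℝ} (hlam : 0 < lam) (α β : Fin n → ℂ) :
    ∫ η, reproKernel lam α η * reproKernel lam η β =
      (((Real.pi / (1 + lam)) ^ n : ℝ) : ℂ) * reproKernel lam α β := by
  have h : (1 + lam) ≠ 0 := by positivity
  rw [reproKernel, integral_twistedKernel_mul fun _ => by positivity]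
  congr 1
  · congr 1
    rw [Finset.prod_const, Finset.card_univ, Fintype.card_fin]
    congr 2
    ring
  · congr 1
    ext l
    field_simp
    ring

/-- Pairing with the coherent states, averaged with the reproducing kernel. -/
def reproduce {lam : ℝ} (hlam : 0 < lam) (α : Fin n → ℂ) : Modes n →L[ℂ] ℂ :=
  have hi : ∀ ψ : Modes n, Integrable fun α' : Fin n → ℂ =>
      (amplitude lam α' : ℂ) * (reproKernel lam α α' * inner ℂ (coherent α') ψ) := fun ψ => by
    refine (integrable_amplitude hlam).ofReal.mul_bdd (c := ‖ψ‖) ?_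
      (Filter.Eventually.of_forall fun α' => ?_)
    · have h1 := continuous_coherent (n := n)
      have h2 : Continuous fun α' => reproKernel lam α α' :=
        continuous_reproKernel_comp continuous_const continuous_id lam
      exact Continuous.aestronglyMeasurable (by fun_prop)
    · rw [norm_mul]
      refine (mul_le_of_le_one_left (norm_nonneg _) (norm_reproKernel_le_one hlam _ _)).trans ?_
      refine (norm_inner_le_norm _ _).trans ?_
      rw [norm_coherent, one_mul]
  LinearMap.mkContinuous
    { toFun := fun ψ => ∫ α' : Fin n → ℂ,
        (amplitude lam α' : ℂ) * (reproKernel lam α α' * inner ℂ (coherent α') ψ)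
      map_add' := fun ψ ψ' => by
        simp_rw [inner_add_right, mul_add]
        exact integral_add (hi ψ) (hi ψ')
      map_smul' := fun c ψ => by
        simp_rw [inner_smul_right, mul_left_comm _ c]
        exact integral_const_mul _ _ }
    (∫ α' : Fin n → ℂ, amplitude lam α') fun ψ => by
      rw [← integral_mul_const]
      refine norm_integral_le_of_norm_le ((integrable_amplitude hlam).mul_const _)
        (Filter.Eventually.of_forall fun α' => ?_)
      rw [norm_mul, norm_mul, Complex.norm_real, Real.norm_of_nonneg (amplitude_nonneg _ _)]
      refine mul_le_mul_of_nonneg_left ?_ (amplitude_nonneg _ _)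
      refine (mul_le_of_le_one_left (norm_nonneg _) (norm_reproKernel_le_one hlam _ _)).trans ?_
      refine (norm_inner_le_norm _ _).trans ?_
      rw [norm_coherent, one_mul]

theorem reproduce_apply {lam : ℝ} (hlam : 0 < lam) (α : Fin n → ℂ) (ψ : Modes n) :
    reproduce hlam α ψ = ∫ α' : Fin n → ℂ,
      (amplitude lam α' : ℂ) * (reproKernel lam α α' * inner ℂ (coherent α') ψ) := rfl

/-- The product of amplitude and coherent overlap is `exp(-(1+λ)|α|²/2)` times an antiholomorphic
function of `α`, and `reproKernel` is the Bargmann kernel for that weight. The check is a Gaussian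
integral for coherent `ψ`; totality does the rest. -/
theorem reproduce_eq {lam : ℝ} (hlam : 0 < lam) (α : Fin n → ℂ) (ψ : Modes n) :
    reproduce hlam α ψ =
      (((Real.pi / (1 + lam)) ^ n : ℝ) : ℂ) * ((amplitude lam α : ℂ) * inner ℂ (coherent α) ψ) := by
  have key : reproduce hlam α = ((((Real.pi / (1 + lam)) ^ n : ℝ) : ℂ) * (amplitude lam α : ℂ)) •
      innerSL ℂ (coherent α) := by
    refine total_coherent.ext_clm fun β => ?_
    have hmu : 0 < 1 + lam := by positivity
    simp only [smul_apply, innerSL_apply_apply, reproduce_apply]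
    calc _ = ∫ α' : Fin n → ℂ, cexp (∑ j, (-((1 + lam : ℝ) : ℂ) * ((‖α' j‖ ^ 2 : ℝ) : ℂ) +
            β j * conj (α' j) + ((1 + lam) * conj (α j)) * α' j)) *
            ((√((lam / Real.pi) ^ n) : ℝ) * cexp (∑ j, (-((1 + lam) / 2 : ℂ) *
              ((‖α j‖ ^ 2 : ℝ) : ℂ) - ((‖β j‖ ^ 2 : ℝ) : ℂ) / 2))) := by
          refine integral_congr_ae (Filter.Eventually.of_forall fun α' => ?_)
          simp only [amplitude, reproKernel_eq, inner_coherent]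
          rw [mul_left_comm (cexp _), ← Complex.exp_add, ← Complex.exp_add, Complex.ofReal_mul,
            Complex.ofReal_exp, mul_assoc, ← Complex.exp_add]
          congr 2
          rw [Complex.ofReal_mul, Complex.ofReal_sum, Finset.mul_sum, ← Finset.sum_add_distrib,
            ← Finset.sum_add_distrib, ← Finset.sum_add_distrib]
          refine Finset.sum_congr rfl fun j _ => ?_
          push_cast
          ring
      _ = _ := by
          rw [integral_mul_const, integral_cexp_sum_sq_norm fun _ => hmu, amplitude,
            inner_coherent, mul_mul_mul_comm, ← Complex.exp_add, Complex.ofReal_mul,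
            Complex.ofReal_exp, smul_eq_mul, ← mul_assoc, mul_assoc _ (cexp _) (cexp _),
            ← Complex.exp_add, Complex.ofReal_mul, Complex.ofReal_sum, Finset.mul_sum,
            ← Finset.sum_add_distrib, ← Finset.sum_add_distrib]
          congr 1
          · simp [div_pow]
          · congr 1
            refine Finset.sum_congr rfl fun j _ => ?_
            have : (1 + lam : ℂ) ≠ 0 := by exact_mod_cast hmu.ne'
            push_cast
            field_simp
            ring
  rw [key]
  simp [mul_assoc]

/-! ### The bound for a single Kraus operator -/

/-- Let `F = √p ⟨Lα|K|α⟩`, `X = ∫|F|²`, `N = ∫ p‖K|α⟩‖²` and `q = (π/(1+λ))ⁿ`. Reproducing `F` in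
the variable of `K|α⟩` writes `qX` as the pairing of `√p K|α'⟩` with vectors `v(α')` built from the
targets. Cauchy-Schwarz gives `(qX)² ≤ N ∫‖v‖²`, and idempotency of the kernel with `hC` gives
`∫‖v‖² ≤ qCX`. Dividing by `q²X` leaves `X ≤ CN/q`. -/
theorem integral_density_mul_le {lam : ℝ} (hlam : 0 < lam) {L : (Fin n → ℂ) → (Fin n → ℂ)}
    (hL : Continuous L) {C : ℝ}
    (hC : ∀ h : (Fin n → ℂ) → ℂ, Integrable h → MemLp h 2 →
      ‖∫ p : (Fin n → ℂ) × (Fin n → ℂ), conj (h p.1) * (reproKernel lam p.2 p.1 *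
        inner ℂ (coherent (L p.1)) (coherent (L p.2))) * h p.2‖ ≤ C * ∫ ζ, ‖h ζ‖ ^ 2)
    (K : Modes n →L[ℂ] Modes n) :
    ∫ α, gaussianDensity lam α * ‖(inner ℂ (coherent (L α)) (K (coherent α)) : ℂ)‖ ^ 2 ≤
      ((1 + lam) / Real.pi) ^ n * C * ∫ α, gaussianDensity lam α * ‖K (coherent α)‖ ^ 2 := by
  have hmu : 0 < 1 + lam := by positivity
  have hcoh := continuous_coherent (n := n)
  have hamp := continuous_amplitude (n := n) lam
  set φ : (Fin n → ℂ) → Modes n := fun α => coherent (L α) with hφ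
  have hφc : Continuous φ := hcoh.comp hL
  have hφ1 : ∀ α, ‖φ α‖ = 1 := fun α => norm_coherent _
  set F : (Fin n → ℂ) → ℂ := fun α => (amplitude lam α : ℂ) * inner ℂ (φ α) (K (coherent α)) with hF
  have hFc : Continuous F := by fun_prop
  have hK1 : ∀ α : Fin n → ℂ, ‖K (coherent α)‖ ≤ ‖K‖ := fun α => by
    simpa [norm_coherent] using K.le_opNorm (coherent α)
  have hFb : ∀ α, ‖F α‖ ≤ amplitude lam α * ‖K‖ := fun α => by
    rw [hF, norm_mul, Complex.norm_real, Real.norm_of_nonneg (amplitude_nonneg _ _)]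
    refine mul_le_mul_of_nonneg_left ?_ (amplitude_nonneg _ _)
    refine (norm_inner_le_norm _ _).trans ?_
    rw [hφ1, one_mul]
    exact hK1 α
  have hFi : Integrable F := ((integrable_amplitude hlam).mul_const ‖K‖).mono'
    hFc.aestronglyMeasurable (Filter.Eventually.of_forall hFb)
  have hF2 : MemLp F 2 := by
    rw [memLp_two_iff_integrable_sq_norm hFc.aestronglyMeasurable]
    refine ((integrable_gaussianDensity hlam).mul_const (‖K‖ ^ 2)).mono'
      (Continuous.aestronglyMeasurable (by fun_prop)) (Filter.Eventually.of_forall fun α => ?_)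
    rw [Real.norm_of_nonneg (by positivity), ← amplitude_sq hlam, ← mul_pow]
    gcongr
    exact hFb α
  have hFsq : ∀ α, ‖F α‖ ^ 2 =
      gaussianDensity lam α * ‖(inner ℂ (φ α) (K (coherent α)) : ℂ)‖ ^ 2 := fun α => by
    rw [hF, norm_mul, mul_pow, Complex.norm_real, Real.norm_of_nonneg (amplitude_nonneg _ _),
      amplitude_sq hlam]
  -- the dual vectors
  set g : (Fin n → ℂ) → (Fin n → ℂ) → Modes n :=
    fun α' α => (F α * reproKernel lam α α') • φ α with hg
  have hgc : ∀ α', Continuous (g α') := fun α' => by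
    have := continuous_reproKernel_comp (X := Fin n → ℂ) continuous_id
      (continuous_const (y := α')) lam
    simp only [id] at this
    fun_prop
  have hgb : ∀ α' α, ‖g α' α‖ ≤ ‖F α‖ := fun α' α => by
    rw [hg, norm_smul, norm_mul, hφ1, mul_one]
    exact mul_le_of_le_one_right (norm_nonneg _) (norm_reproKernel_le_one hlam _ _)
  have hgi : ∀ α', Integrable (g α') := fun α' =>
    hFi.norm.mono' (hgc α').aestronglyMeasurable (Filter.Eventually.of_forall (hgb α'))
  set v : (Fin n → ℂ) → Modes n := fun α' => ∫ α, g α' α with hv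
  have hvm : AEStronglyMeasurable v volume := by
    have h1 : Continuous fun p : (Fin n → ℂ) × (Fin n → ℂ) => g p.1 p.2 := by
      have := continuous_reproKernel_comp (X := (Fin n → ℂ) × (Fin n → ℂ))
        continuous_snd continuous_fst lam
      simp only [hg]
      fun_prop
    exact h1.aestronglyMeasurable.integral_prod_right'
  have hgg : ∀ α' α₁ α₂, (inner ℂ (g α' α₁) (g α' α₂) : ℂ) =
      conj (F α₁) * reproKernel lam α' α₁ * (reproKernel lam α₂ α' * F α₂) *
        inner ℂ (φ α₁) (φ α₂) := by
    intro α' α₁ α₂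
    rw [hg, inner_smul_left, inner_smul_right, map_mul, conj_reproKernel]
    ring
  have htr : Integrable (fun p : (Fin n → ℂ) × ((Fin n → ℂ) × (Fin n → ℂ)) =>
      (inner ℂ (g p.1 p.2.1) (g p.1 p.2.2) : ℂ)) (volume.prod (volume.prod volume)) := by
    refine (integrable_twisted_triple (a := fun _ => (1 + lam) / 2) (fun _ => by positivity)
      (fun _ => 1 + lam) hFi).norm.mono' ?_ (Filter.Eventually.of_forall fun p => ?_)
    · have h1 : Continuous fun p : (Fin n → ℂ) × ((Fin n → ℂ) × (Fin n → ℂ)) =>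
          reproKernel lam p.2.1 p.1 := continuous_reproKernel_comp (by fun_prop) (by fun_prop) lam
      have h2 : Continuous fun p : (Fin n → ℂ) × ((Fin n → ℂ) × (Fin n → ℂ)) =>
          reproKernel lam p.2.2 p.1 := continuous_reproKernel_comp (by fun_prop) (by fun_prop) lam
      simp only [hg]
      exact Continuous.aestronglyMeasurable (by fun_prop)
    · rw [hgg, norm_mul]
      refine (mul_le_of_le_one_right (norm_nonneg _) ?_).trans_eq ?_
      · refine (norm_inner_le_norm _ _).trans ?_
        rw [hφ1, hφ1, one_mul]
      · clear_value F
        have e : ∀ α β : Fin n → ℂ, ‖twistedKernel (fun _ => (1 + lam) / 2) (fun _ => 1 + lam) α β‖ =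
            ‖reproKernel lam β α‖ := fun α β => by
          rw [← conj_reproKernel, RCLike.norm_conj]
          rfl
        simp only [norm_mul, RCLike.norm_conj, e]
  have hvv : ∀ α', ∫ p : (Fin n → ℂ) × (Fin n → ℂ), (inner ℂ (g α' p.1) (g α' p.2) : ℂ) =
      ((‖v α'‖ ^ 2 : ℝ) : ℂ) := by
    intro α'
    have hi : Integrable (fun p : (Fin n → ℂ) × (Fin n → ℂ) =>
        (inner ℂ (g α' p.1) (g α' p.2) : ℂ)) (volume.prod volume) := by
      refine (hFi.norm.mul_prod hFi.norm).mono' ?_ (Filter.Eventually.of_forall fun p => ?_)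
      · have := hgc α'
        exact Continuous.aestronglyMeasurable (by fun_prop)
      · refine (norm_inner_le_norm _ _).trans ?_
        exact mul_le_mul (hgb _ _) (hgb _ _) (norm_nonneg _) (norm_nonneg _)
    rw [Measure.volume_eq_prod, integral_prod _ hi]
    simp_rw [integral_inner (hgi α')]
    have h1 : ∀ α, (inner ℂ (g α' α) (v α') : ℂ) = conj (inner ℂ (v α') (g α' α)) := fun α =>
      (inner_conj_symm _ _).symm
    change ∫ α, (inner ℂ (g α' α) (v α') : ℂ) = _
    simp_rw [h1]
    rw [integral_conj, integral_inner (hgi α'), inner_conj_symm]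
    rw [Complex.ofReal_pow]
    exact inner_self_eq_norm_sq_to_K (𝕜 := ℂ) (v α')
  have hvi : Integrable fun α' => ‖v α'‖ ^ 2 := by
    have := htr.integral_prod_left
    simp_rw [← Measure.volume_eq_prod, hvv] at this
    exact this.re
  -- Integrating over `α'` first composes the two kernels into one, which leaves exactly the form in
  -- `hC`.
  have hvnorm : ∫ α', ‖v α'‖ ^ 2 ≤ (Real.pi / (1 + lam)) ^ n * (C * ∫ α, ‖F α‖ ^ 2) := by
    have h1 : ((∫ α', ‖v α'‖ ^ 2 : ℝ) : ℂ) = (((Real.pi / (1 + lam)) ^ n : ℝ) : ℂ) *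
        ∫ p : (Fin n → ℂ) × (Fin n → ℂ), conj (F p.1) * (reproKernel lam p.2 p.1 *
          inner ℂ (φ p.1) (φ p.2)) * F p.2 := by
      rw [← integral_complex_ofReal]
      simp_rw [← hvv]
      rw [Measure.volume_eq_prod, integral_integral_swap htr, ← integral_const_mul]
      refine integral_congr_ae (Filter.Eventually.of_forall fun p => ?_)
      simp only [hgg]
      calc _ = ∫ η, (conj (F p.1) * F p.2 * inner ℂ (φ p.1) (φ p.2)) *
            (reproKernel lam p.2 η * reproKernel lam η p.1) := by
            refine integral_congr_ae (Filter.Eventually.of_forall fun η => ?_)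
            ring
        _ = _ := by
            rw [integral_const_mul, integral_reproKernel_mul hlam]
            ring
    have h2 := congrArg norm h1
    rw [Complex.norm_real, norm_mul, Complex.norm_real,
      Real.norm_of_nonneg (integral_nonneg fun _ => by positivity),
      Real.norm_of_nonneg (by positivity)] at h2
    rw [h2]
    exact mul_le_mul_of_nonneg_left (hC F hFi hF2) (by positivity)
  -- the pairing
  have hpair : (((Real.pi / (1 + lam)) ^ n : ℝ) : ℂ) * ((∫ α, ‖F α‖ ^ 2 : ℝ) : ℂ) =
      ∫ α', conj ((amplitude lam α' * ‖K (coherent α')‖ : ℝ) : ℂ) *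
        (((‖K (coherent α')‖⁻¹ : ℝ) : ℂ) * inner ℂ (v α') (K (coherent α'))) := by
    have h1 : ∀ α, (((Real.pi / (1 + lam)) ^ n : ℝ) : ℂ) * F α = ∫ α' : Fin n → ℂ,
        (amplitude lam α' : ℂ) * (reproKernel lam α' α * inner ℂ (φ α) (K (coherent α'))) := by
      intro α
      -- The target `φ α` is frozen here: only the input of `K` is reproduced, since `φ` itself need
      -- not be holomorphic.
      have h2 := reproduce_eq hlam α (ContinuousLinearMap.adjoint K (φ α))
      have h3 := congrArg conj h2
      rw [reproduce_apply, ← integral_conj] at h3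
      simp only [map_mul, Complex.conj_ofReal, conj_reproKernel, inner_conj_symm,
        ContinuousLinearMap.adjoint_inner_left] at h3
      exact h3.symm
    have hi : Integrable (fun p : (Fin n → ℂ) × (Fin n → ℂ) => conj (F p.1) *
        ((amplitude lam p.2 : ℂ) * (reproKernel lam p.2 p.1 * inner ℂ (φ p.1) (K (coherent p.2)))))
        (volume.prod volume) := by
      refine (hFi.norm.mul_prod ((integrable_amplitude hlam).mul_const ‖K‖)).mono' ?_
        (Filter.Eventually.of_forall fun p => ?_)
      · have := continuous_reproKernel_comp (X := (Fin n → ℂ) × (Fin n → ℂ))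
          continuous_snd continuous_fst lam
        exact Continuous.aestronglyMeasurable (by fun_prop)
      · clear_value F
        rw [norm_mul, RCLike.norm_conj, norm_mul, Complex.norm_real,
          Real.norm_of_nonneg (amplitude_nonneg _ _), norm_mul]
        refine mul_le_mul_of_nonneg_left (mul_le_mul_of_nonneg_left ?_ (amplitude_nonneg _ _))
          (norm_nonneg _)
        refine (mul_le_of_le_one_left (norm_nonneg _) (norm_reproKernel_le_one hlam _ _)).trans ?_
        refine (norm_inner_le_norm _ _).trans ?_
        rw [hφ1, one_mul]
        exact hK1 _
    calc _ = ∫ α, conj (F α) * ((((Real.pi / (1 + lam)) ^ n : ℝ) : ℂ) * F α) := by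
          rw [← integral_complex_ofReal, ← integral_const_mul]
          refine integral_congr_ae (Filter.Eventually.of_forall fun α => ?_)
          simp only
          rw [ofReal_sq_norm]
          ring
      _ = ∫ α, ∫ α', conj (F α) * ((amplitude lam α' : ℂ) *
            (reproKernel lam α' α * inner ℂ (φ α) (K (coherent α')))) := by
          refine integral_congr_ae (Filter.Eventually.of_forall fun α => ?_)
          simp only
          rw [h1, integral_const_mul]
      _ = ∫ α', ∫ α, conj (F α) * ((amplitude lam α' : ℂ) *
            (reproKernel lam α' α * inner ℂ (φ α) (K (coherent α')))) :=
          integral_integral_swap hi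
      _ = _ := by
          refine integral_congr_ae (Filter.Eventually.of_forall fun α' => ?_)
          simp only
          have h4 : (inner ℂ (v α') (K (coherent α')) : ℂ) =
              ∫ α, conj (F α) * (reproKernel lam α' α * inner ℂ (φ α) (K (coherent α'))) := by
            rw [← inner_conj_symm, hv, ← integral_inner (hgi α'), ← integral_conj]
            refine integral_congr_ae (Filter.Eventually.of_forall fun α => ?_)
            simp only [hg]
            rw [inner_conj_symm, inner_smul_left, map_mul, conj_reproKernel, mul_assoc]
          -- Moving `‖K|α'⟩‖` into the first factor makes both factors scalar functions, so that
          -- scalar Cauchy-Schwarz applies; where `K|α'⟩ = 0` both sides vanish.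
          have h5 : (((amplitude lam α' * ‖K (coherent α')‖ : ℝ) : ℂ)) *
              (((‖K (coherent α')‖⁻¹ : ℝ) : ℂ) * inner ℂ (v α') (K (coherent α'))) =
              (amplitude lam α' : ℂ) * inner ℂ (v α') (K (coherent α')) := by
            by_cases h0 : K (coherent α') = 0
            · simp [h0]
            · have : (‖K (coherent α')‖ : ℂ) ≠ 0 := by
                exact_mod_cast norm_ne_zero_iff.2 h0
              push_cast
              field_simp
          rw [Complex.conj_ofReal, h5, h4, ← integral_const_mul]
          refine integral_congr_ae (Filter.Eventually.of_forall fun α => ?_)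
          ring
  have hm1 : MemLp (fun α' : Fin n → ℂ =>
      ((amplitude lam α' * ‖K (coherent α')‖ : ℝ) : ℂ)) 2 := by
    rw [memLp_two_iff_integrable_sq_norm (Continuous.aestronglyMeasurable (by fun_prop))]
    refine ((integrable_gaussianDensity hlam).mul_const (‖K‖ ^ 2)).mono'
      (Continuous.aestronglyMeasurable (by fun_prop)) (Filter.Eventually.of_forall fun α => ?_)
    rw [Real.norm_of_nonneg (by positivity), Complex.norm_real, Real.norm_of_nonneg
      (mul_nonneg (amplitude_nonneg _ _) (norm_nonneg _)), mul_pow, amplitude_sq hlam]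
    have h1 : 0 ≤ gaussianDensity lam α := by rw [← amplitude_sq hlam]; positivity
    exact mul_le_mul_of_nonneg_left (pow_le_pow_left₀ (norm_nonneg _) (hK1 α) 2) h1
  have hb2 : ∀ α', ‖((‖K (coherent α')‖⁻¹ : ℝ) : ℂ) * inner ℂ (v α') (K (coherent α'))‖ ≤ ‖v α'‖ := by
    intro α'
    rw [norm_mul, Complex.norm_real, norm_inv, norm_norm]
    by_cases h0 : K (coherent α') = 0
    · simp [h0]
    · rw [inv_mul_le_iff₀ (norm_pos_iff.2 h0), mul_comm]
      exact norm_inner_le_norm _ _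
  have hm2 : MemLp (fun α' : Fin n → ℂ =>
      ((‖K (coherent α')‖⁻¹ : ℝ) : ℂ) * inner ℂ (v α') (K (coherent α'))) 2 := by
    have hv2 : MemLp v 2 := (memLp_two_iff_integrable_sq_norm hvm).2 hvi
    refine hv2.of_le ?_ (Filter.Eventually.of_forall hb2)
    have h1 : Continuous fun α' : Fin n → ℂ => ‖K (coherent α')‖ := by fun_prop
    have h2 : Continuous fun α' : Fin n → ℂ => K (coherent α') := by fun_prop
    exact (Complex.measurable_ofReal.comp h1.measurable.inv).aestronglyMeasurable.mul
      (hvm.inner h2.aestronglyMeasurable)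
  have hCS := norm_integral_conj_mul_sq_le hm1 hm2
  rw [← hpair] at hCS
  set X := ∫ α, ‖F α‖ ^ 2 with hX
  have hX0 : 0 ≤ X := integral_nonneg fun _ => by positivity
  set q := (Real.pi / (1 + lam)) ^ n with hq
  have hq0 : 0 < q := by positivity
  set N := ∫ α, gaussianDensity lam α * ‖K (coherent α)‖ ^ 2 with hN
  have hN' : ∫ α', ‖((amplitude lam α' * ‖K (coherent α')‖ : ℝ) : ℂ)‖ ^ 2 = N := by
    refine integral_congr_ae (Filter.Eventually.of_forall fun α => ?_)
    simp only [Complex.norm_real, Real.norm_eq_abs, sq_abs, mul_pow, amplitude_sq hlam]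
  have hN0 : 0 ≤ N := by rw [← hN']; exact integral_nonneg fun _ => by positivity
  have hle2 : ∫ α', ‖((‖K (coherent α')‖⁻¹ : ℝ) : ℂ) * inner ℂ (v α') (K (coherent α'))‖ ^ 2 ≤
      q * (C * X) := by
    refine le_trans (integral_mono_of_nonneg (Filter.Eventually.of_forall fun _ => by positivity)
      hvi (Filter.Eventually.of_forall fun α' => ?_)) hvnorm
    exact pow_le_pow_left₀ (norm_nonneg _) (hb2 α') 2
  have hmain : (q * X) ^ 2 ≤ N * (q * (C * X)) := by
    rw [hN', norm_mul, Complex.norm_real, Complex.norm_real, Real.norm_of_nonneg hq0.le,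
      Real.norm_of_nonneg hX0] at hCS
    exact hCS.trans (mul_le_mul_of_nonneg_left hle2 hN0)
  have hgoal : X ≤ q⁻¹ * C * N := by
    have hCN : 0 ≤ C * X := by
      have := (norm_nonneg _).trans (hC F hFi hF2)
      exact this
    rcases hX0.eq_or_lt with h0 | h0
    -- With `X = 0` there is nothing to divide by and the sign of `C` matters; testing `hC` on the
    -- amplitude shows that `C` cannot be negative.
    · have h1 : 0 ≤ C ∨ N = 0 := by
        by_contra hcon
        push Not at hcon
        obtain ⟨hc1, -⟩ := hcon
        obtain ⟨h, hh⟩ : ∃ h : (Fin n → ℂ) → ℂ, Integrable h ∧ MemLp h 2 ∧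
            0 < ∫ ζ, ‖h ζ‖ ^ 2 := by
          have e : ∀ ζ : Fin n → ℂ, ‖((amplitude lam ζ : ℝ) : ℂ)‖ ^ 2 = gaussianDensity lam ζ :=
            fun ζ => by rw [Complex.norm_real, Real.norm_eq_abs, sq_abs, amplitude_sq hlam]
          refine ⟨fun α => (amplitude lam α : ℂ), (integrable_amplitude hlam).ofReal, ?_, ?_⟩
          · rw [memLp_two_iff_integrable_sq_norm (Continuous.aestronglyMeasurable (by fun_prop))]
            simp_rw [e]
            exact integrable_gaussianDensity hlam
          · simp_rw [e, integral_gaussianDensity hlam]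
            exact one_pos
        have := (norm_nonneg _).trans (hC h hh.1 hh.2.1)
        nlinarith [hh.2.2]
      rw [← h0]
      rcases h1 with h1 | h1
      · positivity
      · rw [h1, mul_zero]
    · have h1 : q * X ≤ N * C := by
        have h2 : (q * X) * (q * X) ≤ (N * C) * (q * X) := by nlinarith
        exact le_of_mul_le_mul_right h2 (by positivity)
      rw [inv_mul_eq_div, div_mul_eq_mul_div, le_div_iff₀ hq0]
      linarith
  have hqi : q⁻¹ = ((1 + lam) / Real.pi) ^ n := by
    rw [hq, ← inv_pow, inv_div]
  rw [← hqi]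
  refine le_of_eq_of_le (integral_congr_ae (Filter.Eventually.of_forall fun α => ?_)) hgoal
  exact (hFsq α).symm

end

end GravLOCC

/-! ### Unitary coordinates on phase space -/

namespace GravLOCC

noncomputable section

open Complex
open scoped ComplexConjugate

variable {n : ℕ}

/-! ### Sesquilinear forms and unitary matrices -/

open Matrix in
theorem star_dotProduct_self (z : Fin n → ℂ) : star z ⬝ᵥ z = ((∑ j, ‖z j‖ ^ 2 : ℝ) : ℂ) := by
  rw [Complex.ofReal_sum]
  refine Finset.sum_congr rfl fun j _ => ?_
  rw [ofReal_sq_norm, Pi.star_apply, mul_comm]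
  rfl

open Matrix in
theorem conj_star_dotProduct (z z' : Fin n → ℂ) : conj (star z ⬝ᵥ z') = star z' ⬝ᵥ z := by
  simp [dotProduct, map_sum, mul_comm]

open Matrix in
theorem star_mulVec_dotProduct (Z : Matrix (Fin n) (Fin n) ℂ) (z z' : Fin n → ℂ) :
    star (Z *ᵥ z) ⬝ᵥ z' = star z ⬝ᵥ (Zᴴ *ᵥ z') := by
  rw [star_mulVec, dotProduct_mulVec]

open Matrix in
theorem sum_sq_norm_mulVec {Z : Matrix (Fin n) (Fin n) ℂ} (hZ : Zᴴ * Z = 1) (z : Fin n → ℂ) :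
    ∑ j, ‖(Z *ᵥ z) j‖ ^ 2 = ∑ j, ‖z j‖ ^ 2 := by
  have h := star_dotProduct_self (Z *ᵥ z)
  rw [star_mulVec_dotProduct, mulVec_mulVec, hZ, one_mulVec, star_dotProduct_self] at h
  exact_mod_cast h.symm

theorem norm_toLp_eq_of_sum_sq_eq {z z' : Fin n → ℂ} (h : ∑ j, ‖z j‖ ^ 2 = ∑ j, ‖z' j‖ ^ 2) :
    ‖WithLp.toLp 2 z‖ = ‖WithLp.toLp 2 z'‖ := by
  rw [EuclideanSpace.norm_eq, EuclideanSpace.norm_eq]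
  exact congrArg _ h

/-- A real linear equivalence of `ℂⁿ` that preserves `∑ |zⱼ|²` preserves the volume. -/
theorem measurePreserving_of_sum_sq (T : (Fin n → ℂ) ≃ₗ[ℝ] (Fin n → ℂ))
    (hT : ∀ z, ∑ j, ‖T z j‖ ^ 2 = ∑ j, ‖z j‖ ^ 2) :
    MeasurePreserving T (volume : Measure (Fin n → ℂ)) volume := by
  have hc : Continuous T := T.toLinearMap.continuous_of_finiteDimensional
  have hdet : LinearMap.det T.toLinearMap ≠ 0 := (LinearEquiv.isUnit_det' T).ne_zero
  have hmap := Measure.map_linearMap_addHaar_eq_smul_addHaar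
    (volume : Measure (Fin n → ℂ)) hdet
  set c := |(LinearMap.det T.toLinearMap)⁻¹|
  -- The Jacobian factor is read off from a Gaussian integral that is invariant under `T` and
  -- nonzero.
  have h1 : ∫ z : Fin n → ℂ, Real.exp (-1 * ∑ j, ‖z j‖ ^ 2) =
      c * ∫ z : Fin n → ℂ, Real.exp (-1 * ∑ j, ‖z j‖ ^ 2) := by
    calc _ = ∫ z : Fin n → ℂ, Real.exp (-1 * ∑ j, ‖T z j‖ ^ 2) := by simp_rw [hT]
      _ = ∫ z, Real.exp (-1 * ∑ j, ‖z j‖ ^ 2) ∂(Measure.map T volume) := by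
          rw [integral_map hc.measurable.aemeasurable]
          exact Continuous.aestronglyMeasurable (by fun_prop)
      _ = _ := by
          change ∫ z, _ ∂(Measure.map T.toLinearMap volume) = _
          rw [hmap, integral_smul_measure, ENNReal.toReal_ofReal (abs_nonneg _), smul_eq_mul]
  have h2 : (∫ z : Fin n → ℂ, Real.exp (-1 * ∑ j, ‖z j‖ ^ 2)) ≠ 0 := by
    rw [integral_exp_neg_sum_sq_norm one_pos]
    positivity
  have hc1 : c = 1 := by
    have := mul_right_cancel₀ h2 ((one_mul _).trans h1)
    exact this.symm
  refine ⟨hc.measurable, ?_⟩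
  change Measure.map T.toLinearMap volume = volume
  rw [hmap, hc1, ENNReal.ofReal_one, one_smul]

/-! ### Partial complex conjugation of the modes -/

theorem conjOn_conjOn (J : Finset (Fin n)) (α : Fin n → ℂ) : conjOn J (conjOn J α) = α := by
  ext j
  by_cases h : j ∈ J <;> simp [conjOn, h]

theorem norm_conjOn_apply (J : Finset (Fin n)) (α : Fin n → ℂ) (j : Fin n) :
    ‖conjOn J α j‖ = ‖α j‖ := by
  by_cases h : j ∈ J <;> simp [conjOn, h]

theorem continuous_conjOn (J : Finset (Fin n)) : Continuous (conjOn J) := by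
  refine continuous_pi fun j => ?_
  by_cases h : j ∈ J
  · simp only [conjOn, h, if_true]; fun_prop
  · simp only [conjOn, h, if_false]; fun_prop

open Matrix in
-- Partial conjugation keeps the real part of each term of the inner product and flips the imaginary
-- part exactly for `j ∈ J`; so the real part is that of `⟨α, β⟩` and the imaginary part is minus
-- that of `⟨α, Ξ_J β⟩`.
theorem star_conjOn_dotProduct (J : Finset (Fin n)) (α β : Fin n → ℂ) :
    star (conjOn J α) ⬝ᵥ conjOn J β =
      (star α ⬝ᵥ β + conj (star α ⬝ᵥ β)) / 2 -
        (star α ⬝ᵥ (Xi J *ᵥ β) - conj (star α ⬝ᵥ (Xi J *ᵥ β))) / 2 := by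
  rw [sub_eq_add_neg, add_div, neg_div', neg_sub, sub_div]
  simp only [dotProduct, map_sum, Finset.sum_div, ← Finset.sum_add_distrib,
    ← Finset.sum_sub_distrib]
  refine Finset.sum_congr rfl fun j _ => ?_
  by_cases h : j ∈ J
  · simp [conjOn, h, Xi, mulVec_diagonal]
    ring
  · simp [conjOn, h, Xi, mulVec_diagonal]
    ring

open Matrix in
/-- Partial conjugation followed by a unitary matrix, as a real linear equivalence. -/
def conjOnEquiv (J : Finset (Fin n)) (Z : Matrix (Fin n) (Fin n) ℂ) (hZ : Zᴴ * Z = 1) :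
    (Fin n → ℂ) ≃ₗ[ℝ] (Fin n → ℂ) where
  toFun α := Z *ᵥ conjOn J α
  invFun α := conjOn J (Zᴴ *ᵥ α)
  left_inv α := by
    change conjOn J (Zᴴ *ᵥ (Z *ᵥ conjOn J α)) = α
    rw [mulVec_mulVec, hZ, one_mulVec, conjOn_conjOn]
  right_inv α := by
    change Z *ᵥ conjOn J (conjOn J (Zᴴ *ᵥ α)) = α
    rw [conjOn_conjOn, mulVec_mulVec, mul_eq_one_comm.1 hZ, one_mulVec]
  map_add' α β := by
    rw [← mulVec_add]
    congr 1
    ext j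
    by_cases h : j ∈ J <;> simp [conjOn, h]
  map_smul' c α := by
    rw [RingHom.id_apply, ← mulVec_smul]
    congr 1
    ext j
    by_cases h : j ∈ J <;> simp [conjOn, h]

open Matrix in
theorem measurePreserving_conjOnEquiv (J : Finset (Fin n)) (Z : Matrix (Fin n) (Fin n) ℂ)
    (hZ : Zᴴ * Z = 1) :
    MeasurePreserving (conjOnEquiv J Z hZ) (volume : Measure (Fin n → ℂ)) volume := by
  refine measurePreserving_of_sum_sq _ fun z => ?_
  refine (sum_sq_norm_mulVec hZ _).trans ?_
  simp_rw [norm_conjOn_apply]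

/-! ### The rotation of phase space by the interaction -/

/-- The unitary matrix `exp(-iM/2)`. -/
def halfRot (M : Matrix (Fin n) (Fin n) ℝ) : Matrix (Fin n) (Fin n) ℂ :=
  NormedSpace.exp (-(I / 2) • M.map Complex.ofReal)

section HalfRot

open Matrix

variable {M : Matrix (Fin n) (Fin n) ℝ}

theorem halfRot_conjTranspose (hM : M.IsSymm) :
    (halfRot M)ᴴ = NormedSpace.exp ((I / 2) • M.map Complex.ofReal) := by
  have hMc : (M.map Complex.ofReal).conjTranspose = M.map Complex.ofReal := by
    ext j k
    simp [Matrix.conjTranspose_apply, hM.apply j k]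
  have hI : star (-(Complex.I / 2)) = Complex.I / 2 := by simp [neg_div]
  rw [halfRot, ← exp_conjTranspose, conjTranspose_smul, hMc, hI]

theorem halfRot_transpose (hM : M.IsSymm) : (halfRot M)ᵀ = halfRot M := by
  rw [halfRot, ← exp_transpose, transpose_smul, ← transpose_map, hM]

theorem halfRot_conjTranspose_mul (hM : M.IsSymm) : (halfRot M)ᴴ * halfRot M = 1 := by
  rw [halfRot_conjTranspose hM, halfRot, neg_smul, Matrix.exp_neg]
  exact mul_nonsing_inv _ ((isUnit_iff_isUnit_det _).1 (isUnit_exp _))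

theorem halfRot_mul_conjTranspose (hM : M.IsSymm) : halfRot M * (halfRot M)ᴴ = 1 :=
  mul_eq_one_comm.1 (halfRot_conjTranspose_mul hM)

theorem rotatedXi_eq (lam : ℝ) (hM : M.IsSymm) (J : Finset (Fin n)) : rotatedXi lam M J =
    ((1 + lam : ℝ) : ℂ) • ((halfRot M)ᴴ * Xi J * halfRot M) - Xi J := by
  rw [halfRot_conjTranspose hM, rotatedXi, halfRot]

/-- A real symmetric matrix is diagonalised by an orthogonal matrix, and so are its functions. -/
theorem exists_diagonalization (hM : M.IsSymm) :
    ∃ (O : Matrix (Fin n) (Fin n) ℝ) (κ : Fin n → ℝ), Oᵀ * O = 1 ∧ O * Oᵀ = 1 ∧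
      M = O * diagonal κ * Oᵀ ∧ ∀ f : ℝ → ℝ, cfc f M = O * diagonal (fun j => f (κ j)) * Oᵀ := by
  have hH : M.IsHermitian := by rw [IsHermitian, conjTranspose_eq_transpose_of_trivial]; exact hM
  have hs : star (hH.eigenvectorUnitary : Matrix (Fin n) (Fin n) ℝ) =
      (hH.eigenvectorUnitary : Matrix (Fin n) (Fin n) ℝ)ᵀ := by
    rw [star_eq_conjTranspose, conjTranspose_eq_transpose_of_trivial]
  refine ⟨hH.eigenvectorUnitary, hH.eigenvalues, ?_, ?_, ?_, fun f => ?_⟩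
  · rw [← hs]; exact Unitary.coe_star_mul_self _
  · rw [← hs]; exact Unitary.coe_mul_star_self _
  · conv_lhs => rw [hH.spectral_theorem, Unitary.conjStarAlgAut_apply, hs]
    rfl
  · rw [hH.cfc_eq, IsHermitian.cfc, Unitary.conjStarAlgAut_apply, hs]
    rfl

theorem exp_smul_map_of_diagonalization {O : Matrix (Fin n) (Fin n) ℝ} {κ : Fin n → ℝ}
    (h1 : O * Oᵀ = 1) (c : ℂ) :
    NormedSpace.exp (c • (O * diagonal κ * Oᵀ).map Complex.ofReal) =
      O.map Complex.ofReal * diagonal (fun j => cexp (c * κ j)) * (O.map Complex.ofReal)ᵀ := by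
  have hO : O.map Complex.ofReal * (O.map Complex.ofReal)ᵀ = 1 := by
    have := congrArg (fun A : Matrix (Fin n) (Fin n) ℝ => A.map Complex.ofRealHom) h1
    simp only [Matrix.map_mul] at this
    refine Eq.trans ?_ (this.trans (Matrix.map_one _ (map_zero _) (map_one _)))
    rfl
  have hinv : (O.map Complex.ofReal)⁻¹ = (O.map Complex.ofReal)ᵀ := inv_eq_right_inv hO
  have hd : (O * diagonal κ * Oᵀ).map Complex.ofReal =
      O.map Complex.ofReal * diagonal (fun j => (κ j : ℂ)) * (O.map Complex.ofReal)ᵀ := by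
    have := Matrix.map_mul (L := O * diagonal κ) (M := Oᵀ) (f := Complex.ofRealHom)
    refine this.trans ?_
    rw [Matrix.map_mul, diagonal_map (map_zero _)]
    rfl
  rw [hd, ← hinv, ← smul_mul_assoc, ← mul_smul_comm, exp_conj _ _
    ((isUnit_iff_isUnit_det _).2 (isUnit_det_of_right_inverse hO)), ← diagonal_smul, exp_diagonal]
  congr 3
  ext j
  rw [Pi.coe_exp, Complex.exp_eq_exp_ℂ]
  rfl

theorem halfRot_eq_cfc (hM : M.IsSymm) : halfRot M =
    (cfc Real.cos ((1 / 2 : ℝ) • M)).map Complex.ofReal -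
      I • (cfc Real.sin ((1 / 2 : ℝ) • M)).map Complex.ofReal := by
  obtain ⟨O, κ, h1, h2, h3, h4⟩ := exists_diagonalization (M := (1 / 2 : ℝ) • M) (by
    rw [IsSymm, transpose_smul, hM])
  have e : ∀ f : Fin n → ℝ, (O * diagonal f * Oᵀ).map Complex.ofReal =
      O.map Complex.ofReal * diagonal (fun j => (f j : ℂ)) * (O.map Complex.ofReal)ᵀ := by
    intro f
    have := Matrix.map_mul (L := O * diagonal f) (M := Oᵀ) (f := Complex.ofRealHom)
    refine this.trans ?_
    rw [Matrix.map_mul, diagonal_map (map_zero _)]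
    rfl
  have h5 : halfRot M = NormedSpace.exp (-I • ((1 / 2 : ℝ) • M).map Complex.ofReal) := by
    rw [halfRot]
    congr 1
    ext j k
    simp
    ring
  rw [h5, h4, h4, h3, exp_smul_map_of_diagonalization h2, e, e, ← smul_mul_assoc, ← mul_smul_comm,
    ← sub_mul, ← mul_sub, ← diagonal_smul, diagonal_sub]
  congr 3
  ext j
  rw [neg_mul, ← mul_neg, mul_comm, ← Complex.ofReal_neg, Complex.exp_mul_I]
  simp [mul_comm, sub_eq_add_neg]

/-- In the complex coordinate `x + ip` the blocks act as `cos(M/2) - i sin(M/2)`. -/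
theorem Seff_mulVec_ph (hM : M.IsSymm) (z : Fin n → ℂ) :
    (Seff M).mulVec (ph z) = ph (halfRot M *ᵥ z) := by
  rw [halfRot_eq_cfc hM, Seff, fromBlocks_mulVec]
  ext i
  rcases i with i | i
  · simp only [ph, mulVec, dotProduct, Sum.elim_inl, Pi.add_apply, Function.comp_apply,
      Sum.elim_inr, Finset.mul_sum, ← Finset.sum_add_distrib, Complex.re_sum]
    refine Finset.sum_congr rfl fun j _ => ?_
    simp
    ring
  · simp only [ph, mulVec, dotProduct, Sum.elim_inl, Pi.add_apply, Function.comp_apply,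
      Sum.elim_inr, Finset.mul_sum, ← Finset.sum_add_distrib, Complex.im_sum]
    refine Finset.sum_congr rfl fun j _ => ?_
    simp
    ring

end HalfRot

end

end GravLOCC

/-! ### The LOCC bound and its minimum over `J` -/

namespace GravLOCC

noncomputable section

open Complex
open scoped ComplexConjugate

variable {n : ℕ}

/-! ### The effective Gaussian unitary on coherent states -/

section Matrices

open Matrix

variable {M : Matrix (Fin n) (Fin n) ℝ}

theorem sum_sq_Seff_mulVec (hM : M.IsSymm) (δ : Fin n ⊕ Fin n → ℝ) :
    ∑ i, (Seff M).mulVec δ i ^ 2 = ∑ i, δ i ^ 2 := by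
  rw [← ph_phInv δ, Seff_mulVec_ph hM, sum_ph_sq, sum_ph_sq,
    sum_sq_norm_mulVec (halfRot_conjTranspose_mul hM)]

/-- The effective matrix is orthogonal, so `le_norm_inner_vacuum_sq` with `s = 1` gives vacuum
overlap of modulus 1. Equality in Cauchy-Schwarz makes the vacuum an eigenvector, and covariance
carries this to all coherent states. -/
theorem IsGaussianUnitary.exists_coherent {U : Modes n ≃ₗᵢ[ℂ] Modes n} (hM : M.IsSymm)
    (hU : IsGaussianUnitary (Seff M) U) :
    ∃ c : ℂ, ‖c‖ = 1 ∧ ∀ α, U (coherent α) = c • coherent (halfRot M *ᵥ α) := by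
  set c : ℂ := inner ℂ (vacuum n) (U (vacuum n)) with hc
  have h1 : (1 : ℝ) ≤ ‖c‖ ^ 2 := by
    have := le_norm_inner_vacuum_sq (X := U) (T := (Seff M).mulVec) hU zero_le_one
      fun δ => by rw [one_mul, sum_sq_Seff_mulVec hM]
    simpa [one_add_one_eq_two] using this
  have h2 : ‖c‖ ≤ 1 := by
    refine (norm_inner_le_norm _ _).trans ?_
    rw [LinearIsometryEquiv.norm_map, norm_vacuum, one_mul]
  have h3 : ‖c‖ = 1 := le_antisymm h2 (by nlinarith [norm_nonneg c])
  have h4 : U (vacuum n) = c • vacuum n := by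
    rw [← sub_eq_zero, ← norm_eq_zero, ← sq_eq_zero_iff, @norm_sub_sq ℂ, inner_smul_right,
      ← inner_conj_symm, ← hc, LinearIsometryEquiv.norm_map, norm_smul, norm_vacuum, h3,
      Complex.mul_conj, Complex.normSq_eq_norm_sq, h3]
    norm_num
  refine ⟨c, h3, fun α => ?_⟩
  rw [coherent_eq, hU, h4, displace_smul_right, Seff_mulVec_ph hM, coherent_eq]

theorem Xi_mul_self (J : Finset (Fin n)) : (Xi J)ᴴ * Xi J = 1 := by
  rw [Xi, diagonal_conjTranspose, diagonal_mul_diagonal, ← diagonal_one]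
  congr 1
  ext j
  by_cases h : j ∈ J <;> simp [h]

theorem norm_toLp_mulVec {Z : Matrix (Fin n) (Fin n) ℂ} (hZ : Zᴴ * Z = 1) (z : Fin n → ℂ) :
    ‖WithLp.toLp 2 (Z *ᵥ z)‖ = ‖WithLp.toLp 2 z‖ :=
  norm_toLp_eq_of_sum_sq_eq (sum_sq_norm_mulVec hZ z)

theorem exists_eigenvector (lam : ℝ) (hM : M.IsSymm) (J : Finset (Fin n)) (l : Fin n) :
    ∃ v : Fin n → ℂ, ‖WithLp.toLp 2 v‖ = 1 ∧ rotatedXi lam M J *ᵥ v = (w lam hM J l : ℂ) • v := by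
  refine ⟨((rotatedXi_isHermitian lam hM J).eigenvectorBasis l).ofLp,
    (rotatedXi_isHermitian lam hM J).eigenvectorBasis.norm_eq_one l, ?_⟩
  rw [IsHermitian.mulVec_eigenvectorBasis, w, Complex.coe_smul]

/-- The matrix is `1 + λ` times a unitary minus a unitary. The upper estimate supplies the
hypothesis `|w|/2 ≤ a` of the twisted convolution bound, the lower one shows that the LOCC bounds do
not exceed 1. -/
theorem norm_rotatedXi_mulVec {lam : ℝ} (hlam : 0 < lam) (hM : M.IsSymm) (J : Finset (Fin n))
    {v : Fin n → ℂ} (hv : ‖WithLp.toLp 2 v‖ = 1) :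
    lam ≤ ‖WithLp.toLp 2 (rotatedXi lam M J *ᵥ v)‖ ∧
      ‖WithLp.toLp 2 (rotatedXi lam M J *ᵥ v)‖ ≤ 2 + lam := by
  have h1 : WithLp.toLp 2 (rotatedXi lam M J *ᵥ v) = ((1 + lam : ℝ) : ℂ) •
      WithLp.toLp 2 ((halfRot M)ᴴ *ᵥ (Xi J *ᵥ (halfRot M *ᵥ v))) - WithLp.toLp 2 (Xi J *ᵥ v) := by
    rw [rotatedXi_eq lam hM, sub_mulVec, smul_mulVec, ← WithLp.toLp_smul, ← WithLp.toLp_sub,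
      mulVec_mulVec, mulVec_mulVec, mul_assoc]
  have hA : ‖((1 + lam : ℝ) : ℂ) •
      WithLp.toLp 2 ((halfRot M)ᴴ *ᵥ (Xi J *ᵥ (halfRot M *ᵥ v)))‖ = 1 + lam := by
    rw [norm_smul, norm_toLp_mulVec (by
      rw [conjTranspose_conjTranspose]; exact halfRot_mul_conjTranspose hM),
      norm_toLp_mulVec (Xi_mul_self J), norm_toLp_mulVec (halfRot_conjTranspose_mul hM), hv,
      Complex.norm_real, Real.norm_of_nonneg (by positivity), mul_one]
  have hB : ‖WithLp.toLp 2 (Xi J *ᵥ v)‖ = 1 := by rw [norm_toLp_mulVec (Xi_mul_self J), hv]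
  rw [h1]
  constructor
  · have := norm_sub_norm_le (((1 + lam : ℝ) : ℂ) •
      WithLp.toLp 2 ((halfRot M)ᴴ *ᵥ (Xi J *ᵥ (halfRot M *ᵥ v)))) (WithLp.toLp 2 (Xi J *ᵥ v))
    rw [hA, hB] at this
    linarith
  · refine (norm_sub_le _ _).trans ?_
    rw [hA, hB]
    linarith

theorem abs_w_eq (lam : ℝ) (hM : M.IsSymm) (J : Finset (Fin n)) (l : Fin n) :
    ∃ v : Fin n → ℂ, ‖WithLp.toLp 2 v‖ = 1 ∧
      |w lam hM J l| = ‖WithLp.toLp 2 (rotatedXi lam M J *ᵥ v)‖ := by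
  obtain ⟨v, hv, h⟩ := exists_eigenvector lam hM J l
  refine ⟨v, hv, ?_⟩
  rw [h, WithLp.toLp_smul, norm_smul, hv, mul_one, Complex.norm_real, Real.norm_eq_abs]

theorem le_abs_w {lam : ℝ} (hlam : 0 < lam) (hM : M.IsSymm) (J : Finset (Fin n)) (l : Fin n) :
    lam ≤ |w lam hM J l| := by
  obtain ⟨v, hv, h⟩ := abs_w_eq lam hM J l
  exact h ▸ (norm_rotatedXi_mulVec hlam hM J hv).1

theorem abs_w_le {lam : ℝ} (hlam : 0 < lam) (hM : M.IsSymm) (J : Finset (Fin n)) (l : Fin n) :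
    |w lam hM J l| ≤ 2 + lam := by
  obtain ⟨v, hv, h⟩ := abs_w_eq lam hM J l
  exact h ▸ (norm_rotatedXi_mulVec hlam hM J hv).2

/-! ### Diagonalisation of the kernel -/

theorem inner_coherent_eq_dotProduct (α β : Fin n → ℂ) : inner ℂ (coherent α) (coherent β) =
    cexp (-((∑ j, ‖α j‖ ^ 2 : ℝ) : ℂ) / 2 - ((∑ j, ‖β j‖ ^ 2 : ℝ) : ℂ) / 2 + star α ⬝ᵥ β) := by
  rw [inner_coherent]
  congr 1
  simp only [Finset.sum_add_distrib, Finset.sum_sub_distrib, neg_div, Finset.sum_neg_distrib,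
    ← Finset.sum_div, ofReal_sum, dotProduct]
  rfl

theorem reproKernel_eq_dotProduct (lam : ℝ) (α β : Fin n → ℂ) : reproKernel lam α β =
    cexp (-((1 + lam) / 2 : ℂ) * (((∑ j, ‖α j‖ ^ 2 : ℝ) : ℂ) + ((∑ j, ‖β j‖ ^ 2 : ℝ) : ℂ)) +
      (1 + lam) * (star α ⬝ᵥ β)) := by
  rw [reproKernel_eq]
  congr 1
  simp only [Finset.sum_add_distrib, Finset.sum_sub_distrib, ← Finset.mul_sum, mul_assoc,
    ofReal_sum, dotProduct]
  rw [sub_eq_add_neg, ← neg_mul, ← mul_add]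
  rfl

theorem twistedKernel_eq_dotProduct (a : ℝ) (w : Fin n → ℝ) (ζ ζ' : Fin n → ℂ) :
    twistedKernel (fun _ => a) w ζ ζ' =
    cexp (-(a : ℂ) * (((∑ j, ‖ζ j‖ ^ 2 : ℝ) : ℂ) + ((∑ j, ‖ζ' j‖ ^ 2 : ℝ) : ℂ)) +
      a * (star ζ ⬝ᵥ ζ' + conj (star ζ ⬝ᵥ ζ')) +
      (star ζ ⬝ᵥ (diagonal (fun l => (w l : ℂ)) *ᵥ ζ') -
        conj (star ζ ⬝ᵥ (diagonal (fun l => (w l : ℂ)) *ᵥ ζ'))) / 2) := by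
  rw [twistedKernel]
  congr 1
  simp only [dotProduct, map_sum, ← Finset.sum_sub_distrib, Finset.sum_div, ofReal_sum,
    ← Finset.sum_add_distrib, Finset.mul_sum, mulVec_diagonal]
  refine Finset.sum_congr rfl fun l _ => ?_
  rw [ofReal_sq_norm, ofReal_sq_norm, ofReal_sq_norm]
  simp only [Pi.star_apply, Complex.star_def, map_sub, map_mul, Complex.conj_conj,
    Complex.conj_ofReal]
  ring

/-- The unitary matrix that diagonalises the sesquilinear form in the kernel. -/
theorem exists_unitary_conj_form (lam : ℝ) (hM : M.IsSymm) (J : Finset (Fin n)) :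
    ∃ Z : Matrix (Fin n) (Fin n) ℂ, Zᴴ * Z = 1 ∧
      Zᴴ * diagonal (fun l => (w lam hM J l : ℂ)) * Z =
        ((1 + lam : ℝ) : ℂ) • Xi J - (halfRot M)ᴴ * Xi J * halfRot M := by
  set hR := rotatedXi_isHermitian lam hM J
  set Y : Matrix (Fin n) (Fin n) ℂ := hR.eigenvectorUnitary.1 with hY
  have hY1 : Yᴴ * Y = 1 := Unitary.coe_star_mul_self hR.eigenvectorUnitary
  have hY2 : Y * Yᴴ = 1 := mul_eq_one_comm.1 hY1
  have hsp : rotatedXi lam M J = Y * diagonal (fun l => (w lam hM J l : ℂ)) * Yᴴ := by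
    have := hR.spectral_theorem
    rw [Unitary.conjStarAlgAut_apply] at this
    exact this
  have hV := halfRot_conjTranspose_mul hM
  have hV' := halfRot_mul_conjTranspose hM
  have hct : ∀ A : Matrix (Fin n) (Fin n) ℂ, (Aᵀ)ᴴ = (Aᴴ)ᵀ := fun A => rfl
  have hT : ((halfRot M)ᴴ)ᵀ = (halfRot M)ᴴ := by
    rw [← hct, halfRot_transpose hM]
  have hXT : (Xi J)ᵀ = Xi J := by rw [Xi, diagonal_transpose]
  -- With `V = halfRot M` symmetric, the form on the right is `Vᴴ Rᵀ V` for `R` the matrix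
  -- `rotatedXi`. The transpose explains why `Yᵀ` enters instead of `Yᴴ`; the eigenvalues are the
  -- same.
  refine ⟨Yᵀ * halfRot M, ?_, ?_⟩
  · have h1 : (Yᵀ)ᴴ * Yᵀ = 1 := by
      rw [hct, ← transpose_mul, hY2, transpose_one]
    rw [conjTranspose_mul, mul_assoc, ← mul_assoc _ Yᵀ, h1, one_mul, hV]
  · have h2 : (rotatedXi lam M J)ᵀ =
        (Yᵀ)ᴴ * diagonal (fun l => (w lam hM J l : ℂ)) * Yᵀ := by
      rw [hsp, transpose_mul, transpose_mul, diagonal_transpose, hct,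
        mul_assoc]
    have h3 : (rotatedXi lam M J)ᵀ =
        ((1 + lam : ℝ) : ℂ) • (halfRot M * Xi J * (halfRot M)ᴴ) - Xi J := by
      rw [rotatedXi_eq lam hM, transpose_sub, transpose_smul, transpose_mul, transpose_mul, hT,
        halfRot_transpose hM, hXT, mul_assoc]
    calc _ = (halfRot M)ᴴ * ((Yᵀ)ᴴ * diagonal (fun l => (w lam hM J l : ℂ)) * Yᵀ) *
          halfRot M := by
          rw [conjTranspose_mul]
          simp only [mul_assoc]
      _ = _ := by
          rw [← h2, h3, mul_sub, sub_mul, mul_smul_comm, smul_mul_assoc]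
          congr 2
          calc _ = ((halfRot M)ᴴ * halfRot M) * Xi J * ((halfRot M)ᴴ * halfRot M) := by
                simp only [mul_assoc]
            _ = _ := by rw [hV, one_mul, mul_one]

/-- After substituting partially conjugated variables, `star_conjOn_dotProduct` separates the
exponent. The real parts add up to the damping `((1+λ) + 1)/2`, the imaginary parts to the form of
`(1+λ)Ξ_J - VᴴΞ_J V`, which `Z` diagonalises. -/
theorem kernel_eq_twistedKernel {lam : ℝ} (hM : M.IsSymm) (J : Finset (Fin n))
    {Z : Matrix (Fin n) (Fin n) ℂ} (hZ : Zᴴ * Z = 1)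
    (hZ' : Zᴴ * diagonal (fun l => (w lam hM J l : ℂ)) * Z =
        ((1 + lam : ℝ) : ℂ) • Xi J - (halfRot M)ᴴ * Xi J * halfRot M) (α β : Fin n → ℂ) :
    reproKernel lam β α * inner ℂ (coherent (conjOn J (halfRot M *ᵥ conjOn J α)))
      (coherent (conjOn J (halfRot M *ᵥ conjOn J β))) =
    twistedKernel (fun _ => (2 + lam) / 2) (w lam hM J) (Z *ᵥ conjOn J α) (Z *ᵥ conjOn J β) := by
  obtain ⟨a, rfl⟩ : ∃ a, α = conjOn J a := ⟨_, (conjOn_conjOn J α).symm⟩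
  obtain ⟨b, rfl⟩ : ∃ b, β = conjOn J b := ⟨_, (conjOn_conjOn J β).symm⟩
  have hV := halfRot_conjTranspose_mul hM
  rw [conjOn_conjOn, conjOn_conjOn, reproKernel_eq_dotProduct, inner_coherent_eq_dotProduct,
    twistedKernel_eq_dotProduct, ← Complex.exp_add, ← conj_star_dotProduct (conjOn J a),
    star_conjOn_dotProduct, star_conjOn_dotProduct, sum_sq_norm_mulVec hZ, sum_sq_norm_mulVec hZ]
  simp_rw [norm_conjOn_apply]
  rw [sum_sq_norm_mulVec hV, sum_sq_norm_mulVec hV, star_mulVec_dotProduct, star_mulVec_dotProduct,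
    star_mulVec_dotProduct, star_mulVec_dotProduct, mulVec_mulVec, mulVec_mulVec, mulVec_mulVec,
    mulVec_mulVec, mulVec_mulVec, mulVec_mulVec, hV, hZ, one_mulVec, hZ',
    sub_mulVec, smul_mulVec, dotProduct_sub, dotProduct_smul]
  congr 1
  simp only [map_sub, map_add, map_div₀, Complex.conj_conj, smul_eq_mul, map_mul,
    Complex.conj_ofReal, map_ofNat]
  push_cast
  ring

theorem norm_integral_kernel_le {lam : ℝ} (hlam : 0 < lam) (hM : M.IsSymm) (J : Finset (Fin n))
    {h : (Fin n → ℂ) → ℂ} (hi : Integrable h) (h2 : MemLp h 2) :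
    ‖∫ p : (Fin n → ℂ) × (Fin n → ℂ), conj (h p.1) * (reproKernel lam p.2 p.1 *
      inner ℂ (coherent (conjOn J (halfRot M *ᵥ conjOn J p.1)))
        (coherent (conjOn J (halfRot M *ᵥ conjOn J p.2)))) * h p.2‖ ≤
      (∏ l, (Real.pi / ((2 + lam) / 2 + |w lam hM J l| / 2))) * ∫ ζ, ‖h ζ‖ ^ 2 := by
  obtain ⟨Z, hZ, hZ'⟩ := exists_unitary_conj_form lam hM J
  set e : (Fin n → ℂ) ≃ᵐ (Fin n → ℂ) :=
    (conjOnEquiv J Z hZ).toContinuousLinearEquiv.toHomeomorph.toMeasurableEquiv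
  have hmp : MeasurePreserving e (volume : Measure (Fin n → ℂ)) volume :=
    measurePreserving_conjOnEquiv J Z hZ
  have hmp' : MeasurePreserving e.symm (volume : Measure (Fin n → ℂ)) volume := hmp.symm e
  have key := norm_twistedForm_le_prod (a := fun _ => (2 + lam) / 2) (w := w lam hM J)
    (fun _ => by positivity) (fun l => by have := abs_w_le hlam hM J l; linarith)
    ((hmp'.integrable_comp_emb e.symm.measurableEmbedding).2 hi)
    (h2.comp_measurePreserving hmp')
  have hN : ∫ ζ, ‖(h ∘ e.symm) ζ‖ ^ 2 = ∫ ζ, ‖h ζ‖ ^ 2 :=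
    hmp'.integral_comp' (fun ζ => ‖h ζ‖ ^ 2)
  rw [hN] at key
  refine le_of_eq_of_le (congrArg norm ?_) key
  have hprod : MeasurePreserving (e.prodCongr e)
      (volume : Measure ((Fin n → ℂ) × (Fin n → ℂ))) volume := hmp.prod hmp
  rw [twistedForm]
  refine Eq.trans ?_ (hprod.integral_comp' (fun q => conj ((h ∘ e.symm) q.1) *
    twistedKernel (fun _ => (2 + lam) / 2) (w lam hM J) q.1 q.2 * (h ∘ e.symm) q.2))
  refine integral_congr_ae (Filter.Eventually.of_forall fun p => ?_)
  simp only [Function.comp_apply, kernel_eq_twistedKernel hM J hZ hZ']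
  change _ = conj (h (e.symm (e p.1))) * _ * h (e.symm (e p.2))
  rw [MeasurableEquiv.symm_apply_apply, MeasurableEquiv.symm_apply_apply]
  rfl

theorem bound_eq {lam : ℝ} (hM : M.IsSymm) (J : Finset (Fin n)) :
    ((1 + lam) / Real.pi) ^ n * (∏ l, (Real.pi / ((2 + lam) / 2 + |w lam hM J l| / 2))) =
      bound lam hM J := by
  have h1 : ∀ a : ℝ, (∏ _l : Fin n, a) = a ^ n := fun a => by simp
  rw [bound, ← h1, ← h1, ← h1, ← Finset.prod_mul_distrib, ← Finset.prod_mul_distrib,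
    ← Finset.prod_div_distrib]
  refine Finset.prod_congr rfl fun l _ => ?_
  rw [div_mul_div_comm, mul_comm Real.pi, mul_div_mul_right _ _ Real.pi_ne_zero, ← add_div,
    div_div_eq_mul_div, mul_comm]

theorem integrable_density_mul_norm_sq {E : Type*} [SeminormedAddCommGroup E] {lam : ℝ}
    (hlam : 0 < lam) {f : (Fin n → ℂ) → E} (hf : Continuous f) {C : ℝ} (hC : ∀ α, ‖f α‖ ≤ C) :
    Integrable fun α => gaussianDensity lam α * ‖f α‖ ^ 2 := by
  refine (integrable_gaussianDensity hlam).mul_bdd (c := C ^ 2)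
    (Continuous.aestronglyMeasurable (by fun_prop)) (Filter.Eventually.of_forall fun α => ?_)
  rw [Real.norm_of_nonneg (by positivity)]
  exact pow_le_pow_left₀ (norm_nonneg _) (hC α) 2

/-- Tonelli: an inequality between integrals that holds for every Kraus operator may be summed over
the countable index. -/
theorem lintegral_ofReal_le_of_hasSum {X ι : Type*} [MeasurableSpace X] {μ : Measure X}
    [Countable ι] {F G : ι → X → ℝ} {f g : X → ℝ} {b : ℝ} (hb : 0 ≤ b)
    (hF : ∀ i, Integrable (F i) μ) (hG : ∀ i, Integrable (G i) μ) (hF0 : ∀ i x, 0 ≤ F i x)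
    (hG0 : ∀ i x, 0 ≤ G i x) (hf : ∀ x, HasSum (fun i => F i x) (f x))
    (hg : ∀ x, HasSum (fun i => G i x) (g x)) (hle : ∀ i, ∫ x, F i x ∂μ ≤ b * ∫ x, G i x ∂μ) :
    ∫⁻ x, ENNReal.ofReal (f x) ∂μ ≤ ENNReal.ofReal b * ∫⁻ x, ENNReal.ofReal (g x) ∂μ := by
  have hsum : ∀ {u : ι → ℝ} {s : ℝ}, (∀ i, 0 ≤ u i) → HasSum u s →
      ENNReal.ofReal s = ∑' i, ENNReal.ofReal (u i) := fun hu hs => by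
    rw [← hs.tsum_eq, ENNReal.ofReal_tsum_of_nonneg hu hs.summable]
  simp_rw [hsum (fun i => hF0 i _) (hf _), hsum (fun i => hG0 i _) (hg _)]
  rw [lintegral_tsum fun i => (hF i).1.aemeasurable.ennreal_ofReal,
    lintegral_tsum fun i => (hG i).1.aemeasurable.ennreal_ofReal, ← ENNReal.tsum_mul_left]
  refine ENNReal.tsum_le_tsum fun i => ?_
  rw [← ofReal_integral_eq_lintegral_ofReal (hF i) (Filter.Eventually.of_forall (hF0 i)),
    ← ofReal_integral_eq_lintegral_ofReal (hG i) (Filter.Eventually.of_forall (hG0 i)),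
    ← ENNReal.ofReal_mul hb]
  exact ENNReal.ofReal_le_ofReal (hle i)

theorem overlap_smul (P : LOCC n) {c : ℂ} (hc : ‖c‖ = 1) (ψ φ : Modes n) :
    overlap P ψ (c • φ) = overlap P ψ φ := by
  rw [overlap, map_smul, inner_smul_left, inner_smul_right, ← mul_assoc,
    ← Complex.normSq_eq_conj_mul_self, Complex.normSq_eq_norm_sq, hc, one_pow, ofReal_one, one_mul,
    overlap]

theorem gaussianDensity_nonneg {lam : ℝ} (hlam : 0 < lam) (α : Fin n → ℂ) :
    0 ≤ gaussianDensity lam α := by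
  rw [← amplitude_sq hlam]; positivity

theorem gaussianDensity_conjOn (lam : ℝ) (J : Finset (Fin n)) (α : Fin n → ℂ) :
    gaussianDensity lam (conjOn J α) = gaussianDensity lam α := by
  simp only [gaussianDensity, norm_conjOn_apply]

theorem lintegral_comp_conjOn (J : Finset (Fin n)) (f : (Fin n → ℂ) → ℝ≥0∞) :
    ∫⁻ α, f (conjOn J α) = ∫⁻ α, f α := by
  set e : (Fin n → ℂ) ≃ᵐ (Fin n → ℂ) :=
    (conjOnEquiv J 1 (by simp)).toContinuousLinearEquiv.toHomeomorph.toMeasurableEquiv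
  have hmp : MeasurePreserving e (volume : Measure (Fin n → ℂ)) volume :=
    measurePreserving_conjOnEquiv J 1 (by simp)
  have he : ∀ α, e α = conjOn J α := fun α => Matrix.one_mulVec _
  simp_rw [← he]
  exact hmp.lintegral_comp_emb e.measurableEmbedding f

/-- `integral_density_mul_le` is applied to each conjugated Kraus operator. Completeness is used
only on coherent states, where the squared norms of these operators sum to 1. -/
theorem lintegral_overlap_le_bound {lam : ℝ} (hlam : 0 < lam) (hM : M.IsSymm) (P : LOCC n)
    (J : Finset (Fin n)) :
    ∫⁻ α, ENNReal.ofReal (gaussianDensity lam α *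
      overlap P (coherent α) (coherent (halfRot M *ᵥ α))) ≤ ENNReal.ofReal (bound lam hM J) := by
  have hcoh := continuous_coherent (n := n)
  have hL : Continuous fun α : Fin n → ℂ => conjOn J (halfRot M *ᵥ conjOn J α) := by
    have h1 := continuous_conjOn J
    have h2 : Continuous fun z : Fin n → ℂ => halfRot M *ᵥ z := by fun_prop
    exact h1.comp (h2.comp h1)
  have hφ := hcoh.comp hL
  have hb0 : 0 ≤ bound lam hM J := by unfold bound; positivity
  obtain ⟨ι, hι, K, hK1, hK2⟩ := P.exists_kraus_conjOn J
  have hKb : ∀ i (α : Fin n → ℂ), ‖K i (coherent α)‖ ≤ ‖K i‖ := fun i α => by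
    simpa [norm_coherent] using (K i).le_opNorm (coherent α)
  have hKc : ∀ i, Continuous fun α : Fin n → ℂ => K i (coherent α) := fun i =>
    (K i).continuous.comp hcoh
  have hmain := fun i => integral_density_mul_le hlam hL
    (fun h hi h2 => norm_integral_kernel_le hlam hM J hi h2) (K i)
  simp_rw [bound_eq] at hmain
  have key := lintegral_ofReal_le_of_hasSum hb0
    (fun i => integrable_density_mul_norm_sq (C := ‖K i‖) hlam (hφ.inner (𝕜 := ℂ) (hKc i))
      fun α => (norm_inner_le_norm _ _).trans (by
        rw [Function.comp_apply, norm_coherent, one_mul]; exact hKb i α))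
    (fun i => integrable_density_mul_norm_sq hlam (hKc i) (hKb i))
    (fun i α => mul_nonneg (gaussianDensity_nonneg hlam α) (by positivity))
    (fun i α => mul_nonneg (gaussianDensity_nonneg hlam α) (by positivity))
    (fun α => by
      have := (hK2 (conjOn J α) (halfRot M *ᵥ conjOn J α)).mul_left (gaussianDensity lam α)
      rwa [conjOn_conjOn] at this)
    (fun α => by
      have := (hK1 (conjOn J α)).mul_left (gaussianDensity lam α)
      rwa [conjOn_conjOn] at this) hmain
  simp only [mul_one] at key
  rw [← ofReal_integral_eq_lintegral_ofReal (integrable_gaussianDensity hlam)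
    (Filter.Eventually.of_forall (gaussianDensity_nonneg hlam)), integral_gaussianDensity hlam,
    ENNReal.ofReal_one, mul_one] at key
  -- The ensemble is invariant under partial conjugation, so the integration variable may be
  -- conjugated to match the conjugated operators.
  rw [← lintegral_comp_conjOn J]
  simp_rw [gaussianDensity_conjOn]
  exact key

theorem simFidelity_le_bound {lam : ℝ} (hlam : 0 < lam) (hM : M.IsSymm)
    {U : Modes n ≃ₗᵢ[ℂ] Modes n} (hU : IsGaussianUnitary (Seff M) U) (J : Finset (Fin n)) :
    simFidelity lam U ≤ ENNReal.ofReal (bound lam hM J) := by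
  obtain ⟨c, hc, hUc⟩ := hU.exists_coherent hM
  refine iSup_le fun P => ?_
  simp_rw [hUc, overlap_smul P hc]
  exact lintegral_overlap_le_bound hlam hM P J

/-! ### Comparison of the bounds -/

/-- A form of the product that does not depend on the enumeration of the eigenvalues, which makes
`J` and its complement comparable. -/
theorem prod_add_abs_w_eq_det (c lam : ℝ) (hM : M.IsSymm) (J : Finset (Fin n)) :
    ((∏ l, (c + |w lam hM J l|) : ℝ) : ℂ) = (cfc (fun x : ℝ => c + |x|) (rotatedXi lam M J)).det := by
  set hR := rotatedXi_isHermitian lam hM J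
  rw [hR.cfc_eq, IsHermitian.cfc, Unitary.conjStarAlgAut_apply, det_mul_right_comm,
    Unitary.mul_star_self_of_mem hR.eigenvectorUnitary.2, one_mul, det_diagonal, ofReal_prod]
  rfl

theorem Xi_compl (J : Finset (Fin n)) : Xi Jᶜ = -Xi J := by
  rw [Xi, Xi, diagonal_neg]
  congr 1
  ext j
  by_cases h : j ∈ J <;> simp [h]

theorem rotatedXi_compl (lam : ℝ) (M : Matrix (Fin n) (Fin n) ℝ) (J : Finset (Fin n)) :
    rotatedXi lam M Jᶜ = -rotatedXi lam M J := by
  rw [rotatedXi, rotatedXi, Xi_compl, mul_neg, neg_mul, smul_neg]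
  abel

theorem bound_compl (lam : ℝ) (hM : M.IsSymm) (J : Finset (Fin n)) :
    bound lam hM Jᶜ = bound lam hM J := by
  have h : ∏ l, (2 + lam + |w lam hM Jᶜ l|) = ∏ l, (2 + lam + |w lam hM J l|) := by
    have : ((∏ l, (2 + lam + |w lam hM Jᶜ l|) : ℝ) : ℂ) =
        ((∏ l, (2 + lam + |w lam hM J l|) : ℝ) : ℂ) := by
      rw [prod_add_abs_w_eq_det, prod_add_abs_w_eq_det, rotatedXi_compl, ← cfc_comp_neg _ _
        (by fun_prop) (rotatedXi_isHermitian lam hM J).isSelfAdjoint]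
      simp only [abs_neg]
    exact_mod_cast this
  rw [bound, bound, h]

theorem bound_le_one {lam : ℝ} (hlam : 0 < lam) (hM : M.IsSymm) (J : Finset (Fin n)) :
    bound lam hM J ≤ 1 := by
  rw [bound, div_le_one (Finset.prod_pos fun l _ => by positivity), ← mul_pow]
  calc (2 * (1 + lam)) ^ n = ∏ _l : Fin n, (2 * (1 + lam)) := by simp
    _ ≤ _ := Finset.prod_le_prod (fun _ _ => by positivity) fun l _ => by
        have := le_abs_w hlam hM J l
        linarith

theorem bound_empty {lam : ℝ} (hlam : 0 < lam) (hM : M.IsSymm) : bound lam hM ∅ = 1 := by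
  have hX : Xi (∅ : Finset (Fin n)) = -1 := by
    rw [Xi, ← diagonal_one, diagonal_neg]
    simp
  have hR : rotatedXi lam M ∅ = ((-lam : ℝ) : ℂ) • 1 := by
    rw [rotatedXi_eq lam hM, hX, mul_neg, neg_mul, mul_one, halfRot_conjTranspose_mul hM, smul_neg,
      ← neg_smul, sub_neg_eq_add]
    nth_rewrite 2 [← one_smul ℂ (1 : Matrix (Fin n) (Fin n) ℂ)]
    rw [← add_smul]
    congr 1
    push_cast
    ring
  have hw : ∀ l, |w lam hM ∅ l| = lam := fun l => by
    obtain ⟨v, hv, h⟩ := abs_w_eq lam hM ∅ l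
    rw [h, hR, smul_mulVec, one_mulVec, WithLp.toLp_smul, norm_smul, hv, mul_one,
      Complex.norm_real, Real.norm_eq_abs, abs_neg, abs_of_pos hlam]
  simp only [bound, hw, Finset.prod_const, Finset.card_univ, Fintype.card_fin]
  rw [← mul_pow, ← div_pow, show 2 + lam + lam = 2 * (1 + lam) by ring,
    div_self (by positivity), one_pow]

/-- Complementary sets give equal bounds, which removes the sets with more than `n / 2` elements.
The empty set and its complement give the trivial value 1, which no bound exceeds. For `2 ≤ n` the
singletons keep the restricted family nonempty. -/
theorem iInf_bound_eq {lam : ℝ} (hlam : 0 < lam) (hM : M.IsSymm) (hn : 2 ≤ n) :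
    (⨅ J : Finset (Fin n), bound lam hM J) =
      ⨅ J : {J : Finset (Fin n) // 1 ≤ J.card ∧ J.card ≤ n / 2}, bound lam hM J.1 := by
  have hs : ∀ f : Finset (Fin n) → ℝ, BddBelow (Set.range f) := fun f =>
    (Set.finite_range f).bddBelow
  have hsub : BddBelow (Set.range fun J : {J : Finset (Fin n) // 1 ≤ J.card ∧ J.card ≤ n / 2} =>
      bound lam hM J.1) := (Set.finite_range _).bddBelow
  let j₀ : Fin n := ⟨0, by omega⟩
  have hne : Nonempty {J : Finset (Fin n) // 1 ≤ J.card ∧ J.card ≤ n / 2} :=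
    ⟨⟨{j₀}, by simp; omega⟩⟩
  refine le_antisymm (le_ciInf fun J => ciInf_le (hs _) J.1) (le_ciInf fun J => ?_)
  have htriv : ∀ {x : ℝ}, x = 1 →
      (⨅ J : {J : Finset (Fin n) // 1 ≤ J.card ∧ J.card ≤ n / 2}, bound lam hM J.1) ≤ x :=
    fun hx => (ciInf_le hsub hne.some).trans ((bound_le_one hlam hM _).trans hx.ge)
  have hcard := J.card_compl
  rw [Fintype.card_fin] at hcard
  have hJn := J.card_le_univ
  rw [Fintype.card_fin] at hJn
  by_cases h0 : J.card = 0
  · rw [Finset.card_eq_zero.1 h0]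
    exact htriv (bound_empty hlam hM)
  by_cases h1 : J.card ≤ n / 2
  · exact ciInf_le hsub ⟨J, by omega, h1⟩
  by_cases h2 : Jᶜ.card = 0
  · rw [← bound_compl, Finset.card_eq_zero.1 h2]
    exact htriv (bound_empty hlam hM)
  · rw [← bound_compl]
    exact ciInf_le hsub ⟨Jᶜ, by omega, by omega⟩

theorem simFidelity_le_iInf_bound {lam : ℝ} (hlam : 0 < lam) (hM : M.IsSymm)
    {U : Modes n ≃ₗᵢ[ℂ] Modes n} (hU : IsGaussianUnitary (Seff M) U) :
    simFidelity lam U ≤ ENNReal.ofReal (⨅ J : Finset (Fin n), bound lam hM J) := by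
  obtain ⟨J, hJ⟩ := exists_eq_ciInf_of_finite (f := fun J : Finset (Fin n) => bound lam hM J)
  rw [← hJ]
  exact simFidelity_le_bound hlam hM hU J

end Matrices

end

end GravLOCC

/-! ### Passive Gaussian unitaries and the Hessian of the Newtonian potential -/

namespace GravLOCC

noncomputable section

open Complex
open scoped ComplexConjugate

variable {n : ℕ}

/-! ### Existence of the passive Gaussian unitaries -/

section Passive

open Matrix

variable {M : Matrix (Fin n) (Fin n) ℝ}

theorem symp_ph_mulVec {V : Matrix (Fin n) (Fin n) ℂ} (hV : Vᴴ * V = 1) (z z' : Fin n → ℂ) :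
    ∑ j, ((V *ᵥ z) j * conj ((V *ᵥ z') j)).im = ∑ j, (z j * conj (z' j)).im := by
  have e : ∀ a b : Fin n → ℂ, ∑ j, (a j * conj (b j)).im = (star b ⬝ᵥ a).im := fun a b => by
    simp [dotProduct, mul_comm]
  rw [e, e, star_mulVec_dotProduct, mulVec_mulVec, hV, one_mulVec]

/-- On coherent states both sides differ at most by the Weyl phase, and that phase is invariant
because a unitary `V` preserves the imaginary part of the inner product. -/
theorem displace_map_of_coherent_map {V : Matrix (Fin n) (Fin n) ℂ} (hV : Vᴴ * V = 1)
    {U : Modes n ≃ₗᵢ[ℂ] Modes n} (hU : ∀ α, U (coherent α) = coherent (V *ᵥ α))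
    (z : Fin n → ℂ) (ψ : Modes n) :
    U (displace (ph z) ψ) = displace (ph (V *ᵥ z)) (U ψ) := by
  have h : ((dispLIE (ph z)).trans U).toContinuousLinearEquiv.toContinuousLinearMap =
      (U.trans (dispLIE (ph (V *ᵥ z)))).toContinuousLinearEquiv.toContinuousLinearMap := by
    refine total_coherent.ext_clm fun β => ?_
    change U (displace (ph z) (coherent β)) = displace (ph (V *ᵥ z)) (U (coherent β))
    rw [displace_coherent, map_smul, hU, hU, displace_coherent, symp_ph_mulVec hV, mulVec_add]
  exact congrArg (fun f : Modes n →L[ℂ] Modes n => f ψ) h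

theorem exists_unitary_coherent_map {V : Matrix (Fin n) (Fin n) ℂ} (hV : Vᴴ * V = 1) :
    ∃ U : Modes n ≃ₗᵢ[ℂ] Modes n, ∀ α, U (coherent α) = coherent (V *ᵥ α) := by
  refine exists_isometryEquiv_of_gram total_coherent (fun ψ hψ => total_coherent ψ fun α => ?_)
    fun α β => ?_
  · have := hψ (Vᴴ *ᵥ α)
    rwa [mulVec_mulVec, mul_eq_one_comm.1 hV, one_mulVec] at this
  · rw [inner_coherent_eq_dotProduct, inner_coherent_eq_dotProduct, sum_sq_norm_mulVec hV,
      sum_sq_norm_mulVec hV, star_mulVec_dotProduct, mulVec_mulVec, hV, one_mulVec]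

theorem exists_isGaussianUnitary_Seff (hM : M.IsSymm) :
    ∃ U : Modes n ≃ₗᵢ[ℂ] Modes n, IsGaussianUnitary (Seff M) U := by
  obtain ⟨U, hU⟩ := exists_unitary_coherent_map (halfRot_conjTranspose_mul hM)
  refine ⟨U, fun δ ψ => ?_⟩
  rw [← ph_phInv δ, Seff_mulVec_ph hM]
  exact displace_map_of_coherent_map (halfRot_conjTranspose_mul hM) hU _ _

/-- The rotation of the phase space of every mode by `c`, as a local unitary. -/
theorem exists_local_rotation {c : ℂ} (hc : ‖c‖ = 1) :
    ∃ W : Modes n ≃ₗᵢ[ℂ] Modes n, IsLocalUnitary W ∧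
      ∀ z ψ, W (displace (ph z) ψ) = displace (ph (c • z)) (W ψ) := by
  have hcc : conj c * c = 1 := by
    rw [← Complex.normSq_eq_conj_mul_self, Complex.normSq_eq_norm_sq, hc]; simp
  obtain ⟨u, hu⟩ : ∃ u : Mode ≃ₗᵢ[ℂ] Mode, ∀ a, u (coh a) = coh (c * a) := by
    refine exists_isometryEquiv_of_gram total_coh (fun ψ hψ => total_coh ψ fun α => ?_)
      fun α β => ?_
    · have := hψ (conj c * α)
      rwa [← mul_assoc, mul_comm c, hcc, one_mul] at this
    · rw [inner_coh, inner_coh, norm_mul, norm_mul, hc, one_mul, one_mul, map_mul,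
        mul_mul_mul_comm, hcc, one_mul]
  obtain ⟨W, hW⟩ := exists_tensor_unitary fun _ : Fin n => u
  refine ⟨W, ⟨_, hW⟩, fun z ψ => ?_⟩
  have hV : (c • (1 : Matrix (Fin n) (Fin n) ℂ))ᴴ * c • (1 : Matrix (Fin n) (Fin n) ℂ) = 1 := by
    rw [conjTranspose_smul, conjTranspose_one, smul_mul_smul_comm, mul_one, Complex.star_def, hcc,
      one_smul]
  have := displace_map_of_coherent_map hV (U := W) (fun α => by
    rw [coherent_eq_tensor, hW, coherent_eq_tensor]
    simp [hu, smul_mulVec]) z ψ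
  rwa [smul_mulVec, one_mulVec] at this

/-! ### The effective matrix is symplectic and orthogonal -/

theorem cfc_cos_sin (hM : M.IsSymm) :
    (cfc Real.cos M)ᵀ = cfc Real.cos M ∧ (cfc Real.sin M)ᵀ = cfc Real.sin M ∧
      cfc Real.cos M * cfc Real.cos M + cfc Real.sin M * cfc Real.sin M = 1 ∧
      cfc Real.cos M * cfc Real.sin M = cfc Real.sin M * cfc Real.cos M := by
  obtain ⟨O, κ, h1, h2, -, h4⟩ := exists_diagonalization hM
  have hm : ∀ f g : Fin n → ℝ, O * diagonal f * Oᵀ * (O * diagonal g * Oᵀ) =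
      O * diagonal (f * g) * Oᵀ := fun f g => by
    rw [show O * diagonal f * Oᵀ * (O * diagonal g * Oᵀ) =
      O * (diagonal f * (Oᵀ * O) * diagonal g) * Oᵀ by simp only [mul_assoc], h1, mul_one,
      diagonal_mul_diagonal']
    rfl
  have ht : ∀ f : Fin n → ℝ, (O * diagonal f * Oᵀ)ᵀ = O * diagonal f * Oᵀ := fun f => by
    rw [transpose_mul, transpose_mul, transpose_transpose, diagonal_transpose, mul_assoc]
  rw [h4, h4]
  refine ⟨ht _, ht _, ?_, ?_⟩
  · rw [hm, hm, ← add_mul, ← mul_add, diagonal_add]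
    have : (fun i => ((fun j => Real.cos (κ j)) * fun j => Real.cos (κ j)) i +
        ((fun j => Real.sin (κ j)) * fun j => Real.sin (κ j)) i) = fun _ => (1 : ℝ) := by
      ext i
      simp [← sq]
    rw [this, diagonal_one, mul_one, h2]
  · rw [hm, hm, mul_comm]

theorem Seff_mem_symplecticGroup (hM : M.IsSymm) : Seff M ∈ symplecticGroup (Fin n) ℝ := by
  obtain ⟨h1, h2, h3, h4⟩ := cfc_cos_sin (M := (1 / 2 : ℝ) • M) (by
    rw [IsSymm, transpose_smul, hM])
  rw [SymplecticGroup.mem_iff, Seff, Matrix.J, fromBlocks_transpose, transpose_neg, h1, h2,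
    fromBlocks_multiply, fromBlocks_multiply]
  refine fromBlocks_inj.2 ⟨?_, ?_, ?_, ?_⟩ <;>
    simp only [mul_zero, mul_one, zero_add, add_zero, mul_neg, neg_mul, neg_neg]
  · rw [h4, add_neg_cancel]
  · rw [← h3]; abel
  · rw [← h3]
  · rw [h4, neg_add_cancel]

theorem Seff_mem_orthogonalGroup (hM : M.IsSymm) :
    Seff M ∈ orthogonalGroup (Fin n ⊕ Fin n) ℝ := by
  obtain ⟨h1, h2, h3, h4⟩ := cfc_cos_sin (M := (1 / 2 : ℝ) • M) (by
    rw [IsSymm, transpose_smul, hM])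
  rw [mem_orthogonalGroup_iff, Seff, fromBlocks_transpose, transpose_neg, h1, h2,
    fromBlocks_multiply, ← fromBlocks_one]
  refine fromBlocks_inj.2 ⟨h3, ?_, ?_, ?_⟩ <;> simp only [mul_neg, neg_mul, neg_neg]
  · rw [h4, neg_add_cancel]
  · rw [h4, neg_add_cancel]
  · rw [← h3, add_comm]

end Passive

/-! ### The Newtonian potential -/

section Potential

variable {E : Type*} [NormedAddCommGroup E] [InnerProductSpace ℝ E]

theorem hasFDerivAt_inv_norm {y : E} (hy : y ≠ 0) :
    HasFDerivAt (fun y : E => ‖y‖⁻¹) (-(‖y‖⁻¹ ^ 3) • innerSL ℝ y) y := by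
  have hn : ‖y‖ ≠ 0 := norm_ne_zero_iff.2 hy
  have h1 : HasFDerivAt (fun y : E => ‖y‖) (‖y‖⁻¹ • innerSL ℝ y) y := by
    have h2 := ((hasStrictFDerivAt_norm_sq y).hasFDerivAt).sqrt (by positivity)
    have h3 : (fun y : E => √(‖y‖ ^ 2)) = fun y => ‖y‖ := by
      ext z; exact Real.sqrt_sq (norm_nonneg _)
    rw [h3, Real.sqrt_sq (norm_nonneg _)] at h2
    convert h2 using 1
    ext v
    simp
    ring
  have h2 := (hasDerivAt_inv hn).comp_hasFDerivAt y h1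
  refine HasFDerivAt.congr_fderiv (f := fun y : E => ‖y‖⁻¹) h2 ?_
  ext v
  simp only [smul_apply, smul_eq_mul]
  ring

variable {m : ℕ} (c : ℝ) (a : E) (L : (Fin m → ℝ) →L[ℝ] E)

theorem hasFDerivAt_pair {x : Fin m → ℝ} (hx : a + L x ≠ 0) :
    HasFDerivAt (fun x => c * ‖a + L x‖⁻¹)
      (c • (-(‖a + L x‖⁻¹ ^ 3) • innerSL ℝ (a + L x)) ∘L L) x := by
  have h1 : HasFDerivAt (fun x => a + L x) L x := L.hasFDerivAt.const_add a
  exact ((hasFDerivAt_inv_norm hx).comp x h1).const_mul c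

theorem hasFDerivAt_pair_deriv (ha : a ≠ 0) (u : E) :
    HasFDerivAt (fun x => c * (-(‖a + L x‖⁻¹ ^ 3) * inner ℝ (a + L x) u))
      (c • ((-(‖a‖⁻¹ ^ 3)) • (innerSL ℝ u ∘L L) +
        (3 * ‖a‖⁻¹ ^ 5 * inner ℝ a u) • (innerSL ℝ a ∘L L))) 0 := by
  have h0 : a + L 0 ≠ 0 := by simpa using ha
  have h1 : HasFDerivAt (fun x => a + L x) L 0 := L.hasFDerivAt.const_add a
  have h2 := ((hasFDerivAt_inv_norm h0).comp 0 h1)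
  have h3 : HasFDerivAt (fun x => inner ℝ (a + L x) u) (innerSL ℝ u ∘L L) 0 := by
    have := (innerSL ℝ u).hasFDerivAt.comp (0 : Fin m → ℝ) h1
    refine this.congr_of_eventuallyEq (Filter.Eventually.of_forall fun x => ?_)
    simp [real_inner_comm]
  have h4 := (((h2.pow 3).neg).mul h3).const_mul c
  refine HasFDerivAt.congr_fderiv (f := fun x => c * (-(‖a + L x‖⁻¹ ^ 3) * inner ℝ (a + L x) u))
    h4 ?_
  ext v
  simp only [smul_apply, add_apply, neg_apply, ContinuousLinearMap.comp_apply, innerSL_apply_apply,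
    smul_eq_mul, Function.comp_apply, map_zero, add_zero, nsmul_eq_mul, Pi.neg_apply]
  push_cast
  ring

end Potential

namespace Oscillators

variable (A : Oscillators n)

/-- The relative displacement of the `j`-th and the `k`-th oscillator. -/
def relDisp (j k : Fin n) : (Fin n → ℝ) →L[ℝ] EuclideanSpace ℝ (Fin 3) :=
  (ContinuousLinearMap.proj (R := ℝ) (φ := fun _ : Fin n => ℝ) k).smulRight (A.dir k) -
    (ContinuousLinearMap.proj (R := ℝ) (φ := fun _ : Fin n => ℝ) j).smulRight (A.dir j)

theorem potential_eq : A.potential = fun x => ∑ j, ∑ k ∈ Finset.Ioi j,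
    (-(A.G * A.mass j * A.mass k)) * ‖A.sep j k + A.relDisp j k x‖⁻¹ := by
  ext x
  rw [potential, ← Finset.sum_neg_distrib]
  refine Finset.sum_congr rfl fun j _ => ?_
  rw [← Finset.sum_neg_distrib]
  refine Finset.sum_congr rfl fun k _ => ?_
  have : A.sep j k - x j • A.dir j + x k • A.dir k = A.sep j k + A.relDisp j k x := by
    simp only [relDisp, sub_apply, ContinuousLinearMap.smulRight_apply,
      ContinuousLinearMap.proj_apply]
    abel
  rw [this, div_eq_mul_inv, neg_mul]

theorem sep_ne_zero {j k : Fin n} (h : j ≠ k) : A.sep j k ≠ 0 :=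
  sub_ne_zero.2 fun e => h (A.center_injective e).symm

theorem contDiffAt_potential : ContDiffAt ℝ ((⊤ : ℕ∞) : WithTop ℕ∞) A.potential 0 := by
  rw [potential_eq]
  refine ContDiffAt.sum fun j _ => ContDiffAt.sum fun k hk => ?_
  have h0 : A.sep j k + A.relDisp j k 0 ≠ 0 := by
    rw [map_zero, add_zero]
    exact A.sep_ne_zero (Finset.mem_Ioi.1 hk).ne
  refine contDiffAt_const.mul (ContDiffAt.inv (ContDiffAt.norm ℝ ?_ h0) (norm_ne_zero_iff.2 h0))
  exact contDiffAt_const.add (A.relDisp j k).contDiff.contDiffAt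

/-- The contribution of the pair `(j, k)` to the second derivatives of the potential. -/
def pairHessian (j k : Fin n) (u v : EuclideanSpace ℝ (Fin 3)) : ℝ :=
  A.G * A.mass j * A.mass k * ((A.distance j k)⁻¹ ^ 3 * inner ℝ u v -
    3 * (A.distance j k)⁻¹ ^ 5 * inner ℝ (A.sep j k) u * inner ℝ (A.sep j k) v)

theorem partialDeriv_partialDeriv_potential (p q : Fin n) :
    partialDeriv p (partialDeriv q A.potential) 0 = ∑ j, ∑ k ∈ Finset.Ioi j,
      A.pairHessian j k (A.relDisp j k (Pi.single q 1)) (A.relDisp j k (Pi.single p 1)) := by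
  -- The first derivative is needed on a neighbourhood, not only at the origin, in order to be
  -- differentiated again.
  have hev : ∀ᶠ x : Fin n → ℝ in nhds 0, ∀ j, ∀ k ∈ Finset.Ioi j,
      A.sep j k + A.relDisp j k x ≠ 0 := by
    rw [Filter.eventually_all]
    intro j
    rw [Filter.eventually_all_finset]
    intro k hk
    have hc : Continuous fun x => A.sep j k + A.relDisp j k x := by fun_prop
    refine hc.continuousAt.eventually_ne ?_
    rw [map_zero, add_zero]
    exact A.sep_ne_zero (Finset.mem_Ioi.1 hk).ne
  have h1 : partialDeriv q A.potential =ᶠ[nhds 0] fun x => ∑ j, ∑ k ∈ Finset.Ioi j,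
      (-(A.G * A.mass j * A.mass k)) * (-(‖A.sep j k + A.relDisp j k x‖⁻¹ ^ 3) *
        inner ℝ (A.sep j k + A.relDisp j k x) (A.relDisp j k (Pi.single q 1))) := by
    filter_upwards [hev] with x hx
    have := HasFDerivAt.fun_sum (u := Finset.univ) fun j _ => HasFDerivAt.fun_sum (u := Finset.Ioi j)
      fun k hk => hasFDerivAt_pair (-(A.G * A.mass j * A.mass k)) (A.sep j k) (A.relDisp j k)
        (hx j k hk)
    rw [partialDeriv, potential_eq, this.fderiv]
    simp only [sum_apply, smul_apply, ContinuousLinearMap.comp_apply, innerSL_apply_apply,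
      smul_eq_mul]
  have h2 := HasFDerivAt.fun_sum (u := Finset.univ) fun j _ =>
    HasFDerivAt.fun_sum (u := Finset.Ioi j) fun k hk =>
      hasFDerivAt_pair_deriv (-(A.G * A.mass j * A.mass k)) (A.sep j k) (A.relDisp j k)
        (A.sep_ne_zero (Finset.mem_Ioi.1 hk).ne) (A.relDisp j k (Pi.single q 1))
  rw [partialDeriv, h1.fderiv_eq, h2.fderiv]
  simp only [sum_apply, smul_apply, add_apply, ContinuousLinearMap.comp_apply,
    innerSL_apply_apply, smul_eq_mul, pairHessian, distance]
  refine Finset.sum_congr rfl fun j _ => Finset.sum_congr rfl fun k _ => ?_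
  ring

theorem distance_comm (j k : Fin n) : A.distance j k = A.distance k j := norm_sub_rev _ _

theorem sep_comm (j k : Fin n) : A.sep j k = -A.sep k j := (neg_sub _ _).symm

theorem pairHessian_comm (j k : Fin n) (u v : EuclideanSpace ℝ (Fin 3)) :
    A.pairHessian j k u v = A.pairHessian k j u v := by
  rw [pairHessian, pairHessian, A.distance_comm j k, A.sep_comm j k, inner_neg_left, inner_neg_left]
  ring

/-- Passing to ordered pairs avoids the case distinction whether `p < q` or `q < p` in the Hessian.
-/
theorem two_mul_sum_Ioi {F : Fin n → Fin n → ℝ} (hF : ∀ j k, F j k = F k j) :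
    2 * ∑ j, ∑ k ∈ Finset.Ioi j, F j k = ∑ j, ∑ k, if j = k then 0 else F j k := by
  have h1 : ∑ j, ∑ k ∈ Finset.Ioi j, F j k = ∑ j, ∑ k, if j < k then F j k else 0 := by
    refine Finset.sum_congr rfl fun j _ => ?_
    rw [← Finset.sum_filter]
    refine Finset.sum_congr ?_ fun _ _ => rfl
    ext k; simp
  have h2 : ∑ j, ∑ k ∈ Finset.Ioi j, F j k = ∑ j, ∑ k, if k < j then F j k else 0 := by
    rw [h1, Finset.sum_comm]
    refine Finset.sum_congr rfl fun j _ => Finset.sum_congr rfl fun k _ => ?_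
    rw [hF]
  rw [two_mul]
  nth_rewrite 1 [h1]
  rw [h2, ← Finset.sum_add_distrib]
  refine Finset.sum_congr rfl fun j _ => ?_
  rw [← Finset.sum_add_distrib]
  refine Finset.sum_congr rfl fun k _ => ?_
  rcases lt_trichotomy j k with h | h | h
  · simp [h, h.ne, h.not_gt]
  · simp [h]
  · simp [h, h.ne', h.not_gt]

theorem pairHessian_relDisp (j k p q : Fin n) :
    A.pairHessian j k (A.relDisp j k (Pi.single q 1)) (A.relDisp j k (Pi.single p 1)) =
      (if k = q then if k = p then A.pairHessian j k (A.dir k) (A.dir k) else 0 else 0) -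
      (if k = q then if j = p then A.pairHessian j k (A.dir k) (A.dir j) else 0 else 0) -
      (if j = q then if k = p then A.pairHessian j k (A.dir j) (A.dir k) else 0 else 0) +
      (if j = q then if j = p then A.pairHessian j k (A.dir j) (A.dir j) else 0 else 0) := by
  have hrel : ∀ p : Fin n, A.relDisp j k (Pi.single p 1) =
      (if k = p then (1 : ℝ) else 0) • A.dir k - (if j = p then (1 : ℝ) else 0) • A.dir j := by
    intro p
    simp [relDisp, Pi.single_apply]
  rw [hrel, hrel]
  simp only [pairHessian, inner_sub_left, inner_sub_right, inner_smul_left, inner_smul_right]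
  split_ifs <;> simp <;> ring

/-- A diagonal entry collects all pairs containing `p`; an off-diagonal entry sees only the pair
`{p, q}`. Its sign is reversed because the two displacements enter the relative one with opposite
signs; the second cosine is measured from the other end, which turns `-3` into `+3` inside the
bracket. -/
theorem hessian_potential (p q : Fin n) : partialDeriv p (partialDeriv q A.potential) 0 =
    A.ω * √(A.mass p * A.mass q) * A.coupling p q := by
  have hω := A.ω_pos
  rw [partialDeriv_partialDeriv_potential]
  have h := two_mul_sum_Ioi (F := fun j k => A.pairHessian j k (A.relDisp j k (Pi.single q 1))
      (A.relDisp j k (Pi.single p 1))) fun j k => by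
    rw [A.pairHessian_relDisp j k, A.pairHessian_relDisp k j, A.pairHessian_comm k j,
      A.pairHessian_comm k j, A.pairHessian_comm k j, A.pairHessian_comm k j]
    ring
  refine mul_left_cancel₀ (two_ne_zero' ℝ) (h.trans ?_)
  simp_rw [A.pairHessian_relDisp]
  by_cases hpq : p = q
  · subst hpq
    have e : ∀ j k : Fin n, (if j = k then (0 : ℝ) else
        (if k = p then if k = p then A.pairHessian j k (A.dir k) (A.dir k) else 0 else 0) -
        (if k = p then if j = p then A.pairHessian j k (A.dir k) (A.dir j) else 0 else 0) -
        (if j = p then if k = p then A.pairHessian j k (A.dir j) (A.dir k) else 0 else 0) +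
        (if j = p then if j = p then A.pairHessian j k (A.dir j) (A.dir j) else 0 else 0)) =
        (if k = p then if j = p then 0 else A.pairHessian p j (A.dir p) (A.dir p) else 0) +
        (if j = p then if k = p then 0 else A.pairHessian p k (A.dir p) (A.dir p) else 0) := by
      intro j k
      by_cases hj : j = p <;> by_cases hk : k = p
      · simp [hj, hk]
      · subst hj; simp [hk, Ne.symm hk]
      · subst hk; simp [hj, A.pairHessian_comm j k]
      · simp [hj, hk]
    simp_rw [e, Finset.sum_add_distrib]
    rw [Finset.sum_comm (f := fun j k => if j = p then _ else _)]
    simp only [Finset.sum_ite_eq', Finset.mem_univ, if_true]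
    rw [← two_mul]
    congr 1
    have h2 : √(A.mass p * A.mass p) = A.mass p := Real.sqrt_mul_self (A.mass_pos p).le
    rw [coupling, if_pos rfl, h2, Finset.mul_sum, ← Finset.add_sum_erase _ _ (Finset.mem_univ p),
      if_pos rfl, zero_add]
    refine Finset.sum_congr rfl fun k hk => ?_
    have hkp := Finset.ne_of_mem_erase hk
    have hd : A.distance p k ≠ 0 := norm_ne_zero_iff.2 (A.sep_ne_zero hkp.symm)
    rw [if_neg hkp, pairHessian, cosθ, inner_smul_right, real_inner_self_eq_norm_sq, A.norm_dir,
      real_inner_comm (A.dir p)]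
    field_simp
  · have hd : A.distance p q ≠ 0 := norm_ne_zero_iff.2 (A.sep_ne_zero hpq)
    have e : ∀ j k : Fin n, (if j = k then (0 : ℝ) else
        (if k = q then if k = p then A.pairHessian j k (A.dir k) (A.dir k) else 0 else 0) -
        (if k = q then if j = p then A.pairHessian j k (A.dir k) (A.dir j) else 0 else 0) -
        (if j = q then if k = p then A.pairHessian j k (A.dir j) (A.dir k) else 0 else 0) +
        (if j = q then if j = p then A.pairHessian j k (A.dir j) (A.dir j) else 0 else 0)) =
        (if k = q then if j = p then -A.pairHessian p q (A.dir q) (A.dir p) else 0 else 0) +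
        (if k = p then if j = q then -A.pairHessian p q (A.dir q) (A.dir p) else 0 else 0) := by
      intro j k
      by_cases hjk : j = k
      · subst hjk
        by_cases hj : j = q
        · simp [hj, Ne.symm hpq]
        · simp [hj]
      · by_cases hj : j = q <;> by_cases hk : k = q
        · exact absurd (hj.trans hk.symm) hjk
        · subst hj
          by_cases hkp : k = p
          · subst hkp; simp [Ne.symm hpq, hpq, A.pairHessian_comm j k]
          · simp [hkp, hk, Ne.symm hk, Ne.symm hpq]
        · subst hk
          by_cases hjp : j = p
          · subst hjp; simp [Ne.symm hpq, hpq]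
          · simp [hjp, hj, Ne.symm hpq]
        · simp [hj, hk]
    simp_rw [e, Finset.sum_add_distrib]
    simp only [Finset.sum_ite_eq', Finset.mem_univ, if_true]
    rw [← two_mul]
    congr 1
    have hm : √(A.mass p * A.mass q) * √(A.mass p * A.mass q) = A.mass p * A.mass q :=
      Real.mul_self_sqrt (mul_pos (A.mass_pos p) (A.mass_pos q)).le
    rw [coupling, if_neg hpq, pairHessian, cosθ, cosθ, cosφ, inner_smul_right, inner_smul_right,
      A.distance_comm q p, A.sep_comm q p, inner_neg_right, real_inner_comm (A.dir p) (A.sep p q),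
      real_inner_comm (A.dir q) (A.sep p q), real_inner_comm (A.dir p) (A.dir q)]
    field_simp
    linear_combination (A.G * A.distance p q ^ 2 * inner ℝ (A.dir p) (A.dir q) -
      3 * A.G * inner ℝ (A.dir q) (A.sep p q) * inner ℝ (A.dir p) (A.sep p q)) * hm

end Oscillators

end

end GravLOCC

/-! ### Unitary groups generated by a total set of solutions -/

namespace GravLOCC

noncomputable section

open Complex
open scoped ComplexConjugate

variable {n : ℕ}

/-! ### Unitary groups from sufficiently many classical solutions -/

section UnitaryGroup

open Filter Topology

variable {H : Type*} [NormedAddCommGroup H] [InnerProductSpace ℂ H]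
  {D : Type*} {j : D → H} {h : D → D}

/-- `u` is a solution of `u' = h u` with values in the domain `D` (embedded in `H` by `j`). -/
def IsSolution (j : D → H) (h : D → D) (u : ℝ → D) : Prop :=
  ∀ t, HasDerivAt (fun s => j (u s)) (j (h (u t))) t

/-- `V` is a strongly continuous one-parameter unitary group whose generator extends `h`. -/
structure IsGroupOf (j : D → H) (h : D → D) (V : ℝ → (H ≃ₗᵢ[ℂ] H)) : Prop where
  map_add : ∀ (s t : ℝ) (ψ : H), V (s + t) ψ = V s (V t ψ)
  continuous : ∀ ψ : H, Continuous fun t => V t ψ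
  generator : ∀ φ : D, HasDerivAt (fun t => V t (j φ)) (j (h φ)) 0

theorem IsSolution.translate {u : ℝ → D} (hu : IsSolution j h u) (t : ℝ) :
    IsSolution j h fun s => u (s + t) := fun s => (hu (s + t)).comp_add_const s t

theorem IsSolution.inner_eq {u v : ℝ → D} (hu : IsSolution j h u) (hv : IsSolution j h v)
    (hskew : ∀ φ ψ, inner ℂ (j (h φ)) (j ψ) = -inner ℂ (j φ) (j (h ψ))) (t : ℝ) :
    (inner ℂ (j (u 0)) (j (v 0)) : ℂ) = inner ℂ (j (u t)) (j (v t)) := by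
  have hd : ∀ s, HasDerivAt (fun s => (inner ℂ (j (u s)) (j (v s)) : ℂ)) 0 s := fun s => by
    have := (hu s).inner ℂ (hv s)
    rwa [hskew, add_neg_cancel] at this
  exact is_const_of_deriv_eq_zero (fun s => (hd s).differentiableAt) (fun s => (hd s).deriv) 0 t

/-- A product rule that needs no derivative of `W` in operator norm: isometries do not enlarge the
remainder of `u`, and strong continuity at the single vector `u'` suffices. -/
theorem hasDerivAt_apply_of_isometry {W : ℝ → (H ≃ₗᵢ[ℂ] H)} {u : ℝ → H} {t : ℝ} {u' w : H}
    (hu : HasDerivAt u u' t) (hW : HasDerivAt (fun s => W s (u t)) w t)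
    (hc : ContinuousAt (fun s => W s u') t) :
    HasDerivAt (fun s => W s (u s)) (w + W t u') t := by
  have h1 : HasDerivAt (fun s => W s (u s - u t)) (W t u') t := by
    rw [hasDerivAt_iff_isLittleO]
    rw [hasDerivAt_iff_isLittleO] at hu
    have h2 : (fun s => W s (u s - u t - (s - t) • u')) =o[𝓝 t] fun s => s - t :=
      hu.norm_left.congr_left (fun s => ((W s).norm_map _).symm) |>.of_norm_left
    have h3 : (fun s => (s - t) • (W s u' - W t u')) =o[𝓝 t] fun s => s - t := by
      have h4 : (fun s => W s u' - W t u') =o[𝓝 t] fun _ => (1 : ℝ) := by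
        rw [Asymptotics.isLittleO_one_iff]
        have := hc.tendsto.sub_const (W t u')
        rwa [sub_self] at this
      simpa using (Asymptotics.isBigO_refl (fun s : ℝ => s - t) (𝓝 t)).smul_isLittleO h4
    refine (h2.add h3).congr_left fun s => ?_
    have e : W s ((s - t) • u') = (s - t) • W s u' :=
      (W s).toLinearEquiv.toLinearMap.map_smul_of_tower (s - t) u'
    simp only [map_sub, e, sub_self, map_zero, sub_zero, smul_sub]
    abel
  refine (hW.add h1).congr_of_eventuallyEq (Eventually.of_forall fun s => ?_)
  simp

theorem IsGroupOf.map_zero {V : ℝ → (H ≃ₗᵢ[ℂ] H)} (hV : IsGroupOf j h V) (ψ : H) :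
    V 0 ψ = ψ := by
  have := hV.map_add 0 0 ψ
  rw [add_zero] at this
  exact ((V 0).injective this).symm

/-- The curve `s ↦ V (-s) (j (u s))` has derivative zero. This is where uniqueness of the group
comes from. -/
theorem IsGroupOf.apply_solution {V : ℝ → (H ≃ₗᵢ[ℂ] H)} (hV : IsGroupOf j h V) {u : ℝ → D}
    (hu : IsSolution j h u) (t : ℝ) : V t (j (u 0)) = j (u t) := by
  have hd : ∀ t, HasDerivAt (fun s => V (-s) (j (u s))) 0 t := by
    intro t
    have h1 : HasDerivAt (fun s => V (-s) (j (u t))) (V (-t) (-j (h (u t)))) t := by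
      have h2 : HasDerivAt (fun s => V s (j (u t))) (j (h (u t))) (t - t) := by
        rw [sub_self]; exact hV.generator (u t)
      have h3 := (((V (-t)).toContinuousLinearEquiv : H →L[ℂ] H).restrictScalars
        ℝ).hasFDerivAt.comp_hasDerivAt t (h2.comp_const_sub t t)
      refine (h3.congr_of_eventuallyEq (Eventually.of_forall fun s => ?_))
      change V (-s) (j (u t)) = V (-t) (V (t - s) (j (u t)))
      rw [← hV.map_add]
      congr 2
      ring
    have h2 := hasDerivAt_apply_of_isometry (W := fun s => V (-s)) (hu t) h1
      ((hV.continuous _).comp continuous_neg).continuousAt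
    simpa using h2
  have h1 := is_const_of_deriv_eq_zero (fun s => (hd s).differentiableAt)
    (fun s => (hd s).deriv) 0 t
  simp only [neg_zero, hV.map_zero] at h1
  rw [h1, ← hV.map_add, add_neg_cancel, hV.map_zero]

/-- Skew symmetry makes inner products of solutions constant, so sending initial values to values at
time `t` preserves Gram matrices and extends to a unitary. Translating solutions in time gives the
group law and the totality of the values at time `t`. -/
theorem existsUnique_isGroupOf [CompleteSpace H]
    (hskew : ∀ φ ψ : D, (inner ℂ (j (h φ)) (j ψ) : ℂ) = -inner ℂ (j φ) (j (h ψ)))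
    (htot : Total fun u : {u : ℝ → D // IsSolution j h u} => j (u.1 0)) :
    ∃! V : ℝ → (H ≃ₗᵢ[ℂ] H), IsGroupOf j h V := by
  have hex : ∀ t : ℝ, ∃ U : H ≃ₗᵢ[ℂ] H, ∀ u : {u : ℝ → D // IsSolution j h u},
      U (j (u.1 0)) = j (u.1 t) := by
    intro t
    refine exists_isometryEquiv_of_gram htot (fun ψ hψ => htot ψ fun u => ?_)
      fun u v => u.2.inner_eq v.2 hskew t
    have := hψ ⟨_, u.2.translate (-t)⟩
    simpa using this
  choose V hV using hex
  have hVs : ∀ t s (u : {u : ℝ → D // IsSolution j h u}), V t (j (u.1 s)) = j (u.1 (t + s)) := by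
    intro t s u
    have := hV t ⟨_, u.2.translate s⟩
    simpa using this
  have hc : ∀ ψ : H, Continuous fun t => V t ψ := by
    let p : Submodule ℂ H :=
      { carrier := {ψ | Continuous fun t => V t ψ}
        add_mem' := fun {a b} ha hb => by
          simp only [Set.mem_ofPred_eq, _root_.map_add] at *
          exact ha.add hb
        zero_mem' := by simp only [Set.mem_ofPred_eq, _root_.map_zero]; exact continuous_const
        smul_mem' := fun c a ha => by
          simp only [Set.mem_ofPred_eq, map_smul] at *
          exact ha.const_smul c }
    have hp : IsClosed (p : Set H) := by
      refine isClosed_of_closure_subset fun ψ hψ => ?_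
      refine continuous_of_uniform_approx_of_continuous fun U hU => ?_
      obtain ⟨ε, hε, hεU⟩ := Metric.mem_uniformity_dist.1 hU
      obtain ⟨φ, hφ, hd⟩ := Metric.mem_closure_iff.1 hψ ε hε
      exact ⟨_, hφ, fun t => hεU (by rwa [(V t).dist_map])⟩
    exact fun ψ => htot.induction p hp (fun u => by
      change Continuous fun t => V t (j (u.1 0))
      simp_rw [hV]
      exact continuous_iff_continuousAt.2 fun t => (u.2 t).continuousAt) ψ
  have hg : IsGroupOf j h V := by
    refine ⟨fun s t ψ => ?_, hc, fun φ => ?_⟩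
    · have : ((V (s + t)).toContinuousLinearEquiv : H →L[ℂ] H) =
          ((V s).toContinuousLinearEquiv : H →L[ℂ] H) ∘L
            ((V t).toContinuousLinearEquiv : H →L[ℂ] H) := by
        refine htot.ext_clm fun u => ?_
        change V (s + t) (j (u.1 0)) = V s (V t (j (u.1 0)))
        rw [hV, hV, hVs]
      exact congrArg (fun f : H →L[ℂ] H => f ψ) this
    -- An arbitrary `φ` need not be the initial value of a known solution. Paired with a known
    -- solution the integrated equation follows from skew symmetry, and totality removes the
    -- pairing; differentiating at zero then gives the generator.
    · have key : ∀ t, V t (j φ) = j φ + ∫ s in (0 : ℝ)..t, V s (j (h φ)) := by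
        intro t
        rw [← sub_eq_zero]
        refine htot _ fun u => ?_
        rw [inner_sub_right, sub_eq_zero]
        have hd1 : ∀ t, HasDerivAt (fun t => (inner ℂ (j (u.1 0)) (V t (j φ)) : ℂ))
            (inner ℂ (j (u.1 0)) (V t (j (h φ)))) t := by
          intro t
          have e : ∀ t ψ, (inner ℂ (j (u.1 0)) (V t ψ) : ℂ) = inner ℂ (j (u.1 (-t))) ψ := by
            intro t ψ
            rw [← (V t).inner_map_map (j (u.1 (-t))), hVs, add_neg_cancel]
          have h1 : HasDerivAt (fun s => j (u.1 (-s))) (-j (h (u.1 (-t)))) t := by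
            have := HasDerivAt.scomp t (u.2 (-t)) (hasDerivAt_neg t)
            rwa [neg_one_smul] at this
          have h2 := h1.inner ℂ (hasDerivAt_const t (j φ))
          rw [inner_zero_right, zero_add, inner_neg_left, hskew, neg_neg] at h2
          simp_rw [e]
          exact h2
        have hd2 : ∀ t, HasDerivAt (fun t => (inner ℂ (j (u.1 0))
            (j φ + ∫ s in (0 : ℝ)..t, V s (j (h φ))) : ℂ))
            (inner ℂ (j (u.1 0)) (V t (j (h φ)))) t := by
          intro t
          have h1 := ((hc (j (h φ))).integral_hasStrictDerivAt 0 t).hasDerivAt.const_add (j φ)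
          have h2 := (hasDerivAt_const t (j (u.1 0))).inner ℂ h1
          rwa [inner_zero_left, add_zero] at h2
        have hz : ∀ t, HasDerivAt (fun t => (inner ℂ (j (u.1 0)) (V t (j φ)) : ℂ) -
            inner ℂ (j (u.1 0)) (j φ + ∫ s in (0 : ℝ)..t, V s (j (h φ)))) 0 t := fun t => by
          have := (hd1 t).sub (hd2 t)
          rwa [sub_self] at this
        have h0 : ∀ ψ, (inner ℂ (j (u.1 0)) (V 0 ψ) : ℂ) = inner ℂ (j (u.1 0)) ψ := fun ψ => by
          nth_rewrite 1 [← hV 0 u]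
          exact (V 0).inner_map_map _ _
        have := is_const_of_deriv_eq_zero (fun s => (hz s).differentiableAt)
          (fun s => (hz s).deriv) t 0
        simp only [intervalIntegral.integral_same, add_zero, h0, sub_self] at this
        exact sub_eq_zero.1 this
      simp_rw [key]
      have h0 : V 0 (j (h φ)) = j (h φ) := by
        have : ((V 0).toContinuousLinearEquiv : H →L[ℂ] H) = ContinuousLinearMap.id ℂ H :=
          htot.ext_clm fun u => hV 0 u
        exact congrArg (fun f : H →L[ℂ] H => f (j (h φ))) this
      have h1 := ((hc (j (h φ))).integral_hasStrictDerivAt 0 0).hasDerivAt.const_add (j φ)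
      rwa [h0] at h1
  refine ⟨V, hg, fun V' hV' => funext fun t => ?_⟩
  have : ((V' t).toContinuousLinearEquiv : H →L[ℂ] H) =
      ((V t).toContinuousLinearEquiv : H →L[ℂ] H) := by
    refine htot.ext_clm fun u => ?_
    change V' t (j (u.1 0)) = V t (j (u.1 0))
    rw [hV, hV'.apply_solution u.2]
  refine LinearIsometryEquiv.ext fun ψ => ?_
  exact congrArg (fun f : H →L[ℂ] H => f ψ) this

end UnitaryGroup

end

end GravLOCC

/-! ### The Hamiltonian on Schwartz functions -/

namespace GravLOCC

noncomputable section

open Complex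
open scoped ComplexConjugate

variable {n : ℕ}

/-! ### Symmetry of the Hamiltonian -/

/-- The sesquilinear form `∫ conj φ ψ` on Schwartz functions. -/
def form (φ ψ : 𝓢(Fin n → ℝ, ℂ)) : ℂ := ∫ x, conj (φ x) * ψ x

theorem inner_toLp_eq_form (φ ψ : 𝓢(Fin n → ℝ, ℂ)) :
    inner ℂ (φ.toLp 2 volume) (ψ.toLp 2 volume) = form φ ψ := by
  rw [form]
  refine (SchwartzMap.inner_toL2_toL2_eq φ ψ volume).trans ?_
  refine integral_congr_ae (Filter.Eventually.of_forall fun x => ?_)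
  exact mul_comm _ _

theorem integrable_form (φ ψ : 𝓢(Fin n → ℝ, ℂ)) : Integrable fun x => conj (φ x) * ψ x := by
  have h1 : MemLp (fun x => conj (φ x)) 2 (volume : Measure (Fin n → ℝ)) :=
    (φ.memLp 2 volume).star
  exact h1.integrable_mul (ψ.memLp 2 volume)

/-- Formally self-adjoint operators on Schwartz functions. -/
def IsSymmOp (T : 𝓢(Fin n → ℝ, ℂ) → 𝓢(Fin n → ℝ, ℂ)) : Prop :=
  ∀ φ ψ, form (T φ) ψ = form φ (T ψ)

theorem form_add_left (φ φ' ψ : 𝓢(Fin n → ℝ, ℂ)) : form (φ + φ') ψ = form φ ψ + form φ' ψ := by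
  simp only [form, add_apply, map_add, add_mul]
  exact integral_add (integrable_form _ _) (integrable_form _ _)

theorem form_add_right (φ ψ ψ' : 𝓢(Fin n → ℝ, ℂ)) : form φ (ψ + ψ') = form φ ψ + form φ ψ' := by
  simp only [form, add_apply, mul_add]
  exact integral_add (integrable_form _ _) (integrable_form _ _)

theorem form_smul_left (c : ℂ) (φ ψ : 𝓢(Fin n → ℝ, ℂ)) : form (c • φ) ψ = conj c * form φ ψ := by
  simp only [form, smul_apply, smul_eq_mul, map_mul, mul_assoc]
  exact integral_const_mul _ _

theorem form_smul_right (c : ℂ) (φ ψ : 𝓢(Fin n → ℝ, ℂ)) : form φ (c • ψ) = c * form φ ψ := by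
  simp only [form, smul_apply, smul_eq_mul, mul_left_comm _ c]
  exact integral_const_mul _ _

theorem IsSymmOp.add {S T : 𝓢(Fin n → ℝ, ℂ) → 𝓢(Fin n → ℝ, ℂ)} (hS : IsSymmOp S)
    (hT : IsSymmOp T) : IsSymmOp fun ψ => S ψ + T ψ := fun φ ψ => by
  rw [form_add_left, form_add_right, hS, hT]

theorem IsSymmOp.smul {T : 𝓢(Fin n → ℝ, ℂ) → 𝓢(Fin n → ℝ, ℂ)} (hT : IsSymmOp T) (c : ℝ) :
    IsSymmOp fun ψ => (c : ℂ) • T ψ := fun φ ψ => by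
  rw [form_smul_left, form_smul_right, hT, conj_ofReal]

theorem IsSymmOp.sum {ι : Type*} (s : Finset ι) {T : ι → 𝓢(Fin n → ℝ, ℂ) → 𝓢(Fin n → ℝ, ℂ)}
    (hT : ∀ i ∈ s, IsSymmOp (T i)) : IsSymmOp fun ψ => ∑ i ∈ s, T i ψ := by
  classical
  induction s using Finset.induction_on with
  | empty => intro φ ψ; simp [form]
  | insert a s ha ih =>
    simp only [Finset.sum_insert ha]
    exact (hT a (Finset.mem_insert_self a s)).add
      (ih fun i hi => hT i (Finset.mem_insert_of_mem hi))

theorem IsSymmOp.comp_of_comm {S T : 𝓢(Fin n → ℝ, ℂ) → 𝓢(Fin n → ℝ, ℂ)} (hS : IsSymmOp S)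
    (hT : IsSymmOp T) (h : ∀ ψ, S (T ψ) = T (S ψ)) : IsSymmOp fun ψ => S (T ψ) := fun φ ψ => by
  change form (S (T φ)) ψ = form φ (S (T ψ))
  rw [hS, hT, h]

theorem isSymmOp_id : IsSymmOp fun ψ : 𝓢(Fin n → ℝ, ℂ) => ψ := fun _ _ => rfl

theorem isSymmOp_opX (j : Fin n) : IsSymmOp (opX j) := fun φ ψ => by
  simp only [form, opX_apply, map_mul, conj_ofReal]
  refine integral_congr_ae (Filter.Eventually.of_forall fun x => ?_)
  ring

theorem isSymmOp_opP (j : Fin n) : IsSymmOp (opP j) := fun φ ψ => by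
  have h := SchwartzMap.integral_bilinear_lineDerivOp_right_eq_neg_left (μ := volume) φ ψ
    ((ContinuousLinearMap.mul ℝ ℂ) ∘L (conjCLE : ℂ →L[ℝ] ℂ)) (Pi.single j (1 : ℝ))
  simp only [ContinuousLinearMap.comp_apply, ContinuousLinearMap.mul_apply'] at h
  rw [opP, opP, form_smul_left, form_smul_right, map_neg, conj_I, neg_neg, form, form]
  have e : ∀ a : ℂ, (conjCLE : ℂ →L[ℝ] ℂ) a = conj a := fun _ => rfl
  simp only [e] at h
  rw [h]
  ring

theorem opX_comm (j k : Fin n) (ψ : 𝓢(Fin n → ℝ, ℂ)) : opX j (opX k ψ) = opX k (opX j ψ) := by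
  ext x
  simp only [opX_apply]
  ring

theorem opX_smul (j : Fin n) (c : ℂ) (ψ : 𝓢(Fin n → ℝ, ℂ)) : opX j (c • ψ) = c • opX j ψ := by
  ext x
  simp only [opX_apply, smul_apply, smul_eq_mul]
  ring

/-- The second partial derivative in direction `j`. -/
def secondDeriv (j : Fin n) (ψ : 𝓢(Fin n → ℝ, ℂ)) : 𝓢(Fin n → ℝ, ℂ) :=
  LineDeriv.lineDerivOp (Pi.single j (1 : ℝ) : Fin n → ℝ)
    (LineDeriv.lineDerivOp (Pi.single j (1 : ℝ) : Fin n → ℝ) ψ)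

namespace Oscillators

variable (A : Oscillators n)

theorem isSymmOp_hamiltonian : IsSymmOp A.hamiltonian := by
  have hx : ∀ j, IsSymmOp (A.posOp j) := fun j => (isSymmOp_opX j).smul _
  have hp : ∀ j, IsSymmOp (A.momOp j) := fun j => (isSymmOp_opP j).smul _
  have hxx : ∀ j k, IsSymmOp fun ψ => A.posOp j (A.posOp k ψ) := fun j k =>
    (hx j).comp_of_comm (hx k) fun ψ => by
      simp only [posOp, opX_smul, opX_comm j k]
      rw [smul_comm]
  have hpp : ∀ j, IsSymmOp fun ψ => A.momOp j (A.momOp j ψ) := fun j =>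
    (hp j).comp_of_comm (hp j) fun ψ => rfl
  exact (((IsSymmOp.sum _ fun j _ => ((hxx j j).smul _).add ((hpp j).smul _)).add
    (isSymmOp_id.smul _)).add (IsSymmOp.sum _ fun j _ => (hx j).smul _)).add
    ((IsSymmOp.sum _ fun j _ => IsSymmOp.sum _ fun k _ => (hxx j k).smul _).smul (1 / 2))

/-- The dimensionless slope of the potential. -/
def slope (j : Fin n) : ℝ := partialDeriv j A.potential 0 * √(A.hbar / (A.mass j * A.ω)) / A.hbar

/-- The dimensionless generator `-i H / ħ`. -/
def gen (ψ : 𝓢(Fin n → ℝ, ℂ)) : 𝓢(Fin n → ℝ, ℂ) := (-(I / (A.hbar : ℂ))) • A.hamiltonian ψ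

theorem gen_skew (φ ψ : 𝓢(Fin n → ℝ, ℂ)) :
    (inner ℂ ((A.gen φ).toLp 2 volume) (ψ.toLp 2 volume) : ℂ) =
      -inner ℂ (φ.toLp 2 volume) ((A.gen ψ).toLp 2 volume) := by
  rw [inner_toLp_eq_form, inner_toLp_eq_form, gen, gen, form_smul_left, form_smul_right,
    A.isSymmOp_hamiltonian]
  simp [neg_div]

theorem isEvolution_iff (V : ℝ → (Modes n ≃ₗᵢ[ℂ] Modes n)) : A.IsEvolution V ↔
    IsGroupOf (fun φ : 𝓢(Fin n → ℝ, ℂ) => φ.toLp 2 volume) A.gen V :=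
  ⟨fun h => ⟨h.map_add, h.continuous, h.generator⟩,
    fun h => ⟨h.map_add, h.continuous, h.generator⟩⟩

/-- In the dimensionless variables masses and `ħ` drop out: the Hessian entry `ω √(m_j m_k) g_jk`
times the two length scales is `ħ g_jk`. -/
theorem gen_apply (ψ : 𝓢(Fin n → ℝ, ℂ)) (x : Fin n → ℝ) : A.gen ψ x =
    -I * ((A.ω / 2 : ℂ) * ∑ j, ((x j : ℂ) ^ 2 * ψ x - secondDeriv j ψ x) +
      (∑ j, (A.slope j : ℂ) * x j + 1 / 2 * ∑ j, ∑ k, (A.coupling j k : ℂ) * x j * x k +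
        ((A.potential 0 / A.hbar : ℝ) : ℂ)) * ψ x) := by
  have hb := A.hbar_pos
  have hbc : (A.hbar : ℂ) ≠ 0 := by exact_mod_cast hb.ne'
  have hω := A.ω_pos
  have hm := A.mass_pos
  have sq1 : ∀ j, ((√(A.hbar / (A.mass j * A.ω)) : ℝ) : ℂ) * ((√(A.hbar / (A.mass j * A.ω)) : ℝ) : ℂ)
      = ((A.hbar / (A.mass j * A.ω) : ℝ) : ℂ) := fun j => by
    have := hm j
    rw [← ofReal_mul, Real.mul_self_sqrt (by positivity)]
  have sq2 : ∀ j, ((√(A.hbar * A.mass j * A.ω) : ℝ) : ℂ) * ((√(A.hbar * A.mass j * A.ω) : ℝ) : ℂ)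
      = ((A.hbar * A.mass j * A.ω : ℝ) : ℂ) := fun j => by
    have := hm j
    rw [← ofReal_mul, Real.mul_self_sqrt (by positivity)]
  have sq3 : ∀ j k, (√(A.hbar / (A.mass j * A.ω)) * √(A.hbar / (A.mass k * A.ω))) *
      (A.ω * √(A.mass j * A.mass k)) = A.hbar := fun j k => by
    have h1 := hm j
    have h2 := hm k
    have h3 : √(A.hbar / (A.mass j * A.ω)) * √(A.hbar / (A.mass k * A.ω)) *
        √(A.mass j * A.mass k) = A.hbar / A.ω := by
      rw [← Real.sqrt_mul (by positivity), ← Real.sqrt_mul (by positivity),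
        show A.hbar / (A.mass j * A.ω) * (A.hbar / (A.mass k * A.ω)) * (A.mass j * A.mass k) =
          (A.hbar / A.ω) ^ 2 by field_simp, Real.sqrt_sq (by positivity)]
    rw [mul_left_comm, mul_comm A.ω, h3]
    field_simp
  have e1 : ∀ j, (((1 / 2 * A.mass j * A.ω ^ 2 : ℝ) : ℂ) • A.posOp j (A.posOp j ψ)
      + ((1 / (2 * A.mass j) : ℝ) : ℂ) • A.momOp j (A.momOp j ψ)) x =
      A.hbar * (A.ω / 2 : ℂ) * ((x j : ℂ) ^ 2 * ψ x - secondDeriv j ψ x) := by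
    intro j
    have hmj : (A.mass j : ℂ) ≠ 0 := by exact_mod_cast (hm j).ne'
    have hωc : (A.ω : ℂ) ≠ 0 := by exact_mod_cast hω.ne'
    have h1 : A.posOp j (A.posOp j ψ) x = ((A.hbar / (A.mass j * A.ω) : ℝ) : ℂ) *
        ((x j : ℂ) ^ 2 * ψ x) := by
      simp only [posOp, opX_smul, smul_apply, smul_eq_mul, opX_apply]
      rw [← sq1]
      ring
    have h2 : A.momOp j (A.momOp j ψ) x = -((A.hbar * A.mass j * A.ω : ℝ) : ℂ) *
        secondDeriv j ψ x := by
      have hsd : LineDeriv.lineDerivOp (Pi.single j (1 : ℝ) : Fin n → ℝ)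
        (LineDeriv.lineDerivOp (Pi.single j (1 : ℝ) : Fin n → ℝ) ψ) = secondDeriv j ψ := rfl
      simp only [momOp, opP, LineDeriv.lineDerivOp_smul, smul_apply, smul_eq_mul, hsd]
      rw [← sq2]
      linear_combination (((√(A.hbar * A.mass j * A.ω) : ℝ) : ℂ) ^ 2 *
        secondDeriv j ψ x) * I_sq
    rw [add_apply, smul_apply, smul_apply, h1, h2]
    push_cast
    simp only [smul_eq_mul]
    field_simp
    ring
  have e2 : ∀ j, ((partialDeriv j A.potential 0 : ℂ) • A.posOp j ψ) x =
      A.hbar * ((A.slope j : ℂ) * x j * ψ x) := by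
    intro j
    simp only [posOp, smul_apply, smul_eq_mul, opX_apply, slope]
    push_cast
    field_simp
  have e3 : ∀ j k, ((partialDeriv j (partialDeriv k A.potential) 0 : ℂ) •
      A.posOp j (A.posOp k ψ)) x = A.hbar * ((A.coupling j k : ℂ) * x j * x k * ψ x) := by
    intro j k
    rw [A.hessian_potential]
    simp only [posOp, smul_apply, smul_eq_mul, opX_apply, opX_smul]
    have h3 := congrArg Complex.ofReal (sq3 j k)
    push_cast at h3 ⊢
    linear_combination ((A.coupling j k : ℂ) * x j * x k * ψ x) * h3
  have e4 : A.hamiltonian ψ x = A.hbar * ((A.ω / 2 : ℂ) *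
      ∑ j, ((x j : ℂ) ^ 2 * ψ x - secondDeriv j ψ x) +
      (∑ j, (A.slope j : ℂ) * x j + 1 / 2 * ∑ j, ∑ k, (A.coupling j k : ℂ) * x j * x k +
        ((A.potential 0 / A.hbar : ℝ) : ℂ)) * ψ x) := by
    rw [hamiltonian]
    simp only [add_apply (F := 𝓢(Fin n → ℝ, ℂ)), sum_apply]
    rw [smul_apply, smul_apply]
    simp only [sum_apply, e2, e3]
    have e1' := fun j => e1 j
    simp only [add_apply] at e1'
    simp only [e1', ← Finset.mul_sum, ← Finset.sum_mul]
    push_cast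
    simp only [smul_eq_mul]
    generalize ∑ j, ((x j : ℂ) ^ 2 * ψ x - secondDeriv j ψ x) = s₁
    field_simp
    ring
  rw [gen, smul_apply, e4, smul_eq_mul, ← mul_assoc]
  congr 1
  field_simp

end Oscillators

end

end GravLOCC

/-! ### Schwartz exponentials and derivatives in `L²` -/

namespace GravLOCC

noncomputable section

open Complex
open scoped ComplexConjugate

variable {n : ℕ}

/-! ### Exponentials that are Schwartz functions -/

theorem norm_iteratedFDeriv_cexp (i : ℕ) (z : ℂ) : ‖iteratedFDeriv ℝ i cexp z‖ = ‖cexp z‖ := by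
  have h : ContDiffAt ℂ i cexp z := Complex.contDiff_exp.contDiffAt
  have h2 := h.restrictScalars_iteratedFDeriv (𝕜 := ℝ)
  rw [← h2, Function.comp_apply, ContinuousMultilinearMap.norm_restrictScalars,
    norm_iteratedFDeriv_eq_norm_iteratedDeriv, iteratedDeriv_eq_iterate, Complex.iter_deriv_exp]

/-- From `(1 + s) ^ m ≤ exp(m s)` and the maximum `m² / (4a)` of `m s - a s²`. -/
theorem pow_mul_exp_le {a : ℝ} (ha : 0 < a) (m : ℕ) {s : ℝ} (hs : 0 ≤ s) :
    (1 + s) ^ m * Real.exp (-a * s ^ 2) ≤ Real.exp (m ^ 2 / (4 * a)) := by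
  have h1 : (1 + s) ^ m ≤ Real.exp (m * s) := by
    rw [Real.exp_nat_mul]
    exact pow_le_pow_left₀ (by positivity) (by rw [add_comm]; exact Real.add_one_le_exp s) m
  calc _ ≤ Real.exp (m * s) * Real.exp (-a * s ^ 2) := by gcongr
    _ = Real.exp (m * s + -a * s ^ 2) := (Real.exp_add _ _).symm
    _ ≤ _ := by
        rw [Real.exp_le_exp, le_div_iff₀ (by positivity)]
        nlinarith [sq_nonneg (2 * a * s - m)]

/-- `exp ∘ q` for `q` of temperate growth whose real part tends to `-∞` quadratically. -/
def expSchwartz {E : Type*} [NormedAddCommGroup E] [NormedSpace ℝ E] (q : E → ℂ)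
    (hq : q.HasTemperateGrowth) (hre : ∃ c a : ℝ, 0 < a ∧ ∀ x, (q x).re ≤ c - a * ‖x‖ ^ 2) :
    𝓢(E, ℂ) where
  toFun x := cexp (q x)
  smooth' := Complex.contDiff_exp.comp hq.1
  decay' k m := by
    obtain ⟨c, a, ha, hre⟩ := hre
    obtain ⟨k₁, C₁, hC₁, h₁⟩ := hq.norm_iteratedFDeriv_le_uniform m
    refine ⟨m.factorial * Real.exp c * (C₁ + 1) ^ m *
      Real.exp (((k + k₁ * m : ℕ) : ℝ) ^ 2 / (4 * a)), fun x => ?_⟩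
    have hx : 0 ≤ ‖x‖ := norm_nonneg x
    have hD1 : 1 ≤ (C₁ + 1) * (1 + ‖x‖) ^ k₁ :=
      one_le_mul_of_one_le_of_one_le (by linarith) (one_le_pow₀ (by linarith))
    -- Every derivative of `exp` has norm `exp(Re q)`, and those of `q` grow polynomially, so the
    -- quadratic decay wins. The summand 1 in `D` makes `D ≥ 1`, hence `D ≤ D ^ i` for `i ≥ 1`.
    have h2 := norm_iteratedFDeriv_comp_le (𝕜 := ℝ) (g := cexp) (f := q) (n := m) (N := m)
      Complex.contDiff_exp (hq.1.of_le (mod_cast le_top)) le_rfl x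
      (C := Real.exp (c - a * ‖x‖ ^ 2)) (D := (C₁ + 1) * (1 + ‖x‖) ^ k₁)
      (fun i _ => by
        rw [norm_iteratedFDeriv_cexp, Complex.norm_exp]
        exact Real.exp_le_exp.2 (hre x))
      (fun i hi him => by
        refine (h₁ i him x).trans (le_trans ?_ (le_self_pow₀ hD1 (by omega)))
        gcongr
        linarith)
    change ‖x‖ ^ k * ‖iteratedFDeriv ℝ m (cexp ∘ q) x‖ ≤ _
    calc _ ≤ (1 + ‖x‖) ^ k * (m.factorial * Real.exp (c - a * ‖x‖ ^ 2) *
          ((C₁ + 1) * (1 + ‖x‖) ^ k₁) ^ m) := by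
          gcongr
          linarith
      _ = m.factorial * Real.exp c * (C₁ + 1) ^ m *
          ((1 + ‖x‖) ^ (k + k₁ * m) * Real.exp (-a * ‖x‖ ^ 2)) := by
          rw [sub_eq_add_neg, Real.exp_add, pow_add, mul_pow, pow_mul, neg_mul]
          ring
      _ ≤ _ := by
          gcongr
          exact pow_mul_exp_le ha _ hx

/-! ### Differentiation in `L²` -/

open Filter Topology in
theorem norm_toLp_sq {X : Type*} [MeasurableSpace X] {μ : Measure X} {g : X → ℂ}
    (hg : MemLp g 2 μ) : ‖hg.toLp g‖ ^ 2 = ∫ x, ‖g x‖ ^ 2 ∂μ := by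
  rw [Lp.norm_toLp, hg.eLpNorm_eq_integral_rpow_norm two_ne_zero ENNReal.ofNat_ne_top,
    ENNReal.toReal_ofReal (by positivity)]
  simp only [ENNReal.toReal_ofNat, Real.rpow_two]
  rw [← Real.rpow_natCast, ← Real.rpow_mul (integral_nonneg fun _ => by positivity)]
  norm_num

open Filter Topology in
-- Dominated convergence for the squared error of the difference quotient: the mean value inequality
-- bounds the quotient by `b`, the derivative is bounded by `b` too, and so `4 b²` dominates.
theorem hasDerivAt_toLp {X : Type*} [MeasurableSpace X] {μ : Measure X} {F F' : ℝ → X → ℂ}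
    (hF : ∀ t, MemLp (F t) 2 μ) {t₀ : ℝ} (hF' : MemLp (F' t₀) 2 μ) {b : X → ℝ} (hb : MemLp b 2 μ)
    {ε : ℝ} (hε : 0 < ε)
    (hd : ∀ t ∈ Metric.ball t₀ ε, ∀ x, HasDerivAt (fun s => F s x) (F' t x) t)
    (hle : ∀ t ∈ Metric.ball t₀ ε, ∀ x, ‖F' t x‖ ≤ b x) :
    HasDerivAt (fun t => (hF t).toLp (F t)) (hF'.toLp (F' t₀)) t₀ := by
  rw [hasDerivAt_iff_tendsto_slope, tendsto_iff_norm_sub_tendsto_zero]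
  have hS : ∀ t, MemLp (fun x => (t - t₀)⁻¹ • (F t x - F t₀ x) - F' t₀ x) 2 μ := fun t =>
    (((hF t).sub (hF t₀)).const_smul (t - t₀)⁻¹).sub hF'
  have e : ∀ t, slope (fun t => (hF t).toLp (F t)) t₀ t - hF'.toLp (F' t₀) = (hS t).toLp _ :=
    fun t => by rfl
  simp_rw [e]
  have h2 : Tendsto (fun t => ‖(hS t).toLp _‖ ^ 2) (𝓝[≠] t₀) (𝓝 0) := by
    simp_rw [norm_toLp_sq]
    have h0 : (0 : ℝ) = ∫ _x : X, (0 : ℝ) ∂μ := by simp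
    rw [h0]
    have hball : ∀ᶠ t in 𝓝[≠] t₀, t ∈ Metric.ball t₀ ε :=
      mem_nhdsWithin_of_mem_nhds (Metric.ball_mem_nhds t₀ hε)
    refine tendsto_integral_filter_of_dominated_convergence (fun x => 4 * b x ^ 2)
      (Eventually.of_forall fun t => ((hS t).1.norm.pow 2)) ?_ ?_ ?_
    · filter_upwards [hball] with t ht
      refine Eventually.of_forall fun x => ?_
      have hb0 : ‖F' t₀ x‖ ≤ b x := hle t₀ (Metric.mem_ball_self hε) x
      have h3 : ‖F t x - F t₀ x‖ ≤ b x * ‖t - t₀‖ :=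
        (convex_ball t₀ ε).norm_image_sub_le_of_norm_hasDerivWithin_le
          (fun s hs => (hd s hs x).hasDerivWithinAt) (fun s hs => hle s hs x)
          (Metric.mem_ball_self hε) ht
      have h4 : ‖(t - t₀)⁻¹ • (F t x - F t₀ x)‖ ≤ b x := by
        rw [norm_smul, norm_inv]
        by_cases h : t - t₀ = 0
        · rw [h]; simpa using (norm_nonneg _).trans hb0
        · rw [inv_mul_le_iff₀ (norm_pos_iff.2 h), mul_comm]
          exact h3
      have h5 : ‖(t - t₀)⁻¹ • (F t x - F t₀ x) - F' t₀ x‖ ≤ 2 * b x :=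
        (norm_sub_le _ _).trans (by linarith)
      rw [Real.norm_of_nonneg (by positivity)]
      calc _ ≤ (2 * b x) ^ 2 := pow_le_pow_left₀ (norm_nonneg _) h5 2
        _ = _ := by ring
    · exact hb.integrable_sq.const_mul 4
    · refine Eventually.of_forall fun x => ?_
      have h3 := hasDerivAt_iff_tendsto_slope.1 (hd t₀ (Metric.mem_ball_self hε) x)
      have h4 := (h3.sub_const (F' t₀ x)).norm.pow 2
      simpa [slope_def_module] using h4
  have h3 := (Real.continuous_sqrt.tendsto 0).comp h2
  rw [Real.sqrt_zero] at h3
  refine h3.congr fun t => ?_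
  simp

end

end GravLOCC

/-! ### Gaussian wave packets -/

namespace GravLOCC

noncomputable section

open Complex
open scoped ComplexConjugate

variable {n : ℕ}

/-! ### Gaussian wave functions in rotated coordinates -/

section Gaussian

open Matrix

variable (O : Matrix (Fin n) (Fin n) ℝ)

/-- The coordinates `Oᵀ x`. -/
def rotCoord (k : Fin n) : (Fin n → ℝ) →L[ℝ] ℝ :=
  ∑ j, O j k • ContinuousLinearMap.proj (R := ℝ) (φ := fun _ : Fin n => ℝ) j

theorem rotCoord_apply (k : Fin n) (x : Fin n → ℝ) : rotCoord O k x = ∑ j, O j k * x j := by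
  simp [rotCoord]

theorem rotCoord_single (k j : Fin n) : rotCoord O k (Pi.single j 1) = O j k := by
  simp [rotCoord_apply, Pi.single_apply]

variable {O}

theorem sum_mul_mul_of_orthogonal {R : Type*} [CommRing R] {P : Matrix (Fin n) (Fin n) R}
    (hP : Pᵀ * P = 1) (u v : Fin n → R) :
    ∑ j, (∑ k, P j k * u k) * (∑ k, P j k * v k) = ∑ k, u k * v k := by
  have h : (P *ᵥ u) ⬝ᵥ (P *ᵥ v) = u ⬝ᵥ v := by
    rw [dotProduct_mulVec, ← vecMul_transpose, vecMul_vecMul, hP, vecMul_one]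
  exact h

theorem sum_rotCoord_sq (h : O * Oᵀ = 1) (x : Fin n → ℝ) :
    ∑ k, rotCoord O k x ^ 2 = ∑ j, x j ^ 2 := by
  have := sum_mul_mul_of_orthogonal (P := Oᵀ) (by rw [transpose_transpose]; exact h) x x
  simp only [rotCoord_apply, sq]
  exact this

theorem sum_mul_rotCoord (h : O * Oᵀ = 1) (b x : Fin n → ℝ) :
    ∑ k, rotCoord O k b * rotCoord O k x = ∑ j, b j * x j := by
  have := sum_mul_mul_of_orthogonal (P := Oᵀ) (by rw [transpose_transpose]; exact h) b x
  simp only [rotCoord_apply]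
  exact this

variable (O)

/-- The exponent `γ + ξ · y - y · z y / 2` with `y = Oᵀ x`. -/
def quadExp (γ : ℂ) (ξ z : Fin n → ℂ) (x : Fin n → ℝ) : ℂ :=
  γ + ∑ k, (ξ k * (rotCoord O k x : ℂ) - z k / 2 * ((rotCoord O k x : ℂ) * (rotCoord O k x : ℂ)))

theorem hasTemperateGrowth_quadExp (γ : ℂ) (ξ z : Fin n → ℂ) :
    (quadExp O γ ξ z).HasTemperateGrowth := by
  have h : ∀ k, (fun x : Fin n → ℝ => ((rotCoord O k x : ℝ) : ℂ)).HasTemperateGrowth := fun k =>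
    (Complex.ofRealCLM ∘L rotCoord O k).hasTemperateGrowth
  unfold quadExp
  refine (Function.HasTemperateGrowth.const γ).add
    (Function.HasTemperateGrowth.sum fun k _ => ?_)
  have hk := h k
  exact ((Function.HasTemperateGrowth.const (ξ k)).mul hk).sub
    ((Function.HasTemperateGrowth.const (z k / 2)).mul (hk.mul hk))

variable {O}

/-- Half of the decay `r y²/2` absorbs the linear term through `K|y| ≤ K²/r + r y²/4`. The constants
depend on the parameters only through `r` and `K`, as needed for domination over a time interval. -/
theorem re_quadExp_le (h : O * Oᵀ = 1) {γ : ℂ} {ξ z : Fin n → ℂ} {r K : ℝ} (hr : 0 < r)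
    (hz : ∀ k, r ≤ (z k).re) (hξ : ∀ k, ‖ξ k‖ ≤ K) (hγ : ‖γ‖ ≤ K) (x : Fin n → ℝ) :
    (quadExp O γ ξ z x).re ≤ K + n * (K ^ 2 / r) - r / 4 * ∑ j, x j ^ 2 := by
  have h1 : ∀ k, (ξ k * (rotCoord O k x : ℂ) -
      z k / 2 * ((rotCoord O k x : ℂ) * (rotCoord O k x : ℂ))).re ≤
      K ^ 2 / r - r / 4 * rotCoord O k x ^ 2 := by
    intro k
    set y := rotCoord O k x
    have e : (ξ k * (y : ℂ) - z k / 2 * ((y : ℂ) * (y : ℂ))).re =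
        (ξ k).re * y - (z k).re / 2 * y ^ 2 := by
      rw [← ofReal_mul, sub_re, re_mul_ofReal, re_mul_ofReal]
      simp [sq]
    have h2 : (ξ k).re * y ≤ K * |y| := by
      refine (le_abs_self _).trans ?_
      rw [abs_mul]
      exact mul_le_mul_of_nonneg_right ((abs_re_le_norm _).trans (hξ k)) (abs_nonneg _)
    have h3 : r / 2 * y ^ 2 ≤ (z k).re / 2 * y ^ 2 := by
      have := hz k
      gcongr
    have h4 : K * |y| ≤ K ^ 2 / r + r / 4 * y ^ 2 := by
      have h5 : K * |y| - r / 4 * y ^ 2 ≤ K ^ 2 / r := by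
        rw [le_div_iff₀ hr, ← sq_abs y]
        nlinarith [sq_nonneg (K - r * |y| / 2)]
      linarith
    rw [e]
    linarith
  rw [quadExp, add_re, re_sum, ← sum_rotCoord_sq h x]
  calc _ ≤ K + ∑ k, (K ^ 2 / r - r / 4 * rotCoord O k x ^ 2) :=
        add_le_add ((re_le_norm _).trans hγ) (Finset.sum_le_sum fun k _ => h1 k)
    _ = _ := by
        rw [Finset.sum_sub_distrib, Finset.sum_const, Finset.card_univ, Fintype.card_fin,
          nsmul_eq_mul, Finset.mul_sum]
        ring

theorem sq_norm_le_sum_sq (x : Fin n → ℝ) : ‖x‖ ^ 2 ≤ ∑ j, x j ^ 2 := by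
  have h : ‖x‖ ≤ √(∑ j, x j ^ 2) := by
    refine (pi_norm_le_iff_of_nonneg (Real.sqrt_nonneg _)).2 fun j => ?_
    rw [Real.norm_eq_abs]
    refine Real.abs_le_sqrt ?_
    exact Finset.single_le_sum (f := fun j => x j ^ 2) (fun _ _ => sq_nonneg _) (Finset.mem_univ j)
  calc ‖x‖ ^ 2 ≤ √(∑ j, x j ^ 2) ^ 2 := pow_le_pow_left₀ (norm_nonneg _) h 2
    _ = _ := Real.sq_sqrt (Finset.sum_nonneg fun _ _ => sq_nonneg _)

theorem exists_pos_le {f : Fin n → ℝ} (hf : ∀ k, 0 < f k) : ∃ r, 0 < r ∧ ∀ k, r ≤ f k := by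
  rcases isEmpty_or_nonempty (Fin n) with h | h
  · exact ⟨1, one_pos, fun k => (h.false k).elim⟩
  · obtain ⟨k, hk⟩ := Finite.exists_min f
    exact ⟨f k, hf k, hk⟩

theorem exists_ge_all (f : Fin n → ℝ) (c : ℝ) : ∃ K, 0 ≤ K ∧ c ≤ K ∧ ∀ k, f k ≤ K := by
  refine ⟨|c| + ∑ k, |f k|, by positivity, ?_, fun k => ?_⟩
  · have : 0 ≤ ∑ k, |f k| := by positivity
    linarith [le_abs_self c]
  · have := Finset.single_le_sum (f := fun k => |f k|) (fun _ _ => abs_nonneg _) (Finset.mem_univ k)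
    linarith [le_abs_self (f k), abs_nonneg c]

theorem exists_re_quadExp_le (h : O * Oᵀ = 1) (γ : ℂ) (ξ z : Fin n → ℂ)
    (hz : ∀ k, 0 < (z k).re) :
    ∃ c a : ℝ, 0 < a ∧ ∀ x, (quadExp O γ ξ z x).re ≤ c - a * ‖x‖ ^ 2 := by
  obtain ⟨r, hr, hrz⟩ := exists_pos_le hz
  obtain ⟨K, -, hK, hKξ⟩ := exists_ge_all (fun k => ‖ξ k‖) ‖γ‖
  refine ⟨K + n * (K ^ 2 / r), r / 4, by positivity, fun x => (re_quadExp_le h hr hrz hKξ hK x).trans ?_⟩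
  have := sq_norm_le_sum_sq x
  gcongr

/-- The Gaussian wave function `exp(γ + ξ · y - y · z y / 2)`, `y = Oᵀ x`. -/
def gauss (h : O * Oᵀ = 1) (γ : ℂ) (ξ z : Fin n → ℂ) (hz : ∀ k, 0 < (z k).re) :
    𝓢(Fin n → ℝ, ℂ) :=
  expSchwartz (quadExp O γ ξ z) (hasTemperateGrowth_quadExp O γ ξ z)
    (exists_re_quadExp_le h γ ξ z hz)

theorem gauss_apply (h : O * Oᵀ = 1) (γ : ℂ) (ξ z : Fin n → ℂ) (hz : ∀ k, 0 < (z k).re)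
    (x : Fin n → ℝ) : gauss h γ ξ z hz x = cexp (quadExp O γ ξ z x) := rfl

variable (O) in
/-- The logarithmic derivative of a Gaussian wave function. -/
def logDeriv (ξ z : Fin n → ℂ) (j : Fin n) (x : Fin n → ℝ) : ℂ :=
  ∑ k, (O j k : ℂ) * (ξ k - z k * (rotCoord O k x : ℂ))

theorem hasDerivAt_rotCoord (k j : Fin n) (x : Fin n → ℝ) :
    HasDerivAt (fun t : ℝ => ((rotCoord O k (x + t • Pi.single j (1 : ℝ)) : ℝ) : ℂ)) (O j k : ℂ) 0 := by
  have h : HasDerivAt (fun t : ℝ => rotCoord O k (x + t • Pi.single j (1 : ℝ))) (O j k) 0 := by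
    simp only [map_add, map_smul, rotCoord_single, smul_eq_mul]
    simpa using ((hasDerivAt_id (0 : ℝ)).mul_const (O j k)).const_add (rotCoord O k x)
  exact h.ofReal_comp

theorem hasDerivAt_cexp_quadExp (γ : ℂ) (ξ z : Fin n → ℂ) (j : Fin n) (x : Fin n → ℝ) :
    HasDerivAt (fun t : ℝ => cexp (quadExp O γ ξ z (x + t • Pi.single j (1 : ℝ))))
      (logDeriv O ξ z j x * cexp (quadExp O γ ξ z x)) 0 := by
  have h1 : HasDerivAt (fun t : ℝ => quadExp O γ ξ z (x + t • Pi.single j (1 : ℝ)))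
      (logDeriv O ξ z j x) 0 := by
    unfold quadExp logDeriv
    refine HasDerivAt.const_add γ (HasDerivAt.fun_sum fun k _ => ?_)
    have hk := hasDerivAt_rotCoord (O := O) k j x
    refine ((hk.const_mul (ξ k)).sub ((hk.mul hk).const_mul (z k / 2))).congr_deriv ?_
    simp only [zero_smul, add_zero]
    ring
  have h2 := h1.cexp
  simp only [zero_smul, add_zero] at h2
  rwa [mul_comm] at h2

theorem lineDerivOp_gauss (h : O * Oᵀ = 1) (γ : ℂ) (ξ z : Fin n → ℂ) (hz : ∀ k, 0 < (z k).re)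
    (j : Fin n) (x : Fin n → ℝ) :
    LineDeriv.lineDerivOp (Pi.single j (1 : ℝ) : Fin n → ℝ) (gauss h γ ξ z hz) x =
      logDeriv O ξ z j x * cexp (quadExp O γ ξ z x) := by
  rw [SchwartzMap.lineDerivOp_apply]
  exact HasLineDerivAt.lineDeriv (hasDerivAt_cexp_quadExp γ ξ z j x)

theorem secondDeriv_gauss (h : O * Oᵀ = 1) (γ : ℂ) (ξ z : Fin n → ℂ) (hz : ∀ k, 0 < (z k).re)
    (j : Fin n) (x : Fin n → ℝ) : secondDeriv j (gauss h γ ξ z hz) x =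
      (logDeriv O ξ z j x ^ 2 - ∑ k, (O j k : ℂ) ^ 2 * z k) * cexp (quadExp O γ ξ z x) := by
  rw [secondDeriv, SchwartzMap.lineDerivOp_apply]
  refine HasLineDerivAt.lineDeriv ?_
  have h1 : HasDerivAt (fun t : ℝ => logDeriv O ξ z j (x + t • Pi.single j (1 : ℝ)))
      (-∑ k, (O j k : ℂ) ^ 2 * z k) 0 := by
    unfold logDeriv
    rw [← Finset.sum_neg_distrib]
    refine HasDerivAt.fun_sum fun k _ => ?_
    have hk := hasDerivAt_rotCoord (O := O) k j x
    refine (((hk.const_mul (z k)).const_sub (ξ k)).const_mul (O j k : ℂ)).congr_deriv ?_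
    ring
  have h2 := h1.mul (hasDerivAt_cexp_quadExp (O := O) γ ξ z j x)
  have e : ∀ y, LineDeriv.lineDerivOp (Pi.single j (1 : ℝ) : Fin n → ℝ) (gauss h γ ξ z hz) y =
      logDeriv O ξ z j y * cexp (quadExp O γ ξ z y) := lineDerivOp_gauss h γ ξ z hz j
  simp only [HasLineDerivAt, e]
  refine HasDerivAt.congr_deriv h2 ?_
  simp only [zero_smul, add_zero]
  ring

/-! ### Time derivative of Gaussian wave functions -/

theorem memLp_exp_neg_sum_sq {a : ℝ} (ha : 0 < a) (C : ℝ) :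
    MemLp (fun x : Fin n → ℝ => C * Real.exp (-a * ∑ j, x j ^ 2)) 2 volume := by
  refine MemLp.const_mul ?_ C
  have hc : Continuous fun x : Fin n → ℝ => Real.exp (-a * ∑ j, x j ^ 2) := by fun_prop
  rw [memLp_two_iff_integrable_sq hc.aestronglyMeasurable]
  have h : Integrable (fun x : Fin n → ℝ => ∏ j, Real.exp (-(2 * a) * x j ^ 2)) volume :=
    Integrable.fintype_prod (f := fun _ (y : ℝ) => Real.exp (-(2 * a) * y ^ 2))
      fun _ => integrable_exp_neg_mul_sq (by positivity)
  refine h.congr (Filter.Eventually.of_forall fun x => ?_)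
  simp only
  rw [← Real.exp_sum, ← Real.exp_nat_mul, ← Finset.mul_sum]
  congr 1
  push_cast
  ring

theorem norm_quadExp_le (h : O * Oᵀ = 1) {γ : ℂ} {ξ z : Fin n → ℂ} {M : ℝ} (hγ : ‖γ‖ ≤ M)
    (hξ : ∀ k, ‖ξ k‖ ≤ M) (hz : ∀ k, ‖z k‖ ≤ M) (x : Fin n → ℝ) :
    ‖quadExp O γ ξ z x‖ ≤ M * ((1 + n) * (1 + 2 * ∑ j, x j ^ 2)) := by
  have hM : 0 ≤ M := (norm_nonneg _).trans hγ
  have h1 : ∀ k, ‖ξ k * (rotCoord O k x : ℂ) -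
      z k / 2 * ((rotCoord O k x : ℂ) * (rotCoord O k x : ℂ))‖ ≤
      M * (1 + 2 * rotCoord O k x ^ 2) := by
    intro k
    set y := rotCoord O k x
    refine (norm_sub_le _ _).trans ?_
    rw [norm_mul, norm_mul, norm_mul, norm_div, Complex.norm_real, Real.norm_eq_abs]
    have h2 := mul_le_mul_of_nonneg_right (hξ k) (abs_nonneg y)
    have h3 := mul_le_mul_of_nonneg_right (hz k) (mul_nonneg (abs_nonneg y) (abs_nonneg y))
    have h4 : |y| * |y| = y ^ 2 := by rw [← sq, sq_abs]
    have h5 : |y| ≤ 1 + y ^ 2 := by nlinarith [sq_nonneg (|y| - 1), sq_abs y]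
    have h6 := mul_le_mul_of_nonneg_left h5 hM
    rw [h4] at h3 ⊢
    have : ‖(2 : ℂ)‖ = 2 := by simp
    rw [this]
    nlinarith [mul_nonneg hM (sq_nonneg y)]
  have hs : 0 ≤ ∑ j, x j ^ 2 := Finset.sum_nonneg fun _ _ => sq_nonneg _
  calc _ ≤ ‖γ‖ + ∑ k, M * (1 + 2 * rotCoord O k x ^ 2) :=
        (norm_add_le _ _).trans (add_le_add_right ((norm_sum_le _ _).trans
          (Finset.sum_le_sum fun k _ => h1 k)) _)
    _ ≤ M + M * (n + 2 * ∑ j, x j ^ 2) := by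
        rw [← Finset.mul_sum, Finset.sum_add_distrib, ← Finset.mul_sum, sum_rotCoord_sq h]
        simp
        exact hγ
    _ ≤ _ := by
        have : 0 ≤ M * (n * (∑ j, x j ^ 2)) := by positivity
        nlinarith

/-- Absorbs the polynomial factor of a time derivative at the price of half of the decay `r s/4`
left by `re_quadExp_le`. -/
theorem one_add_two_mul_le_exp {r s : ℝ} (hr : 0 < r) (hs : 0 ≤ s) :
    1 + 2 * s ≤ (1 + 16 / r) * Real.exp (r / 8 * s) := by
  have h1 : r / 8 * s + 1 ≤ Real.exp (r / 8 * s) := Real.add_one_le_exp _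
  have h2 : 2 * s = 16 / r * (r / 8 * s) := by field_simp; ring
  have h3 : 0 ≤ r / 8 * s := by positivity
  have h4 : 0 < 16 / r := by positivity
  rw [h2]
  nlinarith

open Filter Topology in
-- The exponent is linear in its parameters, so its time derivative is `quadExp` of their
-- derivatives. Near `t₀` the parameters are bounded and `Re z ≥ r/2`, so a single Gaussian
-- dominates all the pointwise derivatives.
theorem hasDerivAt_gauss (h : O * Oᵀ = 1) {γ γ' : ℝ → ℂ} {ξ ξ' z z' : ℝ → Fin n → ℂ}
    (hz : ∀ t k, 0 < (z t k).re) (hγd : ∀ t, HasDerivAt γ (γ' t) t)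
    (hξd : ∀ t k, HasDerivAt (fun s => ξ s k) (ξ' t k) t)
    (hzd : ∀ t k, HasDerivAt (fun s => z s k) (z' t k) t) {t₀ : ℝ} (hγc : ContinuousAt γ' t₀)
    (hξc : ∀ k, ContinuousAt (fun s => ξ' s k) t₀) (hzc : ∀ k, ContinuousAt (fun s => z' s k) t₀)
    {φ : 𝓢(Fin n → ℝ, ℂ)} (hφ : ∀ x, φ x = quadExp O (γ' t₀) (ξ' t₀) (z' t₀) x *
      gauss h (γ t₀) (ξ t₀) (z t₀) (hz t₀) x) :
    HasDerivAt (fun t => (gauss h (γ t) (ξ t) (z t) (hz t)).toLp 2 volume) (φ.toLp 2 volume) t₀ := by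
  obtain ⟨r, hr, hrz⟩ := exists_pos_le (hz t₀)
  obtain ⟨K, -, hK, hKξ⟩ := exists_ge_all (fun k => ‖ξ t₀ k‖) ‖γ t₀‖
  obtain ⟨M₁, hM₁, hM₁γ, hM₁ξ⟩ := exists_ge_all (fun k => ‖ξ' t₀ k‖) ‖γ' t₀‖
  obtain ⟨M, hM, hM₁M, hMz⟩ := exists_ge_all (fun k => ‖z' t₀ k‖) M₁
  have hev : ∀ᶠ t in 𝓝 t₀, (∀ k, r / 2 ≤ (z t k).re) ∧ (∀ k, ‖ξ t k‖ ≤ K + 1) ∧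
      ‖γ t‖ ≤ K + 1 ∧ ‖γ' t‖ ≤ M + 1 ∧ (∀ k, ‖ξ' t k‖ ≤ M + 1) ∧ ∀ k, ‖z' t k‖ ≤ M + 1 := by
    simp only [eventually_and, eventually_all]
    refine ⟨fun k => ?_, fun k => ?_, ?_, ?_, fun k => ?_, fun k => ?_⟩
    · have hc : ContinuousAt (fun s => (z s k).re) t₀ :=
        continuous_re.continuousAt.comp (hzd t₀ k).continuousAt
      exact (hc.eventually_const_lt (by have := hrz k; linarith)).mono fun _ => le_of_lt
    · exact ((hξd t₀ k).continuousAt.norm.eventually_lt_const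
        (by have := hKξ k; linarith)).mono fun _ => le_of_lt
    · exact ((hγd t₀).continuousAt.norm.eventually_lt_const (by linarith)).mono
        fun _ => le_of_lt
    · exact (hγc.norm.eventually_lt_const (by linarith)).mono fun _ => le_of_lt
    · exact ((hξc k).norm.eventually_lt_const
        (by have := hM₁ξ k; linarith)).mono fun _ => le_of_lt
    · exact ((hzc k).norm.eventually_lt_const
        (by have := hMz k; linarith)).mono fun _ => le_of_lt
  obtain ⟨ε, hε, hball⟩ := Metric.eventually_nhds_iff_ball.1 hev
  set c := K + 1 + n * ((K + 1) ^ 2 / (r / 2)) with hc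
  have hF' : MemLp (fun x => quadExp O (γ' t₀) (ξ' t₀) (z' t₀) x *
      gauss h (γ t₀) (ξ t₀) (z t₀) (hz t₀) x) 2 (volume : Measure (Fin n → ℝ)) := by
    have := φ.memLp 2 (volume : Measure (Fin n → ℝ))
    rwa [show (φ : (Fin n → ℝ) → ℂ) = _ from funext hφ] at this
  have key := hasDerivAt_toLp (μ := (volume : Measure (Fin n → ℝ)))
    (F := fun t x => gauss h (γ t) (ξ t) (z t) (hz t) x)
    (F' := fun t x => quadExp O (γ' t) (ξ' t) (z' t) x * gauss h (γ t) (ξ t) (z t) (hz t) x)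
    (fun t => (gauss h (γ t) (ξ t) (z t) (hz t)).memLp 2 volume) hF'
    (memLp_exp_neg_sum_sq (n := n) (a := r / 2 / 8) (by positivity)
      ((M + 1) * (1 + n) * (1 + 16 / (r / 2)) * Real.exp c)) hε ?_ ?_
  · have e : φ.toLp 2 volume = hF'.toLp _ := by
      refine Lp.ext ?_
      filter_upwards [φ.coeFn_toLp 2 volume, hF'.coeFn_toLp] with x h1 h2
      rw [h1, h2, hφ]
    rw [e]
    exact key
  · intro t _ x
    have hq : HasDerivAt (fun s => quadExp O (γ s) (ξ s) (z s) x)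
        (quadExp O (γ' t) (ξ' t) (z' t) x) t := by
      unfold quadExp
      refine (hγd t).add (HasDerivAt.fun_sum fun k _ => ?_)
      exact ((hξd t k).mul_const _).sub (((hzd t k).div_const 2).mul_const _)
    have := hq.cexp
    rwa [mul_comm] at this
  · intro t ht x
    obtain ⟨b1, b2, b3, b4, b5, b6⟩ := hball t ht
    have h1 := re_quadExp_le h (half_pos hr) b1 b2 b3 x
    have h2 := norm_quadExp_le h b4 b5 b6 x
    have hs : 0 ≤ ∑ j, x j ^ 2 := Finset.sum_nonneg fun _ _ => sq_nonneg _
    have h3 := one_add_two_mul_le_exp (half_pos hr) hs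
    rw [norm_mul, gauss_apply, Complex.norm_exp]
    set s := ∑ j, x j ^ 2
    calc _ ≤ (M + 1) * ((1 + n) * ((1 + 16 / (r / 2)) * Real.exp (r / 2 / 8 * s))) *
          Real.exp (c - r / 2 / 4 * s) := by
          refine mul_le_mul (h2.trans ?_) (Real.exp_le_exp.2 h1) (Real.exp_nonneg _)
            (by positivity)
          gcongr
      _ = _ := by
          have : Real.exp (-(r / 2 / 8) * s) = Real.exp (r / 2 / 8 * s) *
              Real.exp (-(r / 2 / 4 * s)) := by
            rw [← Real.exp_add]; congr 1; ring
          rw [sub_eq_add_neg, Real.exp_add, this]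
          ring

end Gaussian

end

end GravLOCC

/-! ### Gaussian solutions in the eigenmodes of `g` -/

namespace GravLOCC

noncomputable section

open Complex
open scoped ComplexConjugate

variable {n : ℕ}

/-! ### Gaussian solutions of the Schrödinger equation -/

section Solutions

open Matrix

variable {O : Matrix (Fin n) (Fin n) ℝ} {κ : Fin n → ℝ}

theorem rotCoord_mulVec (h : Oᵀ * O = 1) (v : Fin n → ℝ) (k : Fin n) :
    rotCoord O k (O *ᵥ v) = v k := by
  have : (Oᵀ *ᵥ (O *ᵥ v)) k = v k := by rw [mulVec_mulVec, h, one_mulVec]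
  rw [rotCoord_apply]
  exact this

theorem mulVec_rotCoord (h : O * Oᵀ = 1) (x : Fin n → ℝ) :
    (O *ᵥ fun k => rotCoord O k x) = x := by
  have : O *ᵥ (Oᵀ *ᵥ x) = x := by rw [mulVec_mulVec, h, one_mulVec]
  convert this using 2
  ext k
  rw [rotCoord_apply]
  rfl

theorem sum_quadratic_rotCoord {g : Matrix (Fin n) (Fin n) ℝ} (hg : g = O * diagonal κ * Oᵀ)
    (x : Fin n → ℝ) :
    ∑ j, ∑ k, g j k * x j * x k = ∑ k, κ k * rotCoord O k x ^ 2 := by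
  have h1 : ∑ j, ∑ k, g j k * x j * x k = x ⬝ᵥ (g *ᵥ x) := by
    simp only [dotProduct, mulVec, Finset.mul_sum]
    exact Finset.sum_congr rfl fun j _ => Finset.sum_congr rfl fun k _ => by ring
  have h2 : Oᵀ *ᵥ x = fun k => rotCoord O k x := by
    ext k
    rw [rotCoord_apply]
    rfl
  rw [h1, hg, ← mulVec_mulVec, ← mulVec_mulVec, dotProduct_mulVec, ← mulVec_transpose, h2]
  simp only [dotProduct, mulVec_diagonal]
  exact Finset.sum_congr rfl fun k _ => by ring

theorem sum_logDeriv_sq (h : Oᵀ * O = 1) (ξ z : Fin n → ℂ) (x : Fin n → ℝ) :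
    ∑ j, logDeriv O ξ z j x ^ 2 = ∑ k, (ξ k - z k * (rotCoord O k x : ℂ)) ^ 2 := by
  have hc : (O.map ofReal)ᵀ * O.map ofReal = (1 : Matrix (Fin n) (Fin n) ℂ) := by
    have e := congrArg (fun M : Matrix (Fin n) (Fin n) ℝ => M.map ofRealHom) h
    simp only [Matrix.map_mul, transpose_map] at e
    exact e.trans (Matrix.map_one _ (map_zero _) (map_one _))
  have := sum_mul_mul_of_orthogonal hc (fun k => ξ k - z k * (rotCoord O k x : ℂ))
    (fun k => ξ k - z k * (rotCoord O k x : ℂ))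
  simp only [logDeriv, sq]
  exact this

theorem sum_sum_sq_mul (h : Oᵀ * O = 1) (z : Fin n → ℂ) :
    ∑ j, ∑ k, (O j k : ℂ) ^ 2 * z k = ∑ k, z k := by
  rw [Finset.sum_comm]
  refine Finset.sum_congr rfl fun k _ => ?_
  rw [← Finset.sum_mul]
  have h1 : ∑ j, O j k ^ 2 = 1 := by
    have := congrFun (congrFun h k) k
    rw [one_apply_eq, mul_apply] at this
    rw [← this]
    exact Finset.sum_congr rfl fun j _ => by rw [transpose_apply, sq]
  have h2 : ∑ j, (O j k : ℂ) ^ 2 = 1 := by exact_mod_cast h1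
  rw [h2, one_mul]

variable (A : Oscillators n)

/-- A quadratic Hamiltonian multiplies a Gaussian by a quadratic polynomial. In coordinates
diagonalising `g` this polynomial has no mixed terms and so is again a `quadExp`; its coefficients
are the right-hand sides of the parameter equations. -/
theorem Oscillators.gen_gauss (h : O * Oᵀ = 1) (h' : Oᵀ * O = 1)
    (hg : A.coupling = O * diagonal κ * Oᵀ) (γ : ℂ) (ξ z : Fin n → ℂ) (hz : ∀ k, 0 < (z k).re)
    (x : Fin n → ℝ) : A.gen (gauss h γ ξ z hz) x =
      quadExp O (-I * (((A.potential 0 / A.hbar : ℝ) : ℂ) + A.ω / 2 * ∑ k, (z k - ξ k ^ 2)))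
        (fun k => -I * (A.ω * z k * ξ k + (rotCoord O k A.slope : ℂ)))
        (fun k => I * (A.ω + κ k - A.ω * z k ^ 2)) x * gauss h γ ξ z hz x := by
  have e1 : ∑ j, (x j : ℂ) ^ 2 = ∑ k, (rotCoord O k x : ℂ) ^ 2 := by
    exact_mod_cast (sum_rotCoord_sq h x).symm
  have e2 : ∑ j, (A.slope j : ℂ) * x j =
      ∑ k, (rotCoord O k A.slope : ℂ) * (rotCoord O k x : ℂ) := by
    exact_mod_cast (sum_mul_rotCoord h A.slope x).symm
  have e3 : ∑ j, ∑ k, (A.coupling j k : ℂ) * x j * x k =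
      ∑ k, (κ k : ℂ) * (rotCoord O k x : ℂ) ^ 2 := by
    exact_mod_cast sum_quadratic_rotCoord hg x
  rw [A.gen_apply, e2, e3]
  simp only [secondDeriv_gauss, ← gauss_apply h γ ξ z hz]
  set G := gauss h γ ξ z hz x
  have e4 : ∑ j, ((x j : ℂ) ^ 2 * G - (logDeriv O ξ z j x ^ 2 - ∑ k, (O j k : ℂ) ^ 2 * z k) * G) =
      (∑ k, ((rotCoord O k x : ℂ) ^ 2 - (ξ k - z k * (rotCoord O k x : ℂ)) ^ 2 + z k)) * G := by
    have : ∑ k, ((rotCoord O k x : ℂ) ^ 2 - (ξ k - z k * (rotCoord O k x : ℂ)) ^ 2 + z k) =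
        ∑ j, ((x j : ℂ) ^ 2 - logDeriv O ξ z j x ^ 2 + ∑ k, (O j k : ℂ) ^ 2 * z k) := by
      rw [Finset.sum_add_distrib, Finset.sum_sub_distrib, ← e1, ← sum_logDeriv_sq h' ξ z x,
        ← sum_sum_sq_mul h' z, ← Finset.sum_sub_distrib, ← Finset.sum_add_distrib]
    rw [this, Finset.sum_mul]
    exact Finset.sum_congr rfl fun j _ => by ring
  rw [e4, quadExp]
  have e5 : ∀ s r : ℂ, ∀ f1 f2 f3 f4 f5 : Fin n → ℂ, (∀ k, f5 k = -I * (s * f1 k + f2 k +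
      1 / 2 * f3 k - s * f4 k)) → -I * (s * ((∑ k, f1 k) * G) + (∑ k, f2 k + 1 / 2 * ∑ k, f3 k + r) * G) =
      (-I * (r + s * ∑ k, f4 k) + ∑ k, f5 k) * G := by
    intro s r f1 f2 f3 f4 f5 hf
    rw [Finset.sum_congr rfl fun k _ => hf k, ← Finset.mul_sum, Finset.sum_sub_distrib,
      Finset.sum_add_distrib, Finset.sum_add_distrib, ← Finset.mul_sum, ← Finset.mul_sum,
      ← Finset.mul_sum]
    ring
  exact e5 _ _ _ _ _ _ _ fun k => by ring

theorem Oscillators.isSolution_gauss (h : O * Oᵀ = 1) (h' : Oᵀ * O = 1)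
    (hg : A.coupling = O * diagonal κ * Oᵀ) {γ : ℝ → ℂ} {ξ z : ℝ → Fin n → ℂ}
    (hz : ∀ t k, 0 < (z t k).re)
    (hγd : ∀ t, HasDerivAt γ (-I * (((A.potential 0 / A.hbar : ℝ) : ℂ) +
      A.ω / 2 * ∑ k, (z t k - ξ t k ^ 2))) t)
    (hξd : ∀ t k, HasDerivAt (fun s => ξ s k)
      (-I * (A.ω * z t k * ξ t k + (rotCoord O k A.slope : ℂ))) t)
    (hzd : ∀ t k, HasDerivAt (fun s => z s k) (I * (A.ω + κ k - A.ω * z t k ^ 2)) t) :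
    IsSolution (fun φ : 𝓢(Fin n → ℝ, ℂ) => φ.toLp 2 volume) A.gen
      fun t => gauss h (γ t) (ξ t) (z t) (hz t) := by
  intro t
  have cξ : ∀ k, ContinuousAt (fun s => ξ s k) t := fun k => (hξd t k).continuousAt
  have cz : ∀ k, ContinuousAt (fun s => z s k) t := fun k => (hzd t k).continuousAt
  refine hasDerivAt_gauss h hz hγd hξd hzd ?_ (fun k => ?_) (fun k => ?_)
    (A.gen_gauss h h' hg _ _ _ _)
  · fun_prop
  · have := cξ k
    have := cz k
    fun_prop
  · have := cz k
    fun_prop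

/-! ### Displaced Gaussians -/

theorem displace_gauss (h : O * Oᵀ = 1) (γ : ℂ) (ξ z : Fin n → ℂ) (hz : ∀ k, 0 < (z k).re)
    (δ : Fin n ⊕ Fin n → ℝ) {X P : Fin n → ℝ} (hX : ∀ k, rotCoord O k (fun j => δ (.inl j)) = X k)
    (hP : ∀ k, rotCoord O k (fun j => δ (.inr j)) = P k) :
    displace δ ((gauss h γ ξ z hz).toLp 2 volume) =
      (gauss h (γ + ∑ k, (-(I / 2) * X k * P k - ξ k * X k - z k / 2 * X k ^ 2))
        (fun k => ξ k + I * P k + z k * X k) z hz).toLp 2 volume := by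
  refine Lp.ext ?_
  filter_upwards [coeFn_displace δ ((gauss h γ ξ z hz).toLp 2 volume),
    ae_comp_sub ((gauss h γ ξ z hz).coeFn_toLp 2 volume) (fun j => δ (.inl j)),
    SchwartzMap.coeFn_toLp (gauss h (γ + ∑ k, (-(I / 2) * X k * P k - ξ k * X k - z k / 2 * X k ^ 2))
        (fun k => ξ k + I * P k + z k * X k) z hz) 2 volume] with x h1 h2 h3
  rw [h1, h2, h3, gauss_apply, gauss_apply, ← Complex.exp_add]
  congr 1
  have e1 : ∑ j, δ (.inr j) * x j = ∑ k, P k * rotCoord O k x := by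
    rw [← sum_mul_rotCoord h]; simp only [hP]
  have e2 : ∑ j, δ (.inl j) * δ (.inr j) = ∑ k, X k * P k := by
    rw [← sum_mul_rotCoord h (fun j => δ (.inl j)) fun j => δ (.inr j)]; simp only [hX, hP]
  have e3 : ∀ k, rotCoord O k (fun j => x j - δ (.inl j)) = rotCoord O k x - X k := fun k => by
    rw [← hX, ← map_sub]; rfl
  rw [e1, e2, quadExp, quadExp]
  simp only [e3]
  push_cast
  rw [mul_sub, mul_left_comm I, Finset.mul_sum, Finset.mul_sum, Finset.mul_sum, add_assoc γ,
    ← Finset.sum_add_distrib, ← Finset.sum_sub_distrib, add_left_comm, ← Finset.sum_add_distrib]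
  congr 1
  exact Finset.sum_congr rfl fun k _ => by ring

/-! ### The classical oscillator -/

/-- Solutions of `C' = -μ S`, `S' = C` together with their antiderivatives. -/
structure IsOsc (μ : ℝ) (C S C₁ S₁ : ℝ → ℝ) : Prop where
  hasDerivAt_cos : ∀ t, HasDerivAt C (-μ * S t) t
  hasDerivAt_sin : ∀ t, HasDerivAt S (C t) t
  hasDerivAt_cos_int : ∀ t, HasDerivAt C₁ (C t) t
  hasDerivAt_sin_int : ∀ t, HasDerivAt S₁ (S t) t
  cos_zero : C 0 = 1
  sin_zero : S 0 = 0
  cos_int_zero : C₁ 0 = 0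
  sin_int_zero : S₁ 0 = 0
  sq_add : ∀ t, C t ^ 2 + μ * S t ^ 2 = 1

theorem isOsc_of_hasDerivAt {μ : ℝ} {C S : ℝ → ℝ} (hC : ∀ t, HasDerivAt C (-μ * S t) t)
    (hS : ∀ t, HasDerivAt S (C t) t) (hC0 : C 0 = 1) (hS0 : S 0 = 0) :
    IsOsc μ C S (fun t => ∫ s in (0 : ℝ)..t, C s) (fun t => ∫ s in (0 : ℝ)..t, S s) := by
  have cC : Continuous C := continuous_iff_continuousAt.2 fun t => (hC t).continuousAt
  have cS : Continuous S := continuous_iff_continuousAt.2 fun t => (hS t).continuousAt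
  refine ⟨hC, hS, fun t => cC.integral_hasStrictDerivAt 0 t |>.hasDerivAt,
    fun t => cS.integral_hasStrictDerivAt 0 t |>.hasDerivAt, hC0, hS0, by simp, by simp,
    fun t => ?_⟩
  have hd : ∀ t, HasDerivAt (fun t => C t ^ 2 + μ * S t ^ 2) 0 t := fun t => by
    refine (((hC t).pow 2).add (((hS t).pow 2).const_mul μ)).congr_deriv ?_
    push_cast
    ring
  have := is_const_of_deriv_eq_zero (fun t => (hd t).differentiableAt) (fun t => (hd t).deriv) t 0
  simpa [hC0, hS0] using this

/-- The coupling is arbitrary in the existence statement, so unstable modes with `μ ≤ 0` must be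
included. The explicit trigonometric form is used only in the rotating-wave regime, where `μ > 0`.
-/
theorem exists_isOsc (μ : ℝ) : ∃ C S C₁ S₁ : ℝ → ℝ, IsOsc μ C S C₁ S₁ ∧
    (0 < μ → ∀ t, C t = Real.cos (√μ * t) ∧ S t = Real.sin (√μ * t) / √μ) := by
  rcases lt_trichotomy μ 0 with hμ | rfl | hμ
  · set r := √(-μ) with hr
    have hr0 : 0 < r := Real.sqrt_pos.2 (by linarith)
    have hr2 : r * r = -μ := Real.mul_self_sqrt (by linarith)
    refine ⟨fun t => Real.cosh (r * t), fun t => Real.sinh (r * t) / r, _, _,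
      isOsc_of_hasDerivAt (fun t => ?_) (fun t => ?_) (by simp) (by simp),
      fun h => absurd h (by linarith)⟩
    · refine (((hasDerivAt_id t).const_mul r).cosh).congr_deriv ?_
      rw [← hr2]; field_simp; simp [mul_comm]
    · refine ((((hasDerivAt_id t).const_mul r).sinh).div_const r).congr_deriv ?_
      field_simp; simp
  · refine ⟨fun _ => 1, fun t => t, _, _,
      isOsc_of_hasDerivAt (fun t => ?_) (fun t => ?_) rfl rfl, fun h => absurd h (lt_irrefl _)⟩
    · simpa using hasDerivAt_const t (1 : ℝ)
    · exact hasDerivAt_id t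
  · set r := √μ with hr
    have hr0 : 0 < r := Real.sqrt_pos.2 hμ
    have hr2 : r * r = μ := Real.mul_self_sqrt hμ.le
    refine ⟨fun t => Real.cos (r * t), fun t => Real.sin (r * t) / r, _, _,
      isOsc_of_hasDerivAt (fun t => ?_) (fun t => ?_) (by simp) (by simp),
      fun _ t => ⟨rfl, rfl⟩⟩
    · refine (((hasDerivAt_id t).const_mul r).cos).congr_deriv ?_
      rw [← hr2]; field_simp; simp [mul_comm]
    · refine ((((hasDerivAt_id t).const_mul r).sin).div_const r).congr_deriv ?_
      field_simp; simp

/-- The parameters of a Gaussian solution starting from the vacuum. -/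
theorem IsOsc.exists_gauss_parameter {ω κ b : ℝ} {C S C₁ S₁ : ℝ → ℝ}
    (h : IsOsc (ω * (ω + κ)) C S C₁ S₁) :
    ∃ z ξ : ℝ → ℂ, (∀ t, 0 < (z t).re) ∧ z 0 = 1 ∧ ξ 0 = 0 ∧
      (∀ t, HasDerivAt z (I * (ω + κ - ω * z t ^ 2)) t) ∧
      ∀ t, HasDerivAt ξ (-I * (ω * z t * ξ t + b)) t := by
  -- The Riccati equation becomes linear for `z = m / q` with `q' = iωm` and `m' = i(ω+κ)q`. The
  -- conserved quantity `Re(m conj q) = C² + μS² = 1` keeps `q` away from zero and `Re z` positive;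
  -- `ξ q` is `-ib` times an antiderivative of `q`.
  set q : ℝ → ℂ := fun t => C t + I * ω * S t with hq
  set m : ℝ → ℂ := fun t => C t + I * (ω + κ) * S t with hm
  have hC := fun t => (h.hasDerivAt_cos t).ofReal_comp
  have hS := fun t => (h.hasDerivAt_sin t).ofReal_comp
  have hqd : ∀ t, HasDerivAt q (I * ω * m t) t := fun t => by
    refine ((hC t).add ((hS t).const_mul (I * ω))).congr_deriv ?_
    simp only [hm]
    push_cast
    linear_combination (-(ω : ℂ) * (ω + κ) * S t) * I_sq
  have hmd : ∀ t, HasDerivAt m (I * (ω + κ) * q t) t := fun t => by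
    refine ((hC t).add ((hS t).const_mul (I * (ω + κ)))).congr_deriv ?_
    simp only [hq]
    push_cast
    linear_combination (-(ω : ℂ) * (ω + κ) * S t) * I_sq
  have hre : ∀ t, (m t * conj (q t)).re = 1 := fun t => by
    rw [← h.sq_add t]
    simp [hq, hm]
    ring
  have hq0 : ∀ t, q t ≠ 0 := fun t e => by
    have := hre t
    simp [e] at this
  refine ⟨fun t => m t / q t, fun t => -I * b * (C₁ t + I * ω * S₁ t) / q t, fun t => ?_, ?_, ?_,
    fun t => ?_, fun t => ?_⟩
  · change 0 < (m t / q t).re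
    rw [div_eq_mul_inv, Complex.inv_def, ← mul_assoc, re_mul_ofReal, hre]
    have := normSq_pos.2 (hq0 t)
    positivity
  · simp [hq, hm, h.cos_zero, h.sin_zero]
  · simp [h.cos_int_zero, h.sin_int_zero]
  · refine ((hmd t).div (hqd t) (hq0 t)).congr_deriv ?_
    have := hq0 t
    field_simp
  · have h1 := ((h.hasDerivAt_cos_int t).ofReal_comp.add
      ((h.hasDerivAt_sin_int t).ofReal_comp.const_mul (I * ω))).const_mul (-I * (b : ℂ))
    refine (h1.div (hqd t) (hq0 t)).congr_deriv ?_
    have := hq0 t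
    have e : ((C t : ℝ) : ℂ) + I * ω * ((S t : ℝ) : ℂ) = q t := rfl
    simp only [Pi.add_apply]
    rw [e]
    field_simp
    ring

end Solutions

end

end GravLOCC

/-! ### The classical flow and its action on displacements -/

namespace GravLOCC

noncomputable section

open Complex
open scoped ComplexConjugate

variable {n : ℕ}

/-! ### Phase space in rotated coordinates -/

section PhaseSpace

open Matrix

variable (O : Matrix (Fin n) (Fin n) ℝ)

/-- Rotated position coordinates. -/
def posCoord (δ : Fin n ⊕ Fin n → ℝ) (k : Fin n) : ℝ := rotCoord O k fun j => δ (.inl j)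

/-- Rotated momentum coordinates. -/
def momCoord (δ : Fin n ⊕ Fin n → ℝ) (k : Fin n) : ℝ := rotCoord O k fun j => δ (.inr j)

/-- The phase space vector with given rotated coordinates. -/
def ofCoord (X P : Fin n → ℝ) : Fin n ⊕ Fin n → ℝ := Sum.elim (O *ᵥ X) (O *ᵥ P)

/-- The linear map acting on the `k`-th rotated coordinate pair by the `2 × 2` matrix with rows
`(a k, b k)` and `(c k, d k)`. -/
def blockMap (a b c d : Fin n → ℝ) (δ : Fin n ⊕ Fin n → ℝ) : Fin n ⊕ Fin n → ℝ :=
  ofCoord O (fun k => a k * posCoord O δ k + b k * momCoord O δ k)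
    (fun k => c k * posCoord O δ k + d k * momCoord O δ k)

variable {O}

theorem posCoord_add (δ δ' : Fin n ⊕ Fin n → ℝ) (k : Fin n) :
    posCoord O (δ + δ') k = posCoord O δ k + posCoord O δ' k :=
  map_add (rotCoord O k) (fun j => δ (.inl j)) (fun j => δ' (.inl j))

theorem momCoord_add (δ δ' : Fin n ⊕ Fin n → ℝ) (k : Fin n) :
    momCoord O (δ + δ') k = momCoord O δ k + momCoord O δ' k :=
  map_add (rotCoord O k) (fun j => δ (.inr j)) (fun j => δ' (.inr j))

theorem posCoord_ofCoord (h' : Oᵀ * O = 1) (X P : Fin n → ℝ) (k : Fin n) :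
    posCoord O (ofCoord O X P) k = X k := rotCoord_mulVec h' X k

theorem momCoord_ofCoord (h' : Oᵀ * O = 1) (X P : Fin n → ℝ) (k : Fin n) :
    momCoord O (ofCoord O X P) k = P k := rotCoord_mulVec h' P k

theorem ofCoord_coord (h : O * Oᵀ = 1) (δ : Fin n ⊕ Fin n → ℝ) :
    ofCoord O (posCoord O δ) (momCoord O δ) = δ := by
  ext i
  rcases i with j | j
  · exact congrFun (mulVec_rotCoord h fun j => δ (.inl j)) j
  · exact congrFun (mulVec_rotCoord h fun j => δ (.inr j)) j

theorem ext_coord (h : O * Oᵀ = 1) {δ δ' : Fin n ⊕ Fin n → ℝ}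
    (hX : ∀ k, posCoord O δ k = posCoord O δ' k) (hP : ∀ k, momCoord O δ k = momCoord O δ' k) :
    δ = δ' := by
  rw [← ofCoord_coord h δ, ← ofCoord_coord h δ', funext hX, funext hP]

theorem symp_coord (h : O * Oᵀ = 1) (δ δ' : Fin n ⊕ Fin n → ℝ) :
    symp δ δ' = ∑ k, (momCoord O δ k * posCoord O δ' k - posCoord O δ k * momCoord O δ' k) := by
  rw [symp, Finset.sum_sub_distrib, Finset.sum_sub_distrib,
    ← sum_mul_rotCoord h (fun j => δ (.inr j)) fun j => δ' (.inl j),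
    ← sum_mul_rotCoord h (fun j => δ (.inl j)) fun j => δ' (.inr j)]
  rfl

theorem sum_sq_coord (h : O * Oᵀ = 1) (δ : Fin n ⊕ Fin n → ℝ) :
    ∑ i, δ i ^ 2 = ∑ k, (posCoord O δ k ^ 2 + momCoord O δ k ^ 2) := by
  rw [Fintype.sum_sum_type, Finset.sum_add_distrib, ← sum_rotCoord_sq h fun j => δ (.inl j),
    ← sum_rotCoord_sq h fun j => δ (.inr j)]
  rfl

section
variable {a b c d a' b' c' d' : Fin n → ℝ}

theorem posCoord_blockMap (h' : Oᵀ * O = 1) (δ : Fin n ⊕ Fin n → ℝ) (k : Fin n) :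
    posCoord O (blockMap O a b c d δ) k = a k * posCoord O δ k + b k * momCoord O δ k :=
  posCoord_ofCoord h' _ _ k

theorem momCoord_blockMap (h' : Oᵀ * O = 1) (δ : Fin n ⊕ Fin n → ℝ) (k : Fin n) :
    momCoord O (blockMap O a b c d δ) k = c k * posCoord O δ k + d k * momCoord O δ k :=
  momCoord_ofCoord h' _ _ k

theorem blockMap_add (h : O * Oᵀ = 1) (h' : Oᵀ * O = 1) (δ δ' : Fin n ⊕ Fin n → ℝ) :
    blockMap O a b c d (δ + δ') = blockMap O a b c d δ + blockMap O a b c d δ' := by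
  refine ext_coord h (fun k => ?_) fun k => ?_
  · simp only [posCoord_add, posCoord_blockMap h', momCoord_add]; ring
  · simp only [posCoord_add, momCoord_blockMap h', momCoord_add]; ring

theorem symp_blockMap (h : O * Oᵀ = 1) (h' : Oᵀ * O = 1) (hdet : ∀ k, a k * d k - b k * c k = 1)
    (δ δ' : Fin n ⊕ Fin n → ℝ) :
    symp (blockMap O a b c d δ) (blockMap O a b c d δ') = symp δ δ' := by
  rw [symp_coord h, symp_coord h δ δ']
  refine Finset.sum_congr rfl fun k _ => ?_
  rw [posCoord_blockMap h', posCoord_blockMap h', momCoord_blockMap h', momCoord_blockMap h']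
  linear_combination (momCoord O δ k * posCoord O δ' k - posCoord O δ k * momCoord O δ' k) * hdet k

theorem blockMap_blockMap (h : O * Oᵀ = 1) (h' : Oᵀ * O = 1) (δ : Fin n ⊕ Fin n → ℝ) :
    blockMap O a b c d (blockMap O a' b' c' d' δ) =
      blockMap O (fun k => a k * a' k + b k * c' k) (fun k => a k * b' k + b k * d' k)
        (fun k => c k * a' k + d k * c' k) (fun k => c k * b' k + d k * d' k) δ := by
  refine ext_coord h (fun k => ?_) fun k => ?_
  · simp only [posCoord_blockMap h', momCoord_blockMap h']; ring
  · simp only [posCoord_blockMap h', momCoord_blockMap h']; ring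

theorem blockMap_one (h : O * Oᵀ = 1) (h' : Oᵀ * O = 1) (δ : Fin n ⊕ Fin n → ℝ) :
    blockMap O (fun _ => 1) (fun _ => 0) (fun _ => 0) (fun _ => 1) δ = δ := by
  refine ext_coord h (fun k => ?_) fun k => ?_
  · simp [posCoord_blockMap h']
  · simp [momCoord_blockMap h']

end

end PhaseSpace

/-! ### The evolution acts on displacements by the classical flow -/

section Flow

open Matrix

variable {O : Matrix (Fin n) (Fin n) ℝ} {κ : Fin n → ℝ} (A : Oscillators n)

theorem toLp_gauss_add (h : O * Oᵀ = 1) (γ c : ℂ) (ξ z : Fin n → ℂ) (hz : ∀ k, 0 < (z k).re) :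
    (gauss h (γ + c) ξ z hz).toLp 2 volume = cexp c • (gauss h γ ξ z hz).toLp 2 volume := by
  refine Lp.ext ?_
  filter_upwards [(gauss h (γ + c) ξ z hz).coeFn_toLp 2 volume,
    (gauss h γ ξ z hz).coeFn_toLp 2 volume,
    Lp.coeFn_smul (cexp c) ((gauss h γ ξ z hz).toLp 2 volume)] with x h1 h2 h3
  rw [h1, h3, Pi.smul_apply, h2, gauss_apply, gauss_apply, smul_eq_mul, ← Complex.exp_add]
  congr 1
  simp only [quadExp]
  ring

theorem toLp_gauss_one (h : O * Oᵀ = 1) {z : Fin n → ℂ} (hz : ∀ k, 0 < (z k).re)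
    (hz1 : ∀ k, z k = 1) :
    ∃ c : ℂ, c ≠ 0 ∧ (gauss h 0 (fun _ => 0) z hz).toLp 2 volume = c • vacuum n := by
  have hp : (Real.pi ^ (-(1 / 4) : ℝ)) ≠ 0 := (Real.rpow_pos_of_pos Real.pi_pos _).ne'
  have hpc : ((Real.pi ^ (-(1 / 4) : ℝ) : ℝ) : ℂ) ^ n ≠ 0 := pow_ne_zero _ (by exact_mod_cast hp)
  refine ⟨(((Real.pi ^ (-(1 / 4) : ℝ) : ℝ) : ℂ) ^ n)⁻¹, inv_ne_zero hpc, Lp.ext ?_⟩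
  filter_upwards [(gauss h 0 (fun _ => 0) z hz).coeFn_toLp 2 volume, coeFn_vacuum (n := n),
    Lp.coeFn_smul ((((Real.pi ^ (-(1 / 4) : ℝ) : ℝ) : ℂ) ^ n)⁻¹) (vacuum n)] with x h1 h2 h3
  rw [h1, h3, Pi.smul_apply, h2, gauss_apply, smul_eq_mul, eq_inv_mul_iff_mul_eq₀ hpc]
  simp only [vacuumFun, quadExp, hz1]
  push_cast
  rw [Finset.prod_mul_distrib, Finset.prod_const, Finset.card_univ, Fintype.card_fin,
    ← Complex.exp_sum]
  congr 2
  have e : ∑ k, (rotCoord O k x : ℂ) ^ 2 = ∑ j, (x j : ℂ) ^ 2 := by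
    exact_mod_cast sum_rotCoord_sq h x
  rw [← Finset.sum_div, Finset.sum_neg_distrib, ← e, zero_add, ← Finset.sum_neg_distrib,
    Finset.sum_div]
  exact Finset.sum_congr rfl fun k _ => by ring

/-- The classical flow. -/
def flow (O : Matrix (Fin n) (Fin n) ℝ) (κ : Fin n → ℝ) (ω : ℝ) (C S : Fin n → ℝ → ℝ) (t : ℝ) :
    (Fin n ⊕ Fin n → ℝ) → (Fin n ⊕ Fin n → ℝ) :=
  blockMap O (fun k => C k t) (fun k => ω * S k t) (fun k => -((ω + κ k) * S k t)) fun k => C k t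

/-- The phase accumulated along the classical flow. -/
def flowPhase (O : Matrix (Fin n) (Fin n) ℝ) (ω : ℝ) (b : Fin n → ℝ) (C₁ S₁ : Fin n → ℝ → ℝ)
    (t : ℝ) (δ : Fin n ⊕ Fin n → ℝ) : ℝ :=
  -∑ k, b k * (posCoord O δ k * C₁ k t + ω * momCoord O δ k * S₁ k t)

variable {C S C₁ S₁ : Fin n → ℝ → ℝ}

/-- Displacing the packet `u` along the flow of the homogeneous quadratic part gives another
solution once a phase is attached; the linear term of the potential contributes to the displaced
solution only that phase, whose rate is `-∑ b X`. One `u` serves all `δ`. -/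
theorem Oscillators.exists_displaced_solution (h : O * Oᵀ = 1) (h' : Oᵀ * O = 1)
    (hg : A.coupling = O * diagonal κ * Oᵀ)
    (hosc : ∀ k, IsOsc (A.ω * (A.ω + κ k)) (C k) (S k) (C₁ k) (S₁ k)) :
    ∃ u : ℝ → Modes n, (∃ c : ℂ, c ≠ 0 ∧ u 0 = c • vacuum n) ∧ ∀ δ, ∃ v : ℝ → 𝓢(Fin n → ℝ, ℂ),
      IsSolution (fun φ : 𝓢(Fin n → ℝ, ℂ) => φ.toLp 2 volume) A.gen v ∧
      ∀ t, (v t).toLp 2 volume =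
        cexp (I * (flowPhase O A.ω (fun k => rotCoord O k A.slope) C₁ S₁ t δ : ℂ)) •
          displace (flow O κ A.ω C S t δ) (u t) := by
  have hpar := fun k => (hosc k).exists_gauss_parameter (b := rotCoord O k A.slope)
  choose z ξ hz hz0 hξ0 hzd hξd using hpar
  have hzc : ∀ k, Continuous (z k) := fun k =>
    continuous_iff_continuousAt.2 fun t => (hzd k t).continuousAt
  have hξc : ∀ k, Continuous (ξ k) := fun k =>
    continuous_iff_continuousAt.2 fun t => (hξd k t).continuousAt
  set γ' : ℝ → ℂ := fun t => -I * (((A.potential 0 / A.hbar : ℝ) : ℂ) +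
      A.ω / 2 * ∑ k, (z k t - ξ k t ^ 2)) with hγ'
  have hγc : Continuous γ' := by fun_prop
  set γ : ℝ → ℂ := fun t => ∫ s in (0 : ℝ)..t, γ' s with hγ
  have hγd : ∀ t, HasDerivAt γ (γ' t) t := fun t => (hγc.integral_hasStrictDerivAt 0 t).hasDerivAt
  refine ⟨fun t => (gauss h (γ t) (fun k => ξ k t) (fun k => z k t) fun k => hz k t).toLp 2 volume,
    ?_, fun δ => ?_⟩
  · obtain ⟨c, hc, e⟩ := toLp_gauss_one h (z := fun k => z k 0) (fun k => hz k 0) hz0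
    refine ⟨c, hc, ?_⟩
    rw [← e]
    have : γ 0 = 0 := by simp [hγ]
    simp only [this, hξ0]
  set X : Fin n → ℝ → ℝ := fun k t => C k t * posCoord O δ k + A.ω * S k t * momCoord O δ k with hX
  set P : Fin n → ℝ → ℝ := fun k t =>
    -((A.ω + κ k) * S k t) * posCoord O δ k + C k t * momCoord O δ k with hP
  have hXd : ∀ k t, HasDerivAt (fun s => (X k s : ℂ)) (A.ω * P k t) t := fun k t => by
    have := (((hosc k).hasDerivAt_cos t).mul_const (posCoord O δ k)).add
      ((((hosc k).hasDerivAt_sin t).const_mul A.ω).mul_const (momCoord O δ k))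
    refine (HasDerivAt.ofReal_comp this).congr_deriv ?_
    simp only [hP]
    push_cast
    ring
  have hPd : ∀ k t, HasDerivAt (fun s => (P k s : ℂ)) (-(A.ω + κ k) * X k t) t := fun k t => by
    have := ((((hosc k).hasDerivAt_sin t).const_mul (A.ω + κ k)).neg.mul_const
      (posCoord O δ k)).add (((hosc k).hasDerivAt_cos t).mul_const (momCoord O δ k))
    refine (HasDerivAt.ofReal_comp this).congr_deriv ?_
    simp only [hX]
    push_cast
    ring
  set τ := fun t => flowPhase O A.ω (fun k => rotCoord O k A.slope) C₁ S₁ t δ with hτ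
  have hτd : ∀ t, HasDerivAt (fun s => (τ s : ℂ)) (-∑ k, (rotCoord O k A.slope : ℂ) * X k t) t := by
    intro t
    have : HasDerivAt τ (-∑ k, rotCoord O k A.slope * X k t) t := by
      refine HasDerivAt.neg (HasDerivAt.fun_sum fun k _ => HasDerivAt.const_mul _ ?_)
      refine ((((hosc k).hasDerivAt_cos_int t).const_mul (posCoord O δ k)).add
        (((hosc k).hasDerivAt_sin_int t).const_mul (A.ω * momCoord O δ k))).congr_deriv ?_
      simp only [hX]
      ring
    refine this.ofReal_comp.congr_deriv ?_
    push_cast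
    rfl
  -- The parameters that `displace_gauss` gives for the displaced packet, with the phase `I * τ`
  -- added to the constant term.
  refine ⟨fun t => gauss h (γ t + ∑ k, (-(I / 2) * X k t * P k t - ξ k t * X k t -
    z k t / 2 * X k t ^ 2) + I * τ t) (fun k => ξ k t + I * P k t + z k t * X k t)
    (fun k => z k t) fun k => hz k t, ?_, fun t => ?_⟩
  · refine A.isSolution_gauss h h' hg (fun t k => hz k t) (fun t => ?_) (fun t k => ?_)
      fun t k => hzd k t
    · have hs : HasDerivAt (fun t => ∑ k, (-(I / 2) * X k t * P k t - ξ k t * X k t -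
          z k t / 2 * X k t ^ 2)) (∑ k, (A.ω / 2 * I * ((ξ k t + I * P k t + z k t * X k t) ^ 2 -
            ξ k t ^ 2) + I * rotCoord O k A.slope * X k t)) t := by
        refine HasDerivAt.fun_sum fun k _ => ?_
        refine (((((hXd k t).const_mul (-(I / 2))).mul (hPd k t)).sub
          ((hξd k t).mul (hXd k t))).sub
          (((hzd k t).div_const 2).mul ((hXd k t).pow 2))).congr_deriv ?_
        simp only [Pi.pow_apply, Nat.add_one_sub_one, pow_one, Nat.cast_ofNat]
        linear_combination (-(A.ω / 2 * I * P k t ^ 2) - A.ω * (ξ k t + z k t * X k t) * P k t) * I_sq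
      refine (((hγd t).add hs).add ((hτd t).const_mul I)).congr_deriv ?_
      simp only [hγ']
      rw [Finset.sum_add_distrib, mul_neg, Finset.mul_sum (f := fun k => (rotCoord O k A.slope : ℂ) * X k t),
        add_assoc, add_assoc, ← sub_eq_add_neg, ← Finset.sum_sub_distrib]
      rw [Finset.sum_eq_zero (f := fun k => I * (rotCoord O k A.slope : ℂ) * (X k t : ℂ) -
        I * ((rotCoord O k A.slope : ℂ) * X k t)) fun k _ => by ring, add_zero, ← Finset.mul_sum,
        Finset.sum_sub_distrib, Finset.sum_sub_distrib, Finset.sum_sub_distrib]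
      ring
    · refine (((hξd k t).add ((hPd k t).const_mul I)).add ((hzd k t).mul (hXd k t))).congr_deriv ?_
      linear_combination (A.ω * z k t * P k t : ℂ) * I_sq
  · rw [toLp_gauss_add, displace_gauss h (γ t) (fun k => ξ k t) (fun k => z k t)
      (fun k => hz k t) (flow O κ A.ω C S t δ) (X := fun k => X k t) (P := fun k => P k t)
      (fun k => posCoord_blockMap h' δ k) (fun k => momCoord_blockMap h' δ k)]

theorem flow_zero (h : O * Oᵀ = 1) (h' : Oᵀ * O = 1) {ω : ℝ}
    (hosc : ∀ k, IsOsc (ω * (ω + κ k)) (C k) (S k) (C₁ k) (S₁ k)) (δ : Fin n ⊕ Fin n → ℝ) :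
    flow O κ ω C S 0 δ = δ := by
  simp only [flow, (hosc _).cos_zero, (hosc _).sin_zero, mul_zero, neg_zero]
  exact blockMap_one h h' δ

theorem flowPhase_zero {ω : ℝ} {b : Fin n → ℝ}
    (hosc : ∀ k, IsOsc (ω * (ω + κ k)) (C k) (S k) (C₁ k) (S₁ k)) (δ : Fin n ⊕ Fin n → ℝ) :
    flowPhase O ω b C₁ S₁ 0 δ = 0 := by
  simp [flowPhase, (hosc _).cos_int_zero, (hosc _).sin_int_zero]

theorem flowPhase_add {ω : ℝ} {b : Fin n → ℝ} (t : ℝ) (δ δ' : Fin n ⊕ Fin n → ℝ) :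
    flowPhase O ω b C₁ S₁ t (δ + δ') =
      flowPhase O ω b C₁ S₁ t δ + flowPhase O ω b C₁ S₁ t δ' := by
  simp only [flowPhase, posCoord_add, momCoord_add]
  rw [← neg_add, ← Finset.sum_add_distrib]
  congr 1
  exact Finset.sum_congr rfl fun k _ => by ring

theorem symp_flow (h : O * Oᵀ = 1) (h' : Oᵀ * O = 1) {ω : ℝ}
    (hosc : ∀ k, IsOsc (ω * (ω + κ k)) (C k) (S k) (C₁ k) (S₁ k)) (t : ℝ)
    (δ δ' : Fin n ⊕ Fin n → ℝ) :
    symp (flow O κ ω C S t δ) (flow O κ ω C S t δ') = symp δ δ' :=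
  symp_blockMap h h' (fun k => by linear_combination (hosc k).sq_add t) δ δ'

/-- Totality of the initial values is totality of coherent states: at time zero the flow is the
identity, the phase vanishes and the packet is a multiple of the vacuum. -/
theorem Oscillators.existsUnique_isEvolution :
    ∃! V : ℝ → (Modes n ≃ₗᵢ[ℂ] Modes n), A.IsEvolution V := by
  obtain ⟨O, κ, h', h, hg, -⟩ := exists_diagonalization A.coupling_isSymm
  choose C S C₁ S₁ hosc using fun k => exists_isOsc (A.ω * (A.ω + κ k))
  obtain ⟨u, ⟨c, hc, hu0⟩, hsol⟩ := A.exists_displaced_solution h h' hg fun k => (hosc k).1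
  simp only [A.isEvolution_iff]
  refine existsUnique_isGroupOf A.gen_skew fun ψ hψ => total_coherent ψ fun α => ?_
  obtain ⟨v, hv, he⟩ := hsol (ph α)
  have h1 := hψ ⟨v, hv⟩
  simp only [he, flow_zero h h' fun k => (hosc k).1, flowPhase_zero fun k => (hosc k).1, hu0,
    displace_smul_right, ← coherent_eq] at h1
  simpa [inner_smul_left, hc] using h1

/-- The evolution is, up to a displacement, the Gaussian unitary of the classical flow. -/
theorem Oscillators.IsEvolution.map_displace {A : Oscillators n}
    {V : ℝ → (Modes n ≃ₗᵢ[ℂ] Modes n)} (hV : A.IsEvolution V) (h : O * Oᵀ = 1) (h' : Oᵀ * O = 1)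
    (hg : A.coupling = O * diagonal κ * Oᵀ)
    (hosc : ∀ k, IsOsc (A.ω * (A.ω + κ k)) (C k) (S k) (C₁ k) (S₁ k)) (t : ℝ)
    (δ : Fin n ⊕ Fin n → ℝ) (ψ : Modes n) : V t (displace δ ψ) =
      cexp (I * (flowPhase O A.ω (fun k => rotCoord O k A.slope) C₁ S₁ t δ : ℂ)) •
        displace (flow O κ A.ω C S t δ) (V t ψ) := by
  obtain ⟨u, ⟨c, hc, hu0⟩, hsol⟩ := A.exists_displaced_solution h h' hg hosc
  set τ := flowPhase O A.ω (fun k => rotCoord O k A.slope) C₁ S₁ t with hτ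
  -- On displaced vacua the relation is the explicit solution. The Weyl relation then spreads it to
  -- coherent states because the flow is additive and symplectic and the phase is additive.
  obtain ⟨w, hvac⟩ : ∃ w, ∀ δ, V t (displace δ (vacuum n)) =
      cexp (I * (τ δ : ℂ)) • displace (flow O κ A.ω C S t δ) w := by
    refine ⟨c⁻¹ • u t, fun δ => ?_⟩
    obtain ⟨v, hv, he⟩ := hsol δ
    have h1 := ((A.isEvolution_iff V).1 hV).apply_solution hv t
    simp only [he, flow_zero h h' hosc, flowPhase_zero hosc, hu0, displace_smul_right,
      ofReal_zero, mul_zero, Complex.exp_zero, one_smul, map_smul] at h1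
    rw [displace_smul_right, smul_comm, ← h1, smul_smul, inv_mul_cancel₀ hc, one_smul]
  have key : ((V t).toContinuousLinearEquiv : Modes n →L[ℂ] Modes n) ∘L
      ((dispLIE δ).toContinuousLinearEquiv : Modes n →L[ℂ] Modes n) =
      cexp (I * (τ δ : ℂ)) •
        (((dispLIE (flow O κ A.ω C S t δ)).toContinuousLinearEquiv : Modes n →L[ℂ] Modes n) ∘L
          ((V t).toContinuousLinearEquiv : Modes n →L[ℂ] Modes n)) := by
    refine total_coherent.ext_clm fun α => ?_
    change V t (displace δ (coherent α)) =
      cexp (I * (τ δ : ℂ)) • displace (flow O κ A.ω C S t δ) (V t (coherent α))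
    have e1 : τ (δ + ph α) = τ δ + τ (ph α) := flowPhase_add t δ (ph α)
    have e2 : flow O κ A.ω C S t (δ + ph α) = flow O κ A.ω C S t δ + flow O κ A.ω C S t (ph α) :=
      blockMap_add h h' δ (ph α)
    rw [coherent_eq, displace_displace, map_smul, hvac, hvac, displace_smul_right,
      displace_displace, symp_flow h h' hosc, e1, e2]
    simp only [smul_smul, ← Complex.exp_add]
    congr 2
    push_cast
    ring
  exact congrArg (fun f : Modes n →L[ℂ] Modes n => f ψ) key

theorem displace_comm (δ δ' : Fin n ⊕ Fin n → ℝ) (ψ : Modes n) :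
    displace δ (displace δ' ψ) =
      cexp (I * (symp δ δ' : ℂ)) • displace δ' (displace δ ψ) := by
  rw [displace_displace, displace_displace, add_comm δ' δ, smul_smul, ← Complex.exp_add]
  congr 2
  have : symp δ' δ = -symp δ δ' := by
    rw [symp, symp, ← Finset.sum_neg_distrib]
    exact Finset.sum_congr rfl fun j _ => by ring
  rw [this]
  push_cast
  ring

/-- The accumulated phase is linear in `δ`, hence a symplectic pairing of a fixed vector with the
transported `δ`. Commuting a displacement by that vector past the transported one produces the
opposite phase. -/
theorem Oscillators.IsEvolution.exists_displace {A : Oscillators n}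
    {V : ℝ → (Modes n ≃ₗᵢ[ℂ] Modes n)} (hV : A.IsEvolution V) (h : O * Oᵀ = 1) (h' : Oᵀ * O = 1)
    (hg : A.coupling = O * diagonal κ * Oᵀ)
    (hosc : ∀ k, IsOsc (A.ω * (A.ω + κ k)) (C k) (S k) (C₁ k) (S₁ k)) (t : ℝ) :
    ∃ η, ∀ δ ψ, displace η (V t (displace δ ψ)) =
      displace (flow O κ A.ω C S t δ) (displace η (V t ψ)) := by
  set b := fun k => rotCoord O k A.slope with hb
  -- The vector is found by inverting the flow in each mode; `C² + μS² = 1` is the determinant of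
  -- the block.
  refine ⟨-ofCoord O (fun k => b k * A.ω * (C k t * S₁ k t - S k t * C₁ k t))
    (fun k => -b k * (C k t * C₁ k t + A.ω * (A.ω + κ k) * S k t * S₁ k t)), fun δ ψ => ?_⟩
  rw [hV.map_displace h h' hg hosc, displace_smul_right, displace_comm, smul_smul,
    ← Complex.exp_add]
  convert one_smul ℂ _ using 2
  rw [← mul_add, ← ofReal_add]
  have : flowPhase O A.ω b C₁ S₁ t δ + symp (-ofCoord O
      (fun k => b k * A.ω * (C k t * S₁ k t - S k t * C₁ k t))
      (fun k => -b k * (C k t * C₁ k t + A.ω * (A.ω + κ k) * S k t * S₁ k t)))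
      (flow O κ A.ω C S t δ) = 0 := by
    have e : ∀ δ₁ δ₂ : Fin n ⊕ Fin n → ℝ, symp (-δ₁) δ₂ = -symp δ₁ δ₂ := fun δ₁ δ₂ => by
      rw [symp, symp, ← Finset.sum_neg_distrib]
      exact Finset.sum_congr rfl fun j _ => by simp only [Pi.neg_apply]; ring
    rw [e, symp_coord h, flowPhase, ← neg_add, ← Finset.sum_add_distrib, neg_eq_zero]
    refine Finset.sum_eq_zero fun k _ => ?_
    rw [posCoord_ofCoord h', momCoord_ofCoord h', flow, posCoord_blockMap h', momCoord_blockMap h']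
    linear_combination (-(b k) * (posCoord O δ k * C₁ k t + A.ω * momCoord O δ k * S₁ k t)) *
      (hosc k).sq_add t
  rw [this]
  simp

end Flow

end

end GravLOCC

/-! ### Local corrections and the estimates for the rotating-wave approximation -/

namespace GravLOCC

noncomputable section

open Complex
open scoped ComplexConjugate

variable {n : ℕ}

/-! ### Local displacements and phases -/

theorem exists_phase {H : Type*} [NormedAddCommGroup H] [InnerProductSpace ℂ H] [CompleteSpace H]
    {c : ℂ} (hc : ‖c‖ = 1) : ∃ U : H ≃ₗᵢ[ℂ] H, ∀ ψ, U ψ = c • ψ := by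
  have hcc : conj c * c = 1 := by
    rw [← Complex.normSq_eq_conj_mul_self, Complex.normSq_eq_norm_sq, hc]; simp
  have hc0 : c ≠ 0 := fun e => by simp [e] at hc
  refine exists_isometryEquiv_of_gram (e := fun ψ : H => ψ) (f := fun ψ : H => c • ψ)
    (fun ψ h => inner_self_eq_zero.1 (h ψ)) (fun ψ h => ?_) fun φ ψ => ?_
  · have := h ψ
    rw [inner_smul_left, mul_eq_zero] at this
    rcases this with h1 | h1
    · exact absurd h1 (by simpa using hc0)
    · exact inner_self_eq_zero.1 h1
  · rw [inner_smul_left, inner_smul_right, ← mul_assoc, hcc, one_mul]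

theorem tensor_update_smul (f : Fin n → Mode) (j : Fin n) (c : ℂ) :
    tensor (Function.update f j (c • f j)) = c • tensor f := by
  refine Lp.ext ?_
  have h : ∀ i, Function.update f j (c • f j) i =ᵐ[volume]
      fun x => (if i = j then c else 1) * f i x := fun i => by
    by_cases hi : i = j
    · subst hi
      filter_upwards [Lp.coeFn_smul c (f i)] with x hx
      simp [hx]
    · simp [hi]
  filter_upwards [coeFn_tensor_of_ae h, coeFn_tensor f, Lp.coeFn_smul c (tensor f)] with x h1 h2 h3
  rw [h1, h3, Pi.smul_apply, h2, Finset.prod_mul_distrib, Finset.prod_ite_eq' Finset.univ j]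
  simp

/-- The phase is carried by one mode, so there must be a mode. -/
theorem IsLocalUnitary.exists_smul (hn : 0 < n) {W : Modes n ≃ₗᵢ[ℂ] Modes n}
    (hW : IsLocalUnitary W) {c : ℂ} (hc : ‖c‖ = 1) :
    ∃ W' : Modes n ≃ₗᵢ[ℂ] Modes n, IsLocalUnitary W' ∧ ∀ ψ, W' ψ = c • W ψ := by
  obtain ⟨w, hw⟩ := hW
  obtain ⟨u, hu⟩ := exists_phase (H := Mode) hc
  obtain ⟨Y, hY⟩ := exists_phase (H := Modes n) hc
  let j : Fin n := ⟨0, hn⟩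
  refine ⟨W.trans Y, ⟨Function.update w j ((w j).trans u), fun f => ?_⟩, fun ψ => hY _⟩
  change Y (W (tensor f)) = _
  rw [hY, hw, ← tensor_update_smul _ j]
  congr 1
  ext1 i
  by_cases hi : i = j
  · subst hi
    simp [hu]
  · simp [hi]

theorem exists_mode_displacement (z : ℂ) : ∃ u : Mode ≃ₗᵢ[ℂ] Mode, ∀ a,
    u (coh a) = cexp (I * ((z * conj a).im : ℂ)) • coh (z + a) := by
  refine exists_isometryEquiv_of_gram total_coh (fun ψ hψ => total_coh ψ fun a => ?_)
    fun a b => ?_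
  · have := hψ (a - z)
    rw [add_sub_cancel, inner_smul_left, mul_eq_zero] at this
    rcases this with h | h
    · exact absurd h (by simp)
    · exact h
  · rw [inner_smul_left, inner_smul_right, inner_coh, inner_coh, ← Complex.exp_conj,
      ← Complex.exp_add, ← Complex.exp_add]
    congr 1
    simp only [map_mul, conj_I, conj_ofReal, ← Complex.normSq_eq_norm_sq, ← Complex.mul_conj,
      map_add]
    have him : ∀ w : ℂ, I * (w.im : ℂ) = (w - conj w) / 2 := fun w => by
      rw [Complex.sub_conj]; push_cast; ring
    rw [neg_mul, him, him]
    simp only [map_mul, conj_conj]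
    ring

/-- On coherent states the displacement and the product of one-mode displacements agree, since the
one-mode Weyl phases multiply to the full one. -/
theorem isLocalUnitary_dispLIE (δ : Fin n ⊕ Fin n → ℝ) : IsLocalUnitary (dispLIE δ) := by
  choose u hu using fun j => exists_mode_displacement (phInv δ j)
  obtain ⟨W, hW⟩ := exists_tensor_unitary u
  have key : ((dispLIE δ).toContinuousLinearEquiv : Modes n →L[ℂ] Modes n) =
      (W.toContinuousLinearEquiv : Modes n →L[ℂ] Modes n) := by
    refine total_coherent.ext_clm fun α => ?_
    change displace δ (coherent α) = W (coherent α)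
    rw [coherent_eq_tensor, hW, ← coherent_eq_tensor, ← ph_phInv δ, displace_coherent]
    refine Lp.ext ?_
    have h : ∀ j, u j (coh (α j)) =ᵐ[volume]
        fun x => cexp (I * ((phInv δ j * conj (α j)).im : ℂ)) * coh (phInv δ j + α j) x := fun j => by
      filter_upwards [Lp.coeFn_smul (cexp (I * ((phInv δ j * conj (α j)).im : ℂ)))
        (coh (phInv δ j + α j))] with x hx
      rw [hu, hx]
      rfl
    filter_upwards [coeFn_tensor_of_ae h, Lp.coeFn_smul (cexp (I * ((∑ j, (phInv δ j *
      conj (α j)).im : ℝ) : ℂ))) (coherent (phInv δ + α)),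
      coeFn_tensor fun j => coh (phInv δ j + α j)] with x h1 h2 h3
    rw [h1, h2, Pi.smul_apply, coherent_eq_tensor]
    simp only [Pi.add_apply]
    rw [h3, Finset.prod_mul_distrib, ← Complex.exp_sum, ← Finset.mul_sum, ofReal_sum, smul_eq_mul]
  refine ⟨u, fun f => ?_⟩
  rw [← hW]
  exact congrArg (fun F : Modes n →L[ℂ] Modes n => F (tensor f)) key

/-! ### The effective matrix and the rotations in rotated coordinates -/

section Blocks

open Matrix

variable {O : Matrix (Fin n) (Fin n) ℝ} {κ : Fin n → ℝ}

theorem conj_diagonal_mulVec (f : Fin n → ℝ) (x : Fin n → ℝ) :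
    (O * diagonal f * Oᵀ) *ᵥ x = O *ᵥ fun k => f k * rotCoord O k x := by
  have h2 : Oᵀ *ᵥ x = fun k => rotCoord O k x := by
    ext k
    rw [rotCoord_apply]
    rfl
  rw [← mulVec_mulVec, ← mulVec_mulVec, h2]
  congr 1
  ext k
  rw [mulVec_diagonal]

theorem Seff_mulVec_eq_blockMap {g : Matrix (Fin n) (Fin n) ℝ} (hs : g.IsSymm)
    (hcfc : ∀ f : ℝ → ℝ, cfc f g = O * diagonal (fun j => f (κ j)) * Oᵀ) (t : ℝ)
    (δ : Fin n ⊕ Fin n → ℝ) : (Seff (t • g)).mulVec δ =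
      blockMap O (fun k => Real.cos (κ k * t / 2)) (fun k => Real.sin (κ k * t / 2))
        (fun k => -Real.sin (κ k * t / 2)) (fun k => Real.cos (κ k * t / 2)) δ := by
  have hsa : IsSelfAdjoint g := by
    rw [IsSelfAdjoint, star_eq_conjTranspose, conjTranspose_eq_transpose_of_trivial]
    exact hs
  have e : ∀ f : ℝ → ℝ, Continuous f → cfc f ((1 / 2 : ℝ) • t • g) =
      O * diagonal (fun k => f (κ k * t / 2)) * Oᵀ := fun f hf => by
    rw [smul_smul, ← cfc_comp_const_mul (1 / 2 * t) f g hf.continuousOn hsa, hcfc]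
    congr 3
    ext k
    congr 1
    ring
  have hadd : ∀ u v : Fin n → ℝ, O *ᵥ u + O *ᵥ v = O *ᵥ fun k => u k + v k := fun u v =>
    (mulVec_add O u v).symm
  rw [Seff, e _ Real.continuous_cos, e _ Real.continuous_sin, fromBlocks_mulVec, neg_mulVec,
    conj_diagonal_mulVec, conj_diagonal_mulVec, conj_diagonal_mulVec, conj_diagonal_mulVec,
    ← mulVec_neg, hadd, hadd]
  simp only [Pi.neg_apply, ← neg_mul]
  rfl

theorem ph_exp_smul (h : O * Oᵀ = 1) (h' : Oᵀ * O = 1) (χ : ℝ) (z : Fin n → ℂ) :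
    ph (cexp (χ * I) • z) = blockMap O (fun _ => Real.cos χ) (fun _ => -Real.sin χ)
      (fun _ => Real.sin χ) (fun _ => Real.cos χ) (ph z) := by
  have hre : ∀ j, (cexp (χ * I) * z j).re = Real.cos χ * (z j).re - Real.sin χ * (z j).im := by
    intro j
    rw [mul_re, exp_ofReal_mul_I_re, exp_ofReal_mul_I_im]
  have him : ∀ j, (cexp (χ * I) * z j).im = Real.cos χ * (z j).im + Real.sin χ * (z j).re := by
    intro j
    rw [mul_im, exp_ofReal_mul_I_re, exp_ofReal_mul_I_im]
  refine ext_coord h (fun k => ?_) fun k => ?_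
  · rw [posCoord_blockMap h']
    simp only [posCoord, momCoord, rotCoord_apply, ph, Sum.elim_inl, Sum.elim_inr, Pi.smul_apply,
      smul_eq_mul, hre, Finset.mul_sum, ← Finset.sum_add_distrib]
    exact Finset.sum_congr rfl fun j _ => by ring
  · rw [momCoord_blockMap h']
    simp only [posCoord, momCoord, rotCoord_apply, ph, Sum.elim_inl, Sum.elim_inr, Pi.smul_apply,
      smul_eq_mul, him, Finset.mul_sum, ← Finset.sum_add_distrib]
    exact Finset.sum_congr rfl fun j _ => by ring

/-- In each block the four entries deviate from the identity by at most `e`; each of the two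
coordinates then moves by at most `2e²(X² + P²)` in square, which adds up to `(2e)²`. -/
theorem sum_sq_blockMap_sub_le (h : O * Oᵀ = 1) (h' : Oᵀ * O = 1) {a b c d : Fin n → ℝ} {e : ℝ}
    (ha : ∀ k, |a k - 1| ≤ e) (hb : ∀ k, |b k| ≤ e) (hc : ∀ k, |c k| ≤ e)
    (hd : ∀ k, |d k - 1| ≤ e) (δ : Fin n ⊕ Fin n → ℝ) :
    ∑ i, (blockMap O a b c d δ i - δ i) ^ 2 ≤ (2 * e) ^ 2 * ∑ i, δ i ^ 2 := by
  have hsub : ∀ i, blockMap O a b c d δ i - δ i =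
      blockMap O (fun k => a k - 1) b c (fun k => d k - 1) δ i := by
    have : blockMap O a b c d δ = blockMap O (fun k => a k - 1) b c (fun k => d k - 1) δ + δ := by
      refine ext_coord h (fun k => ?_) fun k => ?_
      · rw [posCoord_add, posCoord_blockMap h', posCoord_blockMap h']; ring
      · rw [momCoord_add, momCoord_blockMap h', momCoord_blockMap h']; ring
    intro i
    rw [this, Pi.add_apply, add_sub_cancel_right]
  simp only [hsub]
  rw [sum_sq_coord h, sum_sq_coord h, Finset.mul_sum]
  refine Finset.sum_le_sum fun k _ => ?_
  rw [posCoord_blockMap h', momCoord_blockMap h']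
  set X := posCoord O δ k
  set P := momCoord O δ k
  have key : ∀ u v : ℝ, |u| ≤ e → |v| ≤ e → (u * X + v * P) ^ 2 ≤ 2 * e ^ 2 * (X ^ 2 + P ^ 2) := by
    intro u v hu hv
    have h1 := sq_le_sq' (abs_le.1 hu).1 (abs_le.1 hu).2
    have h2 := sq_le_sq' (abs_le.1 hv).1 (abs_le.1 hv).2
    nlinarith [sq_nonneg (u * X - v * P), mul_le_mul_of_nonneg_right h1 (sq_nonneg X),
      mul_le_mul_of_nonneg_right h2 (sq_nonneg P), mul_nonneg (sq_nonneg e) (sq_nonneg X),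
      mul_nonneg (sq_nonneg e) (sq_nonneg P)]
  linarith [key _ _ (ha k) (hb k), key _ _ (hc k) (hd k)]

theorem sum_sq_le_of_sub {ι : Type*} [Fintype ι] {x y : ι → ℝ} {r : ℝ} (hr : 0 ≤ r)
    (h : ∑ i, (y i - x i) ^ 2 ≤ r ^ 2 * ∑ i, x i ^ 2) :
    ∑ i, y i ^ 2 ≤ (1 + r) ^ 2 * ∑ i, x i ^ 2 := by
  have hx : 0 ≤ ∑ i, x i ^ 2 := Finset.sum_nonneg fun _ _ => sq_nonneg _
  rcases hr.eq_or_lt with rfl | hr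
  · have h0 : ∀ i, y i = x i := fun i => by
      have h1 : ∑ i, (y i - x i) ^ 2 = 0 :=
        le_antisymm (by simpa using h) (Finset.sum_nonneg fun _ _ => sq_nonneg _)
      have := (Finset.sum_eq_zero_iff_of_nonneg fun _ _ => sq_nonneg _).1 h1 i (Finset.mem_univ i)
      exact sub_eq_zero.1 (pow_eq_zero_iff two_ne_zero |>.1 this)
    simp [h0]
  · have hi : ∀ i, r * y i ^ 2 ≤ (1 + r) * (r * x i ^ 2 + (y i - x i) ^ 2) := fun i => by
      nlinarith [sq_nonneg (r * x i - (y i - x i))]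
    have hsum := Finset.sum_le_sum fun i (_ : i ∈ Finset.univ) => hi i
    rw [← Finset.mul_sum, ← Finset.mul_sum, Finset.sum_add_distrib, ← Finset.mul_sum] at hsum
    have h3 := mul_le_mul_of_nonneg_left h (by positivity : (0 : ℝ) ≤ 1 + r)
    refine le_of_mul_le_mul_left ?_ hr
    nlinarith

end Blocks

/-! ### The rotating-wave estimate for one mode -/

theorem abs_cos_sub_one_le (x : ℝ) : |Real.cos x - 1| ≤ |x| := by
  have h := Real.abs_cos_sub_cos_le x 0
  simpa using h

/-- With `r = κ/ω` and `s = √(1+r)` there are two sources of error. The squeezing replaces `sin N`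
by `sin N / s` or `s sin N`, which costs at most `2|r|`; the frequency `ωs` replaces `ω(1 + r/2)`,
which costs at most `|r||κt|/2` in phase. The four entries are those of the rotation by `χ` composed
with the flow of the mode. -/
theorem rotating_wave_estimate {ω κ t e : ℝ} (hω : 0 < ω) (hκ : |κ / ω| ≤ 1 / 2)
    (he : |κ / ω| * (3 + |κ * t| / 2) ≤ e) :
    0 < ω * (ω + κ) ∧ ∀ C S : ℝ, C = Real.cos (√(ω * (ω + κ)) * t) →
      S = Real.sin (√(ω * (ω + κ)) * t) / √(ω * (ω + κ)) → ∀ χ, χ = (ω + κ / 2) * t →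
      |Real.cos χ * C + Real.sin χ * ((ω + κ) * S) - 1| ≤ e ∧
      |Real.cos χ * (ω * S) - Real.sin χ * C| ≤ e ∧
      |Real.sin χ * C - Real.cos χ * ((ω + κ) * S)| ≤ e ∧
      |Real.sin χ * (ω * S) + Real.cos χ * C - 1| ≤ e := by
  set r := κ / ω with hr
  have hκr : κ = ω * r := by rw [hr]; field_simp
  have hr1 := abs_le.1 hκ
  set s := √(1 + r) with hs
  have hs2 : s * s = 1 + r := Real.mul_self_sqrt (by linarith)
  have hs0 : 1 / 2 ≤ s := Real.le_sqrt_of_sq_le (by nlinarith)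
  have hμ : ω * (ω + κ) = (ω * s) ^ 2 := by rw [hκr, mul_pow, sq s, hs2]; ring
  have hν : √(ω * (ω + κ)) = ω * s := by rw [hμ, Real.sqrt_sq (by positivity)]
  refine ⟨by rw [hμ]; positivity, ?_⟩
  rintro C S hC hS χ hχ
  rw [hν] at hC hS
  set N := ω * s * t with hN
  have hωS : ω * S = Real.sin N + (1 / s - 1) * Real.sin N := by
    rw [hS]; field_simp; ring
  have hκS : (ω + κ) * S = Real.sin N + (s - 1) * Real.sin N := by
    rw [hS, show ω + κ = ω * (s * s) by rw [hs2, hκr]; ring]; field_simp; ring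
  have hs1 : |s - 1| ≤ |r| := by
    have e1 : (s - 1) * (s + 1) = r := by linear_combination hs2
    rw [← e1, abs_mul]
    refine le_mul_of_one_le_right (abs_nonneg _) ?_
    rw [abs_of_nonneg (by linarith)]
    linarith
  have hs1' : |1 / s - 1| ≤ 2 * |r| := by
    have e1 : 1 / s - 1 = -(s - 1) / s := by field_simp; ring
    rw [e1, abs_div, abs_neg, abs_of_nonneg (by linarith : 0 ≤ s), div_le_iff₀ (by linarith)]
    nlinarith [abs_nonneg r]
  -- The frequencies agree to first order in `r`, so the phase error is quadratic in `r` and one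
  -- power of `r` can be traded for `κ t = ω r t`.
  have hθ : |χ - N| ≤ |r| * (|κ * t| / 2) := by
    have e1 : χ - N = (s - 1) ^ 2 / 2 * (ω * t) := by
      rw [hχ, hN, hκr]; linear_combination (-(ω * t) / 2) * hs2
    have e2 : |κ * t| = |r| * |ω * t| := by rw [hκr, ← abs_mul]; congr 1; ring
    rw [e1, abs_mul, e2, abs_of_nonneg (by positivity : 0 ≤ (s - 1) ^ 2 / 2), ← sq_abs]
    have := mul_le_mul hs1 hs1 (abs_nonneg _) (abs_nonneg _)
    nlinarith [abs_nonneg (ω * t), mul_le_mul_of_nonneg_right this (abs_nonneg (ω * t))]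
  have hbd : ∀ a p q : ℝ, |a| ≤ 2 * |r| → |p| ≤ 1 → |q| ≤ 1 → |a * (p * q)| ≤ 2 * |r| := by
    intro a p q ha hp hq
    rw [abs_mul, abs_mul]
    have := mul_le_mul hp hq (abs_nonneg _) zero_le_one
    calc |a| * (|p| * |q|) ≤ 2 * |r| * (1 * 1) :=
          mul_le_mul ha this (by positivity) (by positivity)
      _ = _ := by ring
  have hfin : ∀ x y : ℝ, |x| ≤ |χ - N| → |y| ≤ 2 * |r| → |x + y| ≤ e := fun x y hx hy =>
    (abs_add_le x y).trans (by nlinarith [abs_nonneg r])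
  have h1 : |s - 1| ≤ 2 * |r| := hs1.trans (by linarith [abs_nonneg r])
  have hcc := abs_cos_sub_one_le (χ - N)
  have hss : |Real.sin (χ - N)| ≤ |χ - N| := Real.abs_sin_le_abs
  rw [hωS, hκS, hC]
  refine ⟨?_, ?_, ?_, ?_⟩
  · convert hfin _ _ hcc (hbd _ _ _ h1 (Real.abs_sin_le_one χ) (Real.abs_sin_le_one N)) using 2
    rw [Real.cos_sub]; ring
  · convert hfin (-Real.sin (χ - N)) _ (by rwa [abs_neg])
      (hbd _ _ _ hs1' (Real.abs_cos_le_one χ) (Real.abs_sin_le_one N)) using 2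
    rw [Real.sin_sub]; ring
  · convert hfin _ _ hss (hbd (-(s - 1)) _ _ (by rwa [abs_neg]) (Real.abs_cos_le_one χ)
      (Real.abs_sin_le_one N)) using 2
    rw [Real.sin_sub]; ring
  · convert hfin _ _ hcc (hbd _ _ _ hs1' (Real.abs_sin_le_one χ) (Real.abs_sin_le_one N)) using 2
    rw [Real.cos_sub]; ring

/-! ### Size of the coupling -/

section Coupling

open Matrix

/-- The eigenvalue is the quadratic form of `g` on a unit column of `O`; each product of two
coordinates is at most half the sum of their squares. -/
theorem abs_eigenvalue_le {O g : Matrix (Fin n) (Fin n) ℝ} {κ : Fin n → ℝ} (h' : Oᵀ * O = 1)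
    (hg : g = O * diagonal κ * Oᵀ) {m : ℝ} (hm : ∀ j k, |g j k| ≤ m) (k : Fin n) :
    |κ k| ≤ n * m := by
  have h1 : diagonal κ = Oᵀ * g * O := by
    rw [hg, show Oᵀ * (O * diagonal κ * Oᵀ) * O = (Oᵀ * O) * diagonal κ * (Oᵀ * O) by
      simp only [mul_assoc], h', one_mul, mul_one]
  have h2 : κ k = ∑ l, (∑ j, O j k * g j l) * O l k := by
    have := congrFun (congrFun h1 k) k
    rw [diagonal_apply_eq] at this
    rw [this]
    simp [mul_apply]
  have h3 : ∑ j, O j k ^ 2 = 1 := by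
    have := congrFun (congrFun h' k) k
    rw [one_apply_eq, mul_apply] at this
    rw [← this]
    exact Finset.sum_congr rfl fun j _ => by rw [transpose_apply, sq]
  have hm0 : 0 ≤ m := (abs_nonneg _).trans (hm k k)
  have h4 : |κ k| ≤ ∑ l, ∑ j, (m / 2) * (O j k ^ 2 + O l k ^ 2) := by
    rw [h2]
    refine (Finset.abs_sum_le_sum_abs _ _).trans (Finset.sum_le_sum fun l _ => ?_)
    rw [Finset.sum_mul]
    refine (Finset.abs_sum_le_sum_abs _ _).trans (Finset.sum_le_sum fun j _ => ?_)
    rw [abs_mul, abs_mul]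
    have := hm j l
    rw [← sq_abs (O j k), ← sq_abs (O l k)]
    calc |O j k| * |g j l| * |O l k| ≤ |O j k| * m * |O l k| := by gcongr
      _ ≤ _ := by nlinarith [mul_nonneg hm0 (sq_nonneg (|O j k| - |O l k|))]
  refine h4.trans (le_of_eq ?_)
  simp only [← Finset.mul_sum, Finset.sum_add_distrib, h3, Finset.sum_const, Finset.card_univ,
    Fintype.card_fin, nsmul_eq_mul]
  ring

theorem Oscillators.abs_cosθ_le (A : Oscillators n) {j k : Fin n} : |A.cosθ j k| ≤ 1 := by
  refine (abs_real_inner_le_norm _ _).trans ?_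
  rw [A.norm_dir, one_mul, norm_smul, norm_inv, Real.norm_eq_abs,
    abs_of_nonneg (show 0 ≤ A.distance j k from norm_nonneg _)]
  exact inv_mul_le_one

/-- A diagonal entry has fewer than `n` terms, each at most `2p` because `|1 - 3cos²| ≤ 2`. An
off-diagonal entry is at most `4p`, since the geometric mean of the two masses is at most the larger
one and the angular factor is at most `1 + 3`. -/
theorem Oscillators.abs_coupling_le (A : Oscillators n) {p : ℝ} (hp : 0 ≤ p)
    (h : ∀ j k, j ≠ k → A.G * A.mass j / (A.distance j k ^ 3 * A.ω) ≤ p) (j k : Fin n) :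
    |A.coupling j k| ≤ 4 * n * p := by
  have hω := A.ω_pos
  have hG := A.G_pos
  have hd0 : ∀ j k, 0 ≤ A.distance j k := fun j k => norm_nonneg _
  have hn : (1 : ℝ) ≤ n := by
    have : 1 ≤ n := by have := j.2; omega
    exact_mod_cast this
  rw [coupling]
  split_ifs with hjk
  · refine (Finset.abs_sum_le_sum_abs _ _).trans ?_
    have h1 : ∀ l ∈ Finset.univ.erase j, |A.G * A.mass l / (A.distance j l ^ 3 * A.ω) *
        (1 - 3 * A.cosθ j l ^ 2)| ≤ p * 2 := by
      intro l hl
      have hm := A.mass_pos l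
      have hdl := hd0 j l
      rw [abs_mul, abs_of_nonneg (by positivity)]
      refine mul_le_mul ?_ ?_ (abs_nonneg _) hp
      · rw [A.distance_comm j l]
        exact h l j (Finset.ne_of_mem_erase hl)
      · have := sq_le_sq' (abs_le.1 (A.abs_cosθ_le (j := j) (k := l))).1
          (abs_le.1 (A.abs_cosθ_le (j := j) (k := l))).2
        rw [abs_le]
        constructor <;> nlinarith [sq_nonneg (A.cosθ j l)]
    refine (Finset.sum_le_card_nsmul _ _ _ h1).trans ?_
    rw [nsmul_eq_mul]
    have hc : ((Finset.univ.erase j).card : ℝ) ≤ n := by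
      have := Finset.card_le_univ (Finset.univ.erase j)
      rw [Fintype.card_fin] at this
      exact_mod_cast this
    nlinarith [mul_le_mul_of_nonneg_right hc hp]
  · have hmj := A.mass_pos j
    have hmk := A.mass_pos k
    have hdl := hd0 j k
    have e1 : A.G * √(A.mass j * A.mass k) / (A.distance j k ^ 3 * A.ω) ≤ p := by
      have hs : √(A.mass j * A.mass k) ≤ max (A.mass j) (A.mass k) := by
        refine Real.sqrt_le_iff.2 ⟨le_max_of_le_left hmj.le, ?_⟩
        rw [sq]
        exact mul_le_mul (le_max_left _ _) (le_max_right _ _) hmk.le (le_max_of_le_left hmj.le)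
      calc _ ≤ A.G * max (A.mass j) (A.mass k) / (A.distance j k ^ 3 * A.ω) := by gcongr
        _ ≤ p := by
          rcases max_choice (A.mass j) (A.mass k) with e | e <;> rw [e]
          · exact h j k hjk
          · rw [A.distance_comm j k]
            exact h k j (Ne.symm hjk)
    have e2 : |A.cosφ j k + 3 * A.cosθ j k * A.cosθ k j| ≤ 4 := by
      have h1 : |A.cosφ j k| ≤ 1 := by
        refine (abs_real_inner_le_norm _ _).trans ?_
        rw [A.norm_dir, A.norm_dir, one_mul]
      have h2 : |A.cosθ j k * A.cosθ k j| ≤ 1 := by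
        rw [abs_mul]
        exact mul_le_one₀ A.abs_cosθ_le (abs_nonneg _) A.abs_cosθ_le
      have h3 : |3 * A.cosθ j k * A.cosθ k j| ≤ 3 := by
        rw [mul_assoc, abs_mul, abs_of_pos (by norm_num : (0 : ℝ) < 3)]
        linarith
      exact (abs_add_le _ _).trans (by linarith)
    rw [abs_mul, abs_neg, abs_of_nonneg (by positivity)]
    calc _ ≤ p * 4 := mul_le_mul e1 e2 (abs_nonneg _) hp
      _ ≤ _ := by nlinarith

end Coupling

end

end GravLOCC

/-! ### Nearly trivial Gaussian unitaries and continuity of the fidelity -/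

namespace GravLOCC

noncomputable section

open Complex
open scoped ComplexConjugate

variable {n : ℕ}

/-! ### Gaussian unitaries close to the identity -/

/-- `X` is the Gaussian unitary, with the phase fixed by the vacuum, of a linear map which is
`2 * e`-close to the identity. -/
structure NearId (e : ℝ) (X : Modes n ≃ₗᵢ[ℂ] Modes n) : Prop where
  exists_map : ∃ T : (Fin n ⊕ Fin n → ℝ) → (Fin n ⊕ Fin n → ℝ),
    (∀ δ ψ, X (displace δ ψ) = displace (T δ) (X ψ)) ∧
    ∀ δ, ∑ i, (T δ i - δ i) ^ 2 ≤ (2 * e) ^ 2 * ∑ i, δ i ^ 2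
  inner_vacuum : ∃ r : ℝ, 0 ≤ r ∧ inner ℂ (vacuum n) (X (vacuum n)) = (r : ℂ)

/-- The vacuum overlap is a real number `r` in `[0, 1]`, so `r ≥ r²`, and `r²` is bounded below by
`le_norm_inner_vacuum_sq` with `s = (1 + 2e)²`. -/
theorem NearId.norm_vacuum_sub_sq_le {e : ℝ} {X : Modes n ≃ₗᵢ[ℂ] Modes n} (hX : NearId e X)
    (he : 0 ≤ e) :
    ‖X (vacuum n) - vacuum n‖ ^ 2 ≤ 2 * (1 - (2 / (1 + (1 + 2 * e) ^ 2)) ^ n) := by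
  obtain ⟨⟨T, h1, h2⟩, r, hr, h3⟩ := hX
  have h4 := le_norm_inner_vacuum_sq h1 (sq_nonneg (1 + 2 * e)) fun δ =>
    sum_sq_le_of_sub (by positivity) (h2 δ)
  have hr1 : r ≤ 1 := by
    have := norm_inner_le_norm (𝕜 := ℂ) (vacuum n) (X (vacuum n))
    rw [X.norm_map, norm_vacuum, h3, norm_real, Real.norm_of_nonneg hr] at this
    linarith
  rw [h3, norm_real, Real.norm_of_nonneg hr] at h4
  have h5 : ‖X (vacuum n) - vacuum n‖ ^ 2 = 2 - 2 * r := by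
    rw [norm_sub_rev, @norm_sub_sq ℂ, X.norm_map, norm_vacuum, h3]
    simp only [RCLike.re_eq_complex_re, ofReal_re]
    ring
  rw [h5]
  nlinarith

theorem exists_nearId_vacuum {ε : ℝ} (hε : 0 < ε) : ∃ e₀ : ℝ, 0 < e₀ ∧
    ∀ e, 0 ≤ e → e ≤ e₀ → ∀ X : Modes n ≃ₗᵢ[ℂ] Modes n, NearId e X →
      ‖X (vacuum n) - vacuum n‖ ≤ ε := by
  have hc : ContinuousAt (fun e : ℝ => 2 * (1 - (2 / (1 + (1 + 2 * e) ^ 2)) ^ n)) 0 := by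
    have : (1 + (1 + 2 * (0 : ℝ)) ^ 2) ≠ 0 := by norm_num
    fun_prop (disch := assumption)
  have h0 : 2 * (1 - (2 / (1 + (1 + 2 * (0 : ℝ)) ^ 2)) ^ n) < ε ^ 2 := by
    norm_num
    positivity
  obtain ⟨e₀, he₀, hball⟩ := Metric.eventually_nhds_iff.1 (hc.eventually_lt_const h0)
  refine ⟨e₀ / 2, by positivity, fun e he hee X hX => ?_⟩
  have h1 := hball (y := e) (by
    rw [Real.dist_eq, sub_zero, abs_of_nonneg he]; linarith)
  have h2 := hX.norm_vacuum_sub_sq_le he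
  exact (sq_le_sq₀ (norm_nonneg _) hε.le).1 (h2.trans h1.le)

/-- Covariance gives `X|α⟩ = D_{Tα} X|0⟩`. This is close to `D_{Tα}|0⟩` because `X` nearly fixes the
vacuum, and that is close to `|α⟩` by continuity of coherent states. -/
theorem exists_nearId_coherent (α : Fin n → ℂ) {ε : ℝ} (hε : 0 < ε) : ∃ e₀ : ℝ, 0 < e₀ ∧
    ∀ e, 0 ≤ e → e ≤ e₀ → ∀ X : Modes n ≃ₗᵢ[ℂ] Modes n, NearId e X →
      ‖X (coherent α) - coherent α‖ ≤ ε := by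
  obtain ⟨e₁, he₁, h1⟩ := exists_nearId_vacuum (n := n) (half_pos hε)
  obtain ⟨r, hr, hball⟩ := Metric.continuousAt_iff.1
    (continuous_coherent.continuousAt (x := α)) (ε / 2) (half_pos hε)
  set s := √(∑ i, ph α i ^ 2) with hs
  have hs0 : 0 ≤ s := Real.sqrt_nonneg _
  have hs2 : s ^ 2 = ∑ i, ph α i ^ 2 :=
    Real.sq_sqrt (Finset.sum_nonneg fun _ _ => sq_nonneg _)
  refine ⟨min e₁ (r / (4 * (s + 1))), lt_min he₁ (by positivity), fun e he hee X hX => ?_⟩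
  have hv := h1 e he (hee.trans (min_le_left _ _)) X hX
  obtain ⟨T, hT1, hT2⟩ := hX.exists_map
  have h2e : 2 * e * s < r := by
    have h3 := hee.trans (min_le_right _ _)
    rw [le_div_iff₀ (by positivity)] at h3
    nlinarith
  have hd : dist (phInv (T (ph α))) α < r := by
    rw [dist_pi_lt_iff hr]
    intro j
    rw [dist_eq_norm]
    set β := phInv (T (ph α)) with hβ
    have e1 : ph (β - α) = T (ph α) - ph α := by
      rw [sub_eq_add_neg, ph_add, ph_neg, hβ, ph_phInv, ← sub_eq_add_neg]
    have e2 : 2 * ∑ j, ‖(β - α) j‖ ^ 2 ≤ (2 * e * s) ^ 2 := by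
      rw [← sum_ph_sq, e1, mul_pow _ s, hs2]
      exact hT2 (ph α)
    have e3 := Finset.single_le_sum (f := fun j => ‖(β - α) j‖ ^ 2) (fun _ _ => sq_nonneg _)
      (Finset.mem_univ j)
    have e4 : ‖(β - α) j‖ ^ 2 ≤ (2 * e * s) ^ 2 := by
      refine le_trans ?_ e2
      have : 0 ≤ ‖(β - α) j‖ ^ 2 := sq_nonneg _
      linarith
    exact ((sq_le_sq₀ (norm_nonneg _) (by positivity)).1 e4).trans_lt h2e
  have hcl := hball hd
  rw [dist_eq_norm, coherent_eq, ph_phInv] at hcl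
  calc ‖X (coherent α) - coherent α‖
      = ‖displace (T (ph α)) (X (vacuum n) - vacuum n) +
          (displace (T (ph α)) (vacuum n) - coherent α)‖ := by
        rw [displace_sub_right, coherent_eq, hT1]; congr 1; abel
    _ ≤ ε / 2 + ε / 2 := (norm_add_le _ _).trans
        (add_le_add ((norm_displace _ _).le.trans hv) hcl.le)
    _ = ε := add_halves ε

/-- A class of isometries, indexed by a parameter, that tends strongly to the identity on a total
family does so everywhere. -/
theorem Total.strong_convergence {ι H : Type*} [NormedAddCommGroup H] [InnerProductSpace ℂ H]
    [CompleteSpace H] {f : ι → H} (hf : Total f) {p : ℝ → (H ≃ₗᵢ[ℂ] H) → Prop}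
    (hp : ∀ i, ∀ ε > 0, ∃ e₀ : ℝ, 0 < e₀ ∧ ∀ e, 0 ≤ e → e ≤ e₀ → ∀ X, p e X →
      ‖X (f i) - f i‖ ≤ ε) (ψ : H) :
    ∀ ε > 0, ∃ e₀ : ℝ, 0 < e₀ ∧ ∀ e, 0 ≤ e → e ≤ e₀ → ∀ X, p e X → ‖X ψ - ψ‖ ≤ ε := by
  let q : Submodule ℂ H :=
    { carrier := {ψ | ∀ ε > 0, ∃ e₀ : ℝ, 0 < e₀ ∧ ∀ e, 0 ≤ e → e ≤ e₀ → ∀ X, p e X →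
        ‖X ψ - ψ‖ ≤ ε}
      add_mem' := fun {a b} ha hb ε hε => by
        obtain ⟨e₁, he₁, h1⟩ := ha (ε / 2) (half_pos hε)
        obtain ⟨e₂, he₂, h2⟩ := hb (ε / 2) (half_pos hε)
        refine ⟨min e₁ e₂, lt_min he₁ he₂, fun e he hee X hX => ?_⟩
        rw [map_add, add_sub_add_comm]
        exact (norm_add_le _ _).trans (by
          linarith [h1 e he (hee.trans (min_le_left _ _)) X hX,
            h2 e he (hee.trans (min_le_right _ _)) X hX])
      zero_mem' := fun ε hε => ⟨1, one_pos, fun e _ _ X _ => by simpa using hε.le⟩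
      smul_mem' := fun c a ha ε hε => by
        obtain ⟨e₁, he₁, h1⟩ := ha (ε / (‖c‖ + 1)) (by positivity)
        refine ⟨e₁, he₁, fun e he hee X hX => ?_⟩
        rw [map_smul, ← smul_sub, norm_smul]
        have h2 := h1 e he hee X hX
        rw [le_div_iff₀ (by positivity)] at h2
        nlinarith [norm_nonneg (X a - a), norm_nonneg c] }
  refine hf.induction q ?_ (fun i => hp i) ψ
  refine isClosed_of_closure_subset fun ψ hψ ε hε => ?_
  obtain ⟨φ, hφ, hd⟩ := Metric.mem_closure_iff.1 hψ (ε / 3) (by positivity)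
  obtain ⟨e₁, he₁, h1⟩ := hφ (ε / 3) (by positivity)
  refine ⟨e₁, he₁, fun e he hee X hX => ?_⟩
  have h2 := h1 e he hee X hX
  rw [dist_eq_norm] at hd
  calc ‖X ψ - ψ‖ = ‖X (ψ - φ) + (X φ - φ) - (ψ - φ)‖ := by rw [map_sub]; congr 1; abel
    _ ≤ ‖X (ψ - φ)‖ + ‖X φ - φ‖ + ‖ψ - φ‖ :=
        (norm_sub_le _ _).trans (add_le_add_left (norm_add_le _ _) _)
    _ ≤ ε := by rw [X.norm_map]; linarith

/-- Strong convergence to the identity is uniform on compact sets. -/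
theorem uniform_on_compact {H : Type*} [NormedAddCommGroup H] [InnerProductSpace ℂ H]
    {p : ℝ → (H ≃ₗᵢ[ℂ] H) → Prop}
    (hp : ∀ ψ, ∀ ε > 0, ∃ e₀ : ℝ, 0 < e₀ ∧ ∀ e, 0 ≤ e → e ≤ e₀ → ∀ X, p e X → ‖X ψ - ψ‖ ≤ ε)
    {K : Set H} (hK : IsCompact K) {ε : ℝ} (hε : 0 < ε) :
    ∃ e₀ : ℝ, 0 < e₀ ∧ ∀ X, p e₀ X → ∀ ψ ∈ K, ‖X ψ - ψ‖ ≤ ε := by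
  obtain ⟨s, -, hsf, hsK⟩ := hK.finite_cover_balls (e := ε / 3) (by positivity)
  choose e he h using fun φ => hp φ (ε / 3) (by positivity)
  obtain ⟨e₀, he₀, hmin⟩ : ∃ e₀ : ℝ, 0 < e₀ ∧ ∀ φ ∈ s, e₀ ≤ e φ := by
    rcases s.eq_empty_or_nonempty with rfl | hne
    · exact ⟨1, one_pos, fun φ hφ => hφ.elim⟩
    · obtain ⟨φ, hφ, hm⟩ := Set.exists_min_image s e hsf hne
      exact ⟨e φ, he φ, hm⟩
  refine ⟨e₀, he₀, fun X hX ψ hψ => ?_⟩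
  obtain ⟨φ, hφ, hd⟩ := Set.mem_iUnion₂.1 (hsK hψ)
  have h2 := h φ e₀ he₀.le (hmin φ hφ) X hX
  rw [Metric.mem_ball, dist_eq_norm] at hd
  calc ‖X ψ - ψ‖ = ‖X (ψ - φ) + (X φ - φ) - (ψ - φ)‖ := by rw [map_sub]; congr 1; abel
    _ ≤ ‖X (ψ - φ)‖ + ‖X φ - φ‖ + ‖ψ - φ‖ :=
        (norm_sub_le _ _).trans (add_le_add_left (norm_add_le _ _) _)
    _ ≤ ε := by rw [X.norm_map]; linarith

theorem exists_nearId_compact {K : Set (Modes n)} (hK : IsCompact K) {ε : ℝ} (hε : 0 < ε) :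
    ∃ e₀ : ℝ, 0 < e₀ ∧ ∀ X, NearId e₀ X → ∀ ψ ∈ K, ‖X ψ - ψ‖ ≤ ε :=
  uniform_on_compact (total_coherent.strong_convergence fun α _ hε =>
    exists_nearId_coherent α hε) hK hε

/-! ### Continuity of the simulation fidelity -/

/-- Half of the Gaussian decay pays for the factor `‖α‖²`, so tails are controlled by another
normalised density. -/
theorem gaussianDensity_mul_sum_le {lam : ℝ} (hlam : 0 < lam) (α : Fin n → ℂ) :
    gaussianDensity lam α * ∑ j, ‖α j‖ ^ 2 ≤ 2 / lam * 2 ^ n * gaussianDensity (lam / 2) α := by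
  unfold gaussianDensity
  set s := ∑ j, ‖α j‖ ^ 2
  have h1 : s ≤ 2 / lam * Real.exp (lam / 2 * s) := by
    have := Real.add_one_le_exp (lam / 2 * s)
    calc s = 2 / lam * (lam / 2 * s) := by field_simp
      _ ≤ _ := by gcongr; linarith
  have h2 : (lam / Real.pi) ^ n = 2 ^ n * (lam / 2 / Real.pi) ^ n := by
    rw [← mul_pow]; congr 1; ring
  have h3 : Real.exp (-(lam / 2) * s) = Real.exp (-lam * s) * Real.exp (lam / 2 * s) := by
    rw [← Real.exp_add]; congr 1; ring
  rw [h2, h3]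
  calc _ ≤ 2 ^ n * (lam / 2 / Real.pi) ^ n * Real.exp (-lam * s) *
        (2 / lam * Real.exp (lam / 2 * s)) := by gcongr
    _ = _ := by ring

/-- Coherent states with amplitude in a ball form a compact set, on which `U` and `U'` are close by
hypothesis; outside it the trivial bound 2 meets a small Gaussian tail. Each region contributes at
most `ε / 2`. -/
theorem exists_simFidelity_le {lam : ℝ} (hlam : 0 < lam) {ε : ℝ} (hε : 0 < ε) :
    ∃ K : Set (Modes n), IsCompact K ∧ ∃ ε' > 0, ∀ U U' : Modes n ≃ₗᵢ[ℂ] Modes n,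
      (∀ ψ ∈ K, ‖U ψ - U' ψ‖ ≤ ε') →
        simFidelity lam U ≤ simFidelity lam U' + ENNReal.ofReal ε := by
  set c := 2 / lam * 2 ^ n with hc
  have hc0 : 0 < c := by positivity
  -- On `‖α‖² > R` the integrand is at most `4p ≤ 4p‖α‖²/R`, and `4c/R = ε/2`. The ball below has
  -- radius `1 + R` because `x² ≤ R` implies `x ≤ 1 + R`.
  set R := 8 * c / ε with hR
  have hR0 : 0 < R := by positivity
  refine ⟨coherent '' Metric.closedBall (0 : Fin n → ℂ) (1 + R),
    (isCompact_closedBall _ _).image continuous_coherent, ε / 4, by positivity,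
    fun U U' hU => (simFidelity_le_add hlam U U').trans (add_le_add_right ?_ _)⟩
  have hpt : ∀ α : Fin n → ℂ, gaussianDensity lam α * (2 * ‖U (coherent α) - U' (coherent α)‖) ≤
      ε / 2 * gaussianDensity lam α + ε / 2 * gaussianDensity (lam / 2) α := by
    intro α
    have hp := gaussianDensity_nonneg hlam α
    have hp' := gaussianDensity_nonneg (half_pos hlam) α
    by_cases hα : ∑ j, ‖α j‖ ^ 2 ≤ R
    · have hmem : α ∈ Metric.closedBall (0 : Fin n → ℂ) (1 + R) := by
        rw [mem_closedBall_zero_iff, pi_norm_le_iff_of_nonneg (by positivity)]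
        intro j
        have := (Finset.single_le_sum (f := fun j => ‖α j‖ ^ 2) (fun _ _ => sq_nonneg _)
          (Finset.mem_univ j)).trans hα
        nlinarith [sq_nonneg (‖α j‖ - 1)]
      have h1 := hU _ ⟨α, hmem, rfl⟩
      nlinarith [mul_le_mul_of_nonneg_left h1 hp]
    · have h1 : ‖U (coherent α) - U' (coherent α)‖ ≤ 2 := by
        refine (norm_sub_le _ _).trans ?_
        rw [U.norm_map, U'.norm_map, norm_coherent]
        norm_num
      have h2 := gaussianDensity_mul_sum_le hlam α
      have h3 := mul_le_mul_of_nonneg_left (not_le.1 hα).le hp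
      have h4 : gaussianDensity lam α * R * ε = gaussianDensity lam α * (8 * c) := by
        rw [hR]; field_simp
      have h5 : gaussianDensity lam α * 8 * c ≤ c * gaussianDensity (lam / 2) α * ε := by
        have := mul_le_mul_of_nonneg_right (h3.trans h2) hε.le
        linarith
      have h6 : gaussianDensity lam α * 8 ≤ gaussianDensity (lam / 2) α * ε :=
        le_of_mul_le_mul_left (by linarith) hc0
      nlinarith [mul_le_mul_of_nonneg_left h1 hp]
  have hi1 := (integrable_gaussianDensity (n := n) hlam).const_mul (ε / 2)
  have hi2 := (integrable_gaussianDensity (n := n) (half_pos hlam)).const_mul (ε / 2)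
  calc _ ≤ ∫⁻ α : Fin n → ℂ, ENNReal.ofReal
        (ε / 2 * gaussianDensity lam α + ε / 2 * gaussianDensity (lam / 2) α) :=
        lintegral_mono fun α => ENNReal.ofReal_le_ofReal (hpt α)
    _ = ENNReal.ofReal (∫ α : Fin n → ℂ,
        (ε / 2 * gaussianDensity lam α + ε / 2 * gaussianDensity (lam / 2) α)) := by
        refine (ofReal_integral_eq_lintegral_ofReal (hi1.add hi2)
          (Filter.Eventually.of_forall fun α => ?_)).symm
        have hp := gaussianDensity_nonneg hlam α
        have hp' := gaussianDensity_nonneg (half_pos hlam) α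
        simp only [Pi.zero_apply, Pi.add_apply]
        positivity
    _ = ENNReal.ofReal ε := by
        rw [integral_add hi1 hi2, integral_const_mul, integral_const_mul,
          integral_gaussianDensity hlam, integral_gaussianDensity (half_pos hlam)]
        congr 1
        ring

end

end GravLOCC

/-! ### Assembling the rotating-wave approximation -/

namespace GravLOCC

noncomputable section

open Complex
open scoped ComplexConjugate

variable {n : ℕ}

/-! ### The rotating-wave approximation -/

section RotatingWave

open Matrix

/-- `W` is the displacement that cancels the linear force, followed by the rotation by `ωt` of every
mode and a phase. Undoing `U` adds a rotation by `κt/2` in each eigenmode, so the total rotation is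
by `(ω + κ/2)t`, as in `rotating_wave_estimate`. -/
theorem Oscillators.IsEvolution.exists_local_nearId (hn : 0 < n) {A : Oscillators n}
    {V : ℝ → (Modes n ≃ₗᵢ[ℂ] Modes n)} (hV : A.IsEvolution V) {t : ℝ}
    {U : Modes n ≃ₗᵢ[ℂ] Modes n} (hU : IsGaussianUnitary (Seff (t • A.coupling)) U) {m e : ℝ}
    (hm : ∀ j k, |A.coupling j k| ≤ m) (hmω : n * m / A.ω ≤ 1 / 2)
    (he : n * m / A.ω * (3 + n * m * |t| / 2) ≤ e) :
    ∃ W : Modes n ≃ₗᵢ[ℂ] Modes n, IsLocalUnitary W ∧ NearId e (((V t).trans W).trans U.symm) := by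
  have hω := A.ω_pos
  obtain ⟨O, κ, h', h, hg, hcfc⟩ := exists_diagonalization A.coupling_isSymm
  have hκ := abs_eigenvalue_le h' hg hm
  have hκω : ∀ k, |κ k / A.ω| ≤ n * m / A.ω := fun k => by
    rw [abs_div, abs_of_pos hω]
    have := hκ k
    gcongr
  have hrw := fun k => rotating_wave_estimate (κ := κ k) (t := t) (e := e) hω
    ((hκω k).trans hmω) (le_trans (by
      have h1 := hκω k
      have h2 := hκ k
      have h3 := (abs_nonneg _).trans h1
      rw [abs_mul]
      gcongr) he)
  choose C S C₁ S₁ hosc hCS using fun k => exists_isOsc (A.ω * (A.ω + κ k))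
  obtain ⟨η, hη⟩ := hV.exists_displace h h' hg hosc t
  obtain ⟨Y, hYloc, hY⟩ := exists_local_rotation (n := n) (c := cexp ((A.ω * t : ℝ) * I))
    (norm_exp_ofReal_mul_I _)
  have hZloc : IsLocalUnitary ((dispLIE η).trans Y) := (isLocalUnitary_dispLIE η).trans hYloc
  set rot := blockMap O (fun _ => Real.cos (A.ω * t)) (fun _ => -Real.sin (A.ω * t))
    (fun _ => Real.sin (A.ω * t)) (fun _ => Real.cos (A.ω * t)) with hrot
  have hZ : ∀ δ ψ, Y (displace η (V t (displace δ ψ))) =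
      displace (rot (flow O κ A.ω C S t δ)) (Y (displace η (V t ψ))) := fun δ ψ => by
    rw [hη, ← ph_phInv (flow O κ A.ω C S t δ), hY, ph_exp_smul h h', ph_phInv]
  -- The inverse of the effective matrix in rotated coordinates.
  set back := blockMap O (fun k => Real.cos (κ k * t / 2)) (fun k => -Real.sin (κ k * t / 2))
    (fun k => Real.sin (κ k * t / 2)) (fun k => Real.cos (κ k * t / 2)) with hback
  have hbackS : ∀ δ, (Seff (t • A.coupling)).mulVec (back δ) = δ := fun δ => by
    rw [Seff_mulVec_eq_blockMap A.coupling_isSymm hcfc, hback, blockMap_blockMap h h']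
    convert blockMap_one h h' δ using 2 <;> funext k
    · linear_combination Real.cos_sq_add_sin_sq (κ k * t / 2)
    · ring
    · ring
    · linear_combination Real.cos_sq_add_sin_sq (κ k * t / 2)
  set T := fun δ => back (rot (flow O κ A.ω C S t δ)) with hT
  have hX : ∀ δ ψ, U.symm (Y (displace η (V t (displace δ ψ)))) =
      displace (T δ) (U.symm (Y (displace η (V t ψ)))) := fun δ ψ => by
    rw [LinearIsometryEquiv.symm_apply_eq, hU, hbackS, LinearIsometryEquiv.apply_symm_apply, hZ]
  have hTd : ∀ δ, ∑ i, (T δ i - δ i) ^ 2 ≤ (2 * e) ^ 2 * ∑ i, δ i ^ 2 := by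
    intro δ
    have hχ : ∀ k, Real.cos ((A.ω + κ k / 2) * t) = Real.cos (κ k * t / 2) * Real.cos (A.ω * t) -
        Real.sin (κ k * t / 2) * Real.sin (A.ω * t) := fun k => by
      rw [← Real.cos_add]; congr 1; ring
    have hχ' : ∀ k, Real.sin ((A.ω + κ k / 2) * t) = Real.sin (κ k * t / 2) * Real.cos (A.ω * t) +
        Real.cos (κ k * t / 2) * Real.sin (A.ω * t) := fun k => by
      rw [← Real.sin_add]; congr 1; ring
    have key := fun k => (hrw k).2 (C k t) (S k t) (hCS k (hrw k).1 t).1 (hCS k (hrw k).1 t).2 _ rfl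
    simp only [hχ, hχ'] at key
    simp only [hT, hback, hrot, flow]
    rw [blockMap_blockMap h h', blockMap_blockMap h h']
    refine sum_sq_blockMap_sub_le h h' (fun k => ?_) (fun k => ?_) (fun k => ?_) (fun k => ?_) δ
    · convert (key k).1 using 2
      ring
    · convert (key k).2.1 using 2
      ring
    · convert (key k).2.2.1 using 2
      ring
    · convert (key k).2.2.2 using 2
      ring
  set w : ℂ := inner ℂ (vacuum n) (U.symm (Y (displace η (V t (vacuum n))))) with hw
  -- The Gaussian unitary `U` is given only up to a phase; `c` makes the vacuum expectation
  -- nonnegative, as `NearId` demands.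
  obtain ⟨c, hc, hcw⟩ : ∃ c : ℂ, ‖c‖ = 1 ∧ c * w = (‖w‖ : ℂ) := by
    by_cases hw0 : w = 0
    · exact ⟨1, by simp, by simp [hw0]⟩
    · have hwn : (‖w‖ : ℂ) ≠ 0 := by simpa using hw0
      refine ⟨conj w / ‖w‖, ?_, ?_⟩
      · rw [norm_div, RCLike.norm_conj, norm_real, norm_norm, div_self (by simpa using hw0)]
      · rw [div_mul_eq_mul_div, ← Complex.normSq_eq_conj_mul_self, Complex.normSq_eq_norm_sq,
          ofReal_pow, sq, mul_div_assoc, div_self hwn, mul_one]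
  obtain ⟨W, hWloc, hW⟩ := hZloc.exists_smul hn hc
  have hWU : ∀ ψ, (((V t).trans W).trans U.symm) ψ =
      c • U.symm (Y (displace η (V t ψ))) := fun ψ => by
    change U.symm (W (V t ψ)) = _
    rw [hW, map_smul]
    rfl
  refine ⟨W, hWloc, ⟨T, fun δ ψ => ?_, hTd⟩, ‖w‖, norm_nonneg _, ?_⟩
  · rw [hWU, hWU, hX, displace_smul_right]
  · rw [hWU, inner_smul_right, ← hw, hcw]

theorem rotating_wave (hn : 0 < n) {lam : ℝ} (hlam : 0 < lam) (B : ℝ) {K : Set (Modes n)}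
    (hK : IsCompact K) {ε : ℝ} (hε : 0 < ε) : ∃ η : ℝ, 0 < η ∧ ∀ (A : Oscillators n) (t : ℝ),
      (∀ j k, j ≠ k → A.G * A.mass j * |t| / (A.distance j k ^ 3 * A.ω) ≤ B) →
      (∀ j k, j ≠ k → A.G * A.mass j / (A.distance j k ^ 3 * A.ω ^ 2) ≤ η) →
      ∀ V, A.IsEvolution V → ∀ U, IsGaussianUnitary (Seff (t • A.coupling)) U →
        (∃ W, IsLocalUnitary W ∧ ∀ ψ ∈ K, ‖W (V t ψ) - U ψ‖ ≤ ε) ∧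
        simFidelity lam (V t) ≤ simFidelity lam U + ENNReal.ofReal ε ∧
        simFidelity lam U ≤ simFidelity lam (V t) + ENNReal.ofReal ε := by
  obtain ⟨K', hK', ε', hε', hF⟩ := exists_simFidelity_le (n := n) hlam hε
  obtain ⟨e, he, hnear⟩ := exists_nearId_compact (hK.union hK') (lt_min hε hε')
  have hn' : (0 : ℝ) < n := by exact_mod_cast hn
  -- If `q` bounds the pair couplings, then `4nq` bounds the entries of `g` and `n · 4nq = Nq` its
  -- eigenvalues. The two terms of the minimum below give `|κ/ω| ≤ 1/2` and an error of at most `e`.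
  set N : ℝ := 4 * n ^ 2 with hN
  have hN0 : 0 < N := by positivity
  set D : ℝ := 3 + N * |B| / 2 with hD
  have hD0 : 0 < D := by positivity
  refine ⟨min (1 / (2 * N)) (e / (N * D)), lt_min (by positivity) (by positivity),
    fun A t hB hη V hV U hU => ?_⟩
  set η := min (1 / (2 * N)) (e / (N * D)) with hηd
  have hη0 : 0 < η := lt_min (by positivity) (by positivity)
  have hω := A.ω_pos
  -- One number that exploits both hypotheses. The case `t = 0` is separate because of the division
  -- by `|t|`, and `|B|` appears because `B` carries no sign.
  obtain ⟨q, hq, hqη, hqB, hqe⟩ : ∃ q : ℝ, 0 ≤ q ∧ q ≤ η * A.ω ∧ q * |t| ≤ |B| ∧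
      ∀ j k, j ≠ k → A.G * A.mass j / (A.distance j k ^ 3 * A.ω) ≤ q := by
    have h1 : ∀ j k, j ≠ k → A.G * A.mass j / (A.distance j k ^ 3 * A.ω) ≤ η * A.ω := by
      intro j k hjk
      have := mul_le_mul_of_nonneg_right (hη j k hjk) hω.le
      refine le_trans (le_of_eq ?_) this
      have hd : A.distance j k ≠ 0 := norm_ne_zero_iff.2 (A.sep_ne_zero hjk)
      field_simp
    by_cases ht : t = 0
    · exact ⟨η * A.ω, by positivity, le_rfl, by simp [ht], h1⟩
    · have ht' : 0 < |t| := abs_pos.2 ht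
      refine ⟨min (η * A.ω) (|B| / |t|), by positivity, min_le_left _ _, ?_, fun j k hjk =>
        le_min (h1 j k hjk) ?_⟩
      · calc _ ≤ |B| / |t| * |t| := by gcongr; exact min_le_right _ _
          _ = |B| := by field_simp
      · rw [le_div_iff₀ ht']
        refine le_trans (le_of_eq ?_) ((hB j k hjk).trans (le_abs_self B))
        ring
  have hm := A.abs_coupling_le hq hqe
  have hnm : (n : ℝ) * (4 * n * q) = N * q := by rw [hN]; ring
  have hqω : n * (4 * n * q) / A.ω ≤ N * η := by
    rw [hnm, div_le_iff₀ hω]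
    linarith [mul_le_mul_of_nonneg_left hqη hN0.le]
  obtain ⟨W, hWloc, hX⟩ := hV.exists_local_nearId hn hU hm (e := e)
    (hqω.trans (by
      calc N * η ≤ N * (1 / (2 * N)) := by gcongr; exact min_le_left _ _
        _ = 1 / 2 := by field_simp))
    (by
      calc _ ≤ N * η * D := by
            have h1 : N * q * |t| ≤ N * |B| := by
              linarith [mul_le_mul_of_nonneg_left hqB hN0.le]
            have h2 : 3 + n * (4 * n * q) * |t| / 2 ≤ D := by rw [hnm, hD]; linarith
            exact mul_le_mul hqω h2 (by positivity) (by positivity)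
        _ ≤ N * (e / (N * D)) * D := by gcongr; exact min_le_right _ _
        _ = e := by field_simp)
  have hclose : ∀ ψ ∈ K ∪ K', ‖W (V t ψ) - U ψ‖ ≤ min ε ε' := fun ψ hψ => by
    have := hnear _ hX ψ hψ
    rw [← U.norm_map, map_sub] at this
    change ‖U (U.symm (W (V t ψ))) - U ψ‖ ≤ _ at this
    rwa [LinearIsometryEquiv.apply_symm_apply] at this
  refine ⟨⟨W, hWloc, fun ψ hψ => (hclose ψ (Or.inl hψ)).trans (min_le_left _ _)⟩, ?_, ?_⟩
  · rw [← hWloc.simFidelity_trans lam (V t)]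
    exact hF _ _ fun ψ hψ => (hclose ψ (Or.inr hψ)).trans (min_le_right _ _)
  · rw [← hWloc.simFidelity_trans lam (V t)]
    refine hF _ _ fun ψ hψ => ?_
    rw [norm_sub_rev]
    exact (hclose ψ (Or.inr hψ)).trans (min_le_right _ _)

end RotatingWave

end

end GravLOCC

theorem theorem3 (n : ℕ) (hn : 0 < n) (lam : ℝ) (hlam : 0 < lam) :
    -- the linearised model, the effective Gaussian unitary and the LOCC inequality
    (∀ (A : GravLOCC.Oscillators n) (t : ℝ),
      ContDiffAt ℝ ((⊤ : ℕ∞) : WithTop ℕ∞) A.potential 0 ∧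
      (∀ j k, GravLOCC.partialDeriv j (GravLOCC.partialDeriv k A.potential) 0 =
        A.ω * √(A.mass j * A.mass k) * A.coupling j k) ∧
      (∃! V : ℝ → (GravLOCC.Modes n ≃ₗᵢ[ℂ] GravLOCC.Modes n), A.IsEvolution V) ∧
      GravLOCC.Seff (t • A.coupling) ∈ Matrix.symplecticGroup (Fin n) ℝ ∧
      GravLOCC.Seff (t • A.coupling) ∈ Matrix.orthogonalGroup (Fin n ⊕ Fin n) ℝ ∧
      (∃ U, GravLOCC.IsGaussianUnitary (GravLOCC.Seff (t • A.coupling)) U) ∧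
      (∀ U, GravLOCC.IsGaussianUnitary (GravLOCC.Seff (t • A.coupling)) U →
        GravLOCC.simFidelity lam U ≤
          ENNReal.ofReal (⨅ J : Finset (Fin n),
            GravLOCC.bound lam (A.coupling_isSymm.smul t) J)) ∧
      (2 ≤ n →
        (⨅ J : Finset (Fin n), GravLOCC.bound lam (A.coupling_isSymm.smul t) J) =
          ⨅ J : {J : Finset (Fin n) // 1 ≤ J.card ∧ J.card ≤ n / 2},
            GravLOCC.bound lam (A.coupling_isSymm.smul t) J.1)) ∧
    -- the rotating-wave approximation: for bounded `G m t / (d³ ω)` and small `G m / (d³ ω²)`,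
    -- the dynamics is close to the effective Gaussian unitary up to a local unitary, and so are
    -- the simulation fidelities
    (∀ (B : ℝ) (C : Set (GravLOCC.Modes n)), IsCompact C → ∀ ε : ℝ, 0 < ε → ∃ η : ℝ, 0 < η ∧
      ∀ (A : GravLOCC.Oscillators n) (t : ℝ),
        (∀ j k, j ≠ k → A.G * A.mass j * |t| / (A.distance j k ^ 3 * A.ω) ≤ B) →
        (∀ j k, j ≠ k → A.G * A.mass j / (A.distance j k ^ 3 * A.ω ^ 2) ≤ η) →
        ∀ V, A.IsEvolution V →
        ∀ U, GravLOCC.IsGaussianUnitary (GravLOCC.Seff (t • A.coupling)) U →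
          (∃ W, GravLOCC.IsLocalUnitary W ∧ ∀ ψ ∈ C, ‖W (V t ψ) - U ψ‖ ≤ ε) ∧
          GravLOCC.simFidelity lam (V t) ≤
            GravLOCC.simFidelity lam U + ENNReal.ofReal ε ∧
          GravLOCC.simFidelity lam U ≤
            GravLOCC.simFidelity lam (V t) + ENNReal.ofReal ε) := by
  refine ⟨fun A t => ⟨A.contDiffAt_potential, A.hessian_potential, A.existsUnique_isEvolution,
    GravLOCC.Seff_mem_symplecticGroup (A.coupling_isSymm.smul t),
    GravLOCC.Seff_mem_orthogonalGroup (A.coupling_isSymm.smul t),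
    GravLOCC.exists_isGaussianUnitary_Seff (A.coupling_isSymm.smul t),
    fun U hU => GravLOCC.simFidelity_le_iInf_bound hlam (A.coupling_isSymm.smul t) hU,
    fun h2 => GravLOCC.iInf_bound_eq hlam (A.coupling_isSymm.smul t) h2⟩, ?_⟩
  intro B C hC ε hε
  exact GravLOCC.rotating_wave hn hlam B hC hε
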